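/- **Languages.** $\mathrm{CMV}^{+}$ (mixed sessions) has the processes $$P ::= q\,y\sum_{i\in I} l_i *_i v_i.P_i \;\mid\; P\mid P \;\mid\; (\nu yz)P \;\mid\; \mathsf{if}\ v\ \mathsf{then}\ P\ \mathsf{else}\ P \;\mid\; \mathbf 0,\qquad q\in\{\mathsf{lin},\mathsf{un}\},\ *\in\{!,?\},$$ $I$ finite, values $v$ being names, $\mathsf{true}$, $\mathsf{false}$, $\mathsf{unit}$; an input branch $l?x.P$ binds $x$ and $(\nu yz)P$ binds the two endpoints $y,z$ of a channel. CMV has, instead of the choice, output $y!v.P$, input $q\,y?x.P$, selection $y\triangleleft l.P$ and branching $y\triangleright\{l_i:P_i\}_{i\in I}$. In both languages structural congruence $\equiv$ is the least congruence containing $\alpha$-conversion, commutativity, associativity and unit $\mathbf 0$ of $\mid$, $(\nu yz)\mathbf 0\equiv\mathbf 0$, scope extrusion, $(\nu yz)P\equiv(\nu zy)P$ and $(\nu wx)(\nu yz)P\equiv(\nu yz)(\nu wx)P$. Reduction $\longmapsto$ reduces conditionals on $\mathsf{true}$ and $\mathsf{false}$, is closed under $\mid$, restriction and $\equiv$, and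 contains: in $\mathrm{CMV}^{+}$, $(\nu yz)(q_1\,y(l!v.P+M)\mid q_2\,z(l?x.Q+N)\mid R)\longmapsto(\nu yz)(P\mid Q\{v/x\}\mid C\mid R)$, where $C$ is the parallel composition of those of the two choices that are qualified $\mathsf{un}$; in CMV, $(\nu xy)(x!v.P\mid q\,y?z.Q\mid R)\longmapsto(\nu xy)(P\mid Q\{v/z\}\mid C\mid R)$ with $C$ the input if $q=\mathsf{un}$ (and absent otherwise), and $(\nu xy)(x\triangleleft l_j.P\mid y\triangleright\{l_i:Q_i\}_{i\in I}\mid R)\longmapsto(\nu xy)(P\mid Q_j\mid R)$ for $j\in I$. Let $\Longmapsto$ be the reflexive-transitive closure of $\longmapsto$. **Typing of $\mathrm{CMV}^{+}$.** Types are $T ::= q\,\#\{l_i *_i T_i.U_i\}_{i\in I}\mid \mathsf{end}\mid\mathsf{unit}\mid\mathsf{bool}\mid\mu t.T\mid t$ with view $\#\in\{\oplus,\&\}$ (internal, external), $I$ nonempty, the pairs $(l_i,*_i)$ distinct, $\mu$-types contractive; equivalence $\simeq$, duality $\perp$ and subtyping $<:$ are the usual coinductive relations (a supertype of an internal choice may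 have fewer branches, one of an external choice may have more; payloads are contravariant for $!$, covariant for $?$). A type is unrestricted if, below its $\mu$'s, it is $\mathsf{end}$, $\mathsf{unit}$, $\mathsf{bool}$ or a choice type qualified $\mathsf{un}$; a context is unrestricted if all its types are. Context split $\Gamma_1\circ\Gamma_2$ shares unrestricted entries and gives each entry $x:\mathsf{lin}\,\#\{\dots\}$ to exactly one side; $\Gamma+x:T$ is $\Gamma,x:T$ if $x$ is not in $\Gamma$, and is $\Gamma$ if $x:T$ is in $\Gamma$ and $T$ is unrestricted. The rules for $\Gamma\vdash v:T$ are the axioms for constants and variables (all remaining entries unrestricted) and subsumption. $\mathbf 0$ is typed in unrestricted contexts; $\mid$ splits the context; conditionals split off the typing of a boolean condition; $\Gamma\vdash(\nu xy)P$ if $\Gamma,x:T,y:U\vdash P$ with $T\perp U$. Finally $\Gamma_1\circ\Gamma_2\vdash q_1\,x\sum_{j\in J}l_j *_j v_j.P_j$ if $\Gamma_1\circ\Gamma_2$ is unrestricted in case $q_1=\mathsf{un}$, $\Gamma_1\vdash x:q_2\,\#\{l_i *_i T_i.U_i\}_{i\in I}$, the choice and its type have the same set of pairs $l\,*$, and for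 each $j\in J$, with the matching $T_j,U_j$: for $*_j={!}$, $\Gamma_2+x:U_j=\Gamma_3\circ\Gamma_4$ with $\Gamma_3\vdash v_j:T_j$ and $\Gamma_4\vdash P_j$; for $*_j={?}$, $(\Gamma_2+x:U_j),v_j:T_j\vdash P_j$. **Encoding.** For a finite family let $\mathsf{nd}\{P_i\}_{i\in I}=(\nu st)(s\triangleright\{l_i:P_i\}_{i\in I}\mid\prod_{i\in I}t\triangleleft l_i.\mathbf 0)$ with distinct labels $l_i$. The encoding $[\![\cdot]\!]$ maps a typing derivation of $\Gamma\vdash S$ (abbreviated $[\![S]\!]$) to a CMV process. It is homomorphic on $\mid$, $(\nu yz)$, conditionals and $\mathbf 0$. For a choice on $y$ with qualifier $q_1$, typed by $y:q_2\,\#\{\dots\}$, let $\kappa=(l,*)$ range over the pairs that occur in the choice and write $\overline{!}={?}$, $\overline{?}={!}$. For an endpoint $e$ and a process context $K$ let $A^{e}_{\kappa}[K]$ be the $\mathsf{nd}$-choice, over all summands with pair $\kappa$, of $e!v.K[[\![P]\!]]$ if the summand is $l!v.P$, and of $\mathsf{lin}\,e?x.K[[\![P]\!]]$ if it is $l?x.P$.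 Put $K_0=[\cdot]$ and $K_u=u!\mathsf{unit}.\mathbf 0\mid[\cdot]$. With fresh $c,d,u,v$ the encoding of the choice is * $q_1=q_2=\mathsf{lin}$, internal: $\mathsf{nd}\{y\triangleleft l_{*}.A^{y}_{(l,*)}[K_0]\}_{(l,*)}$; * $q_1=q_2=\mathsf{lin}$, external: $y\triangleright\{l_{\overline{*}}:A^{y}_{(l,*)}[K_0]\}_{(l,*)}$; * $q_1=\mathsf{lin},q_2=\mathsf{un}$, internal: $\mathsf{nd}\{(\nu cd)(y!c.d\triangleleft l_{*}.A^{d}_{(l,*)}[K_0])\}_{(l,*)}$; * $q_1=\mathsf{lin},q_2=\mathsf{un}$, external: $\mathsf{lin}\,y?c.c\triangleright\{l_{\overline{*}}:A^{c}_{(l,*)}[K_0]\}_{(l,*)}$; * $q_1=\mathsf{un}$, internal: $(\nu uv)(u!\mathsf{unit}.\mathbf 0\mid\mathsf{un}\,v?\_.\mathsf{nd}\{(\nu cd)(y!c.d\triangleleft l_{*}.A^{d}_{(l,*)}[K_u])\}_{(l,*)})$; * $q_1=\mathsf{un}$, external: $(\nu uv)(u!\mathsf{unit}.\mathbf 0\mid\mathsf{un}\,v?\_.\mathsf{lin}\,y?c.c\triangleright\{l_{\overline{*}}:A^{c}_{(l,*)}[K_u]\}_{(l,*)})$.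 **Bisimilarity.** A CMV process has the barb $y$ if it has an unguarded output, input, selection or branching on the free name $y$; $P\Downarrow_y$ means $P\Longmapsto P'$ for some $P'$ with barb $y$. A relation $\mathcal R$ is a (weak reduction, barbed) bisimulation if $(P,Q)\in\mathcal R$ implies: whenever $P\Longmapsto P'$ there is $Q'$ with $Q\Longmapsto Q'$ and $(P',Q')\in\mathcal R$; whenever $Q\Longmapsto Q'$ there is $P'$ with $P\Longmapsto P'$ and $(P',Q')\in\mathcal R$; and $P\Downarrow_y$ iff $Q\Downarrow_y$ for all $y$. Let $\approx$ be the union of all bisimulations. **Lemma (Soundness).** The encoding from $\mathrm{CMV}^{+}$ into CMV is operationally sound modulo $\approx$: let $S$ be a $\mathrm{CMV}^{+}$ process with a typing derivation in a context $\Gamma$ (finite, with closed well-formed types), and suppose $[\![S]\!]\Longmapsto T$ for the encoding of $S$ along this derivation. Then there are a $\mathrm{CMV}^{+}$ process $S'$ with $S\Longmapsto S'$, a typing derivation of $S'$ in a context with the same domain as $\Gamma$, and a CMV process $T'$ such that $T\Longmapsto T'$ and $T'\approx[\![S']\!]$. -/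

import Mathlib

namespace MixedSessions

/-! ## Names, values, qualifiers, polarities, views

Terms are represented up to alpha-conversion by de Bruijn indices: a name is a natural number, an
input binds index `0` of its continuation, a restriction of the two endpoints `y`, `z` of a channel
binds the indices `0` (for `y`) and `1` (for `z`). Freshness of the auxiliary names of the encoding is
thereby built in. -/

/-- Labels of choices. -/
abbrev Label := ℕ

/-- Values: names (variables), booleans, unit. -/
inductive Val where
  | var (x : ℕ)
  | tt
  | ff
  | unit

/-- Qualifiers: linear and unrestricted. -/
inductive Qual where
  | lin
  | un
  deriving DecidableEq

/-- Polarities: `out` is `!`, `inp` is `?`. -/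
inductive Pol where
  | out
  | inp
  deriving DecidableEq

/-- The dual polarity. -/
def Pol.dual : Pol → Pol
  | .out => .inp
  | .inp => .out

/-- Views: `int` (internal choice, `⊕`) and `ext` (external choice, `&`). -/
inductive View where
  | int
  | ext

/-- The dual view. -/
def View.dual : View → View
  | .int => .ext
  | .ext => .int

/-- Simultaneous substitution of values for names in a value. -/
def Val.subst (σ : ℕ → Val) : Val → Val
  | .var x => σ x
  | .tt => .tt
  | .ff => .ff
  | .unit => .unit

/-- Renaming of a value. -/
def Val.rename (f : ℕ → ℕ) (v : Val) : Val := v.subst fun x => .var (f x)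

/-- Extension of a substitution under one binder. -/
def up (σ : ℕ → Val) : ℕ → Val
  | 0 => .var 0
  | x + 1 => (σ x).rename (· + 1)

/-- The substitution `{v/x}` where `x` is the name bound by the innermost binder. -/
def inst (v : Val) : ℕ → Val
  | 0 => v
  | x + 1 => .var x

/-- Exchanges the two endpoints bound by the innermost restriction. -/
def swapEnds : ℕ → ℕ
  | 0 => 1
  | 1 => 0
  | x + 2 => x + 2

/-- Exchanges the pairs of endpoints bound by the two innermost restrictions. -/
def swapRes : ℕ → ℕ
  | 0 => 2
  | 1 => 3
  | 2 => 0
  | 3 => 1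
  | x + 4 => x + 4

/-! ## Mixed sessions: processes -/

namespace Mix

/-- The action of a branch: `send v` is `! v`, and `recv` is `? x` where `x` is bound in the
continuation of the branch. -/
inductive Act where
  | send (v : Val)
  | recv

/-- The polarity of an action. -/
def Act.pol : Act → Pol
  | .send _ => .out
  | .recv => .inp

/-- Processes. `choice q y n lab act P` is the choice `q y ∑_{i < n} lab i (act i). P i`; index `0` is
bound in `P i` if and only if `act i` is `recv`. The subject `y` of a choice is a value only so that
substitution is total: a choice on a constant neither reduces nor is typable. An empty choice (for
which one writes inaction) is not typable either. -/
inductive Proc where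
  | choice (q : Qual) (y : Val) (n : ℕ) (lab : Fin n → Label) (act : Fin n → Act)
      (P : Fin n → Proc)
  | par (P Q : Proc)
  | res (P : Proc)
  | ite (v : Val) (P Q : Proc)
  | inact

/-- Substitution in an action. -/
def Act.subst (σ : ℕ → Val) : Act → Act
  | .send v => .send (v.subst σ)
  | .recv => .recv

/-- The substitution to be applied to the continuation of an action. -/
def Act.under (σ : ℕ → Val) : Act → ℕ → Val
  | .send _ => σ
  | .recv => up σ

/-- Simultaneous capture-avoiding substitution of values for names. -/
def Proc.subst : (ℕ → Val) → Proc → Proc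
  | σ, .choice q y n lab act P =>
      .choice q (y.subst σ) n lab (fun i => (act i).subst σ)
        (fun i => (P i).subst ((act i).under σ))
  | σ, .par P Q => .par (P.subst σ) (Q.subst σ)
  | σ, .res P => .res (P.subst (up (up σ)))
  | σ, .ite v P Q => .ite (v.subst σ) (P.subst σ) (Q.subst σ)
  | _, .inact => .inact

/-- Renaming of names. -/
def Proc.rename (f : ℕ → ℕ) (P : Proc) : Proc := P.subst fun x => .var (f x)

/-- Structural congruence. In scope extrusion the shift of `P` by the two bound endpoints expresses
that they are not free in `P`. -/
inductive Cong : Proc → Proc → Prop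
  | refl (P) : Cong P P
  | symm {P Q} : Cong P Q → Cong Q P
  | trans {P Q R} : Cong P Q → Cong Q R → Cong P R
  | choice {q y n lab act} {P P' : Fin n → Proc} :
      (∀ i, Cong (P i) (P' i)) → Cong (.choice q y n lab act P) (.choice q y n lab act P')
  | par {P P' Q Q'} : Cong P P' → Cong Q Q' → Cong (.par P Q) (.par P' Q')
  | res {P P'} : Cong P P' → Cong (.res P) (.res P')
  | ite {v P P' Q Q'} : Cong P P' → Cong Q Q' → Cong (.ite v P Q) (.ite v P' Q')
  | par_comm (P Q) : Cong (.par P Q) (.par Q P)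
  | par_assoc (P Q R) : Cong (.par (.par P Q) R) (.par P (.par Q R))
  | par_inact (P) : Cong (.par P .inact) P
  | res_inact : Cong (.res .inact) .inact
  | extrude (P Q) : Cong (.par P (.res Q)) (.res (.par (P.rename (· + 2)) Q))
  | res_swap (P) : Cong (.res P) (.res (P.rename swapEnds))
  | res_comm (P) : Cong (.res (.res P)) (.res (.res (P.rename swapRes)))

/-- Reduction. In the communication rules the endpoint `y` of the restricted channel is index `0`,
the endpoint `z` is index `1`, summand `i` of the choice on `y` sends and summand `j` of the choice on
`z` receives with the same label. -/
inductive Step : Proc → Proc → Prop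
  | ifT (P Q) : Step (.ite .tt P Q) P
  | ifF (P Q) : Step (.ite .ff P Q) Q
  | linLin {n m lab lab' act act'} {P : Fin n → Proc} {Q : Fin m → Proc} {R v} {i : Fin n}
      {j : Fin m} (hi : act i = .send v) (hj : act' j = .recv) (hl : lab i = lab' j) :
      Step
        (.res (.par (.par (.choice .lin (.var 0) n lab act P) (.choice .lin (.var 1) m lab' act' Q))
          R))
        (.res (.par (.par (P i) ((Q j).subst (inst v))) R))
  | linUn {n m lab lab' act act'} {P : Fin n → Proc} {Q : Fin m → Proc} {R v} {i : Fin n}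
      {j : Fin m} (hi : act i = .send v) (hj : act' j = .recv) (hl : lab i = lab' j) :
      Step
        (.res (.par (.par (.choice .lin (.var 0) n lab act P) (.choice .un (.var 1) m lab' act' Q))
          R))
        (.res (.par (.par (.par (P i) ((Q j).subst (inst v)))
          (.choice .un (.var 1) m lab' act' Q)) R))
  | unLin {n m lab lab' act act'} {P : Fin n → Proc} {Q : Fin m → Proc} {R v} {i : Fin n}
      {j : Fin m} (hi : act i = .send v) (hj : act' j = .recv) (hl : lab i = lab' j) :
      Step
        (.res (.par (.par (.choice .un (.var 0) n lab act P) (.choice .lin (.var 1) m lab' act' Q))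
          R))
        (.res (.par (.par (.par (P i) ((Q j).subst (inst v)))
          (.choice .un (.var 0) n lab act P)) R))
  | unUn {n m lab lab' act act'} {P : Fin n → Proc} {Q : Fin m → Proc} {R v} {i : Fin n}
      {j : Fin m} (hi : act i = .send v) (hj : act' j = .recv) (hl : lab i = lab' j) :
      Step
        (.res (.par (.par (.choice .un (.var 0) n lab act P) (.choice .un (.var 1) m lab' act' Q))
          R))
        (.res (.par (.par (.par (.par (P i) ((Q j).subst (inst v)))
          (.choice .un (.var 0) n lab act P)) (.choice .un (.var 1) m lab' act' Q)) R))
  | par {P P'} (Q) : Step P P' → Step (.par P Q) (.par P' Q)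
  | res {P P'} : Step P P' → Step (.res P) (.res P')
  | struct {P Q Q' P'} : Cong P Q → Step Q Q' → Cong Q' P' → Step P P'

/-- Reduction in many steps. -/
def Steps : Proc → Proc → Prop := Relation.ReflTransGen Step

/-! ## Mixed sessions: types -/

/-- Types. `choice q v n lab pol T U` is the choice type with qualifier `q`, view `v` and the branches
`lab i (pol i) (T i). U i` for `i < n`. Type variables are de Bruijn indices bound by `mu`. -/
inductive Ty where
  | choice (q : Qual) (v : View) (n : ℕ) (lab : Fin n → Label) (pol : Fin n → Pol)
      (T U : Fin n → Ty)
  | fin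
  | unit
  | bool
  | mu (T : Ty)
  | var (t : ℕ)

namespace Ty

/-- Renaming of type variables. -/
def rename : (ℕ → ℕ) → Ty → Ty
  | f, choice q v n lab pol T U =>
      choice q v n lab pol (fun i => (T i).rename f) (fun i => (U i).rename f)
  | _, fin => fin
  | _, unit => unit
  | _, bool => bool
  | f, mu T => mu (T.rename fun | 0 => 0 | t + 1 => f t + 1)
  | f, var t => var (f t)

/-- Substitution of types for type variables. -/
def subst : (ℕ → Ty) → Ty → Ty
  | σ, choice q v n lab pol T U =>
      choice q v n lab pol (fun i => (T i).subst σ) (fun i => (U i).subst σ)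
  | _, fin => fin
  | _, unit => unit
  | _, bool => bool
  | σ, mu T => mu (T.subst fun | 0 => var 0 | t + 1 => (σ t).rename (· + 1))
  | σ, var t => σ t

/-- `unfold T` is `T {μ t. T / t}`, the unfolding of `μ t. T`. -/
def unfold (T : Ty) : Ty := T.subst fun | 0 => mu T | t + 1 => var t

/-- `T` is of the form `μ … μ. t` for the type variable `t`. -/
def HeadVar : ℕ → Ty → Prop
  | k, var t => t = k
  | k, mu T => T.HeadVar (k + 1)
  | _, _ => False

/-- Types with free type variables below `k` in which index sets are nonempty, the pairs of label and
polarity in each choice type are pairwise distinct, and recursive types are contractive. -/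
def WFAt : ℕ → Ty → Prop
  | k, choice _ _ n lab pol T U =>
      0 < n ∧ Function.Injective (fun i => (lab i, pol i)) ∧
        (∀ i, (T i).WFAt k) ∧ ∀ i, (U i).WFAt k
  | k, mu T => ¬ T.HeadVar 0 ∧ T.WFAt (k + 1)
  | k, var t => t < k
  | _, fin => True
  | _, unit => True
  | _, bool => True

/-- Well-formed closed types. -/
def WF (T : Ty) : Prop := T.WFAt 0

/-- Unrestricted types. -/
def Un : Ty → Prop
  | choice q _ _ _ _ _ _ => q = .un
  | fin => True
  | unit => True
  | bool => True
  | mu T => T.Un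
  | var _ => False

/-- The rules of type equivalence, with premises in `R`. -/
inductive EquivRule (R : Ty → Ty → Prop) : Ty → Ty → Prop
  | fin : EquivRule R fin fin
  | unit : EquivRule R unit unit
  | bool : EquivRule R bool bool
  | choice {q v n m lab lab' pol pol'} {T U : Fin n → Ty} {T' U' : Fin m → Ty} (e : Fin n ≃ Fin m)
      (hlab : ∀ i, lab' (e i) = lab i) (hpol : ∀ i, pol' (e i) = pol i)
      (hT : ∀ i, R (T i) (T' (e i))) (hU : ∀ i, R (U i) (U' (e i))) :
      EquivRule R (choice q v n lab pol T U) (choice q v m lab' pol' T' U')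
  | muL {T U} : R T.unfold U → EquivRule R (mu T) U
  | muR {T U} : R T U.unfold → EquivRule R T (mu U)

/-- Type equivalence, coinductively. -/
def Equiv (T U : Ty) : Prop :=
  ∃ R : Ty → Ty → Prop, (∀ A B, R A B → EquivRule R A B) ∧ R T U

/-- The rules of type duality, with coinductive premises in `R`. -/
inductive DualRule (R : Ty → Ty → Prop) : Ty → Ty → Prop
  | fin : DualRule R fin fin
  | choice {q v n m lab lab' pol pol'} {T U : Fin n → Ty} {T' U' : Fin m → Ty} (e : Fin n ≃ Fin m)
      (hlab : ∀ i, lab' (e i) = lab i) (hpol : ∀ i, pol' (e i) = (pol i).dual)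
      (hT : ∀ i, Equiv (T i) (T' (e i))) (hU : ∀ i, R (U i) (U' (e i))) :
      DualRule R (choice q v n lab pol T U) (choice q v.dual m lab' pol' T' U')
  | muL {T U} : R T.unfold U → DualRule R (mu T) U
  | muR {T U} : R T U.unfold → DualRule R T (mu U)

/-- Type duality, coinductively. -/
def Dual (T U : Ty) : Prop :=
  ∃ R : Ty → Ty → Prop, (∀ A B, R A B → DualRule R A B) ∧ R T U

/-- Subtyping of the branches `l * T₁. U₁` and `l * T₂. U₂`: the payload is contravariant for output
and covariant for input. -/
def BranchSub (R : Ty → Ty → Prop) (p : Pol) (T₁ U₁ T₂ U₂ : Ty) : Prop :=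
  match p with
  | .out => R T₂ T₁ ∧ R U₁ U₂
  | .inp => R T₁ T₂ ∧ R U₁ U₂

/-- The rules of subtyping, with premises in `R`. The supertype of an internal choice type may have
fewer branches, the supertype of an external choice type may have more. -/
inductive SubRule (R : Ty → Ty → Prop) : Ty → Ty → Prop
  | fin : SubRule R fin fin
  | unit : SubRule R unit unit
  | bool : SubRule R bool bool
  | int {q n m lab lab' pol pol'} {T U : Fin n → Ty} {T' U' : Fin m → Ty} (f : Fin m → Fin n)
      (hlab : ∀ j, lab (f j) = lab' j) (hpol : ∀ j, pol (f j) = pol' j)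
      (h : ∀ j, BranchSub R (pol' j) (T (f j)) (U (f j)) (T' j) (U' j)) :
      SubRule R (choice q .int n lab pol T U) (choice q .int m lab' pol' T' U')
  | ext {q n m lab lab' pol pol'} {T U : Fin n → Ty} {T' U' : Fin m → Ty} (f : Fin n → Fin m)
      (hlab : ∀ i, lab' (f i) = lab i) (hpol : ∀ i, pol' (f i) = pol i)
      (h : ∀ i, BranchSub R (pol i) (T i) (U i) (T' (f i)) (U' (f i))) :
      SubRule R (choice q .ext n lab pol T U) (choice q .ext m lab' pol' T' U')
  | muL {T U} : R T.unfold U → SubRule R (mu T) U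
  | muR {T U} : R T U.unfold → SubRule R T (mu U)

/-- Subtyping, coinductively. -/
def Sub (T U : Ty) : Prop :=
  ∃ R : Ty → Ty → Prop, (∀ A B, R A B → SubRule R A B) ∧ R T U

end Ty

/-! ## Mixed sessions: typing -/

/-- Typing contexts: partial maps from names to types (finiteness is part of `Ctx.WF`). -/
abbrev Ctx := ℕ → Option Ty

namespace Ctx

/-- Finite contexts of well-formed types. -/
def WF (Γ : Ctx) : Prop := {x | Γ x ≠ none}.Finite ∧ ∀ x T, Γ x = some T → T.WF

/-- Unrestricted contexts. -/
def Un (Γ : Ctx) : Prop := ∀ x T, Γ x = some T → T.Un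

/-- The context `Γ, x : T` where `x` is a newly bound name. -/
def cons (T : Ty) (Γ : Ctx) : Ctx
  | 0 => some T
  | x + 1 => Γ x

/-- Context split at a single name. -/
inductive SplitAt : Option Ty → Option Ty → Option Ty → Prop
  | none : SplitAt none none none
  | un {T} : T.Un → SplitAt (some T) (some T) (some T)
  | left {v n lab pol T U} :
      SplitAt (some (.choice .lin v n lab pol T U)) (some (.choice .lin v n lab pol T U)) Option.none
  | right {v n lab pol T U} :
      SplitAt (some (.choice .lin v n lab pol T U)) Option.none (some (.choice .lin v n lab pol T U))

/-- Context split `Γ = Γ₁ ∘ Γ₂`. -/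
def Split (Γ Γ₁ Γ₂ : Ctx) : Prop := ∀ x, SplitAt (Γ x) (Γ₁ x) (Γ₂ x)

/-- Context update `Γ + x : T = Δ`. -/
def Add (Γ : Ctx) (x : ℕ) (T : Ty) (Δ : Ctx) : Prop :=
  (Γ x = none ∨ (Γ x = some T ∧ T.Un)) ∧ Δ = Function.update Γ x (some T)

end Ctx

/-- Typing of values, `Γ ⊢ v : T`. -/
inductive ValTyping : Ctx → Val → Ty → Prop
  | unit {Γ} : Γ.Un → ValTyping Γ .unit .unit
  | tt {Γ} : Γ.Un → ValTyping Γ .tt .bool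
  | ff {Γ} : Γ.Un → ValTyping Γ .ff .bool
  | var {Γ : Ctx} {x T} : Γ x = some T → (∀ y S, y ≠ x → Γ y = some S → S.Un) →
      ValTyping Γ (.var x) T
  | sub {Γ v T U} : ValTyping Γ v T → T.Sub U → U.WF → ValTyping Γ v U

/-- Typing of branches up to their continuation: a branch `l a. P` is typable in `Γ` with payload
type `T` by the rule for its polarity if and only if `P` is typable in some `Δ` with
`BranchTyping Γ a T Δ`. -/
inductive BranchTyping : Ctx → Act → Ty → Ctx → Prop
  | send {Γ Γ₁ Γ₂ v T} : Γ.Split Γ₁ Γ₂ → ValTyping Γ₁ v T → BranchTyping Γ (.send v) T Γ₂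
  | recv {Γ T} : BranchTyping Γ .recv T (Γ.cons T)

/-- Typing derivations of processes, `Γ ⊢ P`. In the rule for choice, `k` assigns to each summand of
the choice the branch of the choice type with the same label and polarity; it is onto, that is, both
have the same set of pairs of label and polarity. -/
inductive Typing : Ctx → Proc → Type
  | inact {Γ} : Γ.Un → Typing Γ .inact
  | par {Γ Γ₁ Γ₂ P Q} : Γ.Split Γ₁ Γ₂ → Typing Γ₁ P → Typing Γ₂ Q → Typing Γ (.par P Q)
  | ite {Γ Γ₁ Γ₂ v P Q} : Γ.Split Γ₁ Γ₂ → ValTyping Γ₁ v .bool → Typing Γ₂ P → Typing Γ₂ Q →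
      Typing Γ (.ite v P Q)
  | res {Γ : Ctx} {P} {T U : Ty} : T.WF → U.WF → T.Dual U → Typing ((Γ.cons U).cons T) P →
      Typing Γ (.res P)
  | choice {Γ Γ₁ Γ₂ : Ctx} {q₁ : Qual} {x n lab act} {P : Fin n → Proc} (q₂ : Qual) (v : View)
      {m : ℕ} {lab' : Fin m → Label} {pol' : Fin m → Pol} {T U : Fin m → Ty} (k : Fin n → Fin m)
      {Δ Θ : Fin n → Ctx} (hsplit : Γ.Split Γ₁ Γ₂) (hq : q₁ = .un → Γ.Un)
      (hx : ValTyping Γ₁ (.var x) (.choice q₂ v m lab' pol' T U))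
      (hk : Function.Surjective k) (hlab : ∀ j, lab' (k j) = lab j)
      (hpol : ∀ j, pol' (k j) = (act j).pol)
      (hadd : ∀ j, Γ₂.Add x (U (k j)) (Δ j))
      (hbranch : ∀ j, BranchTyping (Δ j) (act j) (T (k j)) (Θ j))
      (D : ∀ j, Typing (Θ j) (P j)) :
      Typing Γ (.choice q₁ (.var x) n lab act P)

end Mix

/-! ## CMV: sessions with branching and selection -/

namespace CMV

/-- The labels of CMV, an infinite set: `tag l !` and `tag l ?` for every label `l` of the source, and
pairwise distinct labels `opt 0, opt 1, …` for the options of non-deterministic choices. -/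
inductive Lab where
  | tag (l : Label) (p : Pol)
  | opt (i : ℕ)

/-- Processes: output `out y v P`, input `inp q y P` (index `0` is bound in `P`), selection
`sel y l P`, branching `bran y n lab P` with the branches `lab i : P i` for `i < n`, parallel
composition, restriction, conditional, inaction. -/
inductive Proc where
  | out (y v : Val) (P : Proc)
  | inp (q : Qual) (y : Val) (P : Proc)
  | sel (y : Val) (l : Lab) (P : Proc)
  | bran (y : Val) (n : ℕ) (lab : Fin n → Lab) (P : Fin n → Proc)
  | par (P Q : Proc)
  | res (P : Proc)
  | ite (v : Val) (P Q : Proc)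
  | inact

/-- Simultaneous capture-avoiding substitution of values for names. -/
def Proc.subst : (ℕ → Val) → Proc → Proc
  | σ, .out y v P => .out (y.subst σ) (v.subst σ) (P.subst σ)
  | σ, .inp q y P => .inp q (y.subst σ) (P.subst (up σ))
  | σ, .sel y l P => .sel (y.subst σ) l (P.subst σ)
  | σ, .bran y n lab P => .bran (y.subst σ) n lab (fun i => (P i).subst σ)
  | σ, .par P Q => .par (P.subst σ) (Q.subst σ)
  | σ, .res P => .res (P.subst (up (up σ)))
  | σ, .ite v P Q => .ite (v.subst σ) (P.subst σ) (Q.subst σ)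
  | _, .inact => .inact

/-- Renaming of names. -/
def Proc.rename (f : ℕ → ℕ) (P : Proc) : Proc := P.subst fun x => .var (f x)

/-- Structural congruence. -/
inductive Cong : Proc → Proc → Prop
  | refl (P) : Cong P P
  | symm {P Q} : Cong P Q → Cong Q P
  | trans {P Q R} : Cong P Q → Cong Q R → Cong P R
  | out {y v P P'} : Cong P P' → Cong (.out y v P) (.out y v P')
  | inp {q y P P'} : Cong P P' → Cong (.inp q y P) (.inp q y P')
  | sel {y l P P'} : Cong P P' → Cong (.sel y l P) (.sel y l P')
  | bran {y n lab} {P P' : Fin n → Proc} :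
      (∀ i, Cong (P i) (P' i)) → Cong (.bran y n lab P) (.bran y n lab P')
  | par {P P' Q Q'} : Cong P P' → Cong Q Q' → Cong (.par P Q) (.par P' Q')
  | res {P P'} : Cong P P' → Cong (.res P) (.res P')
  | ite {v P P' Q Q'} : Cong P P' → Cong Q Q' → Cong (.ite v P Q) (.ite v P' Q')
  | par_comm (P Q) : Cong (.par P Q) (.par Q P)
  | par_assoc (P Q R) : Cong (.par (.par P Q) R) (.par P (.par Q R))
  | par_inact (P) : Cong (.par P .inact) P
  | res_inact : Cong (.res .inact) .inact
  | extrude (P Q) : Cong (.par P (.res Q)) (.res (.par (P.rename (· + 2)) Q))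
  | res_swap (P) : Cong (.res P) (.res (P.rename swapEnds))
  | res_comm (P) : Cong (.res (.res P)) (.res (.res (P.rename swapRes)))

/-- Reduction. In the rules for communication and branching, the endpoints `x` and `y` of the
restricted channel are the indices `0` and `1`. -/
inductive Step : Proc → Proc → Prop
  | ifT (P Q) : Step (.ite .tt P Q) P
  | ifF (P Q) : Step (.ite .ff P Q) Q
  | linCom (v P Q R) :
      Step (.res (.par (.par (.out (.var 0) v P) (.inp .lin (.var 1) Q)) R))
        (.res (.par (.par P (Q.subst (inst v))) R))
  | unCom (v P Q R) :
      Step (.res (.par (.par (.out (.var 0) v P) (.inp .un (.var 1) Q)) R))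
        (.res (.par (.par (.par P (Q.subst (inst v))) (.inp .un (.var 1) Q)) R))
  | case {n lab} (P) (Q : Fin n → Proc) (R) (j : Fin n) :
      Step (.res (.par (.par (.sel (.var 0) (lab j) P) (.bran (.var 1) n lab Q)) R))
        (.res (.par (.par P (Q j)) R))
  | par {P P'} (Q) : Step P P' → Step (.par P Q) (.par P' Q)
  | res {P P'} : Step P P' → Step (.res P) (.res P')
  | struct {P Q Q' P'} : Cong P Q → Step Q Q' → Cong Q' P' → Step P P'

/-- Reduction in many steps. -/
def Steps : Proc → Proc → Prop := Relation.ReflTransGen Step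

/-- `P` emits the barb `x`: it has an unguarded output, input, selection or branching on the free
name `x`. -/
inductive Barb : Proc → ℕ → Prop
  | out {x v P} : Barb (.out (.var x) v P) x
  | inp {q x P} : Barb (.inp q (.var x) P) x
  | sel {x l P} : Barb (.sel (.var x) l P) x
  | bran {x n lab P} : Barb (.bran (.var x) n lab P) x
  | parL {P Q x} : Barb P x → Barb (.par P Q) x
  | parR {P Q x} : Barb Q x → Barb (.par P Q) x
  | res {P x} : Barb P (x + 2) → Barb (.res P) x

/-- `P` reaches the barb `x`. -/
def WeakBarb (P : Proc) (x : ℕ) : Prop := ∃ P', Steps P P' ∧ Barb P' x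

/-- Weak reduction barbed bisimulations. -/
def IsBisimulation (R : Proc → Proc → Prop) : Prop :=
  ∀ P Q, R P Q →
    (∀ P', Steps P P' → ∃ Q', Steps Q Q' ∧ R P' Q') ∧
    (∀ Q', Steps Q Q' → ∃ P', Steps P P' ∧ R P' Q') ∧
    (∀ x, WeakBarb P x ↔ WeakBarb Q x)

/-- Weak reduction barbed bisimilarity. -/
def Bisimilar (P Q : Proc) : Prop := ∃ R, IsBisimulation R ∧ R P Q

/-- Finite parallel composition. -/
def prod : List Proc → Proc
  | [] => .inact
  | [P] => P
  | P :: Q :: Ps => .par P (prod (Q :: Ps))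

/-- Non-deterministic choice `nd {P_i} = (ν s t) (s ▷ {l_i : P_i} | ∏ t ◁ l_i. 0)`. -/
def nd (Ps : List Proc) : Proc :=
  .res (.par
    (.bran (.var 0) Ps.length (fun i => .opt i) (fun i => (Ps.get i).rename (· + 2)))
    (prod ((List.range Ps.length).map fun i => .sel (.var 1) (.opt i) .inact)))

end CMV

/-! ## The encoding -/

namespace Enc

open CMV

section

variable {n : ℕ} (lab : Fin n → Label) (act : Fin n → Mix.Act)

/-- The pairs of label and polarity that occur in a choice, without repetitions. -/
def keys : List (Label × Pol) := (List.ofFn fun j => (lab j, (act j).pol)).dedup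

/-- The summands of a choice with a given label and polarity. -/
def members (κ : Label × Pol) : List (Fin n) :=
  (List.finRange n).filter fun j => (lab j, (act j).pol) = κ

end

/-- Prefixes a continuation by `u ! unit. 0 |` if an endpoint `u` is given. -/
def restart (u : Option ℕ) (E : Proc) : Proc :=
  match u with
  | none => E
  | some u => .par (.out (.var u) .unit .inact) E

/-- The final output or input on the endpoint `x`, with encoded continuation `E`, of the encoding of a
summand; it stands below `k` binders that the encoding adds. -/
def alt (k : ℕ) (x : ℕ) (u : Option ℕ) (a : Mix.Act) (E : Proc) : Proc :=
  match a with
  | .send v => .out (.var x) (v.rename (· + k)) (restart u (E.rename (· + k)))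
  | .recv => .inp .lin (.var x) (restart (u.map (· + 1)) (E.subst (up fun y => .var (y + k))))

section

variable {n : ℕ} (lab : Fin n → Label) (act : Fin n → Mix.Act) (E : Fin n → Proc)

/-- Non-deterministic choice among the summands with a given label and polarity. -/
def alts (k : ℕ) (x : ℕ) (u : Option ℕ) (κ : Label × Pol) : Proc :=
  nd ((members lab act κ).map fun j => alt k x u (act j) (E j))

/-- Branching of an external choice: one branch for each pair of label and polarity, whose label
carries the dual polarity. -/
def offer (k : ℕ) (x : ℕ) (u : Option ℕ) : Proc :=
  .bran (.var x) (keys lab act).length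
    (fun i => .tag ((keys lab act).get i).1 ((keys lab act).get i).2.dual)
    (fun i => alts lab act E k x u ((keys lab act).get i))

/-- A linear choice on `y` typed as linear and internal. -/
def linLinInt (y : ℕ) : Proc :=
  nd ((keys lab act).map fun κ => .sel (.var y) (.tag κ.1 κ.2) (alts lab act E 0 y none κ))

/-- A linear choice on `y` typed as linear and external. -/
def linLinExt (y : ℕ) : Proc := offer lab act E 0 y none

/-- A linear choice on `y` typed as unrestricted and internal:
`nd {(ν c d) y ! c. d ◁ l. …}`. -/
def linUnInt (y : ℕ) : Proc :=
  nd ((keys lab act).map fun κ =>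
    .res (.out (.var (y + 2)) (.var 0) (.sel (.var 1) (.tag κ.1 κ.2) (alts lab act E 2 1 none κ))))

/-- A linear choice on `y` typed as unrestricted and external: `lin y ? c. c ▷ {…}`. -/
def linUnExt (y : ℕ) : Proc := .inp .lin (.var y) (offer lab act E 1 0 none)

/-- An unrestricted choice on `y` typed as internal:
`(ν u v) (u ! unit. 0 | un v ? _. nd {(ν c d) y ! c. d ◁ l. …})`. -/
def unInt (y : ℕ) : Proc :=
  .res (.par (.out (.var 0) .unit .inact)
    (.inp .un (.var 1) (nd ((keys lab act).map fun κ =>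
      .res (.out (.var (y + 5)) (.var 0)
        (.sel (.var 1) (.tag κ.1 κ.2) (alts lab act E 5 1 (some 3) κ)))))))

/-- An unrestricted choice on `y` typed as external:
`(ν u v) (u ! unit. 0 | un v ? _. lin y ? c. c ▷ {…})`. -/
def unExt (y : ℕ) : Proc :=
  .res (.par (.out (.var 0) .unit .inact)
    (.inp .un (.var 1) (.inp .lin (.var (y + 3)) (offer lab act E 4 0 (some 2)))))

/-- The encoding of a choice on `y` with qualifier `q₁`, where `y` has a choice type with qualifier
`q₂` and view `v`, from the encodings `E` of its continuations. (For `q₁ = un` the typing rules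
imply `q₂ = un`.) -/
def choice (q₁ q₂ : Qual) (v : View) (y : ℕ) : Proc :=
  match q₁, q₂, v with
  | .lin, .lin, .int => linLinInt lab act E y
  | .lin, .lin, .ext => linLinExt lab act E y
  | .lin, .un, .int => linUnInt lab act E y
  | .lin, .un, .ext => linUnExt lab act E y
  | .un, _, .int => unInt lab act E y
  | .un, _, .ext => unExt lab act E y

end

end Enc

/-- The encoding of mixed sessions into CMV, a function on typing derivations. -/
def Mix.Typing.encode : {Γ : Mix.Ctx} → {P : Mix.Proc} → Mix.Typing Γ P → CMV.Proc
  | _, _, .inact _ => .inact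
  | _, _, .par _ D₁ D₂ => .par D₁.encode D₂.encode
  | _, _, .ite (v := v) _ _ D₁ D₂ => .ite v D₁.encode D₂.encode
  | _, _, .res _ _ _ D => .res D.encode
  | _, _, .choice (q₁ := q₁) (x := x) (lab := lab) (act := act) q₂ v _ _ _ _ _ _ _ _ _ D =>
      Enc.choice lab act (fun j => (D j).encode) q₁ q₂ v x

end MixedSessions

open Multiset (mem_add mem_cons singleton_add cons_add mem_singleton mem_cons_self cons_inj_right
  add_cons induction_on Rel exists_cons_of_mem cons_swap map_cons mem_map coe_toList mem_cons_of_mem rel_cons_right)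
open Function (update update_of_ne update_self Injective)
open Set (mem_union mem_ofPred_eq subset_union_left subset_union_right union_subset_iff)

namespace MixedSessions

/-! ## Values, names and channels -/

namespace Val

/-- The names of a value. -/
def fv : Val → Set ℕ
  | .var x => {x}
  | _ => ∅

@[simp] theorem mem_fv {v : Val} {x : ℕ} : x ∈ v.fv ↔ v = .var x := by
  cases v <;> simp [fv, eq_comm]

@[simp] theorem subst_var (σ : ℕ → Val) (x : ℕ) : (Val.var x).subst σ = σ x := rfl

theorem subst_subst (σ τ : ℕ → Val) (v : Val) :
    (v.subst σ).subst τ = v.subst fun x => (σ x).subst τ := by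
  cases v <;> rfl

@[simp] theorem subst_id (v : Val) : v.subst .var = v := by cases v <;> rfl

theorem subst_congr {σ τ : ℕ → Val} {v : Val} (h : ∀ x ∈ v.fv, σ x = τ x) :
    v.subst σ = v.subst τ := by
  cases v <;> simp_all [subst, fv]

theorem subst_eq_var {σ : ℕ → Val} {v : Val} {y : ℕ} :
    v.subst σ = .var y ↔ ∃ x, v = .var x ∧ σ x = .var y := by
  cases v <;> simp [subst]

theorem rename_eq_var {f : ℕ → ℕ} {v : Val} {y : ℕ} :
    v.rename f = .var y ↔ ∃ x, v = .var x ∧ f x = y := by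
  simp [rename, subst_eq_var]

end Val

@[simp] theorem up_zero (σ : ℕ → Val) : up σ 0 = .var 0 := rfl

@[simp] theorem up_succ (σ : ℕ → Val) (x : ℕ) : up σ (x + 1) = (σ x).rename (· + 1) := rfl

@[simp] theorem inst_zero (v : Val) : inst v 0 = v := rfl

@[simp] theorem inst_succ (v : Val) (x : ℕ) : inst v (x + 1) = .var x := rfl

theorem up_comp (σ τ : ℕ → Val) :
    (fun x => (up σ x).subst (up τ)) = up fun x => (σ x).subst τ := by
  funext x
  cases x with
  | zero => rfl
  | succ x => simp [Val.rename, Val.subst_subst]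

@[simp] theorem up_id : up Val.var = Val.var := by
  funext x
  cases x <;> rfl

theorem up_congr {σ τ : ℕ → Val} {s : Set ℕ} (h : ∀ x, x + 1 ∈ s → σ x = τ x) :
    ∀ x ∈ s, up σ x = up τ x := by
  intro x hx
  cases x with
  | zero => rfl
  | succ x => simp [h x hx]

theorem up_eq_succ {σ : ℕ → Val} {s : Set ℕ} {y : ℕ} :
    (∃ x ∈ s, up σ x = .var (y + 1)) ↔ ∃ x, x + 1 ∈ s ∧ σ x = .var y := by
  constructor
  · rintro ⟨x, hx, h⟩
    cases x with
    | zero => simp at h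
    | succ x =>
      refine ⟨x, hx, ?_⟩
      obtain ⟨z, hz, h⟩ := Val.rename_eq_var.1 h
      simp only [Nat.add_right_cancel_iff] at h
      rw [hz, h]
  · aesop

/-- The other endpoint of the channel with endpoint `a`. -/
def co (a : ℕ) : ℕ := a + 1 - 2 * (a % 2)

/-- The channel with endpoint `a`; channel `c` has the endpoints `2 * c` and `2 * c + 1`. -/
def ch (a : ℕ) : ℕ := a / 2

@[simp] theorem co_co (a : ℕ) : co (co a) = a := by unfold co; omega

@[simp] theorem ch_co (a : ℕ) : ch (co a) = ch a := by unfold ch co; omega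

theorem co_ne (a : ℕ) : co a ≠ a := by unfold co; omega

theorem eq_or_eq_co {a b : ℕ} (h : ch a = ch b) : a = b ∨ a = co b := by
  unfold ch at h; unfold co; omega

@[simp] theorem ch_two_mul (c : ℕ) : ch (2 * c) = c := by unfold ch; omega

/-- The substitution that opens a restriction with the endpoints `a` and `co a`. -/
def opn (a : ℕ) : ℕ → Val
  | 0 => .var a
  | 1 => .var (co a)
  | x + 2 => .var x

/-- The substitution that binds the endpoints `a` and `co a`. -/
def cls (a : ℕ) (x : ℕ) : Val :=
  if x = a then .var 0 else if x = co a then .var 1 else .var (x + 2)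

@[simp] theorem opn_zero (a : ℕ) : opn a 0 = .var a := rfl
@[simp] theorem opn_one (a : ℕ) : opn a 1 = .var (co a) := rfl
@[simp] theorem opn_add_two (a x : ℕ) : opn a (x + 2) = .var x := rfl

@[simp] theorem cls_self (a : ℕ) : cls a a = .var 0 := by simp [cls]
@[simp] theorem cls_co (a : ℕ) : cls a (co a) = .var 1 := by simp [cls, co_ne]

theorem cls_of_ne {a x : ℕ} (h : ch x ≠ ch a) : cls a x = .var (x + 2) := by
  have h1 : x ≠ a := by rintro rfl; exact h rfl
  have h2 : x ≠ co a := by rintro rfl; simp at h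
  simp [cls, h1, h2]

theorem up_up_add_two (σ : ℕ → Val) (x : ℕ) : up (up σ) (x + 2) = (σ x).rename (· + 2) := by
  simp [Val.rename, Val.subst_subst]

@[simp] theorem up_one (σ : ℕ → Val) : up (up σ) 1 = .var 1 := rfl

/-- The substitution that adds `k` to all names. -/
abbrev shift (k : ℕ) : ℕ → Val := fun x => .var (x + k)

/-! ## Calculi with parallel composition and restriction of channels -/

/-- A process calculus with parallel composition, restriction and inaction, up to structural
congruence. -/
class Calculus (P : Type) where
  par : P → P → P
  res : P → P
  inact : P
  Guard : P → Prop
  subst : (ℕ → Val) → P → P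
  FV : P → Set ℕ
  Cong : P → P → Prop
  subst_par : ∀ σ p q, subst σ (par p q) = par (subst σ p) (subst σ q)
  subst_res : ∀ σ p, subst σ (res p) = res (subst (up (up σ)) p)
  subst_inact : ∀ σ, subst σ inact = inact
  subst_subst : ∀ σ τ p, subst τ (subst σ p) = subst (fun x => (σ x).subst τ) p
  subst_id : ∀ p, subst .var p = p
  subst_congr : ∀ {σ τ p}, (∀ x ∈ FV p, σ x = τ x) → subst σ p = subst τ p
  mem_FV_subst : ∀ {σ p y}, y ∈ FV (subst σ p) ↔ ∃ x ∈ FV p, σ x = .var y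
  FV_par : ∀ p q, FV (par p q) = FV p ∪ FV q
  mem_FV_res : ∀ {p x}, x ∈ FV (res p) ↔ x + 2 ∈ FV p
  FV_inact : FV inact = ∅
  FV_finite : ∀ p, (FV p).Finite
  refl : ∀ p, Cong p p
  symm : ∀ {p q}, Cong p q → Cong q p
  trans : ∀ {p q r}, Cong p q → Cong q r → Cong p r
  cong_par : ∀ {p p' q q'}, Cong p p' → Cong q q' → Cong (par p q) (par p' q')
  cong_res : ∀ {p p'}, Cong p p' → Cong (res p) (res p')
  cong_subst : ∀ σ {p q}, Cong p q → Cong (subst σ p) (subst σ q)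
  par_comm : ∀ p q, Cong (par p q) (par q p)
  par_assoc : ∀ p q r, Cong (par (par p q) r) (par p (par q r))
  par_inact : ∀ p, Cong (par p inact) p
  res_inact : Cong (res inact) inact
  extrude : ∀ p q, Cong (par p (res q)) (res (par (subst (shift 2) p) q))
  res_swap : ∀ p, Cong (res p) (res (subst (fun x => .var (swapEnds x)) p))
  res_comm : ∀ p, Cong (res (res p)) (res (res (subst (fun x => .var (swapRes x)) p)))

namespace Calculus

variable {P : Type} [Calculus P]

/-- The channel `c` does not occur free. -/
def Fresh (c : ℕ) (p : P) : Prop := ∀ x ∈ FV p, ch x ≠ c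

/-- Restriction of the endpoints `a` and `co a`. -/
def nuEnd (a : ℕ) (p : P) : P := res (subst (cls a) p)

/-- Restriction of the channel `c`. -/
def nu (c : ℕ) (p : P) : P := nuEnd (2 * c) p

theorem nuEnd_co (a : ℕ) (p : P) : Cong (nuEnd a p) (nuEnd (co a) p) := by
  refine trans (res_swap _) ?_
  rw [subst_subst]
  have : (fun x => (cls a x).subst fun x => Val.var (swapEnds x)) = cls (co a) := by
    funext x
    by_cases h1 : x = a
    · subst h1
      simp [cls, swapEnds, (co_ne x).symm]
    · by_cases h2 : x = co a
      · aesop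
      · simp [cls, h1, h2, swapEnds]
  rw [this]
  exact refl _

theorem nu_ch (a : ℕ) (p : P) : Cong (nu (ch a) p) (nuEnd a p) := by
  have : ch (2 * ch a) = ch a := by simp
  rcases eq_or_eq_co this with h | h
  · unfold nu; rw [h]; exact refl _
  · unfold nu; rw [h]; exact symm (nuEnd_co _ _)

theorem subst_cls_of_fresh {a : ℕ} {p : P} (h : Fresh (ch a) p) :
    subst (cls a) p = subst (shift 2) p :=
  subst_congr fun x hx => cls_of_ne (h x hx)

theorem par_nu {c : ℕ} {p : P} (h : Fresh c p) (q : P) :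
    Cong (par p (nu c q)) (nu c (par p q)) := by
  refine trans (extrude _ _) ?_
  unfold nu nuEnd
  rw [subst_par, subst_cls_of_fresh (p := p) (by simpa using h)]
  exact refl _

theorem cong_nu (c : ℕ) {p q : P} (h : Cong p q) : Cong (nu c p) (nu c q) :=
  cong_res (cong_subst _ h)

theorem nu_of_fresh {c : ℕ} {p : P} (h : Fresh c p) : Cong (nu c p) p := by
  unfold nu nuEnd
  rw [subst_cls_of_fresh (by simpa using h)]
  refine trans (cong_res (symm (par_inact _))) ?_
  refine trans (symm (extrude _ _)) ?_
  exact trans (cong_par (refl _) res_inact) (par_inact _)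

theorem nu_comm (c d : ℕ) (p : P) : Cong (nu c (nu d p)) (nu d (nu c p)) := by
  by_cases hcd : c = d
  · subst hcd; exact refl _
  unfold nu nuEnd
  rw [subst_res, subst_res, subst_subst, subst_subst]
  refine trans (res_comm _) ?_
  rw [subst_subst]
  have : (fun x => ((cls (2 * d) x).subst (up (up (cls (2 * c))))).subst
      fun x => Val.var (swapRes x)) =
      fun x => (cls (2 * c) x).subst (up (up (cls (2 * d)))) := by
    funext x
    have key : ∀ e f x, e ≠ f → ch x = e → (x = 2 * e ∧ cls (2 * e) x = .var 0 ∨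
        x = 2 * e + 1 ∧ cls (2 * e) x = .var 1) ∧ cls (2 * f) x = .var (x + 2) := by
      intro e f x hef hx
      refine ⟨?_, cls_of_ne (by simpa [hx] using hef)⟩
      rcases eq_or_eq_co (show ch x = ch (2 * e) by simpa using hx) with h | h
      · simp_all
      · right
        refine ⟨by rw [h]; unfold co; omega, by rw [h]; simp⟩
    by_cases h1 : ch x = c
    · obtain ⟨h | h, h'⟩ := key c d x hcd h1 <;>
      · rw [h', h.2]
        simp only [Val.subst_var, up_up_add_two, h.2]
        rfl
    · by_cases h2 : ch x = d
      · obtain ⟨h | h, h'⟩ := key d c x (Ne.symm hcd) h2 <;>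
        · rw [h', h.2]
          simp only [Val.subst_var, up_up_add_two, h.2]
          rfl
      · rw [cls_of_ne (by simpa using h2), cls_of_ne (by simpa using h1)]
        simp only [Val.subst_var, up_up_add_two]
        rw [cls_of_ne (by simpa using h1), cls_of_ne (by simpa using h2)]
        rfl
  rw [this]
  exact refl _

theorem subst_opn_cls {a : ℕ} {p : P} (h : Fresh (ch a) (res p)) :
    subst (cls a) (subst (opn a) p) = p := by
  rw [subst_subst]
  refine (subst_congr fun x hx => ?_).trans (subst_id p)
  match x, hx with
  | 0, _ => simp
  | 1, _ => simp
  | x + 2, hx => simp [cls_of_ne (h x (mem_FV_res.2 hx))]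

theorem nu_opn {a : ℕ} {p : P} (h : Fresh (ch a) (res p)) :
    Cong (nu (ch a) (subst (opn a) p)) (res p) := by
  refine trans (nu_ch _ _) ?_
  unfold nuEnd
  rw [subst_opn_cls h]
  exact refl _

theorem subst_cls_opn {a : ℕ} {p : P} : subst (opn a) (subst (cls a) p) = p := by
  rw [subst_subst]
  refine (subst_congr fun x _ => ?_).trans (subst_id p)
  by_cases h1 : x = a
  · simp_all
  · by_cases h2 : x = co a
    · simp_all
    · simp [cls, h1, h2]

theorem mem_FV_nu {c x : ℕ} {p : P} : x ∈ FV (nu c p) ↔ x ∈ FV p ∧ ch x ≠ c := by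
  unfold nu nuEnd
  rw [mem_FV_res, mem_FV_subst]
  constructor
  · rintro ⟨y, hy, h⟩
    by_cases hc : ch y = c
    · rcases eq_or_eq_co (show ch y = ch (2 * c) by simpa using hc) with h1 | h1 <;>
      · simp_all
    · rw [cls_of_ne (by simpa using hc)] at h
      simp only [Val.var.injEq, Nat.add_right_cancel_iff] at h
      subst h
      exact ⟨hy, hc⟩
  · rintro ⟨h, hc⟩
    exact ⟨x, h, cls_of_ne (by simpa using hc)⟩

theorem mem_FV_opn {a x : ℕ} {p : P} (hx : x ∈ FV (subst (opn a) p)) :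
    x ∈ FV (res p) ∨ ch x = ch a := by
  obtain ⟨y, hy, h⟩ := mem_FV_subst.1 hx
  match y, hy with
  | 0, _ => simp at h; simp [h]
  | 1, _ => simp at h; simp [← h]
  | y + 2, hy => simp at h; subst h; exact Or.inl (mem_FV_res.2 hy)

theorem FV_res_subset_opn {a x : ℕ} {p : P} (hx : x ∈ FV (res p)) :
    x ∈ FV (subst (opn a) p) :=
  mem_FV_subst.2 ⟨x + 2, mem_FV_res.1 hx, rfl⟩

theorem fresh_par {c : ℕ} {p q : P} : Fresh c (par p q) ↔ Fresh c p ∧ Fresh c q := by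
  simp only [Fresh, FV_par, mem_union, or_imp, forall_and]

theorem finite_not_fresh (p : P) : {c | ¬ Fresh c p}.Finite := by
  refine ((FV_finite p).image ch).subset fun c hc => ?_
  simp only [Fresh, mem_ofPred_eq, not_forall, not_not] at hc
  obtain ⟨x, hx, h⟩ := hc
  exact ⟨x, hx, h⟩

theorem finite_not_fresh_multiset (M : Multiset P) : {c | ∃ p ∈ M, ¬ Fresh c p}.Finite := by
  induction M using induction_on with
  | empty => simp
  | cons p M ih =>
    refine ((finite_not_fresh p).union ih).subset ?_
    rintro c ⟨q, hq, h⟩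
    rcases mem_cons.1 hq with rfl | hq
    all_goals grind

theorem fresh_inact (c : ℕ) : Fresh c (inact : P) := by simp [Fresh, FV_inact]

/-! ### Systems: restrictions of parallel compositions -/

/-- Parallel composition of a list. -/
def parList (l : List P) : P := l.foldr par inact

theorem parList_perm {l l' : List P} (h : l.Perm l') : Cong (parList l) (parList l') := by
  induction h with
  | nil => exact refl _
  | cons p _ ih => exact cong_par (refl _) ih
  | swap p q l =>
    exact trans (symm (par_assoc _ _ _)) (trans (cong_par (par_comm _ _) (refl _)) (par_assoc _ _ _))
  | trans _ _ h h' => exact trans h h'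

/-- Restriction of a list of channels. -/
def nuList (l : List ℕ) (p : P) : P := l.foldr nu p

theorem cong_nuList (l : List ℕ) {p q : P} (h : Cong p q) : Cong (nuList l p) (nuList l q) := by
  induction l with
  | nil => exact h
  | cons c l ih => exact cong_nu c ih

theorem nuList_perm {l l' : List ℕ} (h : l.Perm l') (p : P) :
    Cong (nuList l p) (nuList l' p) := by
  induction h with
  | nil => exact refl _
  | cons c _ ih => exact cong_nu c ih
  | swap c d l => exact nu_comm _ _ _
  | trans _ _ h h' => exact trans h h'

/-- Parallel composition of a multiset. -/
noncomputable def parM (M : Multiset P) : P := parList M.toList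

/-- Restriction of a multiset of channels. -/
noncomputable def nuM (C : Multiset ℕ) (p : P) : P := nuList C.toList p

/-- The parallel composition of `M` under the restrictions `C`. -/
noncomputable def sys (C : Multiset ℕ) (M : Multiset P) : P := nuM C (parM M)

theorem toList_cons_perm {α : Type} (a : α) (M : Multiset α) :
    (a ::ₘ M).toList.Perm (a :: M.toList) := by
  rw [← Multiset.coe_eq_coe, coe_toList, ← Multiset.cons_coe, coe_toList]

theorem parM_cons (p : P) (M : Multiset P) : Cong (parM (p ::ₘ M)) (par p (parM M)) :=
  parList_perm (toList_cons_perm _ _)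

theorem parM_zero : parM (0 : Multiset P) = inact := by simp [parM, parList]

theorem parM_singleton (p : P) : Cong (parM {p}) p := by
  refine trans (parM_cons p 0) ?_
  rw [parM_zero]
  exact par_inact _

theorem parM_add (M N : Multiset P) : Cong (parM (M + N)) (par (parM M) (parM N)) := by
  induction M using induction_on with
  | empty =>
    rw [zero_add, parM_zero]
    exact symm (trans (par_comm _ _) (par_inact _))
  | cons p M ih =>
    rw [cons_add]
    refine trans (parM_cons _ _) (trans (cong_par (refl _) ih) ?_)
    exact trans (symm (par_assoc _ _ _)) (cong_par (symm (parM_cons _ _)) (refl _))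

theorem cong_nuM (C : Multiset ℕ) {p q : P} (h : Cong p q) : Cong (nuM C p) (nuM C q) :=
  cong_nuList _ h

theorem nuM_cons (c : ℕ) (C : Multiset ℕ) (p : P) : Cong (nuM (c ::ₘ C) p) (nu c (nuM C p)) :=
  nuList_perm (toList_cons_perm _ _) p

theorem nuM_zero (p : P) : nuM 0 p = p := by simp [nuM, nuList]

theorem nuM_add (C D : Multiset ℕ) (p : P) : Cong (nuM (C + D) p) (nuM C (nuM D p)) := by
  induction C using induction_on with
  | empty => rw [zero_add, nuM_zero]; exact refl _
  | cons c C ih =>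
    rw [cons_add]
    exact trans (nuM_cons _ _ _) (trans (cong_nu c ih) (symm (nuM_cons _ _ _)))

theorem nuM_cons' (c : ℕ) (C : Multiset ℕ) (p : P) : Cong (nuM (c ::ₘ C) p) (nuM C (nu c p)) := by
  have h : c ::ₘ C = C + {c} := by rw [add_comm, singleton_add]
  rw [h]
  refine trans (nuM_add _ _ _) (cong_nuM _ (trans (nuM_cons c 0 p) ?_))
  rw [nuM_zero]
  exact refl _

theorem par_nuM {C : Multiset ℕ} {p : P} (h : ∀ c ∈ C, Fresh c p) (q : P) :
    Cong (par p (nuM C q)) (nuM C (par p q)) := by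
  induction C using induction_on with
  | empty => rw [nuM_zero, nuM_zero]; exact refl _
  | cons c C ih =>
    refine trans (cong_par (refl _) (nuM_cons _ _ _)) ?_
    refine trans (par_nu (h c (by simp)) _) ?_
    refine trans (cong_nu c (ih fun d hd => h d (by simp [hd]))) ?_
    exact symm (nuM_cons _ _ _)

theorem mem_FV_parM {M : Multiset P} {x : ℕ} : x ∈ FV (parM M) ↔ ∃ p ∈ M, x ∈ FV p := by
  have : ∀ l : List P, x ∈ FV (parList l) ↔ ∃ p ∈ l, x ∈ FV p := by
    intro l
    induction l with
    | nil => simp [parList, FV_inact]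
    | cons p l ih =>
      have h : parList (p :: l) = par p (parList l) := rfl
      simp [h, FV_par, ih]
  simp [parM, this]

theorem mem_FV_nuM {C : Multiset ℕ} {p : P} {x : ℕ} :
    x ∈ FV (nuM C p) ↔ x ∈ FV p ∧ ch x ∉ C := by
  have : ∀ l : List ℕ, x ∈ FV (nuList l p) ↔ x ∈ FV p ∧ ch x ∉ l := by
    intro l
    induction l with
    | nil => simp [nuList]
    | cons c l ih =>
      have h : nuList (c :: l) p = nu c (nuList l p) := rfl
      simp only [h, mem_FV_nu, ih, List.mem_cons]
      tauto
  simp [nuM, this]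

theorem mem_FV_sys {C : Multiset ℕ} {M : Multiset P} {x : ℕ} :
    x ∈ FV (sys C M) ↔ (∃ p ∈ M, x ∈ FV p) ∧ ch x ∉ C := by
  rw [sys, mem_FV_nuM, mem_FV_parM]

theorem fresh_parM {c : ℕ} {M : Multiset P} : Fresh c (parM M) ↔ ∀ p ∈ M, Fresh c p := by
  simp only [Fresh, mem_FV_parM]
  exact ⟨fun h p hp x hx => h x ⟨p, hp, hx⟩, fun h x ⟨p, hp, hx⟩ => h p hp x hx⟩

theorem cong_sys (C : Multiset ℕ) {M N : Multiset P} (h : Cong (parM M) (parM N)) :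
    Cong (sys C M) (sys C N) :=
  cong_nuM C h

theorem sys_par (C : Multiset ℕ) (p q : P) (M : Multiset P) :
    Cong (sys C (par p q ::ₘ M)) (sys C (p ::ₘ q ::ₘ M)) := by
  refine cong_sys C (trans (parM_cons _ _) (trans (par_assoc _ _ _) ?_))
  exact symm (trans (parM_cons _ _) (cong_par (refl _) (parM_cons _ _)))

theorem sys_inact (C : Multiset ℕ) (M : Multiset P) :
    Cong (sys C (inact ::ₘ M)) (sys C M) :=
  cong_sys C (trans (parM_cons _ _) (trans (par_comm _ _) (par_inact _)))

theorem sys_cons_cong (C : Multiset ℕ) {p q : P} (h : Cong p q) (M : Multiset P) :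
    Cong (sys C (p ::ₘ M)) (sys C (q ::ₘ M)) :=
  cong_sys C (trans (parM_cons _ _) (trans (cong_par h (refl _)) (symm (parM_cons _ _))))

theorem sys_of_fresh {C D : Multiset ℕ} {M : Multiset P} (h : ∀ c ∈ D, ∀ p ∈ M, Fresh c p) :
    Cong (sys (D + C) M) (sys C M) := by
  rw [add_comm]
  refine trans (nuM_add _ _ _) (cong_nuM _ ?_)
  induction D using induction_on with
  | empty => rw [nuM_zero]; exact refl _
  | cons c D ih =>
    refine trans (nuM_cons' _ _ _) (trans (cong_nuM _ (nu_of_fresh ?_)) ?_)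
    · exact fresh_parM.2 (h c (by simp))
    · grind

/-- Moves the restrictions of a component of a system to the top. -/
theorem sys_nuM {C D : Multiset ℕ} {L M : Multiset P} (h : ∀ c ∈ D, ∀ p ∈ M, Fresh c p) :
    Cong (sys C (sys D L ::ₘ M)) (sys (D + C) (L + M)) := by
  rw [add_comm D]
  refine trans (cong_nuM C ?_) (symm (nuM_add C D _))
  refine trans (parM_cons _ _) (trans (par_comm _ _) ?_)
  refine trans (par_nuM (fun c hc => fresh_parM.2 (h c hc)) _) (cong_nuM _ ?_)
  exact trans (par_comm _ _) (symm (parM_add _ _))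

theorem sys_zero_singleton (p : P) : Cong (sys 0 {p}) p := by
  rw [sys, nuM_zero]
  exact parM_singleton p

/-- Opens a restriction in a system. -/
theorem sys_res (C : Multiset ℕ) {a : ℕ} {p : P} {M : Multiset P} (h : Fresh (ch a) (res p))
    (hM : ∀ q ∈ M, Fresh (ch a) q) :
    Cong (sys C (res p ::ₘ M)) (sys (ch a ::ₘ C) (subst (opn a) p ::ₘ M)) := by
  have h1 : Cong (res p) (sys {ch a} {subst (opn a) p}) := by
    refine trans (symm (nu_opn h)) ?_
    have := nuM_cons (ch a) 0 (parM {subst (opn a) p})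
    rw [nuM_zero] at this
    exact symm (trans this (cong_nu _ (parM_singleton _)))
  refine trans (sys_cons_cong C h1 M) ?_
  refine trans (sys_nuM (by simpa using hM)) ?_
  rw [singleton_add, singleton_add]
  exact refl _

/-! ### Flattening -/

/-- `Flat p M K` says that `p` is the parallel composition of the guarded processes `M` under the
restrictions `K` of fresh channels. -/
inductive Flat : P → Multiset P → Multiset ℕ → Prop
  | guard {p} : Guard p → Flat p {p} 0
  | inact : Flat inact 0 0
  | par {p q M N K J} : Flat p M K → Flat q N J → (∀ c ∈ K, Fresh c q ∧ c ∉ J) →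
      (∀ c ∈ J, Fresh c p) → Flat (par p q) (M + N) (K + J)
  | res {p M K} (a : ℕ) : Flat (subst (opn a) p) M K → ch a ∉ K → Fresh (ch a) (res p) →
      Flat (res p) M (ch a ::ₘ K)

theorem Flat.fresh {p : P} {M K} (h : Flat p M K) : ∀ c ∈ K, Fresh c p := by
  induction h with
  | guard => simp
  | inact => simp
  | par _ _ h1 h2 ih1 ih2 =>
    intro c hc
    rw [fresh_par]
    rcases mem_add.1 hc with hc | hc
    all_goals grind
  | res a _ _ h ih =>
    intro c hc
    rcases mem_cons.1 hc with rfl | hc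
    · exact h
    · exact fun x hx => ih c hc x (FV_res_subset_opn hx)

theorem Flat.mem_FV {p : P} {M K} (h : Flat p M K) {x : ℕ} :
    (∃ q ∈ M, x ∈ FV q) → x ∈ FV p ∨ ch x ∈ K := by
  induction h with
  | guard => simp
  | inact => simp
  | par _ _ h1 h2 ih1 ih2 =>
    rintro ⟨q, hq, hx⟩
    rw [FV_par, mem_union, mem_add]
    rcases mem_add.1 hq with hq | hq
    all_goals grind
  | res a _ _ h ih =>
    intro hq
    rw [mem_cons]
    rcases ih hq with h | h
    · have := mem_FV_opn h; tauto
    · tauto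

theorem Flat.nodup {p : P} {M K} (h : Flat p M K) : K.Nodup := by
  induction h with
  | guard => simp
  | inact => simp
  | par _ _ h1 h2 ih1 ih2 =>
    rw [Multiset.nodup_add]
    exact ⟨ih1, ih2, Multiset.disjoint_left.2 fun {c} hc => (h1 c hc).2⟩
  | res a _ h _ ih => exact Multiset.nodup_cons.2 ⟨h, ih⟩

theorem Flat.guards {p : P} {M K} (h : Flat p M K) : ∀ q ∈ M, Guard q := by
  induction h with
  | guard h => simpa using h
  | inact => simp
  | par _ _ h1 h2 ih1 ih2 => grind
  | res a _ h _ ih => exact ih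

theorem Flat.cong {p : P} {M K} (h : Flat p M K) : Cong p (sys K M) := by
  induction h with
  | guard => exact symm (sys_zero_singleton _)
  | inact => rw [sys, nuM_zero, parM_zero]; exact refl _
  | @par p q M N K J hp hq h1 h2 ih1 ih2 =>
    have h3 : ∀ c ∈ K, ∀ r ∈ ({sys J N} : Multiset P), Fresh c r := by
      simp only [mem_singleton, forall_eq]
      intro c hc x hx
      obtain ⟨hx, _⟩ := mem_FV_sys.1 hx
      rcases hq.mem_FV hx with hx | hx
      · exact (h1 c hc).1 x hx
      · grind
    have h4 : ∀ c ∈ J, ∀ r ∈ M, Fresh c r := by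
      intro c hc r hr x hx
      rcases hp.mem_FV ⟨r, hr, hx⟩ with hx | hx
      · aesop
      · grind
    refine trans (cong_par ih1 ih2) ?_
    refine trans (symm (sys_zero_singleton _)) ?_
    refine trans (sys_par 0 _ _ 0) ?_
    refine trans (sys_nuM h3) ?_
    rw [add_comm M, Multiset.cons_zero, singleton_add]
    refine trans (sys_nuM h4) ?_
    rw [add_zero, add_comm J, add_comm N]
    exact refl _
  | @res p M K a _ _ h ih =>
    refine trans (symm (nu_opn h)) (trans (cong_nu _ ih) ?_)
    exact symm (nuM_cons _ _ _)

theorem sys_flat {p : P} {L M : Multiset P} {K : Multiset ℕ} (C : Multiset ℕ) (h : Flat p L K)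
    (hK : ∀ c ∈ K, ∀ q ∈ M, Fresh c q) : Cong (sys C (p ::ₘ M)) (sys (K + C) (L + M)) :=
  trans (sys_cons_cong C h.cong M) (sys_nuM hK)

theorem Flat.nu {p : P} {M K} (h : Flat p M K) {c : ℕ} (hc : c ∉ K) :
    Flat (nu c p) M (c ::ₘ K) := by
  have := Flat.res (p := subst (cls (2 * c)) p) (M := M) (K := K) (2 * c)
    (by rwa [subst_cls_opn]) (by simpa using hc)
    (by
      intro x hx
      have : x ∈ FV (Calculus.nu c p) := hx
      rw [mem_FV_nu] at this
      simpa using this.2)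
  rw [ch_two_mul] at this
  exact this

theorem Flat.sys {M : Multiset P} {K : Multiset ℕ} (hM : ∀ p ∈ M, Guard p) (hK : K.Nodup) :
    Flat (sys K M) M K := by
  have h1 : ∀ l : List P, (∀ p ∈ l, Guard p) → Flat (parList l) (l : Multiset P) 0 := by
    intro l
    induction l with
    | nil => intro _; exact Flat.inact
    | cons p l ih =>
      intro h
      have := Flat.par (Flat.guard (h p (by simp))) (ih fun q hq => h q (by simp [hq]))
        (by simp) (by simp)
      simpa [parList, ← Multiset.cons_coe] using this
  have h2 : ∀ l : List ℕ, l.Nodup → Flat (nuList l (parM M)) M (l : Multiset ℕ) := by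
    intro l
    induction l with
    | nil =>
      intro _
      have := h1 M.toList (by simpa using hM)
      simpa [nuList, parM] using this
    | cons c l ih =>
      intro h
      rw [List.nodup_cons] at h
      exact (ih h.2).nu (by simpa using h.1)
  have := h2 K.toList (by rw [← Multiset.coe_nodup, coe_toList]; exact hK)
  simpa [Calculus.sys, nuM] using this

end Calculus

namespace CMV
open Calculus (Fresh)

/-! ## CMV as a calculus -/

namespace Proc

/-- Guarded processes. -/
inductive IsGuard : Proc → Prop
  | out (y v P) : IsGuard (.out y v P)
  | inp (q y P) : IsGuard (.inp q y P)
  | sel (y l P) : IsGuard (.sel y l P)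
  | bran (y n lab P) : IsGuard (.bran y n lab P)
  | ite (v P Q) : IsGuard (.ite v P Q)

/-- Free names. -/
def FV : Proc → Set ℕ
  | .out y v P => y.fv ∪ v.fv ∪ P.FV
  | .inp _ y P => y.fv ∪ {x | x + 1 ∈ P.FV}
  | .sel y _ P => y.fv ∪ P.FV
  | .bran y _ _ P => y.fv ∪ {x | ∃ i, x ∈ (P i).FV}
  | .par P Q => P.FV ∪ Q.FV
  | .res P => {x | x + 2 ∈ P.FV}
  | .ite v P Q => v.fv ∪ P.FV ∪ Q.FV
  | .inact => ∅

theorem subst_subst (P : Proc) : ∀ σ τ : ℕ → Val,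
    (P.subst σ).subst τ = P.subst fun x => (σ x).subst τ := by
  induction P <;> intro σ τ <;> simp_all [subst, Val.subst_subst, up_comp]

theorem subst_id (P : Proc) : P.subst .var = P := by induction P <;> simp_all [subst]

theorem subst_congr (P : Proc) : ∀ {σ τ : ℕ → Val}, (∀ x ∈ P.FV, σ x = τ x) →
    P.subst σ = P.subst τ := by
  have hv : ∀ {σ τ : ℕ → Val} {s : Set ℕ} {v : Val}, (∀ x ∈ s, σ x = τ x) → v.fv ⊆ s →
    v.subst σ = v.subst τ := fun h hs => Val.subst_congr fun x hx => h x (hs hx)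
  induction P with
  | out y v P ih =>
    intro σ τ h
    simp only [FV] at h
    simp only [subst, out.injEq]
    exact ⟨hv h fun x hx => Or.inl (Or.inl hx), hv h fun x hx => Or.inl (Or.inr hx),
      ih fun x hx => h x (Or.inr hx)⟩
  | inp q y P ih =>
    intro σ τ h
    simp only [FV] at h
    simp only [subst, inp.injEq, true_and]
    exact ⟨hv h fun x hx => Or.inl hx, ih (up_congr fun x hx => h x (Or.inr hx))⟩
  | sel y l P ih =>
    intro σ τ h
    simp only [FV] at h
    simp only [subst, sel.injEq, true_and]
    exact ⟨hv h fun x hx => Or.inl hx, ih fun x hx => h x (Or.inr hx)⟩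
  | bran y n lab P ih =>
    intro σ τ h
    simp only [FV] at h
    simp only [subst, bran.injEq, true_and, heq_eq_eq]
    exact ⟨hv h fun x hx => Or.inl hx, funext fun i => ih i fun x hx => h x (Or.inr ⟨i, hx⟩)⟩
  | par P Q ih1 ih2 =>
    intro σ τ h
    simp only [FV] at h
    simp only [subst, par.injEq]
    exact ⟨ih1 fun x hx => h x (Or.inl hx), ih2 fun x hx => h x (Or.inr hx)⟩
  | res P ih =>
    intro σ τ h
    simp only [FV] at h
    simp only [subst, res.injEq]
    exact ih (up_congr fun x hx => up_congr (s := {x | x + 1 ∈ P.FV}) (fun x hx => h x hx) x hx)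
  | ite v P Q ih1 ih2 =>
    intro σ τ h
    simp only [FV] at h
    simp only [subst, ite.injEq]
    exact ⟨hv h fun x hx => Or.inl (Or.inl hx), ih1 fun x hx => h x (Or.inl (Or.inr hx)),
      ih2 fun x hx => h x (Or.inr hx)⟩
  | inact => intros; rfl

theorem FV_finite (P : Proc) : P.FV.Finite := by
  have hv : ∀ v : Val, v.fv.Finite := fun v => by cases v <;> simp [Val.fv]
  have hs : ∀ k, ∀ {s : Set ℕ}, s.Finite → {x | x + k ∈ s}.Finite := fun k s h =>
    h.preimage (add_left_injective k).injOn
  induction P with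
  | out y v P ih => exact ((hv y).union (hv v)).union ih
  | inp q y P ih => exact (hv y).union (hs 1 ih)
  | sel y l P ih => exact (hv y).union ih
  | bran y n lab P ih =>
    refine (hv y).union ((Set.finite_iUnion ih).subset ?_)
    rintro x ⟨i, hx⟩
    exact Set.mem_iUnion.2 ⟨i, hx⟩
  | par P Q ih1 ih2 => exact ih1.union ih2
  | res P ih => exact hs 2 ih
  | ite v P Q ih1 ih2 => exact ((hv v).union ih1).union ih2
  | inact => exact Set.finite_empty

theorem mem_FV_subst (P : Proc) : ∀ {σ : ℕ → Val} {y : ℕ},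
    y ∈ (P.subst σ).FV ↔ ∃ x ∈ P.FV, σ x = .var y := by
  induction P with
  | out z v P ih =>
    intro σ y
    simp only [subst, FV, mem_union, Val.mem_fv, ih, Val.subst_eq_var]
    simp only [or_and_right, exists_or]
  | inp q z P ih =>
    intro σ y
    simp only [subst, FV, mem_union, Val.mem_fv, mem_ofPred_eq, ih, Val.subst_eq_var]
    rw [up_eq_succ]
    simp only [or_and_right, exists_or]
  | sel z l P ih =>
    intro σ y
    simp only [subst, FV, mem_union, Val.mem_fv, ih, Val.subst_eq_var]
    simp only [or_and_right, exists_or]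
  | bran z n lab P ih =>
    intro σ y
    simp only [subst, FV, mem_union, Val.mem_fv, mem_ofPred_eq, ih, Val.subst_eq_var]
    rw [exists_comm]
    simp only [or_and_right, exists_or, exists_and_right]
  | par P Q ih1 ih2 =>
    intro σ y
    simp only [subst, FV, mem_union, ih1, ih2]
    simp only [or_and_right, exists_or]
  | res P ih =>
    intro σ y
    simp only [subst, FV, mem_ofPred_eq, ih]
    exact up_eq_succ.trans (up_eq_succ (s := {x | x + 1 ∈ P.FV}))
  | ite v P Q ih1 ih2 =>
    intro σ y
    simp only [subst, FV, mem_union, Val.mem_fv, ih1, ih2, Val.subst_eq_var]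
    simp only [or_and_right, exists_or]
  | inact => simp [subst, FV]

end Proc

theorem Cong.FV_eq {P Q : Proc} (h : Cong P Q) : P.FV = Q.FV := by
  induction h with
  | refl => rfl
  | symm _ ih => exact ih.symm
  | trans _ _ ih1 ih2 => exact ih1.trans ih2
  | out _ ih => simp [Proc.FV, ih]
  | inp _ ih => simp [Proc.FV, ih]
  | sel _ ih => simp [Proc.FV, ih]
  | bran _ ih => simp [Proc.FV, ih]
  | par _ _ ih1 ih2 => simp [Proc.FV, ih1, ih2]
  | res _ ih => simp [Proc.FV, ih]
  | ite _ _ ih1 ih2 => simp [Proc.FV, ih1, ih2]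
  | par_comm => simp [Proc.FV, Set.union_comm]
  | par_assoc => simp [Proc.FV, Set.union_assoc]
  | par_inact => simp [Proc.FV]
  | res_inact => simp [Proc.FV]
  | extrude P Q =>
    ext x
    simp [Proc.FV, Proc.rename, Proc.mem_FV_subst]
  | res_swap P =>
    ext x
    simp only [Proc.FV, Proc.rename, Proc.mem_FV_subst, mem_ofPred_eq, Val.var.injEq]
    constructor
    · aesop
    · rintro ⟨y, hy, h⟩
      match y with
      | 0 => simp [swapEnds] at h
      | 1 => simp [swapEnds] at h
      | y + 2 => simp only [swapEnds] at h; rwa [← h]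
  | res_comm P =>
    ext x
    simp only [Proc.FV, Proc.rename, Proc.mem_FV_subst, mem_ofPred_eq, Val.var.injEq]
    constructor
    · aesop
    · rintro ⟨y, hy, h⟩
      match y with
      | 0 => simp [swapRes] at h
      | 1 => simp [swapRes] at h
      | 2 => simp [swapRes] at h
      | 3 => simp [swapRes] at h
      | y + 4 => simp only [swapRes] at h; have h' : x + 4 = y + 4 := h.symm; rwa [show x + 2 + 2 = y + 4 from h']

theorem subst_shift_two (σ : ℕ → Val) (P : Proc) :
    (P.rename (· + 2)).subst (up (up σ)) = (P.subst σ).rename (· + 2) := by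
  simp only [Proc.rename, Proc.subst_subst, Val.subst_var, up_up_add_two]
  rfl

theorem Cong.subst {P Q : Proc} (h : Cong P Q) : ∀ σ, Cong (P.subst σ) (Q.subst σ) := by
  induction h with
  | refl => exact fun _ => .refl _
  | symm _ ih => exact fun σ => .symm (ih σ)
  | trans _ _ ih1 ih2 => exact fun σ => .trans (ih1 σ) (ih2 σ)
  | out _ ih => exact fun σ => .out (ih _)
  | inp _ ih => exact fun σ => .inp (ih _)
  | sel _ ih => exact fun σ => .sel (ih _)
  | bran _ ih => exact fun σ => .bran fun i => ih i _
  | par _ _ ih1 ih2 => exact fun σ => .par (ih1 _) (ih2 _)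
  | res _ ih => exact fun σ => .res (ih _)
  | ite _ _ ih1 ih2 => exact fun σ => .ite (ih1 _) (ih2 _)
  | par_comm => exact fun σ => .par_comm _ _
  | par_assoc => exact fun σ => .par_assoc _ _ _
  | par_inact => exact fun σ => .par_inact _
  | res_inact => exact fun σ => .res_inact
  | extrude P Q =>
    intro σ
    simp only [Proc.subst, subst_shift_two]
    exact .extrude _ _
  | res_swap P =>
    intro σ
    refine .trans (.res_swap _) ?_
    simp only [Proc.rename, Proc.subst, Proc.subst_subst]
    have : (fun x => ((up (up σ) x).subst fun x => Val.var (swapEnds x))) =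
        fun x => (Val.var (swapEnds x)).subst (up (up σ)) := by
      funext x
      match x with
      | 0 => rfl
      | 1 => rfl
      | x + 2 => simp only [up_up_add_two, swapEnds, Val.subst_var, Val.rename, Val.subst_subst]
    rw [this]
    exact .refl _
  | res_comm P =>
    intro σ
    refine .trans (.res_comm _) ?_
    simp only [Proc.rename, Proc.subst, Proc.subst_subst]
    have : (fun x => ((up (up (up (up σ))) x).subst fun x => Val.var (swapRes x))) =
        fun x => (Val.var (swapRes x)).subst (up (up (up (up σ)))) := by
      funext x
      match x with
      | 0 => rfl
      | 1 => rfl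
      | 2 => rfl
      | 3 => rfl
      | x + 4 =>
        simp only [show x + 4 = x + 2 + 2 from rfl, up_up_add_two, swapRes, Val.subst_var,
          Val.rename, Val.subst_subst]
    rw [this]
    exact .refl _

instance : Calculus Proc where
  par := .par
  res := .res
  inact := .inact
  Guard := Proc.IsGuard
  subst := Proc.subst
  FV := Proc.FV
  Cong := Cong
  subst_par _ _ _ := rfl
  subst_res _ _ := rfl
  subst_inact _ := rfl
  subst_subst σ τ p := p.subst_subst σ τ
  subst_id := Proc.subst_id
  subst_congr h := Proc.subst_congr _ h
  mem_FV_subst := Proc.mem_FV_subst _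
  FV_par _ _ := rfl
  mem_FV_res := Iff.rfl
  FV_inact := rfl
  FV_finite := Proc.FV_finite
  refl := .refl
  symm := .symm
  trans := .trans
  cong_par := .par
  cong_res := .res
  cong_subst σ _ _ h := h.subst σ
  par_comm := .par_comm
  par_assoc := .par_assoc
  par_inact := .par_inact
  res_inact := .res_inact
  extrude := .extrude
  res_swap := .res_swap
  res_comm := .res_comm

open Calculus

/-! ## Inversion of reduction in CMV -/

/-- Guarded processes with the same prefix and congruent continuations. -/
inductive GC : Proc → Proc → Prop
  | out {y v P P'} : Cong P P' → GC (.out y v P) (.out y v P')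
  | inp {q y P P'} : Cong P P' → GC (.inp q y P) (.inp q y P')
  | sel {y l P P'} : Cong P P' → GC (.sel y l P) (.sel y l P')
  | bran {y n lab} {P P' : Fin n → Proc} :
      (∀ i, Cong (P i) (P' i)) → GC (.bran y n lab P) (.bran y n lab P')
  | ite {v P P' Q Q'} : Cong P P' → Cong Q Q' → GC (.ite v P Q) (.ite v P' Q')

theorem GC.cong {P Q : Proc} (h : GC P Q) : Cong P Q := by
  cases h with
  | out h => exact .out h
  | inp h => exact .inp h
  | sel h => exact .sel h
  | bran h => exact .bran h
  | ite h h' => exact .ite h h'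

theorem GC.refl {P : Proc} (h : P.IsGuard) : GC P P := by
  cases h
  · exact .out (.refl _)
  · exact .inp (.refl _)
  · exact .sel (.refl _)
  · exact .bran fun _ => .refl _
  · exact .ite (.refl _) (.refl _)

theorem GC.trans {P Q R : Proc} (h : GC P Q) (h' : GC Q R) : GC P R := by
  cases h with
  | out h => cases h' with | out h' => exact .out (h.trans h')
  | inp h => cases h' with | inp h' => exact .inp (h.trans h')
  | sel h => cases h' with | sel h' => exact .sel (h.trans h')
  | bran h => cases h' with | bran h' => exact .bran fun i => (h i).trans (h' i)
  | ite h1 h2 => cases h' with | ite h3 h4 => exact .ite (h1.trans h3) (h2.trans h4)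

theorem rel_GC_refl {L : Multiset Proc} (h : ∀ P ∈ L, P.IsGuard) : Rel GC L L :=
  Multiset.rel_refl_of_refl_on fun P hP => GC.refl (h P hP)

theorem rel_GC_trans {L M N : Multiset Proc} (h : Rel GC L M)
    (h' : Rel GC M N) : Rel GC L N := by
  induction h generalizing N with
  | zero => simpa using h'
  | cons hab _ ih =>
    obtain ⟨c, N', hbc, hN, rfl⟩ := Multiset.rel_cons_left.1 h'
    exact .cons (hab.trans hbc) (ih hN)

theorem cong_parM_of_rel {L M : Multiset Proc} (h : Rel Cong L M) :
    Cong (parM L) (parM M) := by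
  induction h with
  | zero => exact .refl _
  | cons h _ ih =>
    have e : ∀ (P : Proc) L, Cong (parM (P ::ₘ L)) (.par P (parM L)) := parM_cons
    exact (e _ _).trans ((Cong.par h ih).trans (e _ _).symm)

theorem exists_mem_FV_of_rel {L M : Multiset Proc} (h : Rel GC L M) {x : ℕ} :
    (∃ P ∈ L, x ∈ P.FV) ↔ ∃ P ∈ M, x ∈ P.FV := by
  have := Set.ext_iff.1 (cong_parM_of_rel (h.mono fun _ _ _ _ => GC.cong)).FV_eq x
  exact mem_FV_parM.symm.trans (Iff.trans this (mem_FV_parM (P := Proc)))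

/-! ### Inversion of flattening -/

theorem flat_of_eq {P Q : Proc} (e : P = Q) {L K} (h : Flat Q L K) : Flat P L K := e ▸ h

theorem flat_guard_inv {P : Proc} (hP : P.IsGuard) {L K} (h : Flat P L K) : L = {P} ∧ K = 0 := by
  cases h with
  | guard => exact ⟨rfl, rfl⟩
  | inact => cases hP
  | par => cases hP
  | res => cases hP

theorem flat_inact_inv {L K} (h : Flat Proc.inact L K) : L = 0 ∧ K = 0 := by
  generalize hp : Proc.inact = p at h
  cases h with
  | guard hg => subst hp; cases hg
  | inact => exact ⟨rfl, rfl⟩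
  | par => injection hp
  | res => injection hp

theorem flat_par_inv {P Q : Proc} {L K} (h : Flat (.par P Q) L K) :
    ∃ M N J H, L = M + N ∧ K = J + H ∧ Flat P M J ∧ Flat Q N H ∧
      (∀ c ∈ J, Fresh c Q ∧ c ∉ H) ∧ ∀ c ∈ H, Fresh c P := by
  generalize hp : Proc.par P Q = p at h
  cases h with
  | guard hg => subst hp; cases hg
  | inact => injection hp
  | par h1 h2 h3 h4 =>
    injection hp with e1 e2
    subst e1 e2
    exact ⟨_, _, _, _, rfl, rfl, h1, h2, h3, h4⟩
  | res => injection hp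

theorem flat_res_inv {P : Proc} {L K} (h : Flat (.res P) L K) :
    ∃ a J, K = ch a ::ₘ J ∧ Flat (P.subst (opn a)) L J ∧ ch a ∉ J ∧ Fresh (ch a) (Proc.res P) := by
  generalize hp : Proc.res P = p at h
  cases h with
  | guard hg => subst hp; cases hg
  | inact => injection hp
  | par h1 h2 h3 h4 => injection hp
  | res a h1 h2 h3 =>
    injection hp with e1
    subst e1
    exact ⟨a, _, rfl, h1, h2, h3⟩

/-! ### Flattening and structural congruence -/

/-- Every flattening of `P` is, up to congruence below prefixes and unused channels, one of `Q`. -/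
def FlatSim (P Q : Proc) : Prop :=
  ∀ L K, Flat P L K → ∀ F : Set ℕ, F.Finite →
    ∃ L' K', Flat Q L' K' ∧ Rel GC L L' ∧ ∀ c ∈ K', c ∈ K ∨ c ∉ F

theorem FlatSim.refl (P : Proc) : FlatSim P P := fun L K h _ _ =>
  ⟨L, K, h, rel_GC_refl h.guards, fun _ => Or.inl⟩

theorem FlatSim.of_flat {P Q : Proc} (h : ∀ L K, Flat P L K → Flat Q L K) : FlatSim P Q :=
  fun L K hP _ _ => ⟨L, K, h L K hP, rel_GC_refl hP.guards, fun _ => Or.inl⟩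

theorem FlatSim.trans {P Q R : Proc} (h : FlatSim P Q) (h' : FlatSim Q R) : FlatSim P R := by
  intro L K hP F hF
  obtain ⟨L', K', hQ, h1, h2⟩ := h L K hP F hF
  obtain ⟨L'', K'', hR, h3, h4⟩ := h' L' K' hQ F hF
  refine ⟨L'', K'', hR, rel_GC_trans h1 h3, fun c hc => ?_⟩
  rcases h4 c hc with h | h
  · grind
  · grind

theorem FlatSim.guard {P Q : Proc} (h : GC P Q) (hP : P.IsGuard) (hQ : Q.IsGuard) :
    FlatSim P Q := by
  intro L K hL F hF
  obtain ⟨rfl, rfl⟩ := flat_guard_inv hP hL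
  exact ⟨{Q}, 0, .guard hQ, .cons h .zero, by simp⟩

theorem fresh_congr {P Q : Proc} (h : P.FV = Q.FV) {c : ℕ} (hc : Fresh c P) : Fresh c Q := by
  intro x hx
  exact hc x (h ▸ hx : x ∈ P.FV)

theorem FlatSim.par {P P' Q Q' : Proc} (hP : FlatSim P P') (hQ : FlatSim Q Q')
    (eP : P.FV = P'.FV) (eQ : Q.FV = Q'.FV) : FlatSim (.par P Q) (.par P' Q') := by
  intro L K hL F hF
  obtain ⟨M, N, J, H, rfl, rfl, h1, h2, h3, h4⟩ := flat_par_inv hL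
  have fin : ∀ C : Multiset ℕ, {c | c ∈ C}.Finite := fun C => C.toFinset.finite_toSet.subset
    (by intro c hc; simpa using hc)
  obtain ⟨M', J', g1, g2, g3⟩ := hP M J h1 (F ∪ {c | c ∈ H} ∪ {c | ¬ Fresh c Q})
    ((hF.union (fin H)).union (finite_not_fresh Q))
  obtain ⟨N', H', k1, k2, k3⟩ := hQ N H h2 (F ∪ {c | c ∈ J'} ∪ {c | ¬ Fresh c P})
    ((hF.union (fin J')).union (finite_not_fresh P))
  refine ⟨M' + N', J' + H', .par g1 k1 ?_ ?_, Rel.add g2 k2, ?_⟩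
  · intro c hc
    have h5 : Fresh c Q ∧ c ∉ H := by grind
    refine ⟨fresh_congr eQ h5.1, fun hc' => ?_⟩
    rcases k3 c hc' with h | h
    all_goals grind
  · intro c hc
    rcases k3 c hc with h | h
    · exact fresh_congr eP (h4 c h)
    · simp only [mem_union, mem_ofPred_eq, not_or, not_not] at h
      exact fresh_congr eP h.2
  · grind

theorem FlatSim.res {P P' : Proc} (h : ∀ a, FlatSim (P.subst (opn a)) (P'.subst (opn a)))
    (e : P.FV = P'.FV) : FlatSim (.res P) (.res P') := by
  intro L K hL F hF
  obtain ⟨a, J, rfl, h1, h2, h3⟩ := flat_res_inv hL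
  obtain ⟨M', J', g1, g2, g3⟩ := h a L J h1 (F ∪ {ch a}) (hF.union (Set.finite_singleton _))
  refine ⟨M', ch a ::ₘ J', .res a g1 (fun hc => ?_) (fresh_congr (P := .res P) (Q := .res P')
    (by simp [Proc.FV, e]) h3), g2, ?_⟩
  · grind
  · grind

theorem FlatSim.par_comm (P Q : Proc) : FlatSim (.par P Q) (.par Q P) := by
  refine .of_flat fun L K h => ?_
  obtain ⟨M, N, J, H, rfl, rfl, h1, h2, h3, h4⟩ := flat_par_inv h
  rw [add_comm M, add_comm J]
  exact .par h2 h1 (fun c hc => ⟨h4 c hc, fun hc' => (h3 c hc').2 hc⟩) fun c hc => (h3 c hc).1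

theorem FlatSim.par_assoc (P Q R : Proc) : FlatSim (.par (.par P Q) R) (.par P (.par Q R)) := by
  refine .of_flat fun L K h => ?_
  obtain ⟨M, N, J, H, rfl, rfl, h1, h2, h3, h4⟩ := flat_par_inv h
  obtain ⟨M', N', J', H', rfl, rfl, g1, g2, g3, g4⟩ := flat_par_inv h1
  rw [add_assoc, add_assoc]
  have h5 := fun c hc => fresh_par.1 (h4 c hc)
  have h6 : ∀ c ∈ J' + H', Fresh c R ∧ c ∉ H := h3
  refine .par g1 (.par g2 h2 ?_ ?_) ?_ ?_
  · grind
  · grind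
  · intro c hc
    have := h6 c (by simp [hc])
    exact ⟨fresh_par.2 ⟨(g3 c hc).1, this.1⟩, by simp [this.2, (g3 c hc).2]⟩
  · grind

theorem FlatSim.par_assoc' (P Q R : Proc) : FlatSim (.par P (.par Q R)) (.par (.par P Q) R) := by
  refine .trans (.par_comm _ _) (.trans (.par (.par_comm _ _) (.refl _) ?_ rfl) ?_)
  · simp [Proc.FV, Set.union_comm]
  refine .trans (.par_assoc _ _ _) (.trans (.par_comm _ _) (.par (.par_comm _ _) (.refl _) ?_ rfl))
  simp [Proc.FV, Set.union_comm]

theorem subst_opn_shift (a : ℕ) (P : Proc) : (P.rename (· + 2)).subst (opn a) = P := by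
  rw [Proc.rename, Proc.subst_subst]
  exact P.subst_id

theorem FV_res_par (P Q : Proc) : (Proc.res (.par (P.rename (· + 2)) Q)).FV =
    P.FV ∪ (Proc.res Q).FV :=
  (Cong.extrude P Q).FV_eq.symm

theorem fresh_opn {a c : ℕ} {P : Proc} (h : Fresh c (Proc.res P)) (hc : c ≠ ch a) :
    Fresh c (P.subst (opn a)) := by
  intro x hx
  rcases mem_FV_opn (P := Proc) hx with h' | h'
  · aesop
  · grind

theorem FlatSim.extrude (P Q : Proc) :
    FlatSim (.par P (.res Q)) (.res (.par (P.rename (· + 2)) Q)) := by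
  refine .of_flat fun L K h => ?_
  obtain ⟨M, N, J, H, rfl, rfl, h1, h2, h3, h4⟩ := flat_par_inv h
  obtain ⟨a, H, rfl, g1, g2, g3⟩ := flat_res_inv h2
  rw [add_cons]
  have h5 : Flat (Proc.par P (Q.subst (opn a))) (M + N) (J + H) := by
    refine .par h1 g1 (fun c hc => ?_) fun c hc => h4 c (by simp [hc])
    have := h3 c hc
    rw [mem_cons, not_or] at this
    exact ⟨fresh_opn this.1 this.2.1, this.2.2⟩
  refine Flat.res (P := Proc) (p := .par (P.rename (· + 2)) Q) a ?_ ?_ ?_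
  · have : (Proc.par (P.rename (· + 2)) Q).subst (opn a) = .par P (Q.subst (opn a)) := by
      simp [Proc.subst, subst_opn_shift]
    exact flat_of_eq this h5
  · grind
  · exact fresh_congr (FV_res_par P Q).symm (P := .par P (.res Q))
      (fresh_par.2 ⟨h4 _ (by simp), g3⟩)

theorem FlatSim.extrude' (P Q : Proc) :
    FlatSim (.res (.par (P.rename (· + 2)) Q)) (.par P (.res Q)) := by
  refine .of_flat fun L K h => ?_
  obtain ⟨a, K, rfl, h1, h2, h3⟩ := flat_res_inv h
  have : (Proc.par (P.rename (· + 2)) Q).subst (opn a) = .par P (Q.subst (opn a)) := by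
    simp [Proc.subst, subst_opn_shift]
  rw [this] at h1
  obtain ⟨M, N, J, H, rfl, rfl, g1, g2, g3, g4⟩ := flat_par_inv h1
  have h4 : Fresh (ch a) (Proc.par P (.res Q)) := fresh_congr (FV_res_par P Q) h3
  have h5 : Fresh (ch a) P ∧ Fresh (ch a) (Proc.res Q) := fresh_par.1 h4
  simp only [mem_add, not_or] at h2
  rw [← add_cons]
  refine .par g1 (.res a g2 h2.2 h5.2) (fun c hc => ?_) fun c hc => ?_
  · refine ⟨fun x hx => (g3 c hc).1 x (FV_res_subset_opn (P := Proc) hx), ?_⟩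
    rw [mem_cons, not_or]
    exact ⟨fun e => h2.1 (e ▸ hc), (g3 c hc).2⟩
  · grind

theorem FlatSim.res_swap (P : Proc) : FlatSim (.res P) (.res (P.rename swapEnds)) := by
  refine .of_flat fun L K h => ?_
  obtain ⟨a, K, rfl, h1, h2, h3⟩ := flat_res_inv h
  rw [← ch_co] at h2 h3 ⊢
  refine Flat.res (P := Proc) (co a) ?_ h2 (fresh_congr (Cong.res_swap P).FV_eq h3)
  have : (P.rename swapEnds).subst (opn (co a)) = P.subst (opn a) := by
    rw [Proc.rename, Proc.subst_subst]
    congr 1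
    funext x
    match x with
    | 0 => simp [swapEnds]
    | 1 => simp [swapEnds]
    | x + 2 => simp [swapEnds]
  exact flat_of_eq this h1

theorem FlatSim.res_comm (P : Proc) : FlatSim (.res (.res P)) (.res (.res (P.rename swapRes))) := by
  refine .of_flat fun L K h => ?_
  obtain ⟨a, K, rfl, h1, h2, h3⟩ := flat_res_inv h
  obtain ⟨b, K, rfl, g1, g2, g3⟩ := flat_res_inv h1
  rw [mem_cons, not_or] at h2
  rw [cons_swap]
  have e : ((P.rename swapRes).subst (up (up (opn b)))).subst (opn a) =
      (P.subst (up (up (opn a)))).subst (opn b) := by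
    simp only [Proc.rename, Proc.subst_subst]
    congr 1
    funext x
    match x with
    | 0 => rfl
    | 1 => rfl
    | 2 => rfl
    | 3 => rfl
    | x + 4 => rfl
  have eFV := (Cong.res_comm P).FV_eq
  have e1 : ∀ x c, x ∈ (Proc.res (P.subst (up (up (opn c))))).FV →
      x ∈ (Proc.res (.res P)).FV ∨ ch x = ch c := fun x c hx =>
    mem_FV_opn (P := Proc) (p := .res P) (a := c) hx
  have hb : Fresh (ch b) (Proc.res (.res P)) := fun x hx =>
    g3 x (FV_res_subset_opn (P := Proc) (p := .res P) hx)
  refine Flat.res (P := Proc) b ?_ ?_ (fresh_congr eFV hb)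
  · refine Flat.res (P := Proc) a ?_ h2.2 ?_
    · exact flat_of_eq e g1
    · intro x hx
      rcases mem_FV_opn (P := Proc) (p := .res (P.rename swapRes)) (a := b) hx with h | h
      · exact fresh_congr eFV h3 x h
      · grind
  · grind

theorem Cong.flatSim {P Q : Proc} (h : Cong P Q) :
    ∀ σ, FlatSim (P.subst σ) (Q.subst σ) ∧ FlatSim (Q.subst σ) (P.subst σ) := by
  have guard : ∀ {P Q : Proc}, GC P Q → P.IsGuard → Q.IsGuard → GC Q P →
      FlatSim P Q ∧ FlatSim Q P := fun h hP hQ h' => ⟨.guard h hP hQ, .guard h' hQ hP⟩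
  induction h with
  | refl => exact fun σ => ⟨.refl _, .refl _⟩
  | symm _ ih => exact fun σ => (ih σ).symm
  | trans _ _ ih1 ih2 => exact fun σ => ⟨(ih1 σ).1.trans (ih2 σ).1, (ih2 σ).2.trans (ih1 σ).2⟩
  | out h _ => exact fun σ => guard (.out (h.subst _)) (.out ..) (.out ..) (.out (h.subst _).symm)
  | inp h _ => exact fun σ => guard (.inp (h.subst _)) (.inp ..) (.inp ..) (.inp (h.subst _).symm)
  | sel h _ => exact fun σ => guard (.sel (h.subst _)) (.sel ..) (.sel ..) (.sel (h.subst _).symm)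
  | bran h _ =>
    exact fun σ => guard (.bran fun i => (h i).subst _) (.bran ..) (.bran ..)
      (.bran fun i => ((h i).subst _).symm)
  | par h1 h2 ih1 ih2 =>
    exact fun σ => ⟨.par (ih1 σ).1 (ih2 σ).1 (h1.subst σ).FV_eq (h2.subst σ).FV_eq,
      .par (ih1 σ).2 (ih2 σ).2 (h1.subst σ).FV_eq.symm (h2.subst σ).FV_eq.symm⟩
  | res h ih =>
    intro σ
    constructor
    · refine .res (fun a => ?_) (h.subst _).FV_eq
      simp only [Proc.subst_subst]
      exact (ih _).1
    · refine .res (fun a => ?_) (h.subst _).FV_eq.symm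
      simp only [Proc.subst_subst]
      exact (ih _).2
  | ite h1 h2 _ _ =>
    exact fun σ => guard (.ite (h1.subst _) (h2.subst _)) (.ite ..) (.ite ..)
      (.ite (h1.subst _).symm (h2.subst _).symm)
  | par_comm P Q => exact fun σ => ⟨.par_comm _ _, .par_comm _ _⟩
  | par_assoc P Q R => exact fun σ => ⟨.par_assoc _ _ _, .par_assoc' _ _ _⟩
  | par_inact P =>
    refine fun σ => ⟨.of_flat fun L K h => ?_, .of_flat fun L K h => ?_⟩
    · obtain ⟨M, N, J, H, rfl, rfl, h1, h2, _, _⟩ := flat_par_inv h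
      obtain ⟨rfl, rfl⟩ := flat_inact_inv h2
      simpa using h1
    · have := Flat.par h (Flat.inact (P := Proc)) (fun c _ => ⟨fresh_inact c, by simp⟩) (by simp)
      rw [add_zero, add_zero] at this
      exact this
  | res_inact =>
    refine fun σ => ⟨fun L K h F hF => ?_, fun L K h F hF => ?_⟩
    · obtain ⟨a, K, rfl, h1, h2, h3⟩ := flat_res_inv h
      obtain ⟨rfl, rfl⟩ := flat_inact_inv h1
      exact ⟨0, 0, .inact, .zero, by simp⟩
    · obtain ⟨rfl, rfl⟩ := flat_inact_inv h
      obtain ⟨c, hc⟩ := hF.exists_notMem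
      have h1 : Flat (Proc.res .inact) 0 (ch (2 * c) ::ₘ 0) := by
        refine Flat.res (P := Proc) (p := .inact) (2 * c) .inact (by simp) ?_
        exact fun x hx => absurd hx (Set.notMem_empty (x + 2))
      rw [ch_two_mul] at h1
      exact ⟨0, _, h1, .zero, by simp [hc]⟩
  | extrude P Q =>
    intro σ
    simp only [Proc.subst, subst_shift_two]
    exact ⟨.extrude _ _, .extrude' _ _⟩
  | res_swap P =>
    intro σ
    have e : (P.rename swapEnds).subst (up (up σ)) = (P.subst (up (up σ))).rename swapEnds := by
      simp only [Proc.rename, Proc.subst_subst]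
      congr 1
      funext x
      match x with
      | 0 => rfl
      | 1 => rfl
      | x + 2 => simp only [up_up_add_two, swapEnds, Val.subst_var, Val.rename, Val.subst_subst]
    simp only [Proc.subst, e]
    refine ⟨.res_swap _, ?_⟩
    have := FlatSim.res_swap ((P.subst (up (up σ))).rename swapEnds)
    have e' : ((P.subst (up (up σ))).rename swapEnds).rename swapEnds = P.subst (up (up σ)) := by
      simp only [Proc.rename, Proc.subst_subst]
      congr 1
      funext x
      simp only [Val.subst_subst]
      refine (Val.subst_congr fun y _ => ?_).trans (Val.subst_id _)
      match y with
      | 0 => rfl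
      | 1 => rfl
      | y + 2 => rfl
    rwa [e'] at this
  | res_comm P =>
    intro σ
    have e : (P.rename swapRes).subst (up (up (up (up σ)))) =
        (P.subst (up (up (up (up σ))))).rename swapRes := by
      simp only [Proc.rename, Proc.subst_subst]
      congr 1
      funext x
      match x with
      | 0 => rfl
      | 1 => rfl
      | 2 => rfl
      | 3 => rfl
      | x + 4 => simp only [show x + 4 = x + 2 + 2 from rfl, up_up_add_two, swapRes, Val.subst_var,
          Val.rename, Val.subst_subst]
    simp only [Proc.subst, e]
    refine ⟨.res_comm _, ?_⟩
    have := FlatSim.res_comm ((P.subst (up (up (up (up σ))))).rename swapRes)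
    have e' : ((P.subst (up (up (up (up σ))))).rename swapRes).rename swapRes =
        P.subst (up (up (up (up σ)))) := by
      simp only [Proc.rename, Proc.subst_subst]
      congr 1
      funext x
      simp only [Val.subst_subst]
      refine (Val.subst_congr fun y _ => ?_).trans (Val.subst_id _)
      match y with
      | 0 => rfl
      | 1 => rfl
      | 2 => rfl
      | 3 => rfl
      | y + 4 => rfl
    rwa [e'] at this

/-! ### Reduction of flattened processes -/

/-- What remains of an input that has been used. -/
def keep (q : Qual) (P : Proc) : Multiset Proc :=
  match q with
  | .lin => 0
  | .un => {P}

/-- Reduction of the parallel composition of guarded processes under restrictions `K`. -/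
inductive RS (K : Multiset ℕ) : Multiset Proc → Multiset Proc → Prop
  | ifT (P Q R) : RS K (.ite .tt P Q ::ₘ R) (P ::ₘ R)
  | ifF (P Q R) : RS K (.ite .ff P Q ::ₘ R) (Q ::ₘ R)
  | com {a} (q v P Q R) : ch a ∈ K →
      RS K (.out (.var a) v P ::ₘ .inp q (.var (co a)) Q ::ₘ R)
        (P ::ₘ Q.subst (inst v) ::ₘ (keep q (.inp q (.var (co a)) Q) + R))
  | case {a n lab} (P) (Q : Fin n → Proc) (R) (j : Fin n) : ch a ∈ K →
      RS K (.sel (.var a) (lab j) P ::ₘ .bran (.var (co a)) n lab Q ::ₘ R) (P ::ₘ Q j ::ₘ R)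

theorem rel_cong_of_rel_GC {L M : Multiset Proc} (h : Rel GC L M) :
    Rel Cong L M := h.mono fun _ _ _ _ => GC.cong

theorem RS.of_rel {K K' : Multiset ℕ} {L L' M' : Multiset Proc} (hL : Rel GC L L')
    (h : RS K' L' M') (hK : ∀ x P, P ∈ L → x ∈ P.FV → ch x ∈ K' → ch x ∈ K) :
    ∃ M, RS K L M ∧ Rel Cong M M' := by
  cases h with
  | ifT P Q R =>
    obtain ⟨_, L, h1, h2, rfl⟩ := rel_cons_right.1 hL
    cases h1 with | ite h3 h4 => exact ⟨_, .ifT _ _ _, .cons h3 (rel_cong_of_rel_GC h2)⟩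
  | ifF P Q R =>
    obtain ⟨_, L, h1, h2, rfl⟩ := rel_cons_right.1 hL
    cases h1 with | ite h3 h4 => exact ⟨_, .ifF _ _ _, .cons h4 (rel_cong_of_rel_GC h2)⟩
  | com q v P Q R ha =>
    obtain ⟨_, L, h1, h2, rfl⟩ := rel_cons_right.1 hL
    obtain ⟨_, L, h3, h4, rfl⟩ := rel_cons_right.1 h2
    cases h1 with | out h5 =>
    cases h3 with | inp h6 =>
    refine ⟨_, .com _ _ _ _ _ (hK _ _ (mem_cons_self _ _) ?_ ha),
      .cons h5 (.cons (h6.subst _) (.add ?_ (rel_cong_of_rel_GC h4)))⟩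
    · simp [Proc.FV]
    · cases q
      · exact .zero
      · exact .cons (.inp h6) .zero
  | case P Q R j ha =>
    obtain ⟨_, L, h1, h2, rfl⟩ := rel_cons_right.1 hL
    obtain ⟨_, L, h3, h4, rfl⟩ := rel_cons_right.1 h2
    cases h1 with | sel h5 =>
    cases h3 with | bran h6 =>
    refine ⟨_, .case _ _ _ j (hK _ _ (mem_cons_self _ _) ?_ ha),
      .cons h5 (.cons (h6 j) (rel_cong_of_rel_GC h4))⟩
    simp [Proc.FV]

theorem mem_FV_inst {x : ℕ} {v : Val} {Q : Proc} (h : x ∈ (Q.subst (inst v)).FV) :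
    v = .var x ∨ x + 1 ∈ Q.FV := by
  obtain ⟨y, hy, h⟩ := Q.mem_FV_subst.1 h
  cases y with
  | zero => exact Or.inl h
  | succ y => simp only [inst_succ, Val.var.injEq] at h; subst h; exact Or.inr hy

theorem RS.mem_FV {K : Multiset ℕ} {L M : Multiset Proc} (h : RS K L M) {x : ℕ}
    (hx : ∃ P ∈ M, x ∈ P.FV) : ∃ P ∈ L, x ∈ P.FV := by
  obtain ⟨P, hP, hx⟩ := hx
  cases h with
  | ifT P Q R =>
    rcases mem_cons.1 hP with rfl | hP
    · exact ⟨_, mem_cons_self _ _, Or.inl (Or.inr hx)⟩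
    · grind
  | ifF P Q R =>
    rcases mem_cons.1 hP with rfl | hP
    · exact ⟨_, mem_cons_self _ _, Or.inr hx⟩
    · grind
  | com q v P Q R ha =>
    rcases mem_cons.1 hP with rfl | hP
    · exact ⟨_, mem_cons_self _ _, Or.inr hx⟩
    rcases mem_cons.1 hP with rfl | hP
    · rcases mem_FV_inst hx with rfl | hx
      · exact ⟨_, mem_cons_self _ _, Or.inl (Or.inr (by simp))⟩
      · exact ⟨_, mem_cons_of_mem (mem_cons_self _ _), Or.inr hx⟩
    rcases mem_add.1 hP with hP | hP
    · cases q
      · exact absurd hP (Multiset.notMem_zero _)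
      · obtain rfl := mem_singleton.1 hP
        exact ⟨_, mem_cons_of_mem (mem_cons_self _ _), hx⟩
    · grind
  | case P Q R j ha =>
    rcases mem_cons.1 hP with rfl | hP
    · exact ⟨_, mem_cons_self _ _, Or.inr hx⟩
    rcases mem_cons.1 hP with rfl | hP
    · exact ⟨_, mem_cons_of_mem (mem_cons_self _ _), Or.inr ⟨j, hx⟩⟩
    · grind

theorem nuM_congr {K K' : Multiset ℕ} (hK : K.Nodup) (hK' : K'.Nodup) {P : Proc}
    (h : ∀ x ∈ P.FV, ch x ∈ K ↔ ch x ∈ K') : Cong (nuM K P) (nuM K' P) := by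
  classical
  have key : ∀ K : Multiset ℕ, Cong (nuM K P) (nuM (K.filter fun c => ¬ Fresh c P) P) := by
    intro K
    have h1 := Multiset.filter_add_not (fun c => Fresh c P) K
    have h2 := sys_of_fresh (P := Proc) (C := K.filter fun c => ¬ Fresh c P)
      (D := K.filter fun c => Fresh c P) (M := {P}) (by simp)
    rw [h1] at h2
    have h3 : ∀ C, Cong (sys C {P}) (nuM C P) := fun C => cong_nuM C (parM_singleton P)
    exact (h3 _).symm.trans (Cong.trans h2 (h3 _))
  have e : K.filter (fun c => ¬ Fresh c P) = K'.filter fun c => ¬ Fresh c P := by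
    refine (Multiset.Nodup.ext (hK.filter _) (hK'.filter _)).2 fun c => ?_
    simp only [Multiset.mem_filter, and_congr_left_iff]
    intro hc
    simp only [Fresh, not_forall, not_not] at hc
    obtain ⟨x, hx, rfl⟩ := hc
    exact h x hx
  exact (key K).trans (e ▸ (key K').symm)

theorem cong_sys_of_rel (K : Multiset ℕ) {L M : Multiset Proc} (h : Rel Cong L M) :
    Cong (sys K L) (sys K M) := cong_sys (P := Proc) K (cong_parM_of_rel h)

theorem RS.add {K : Multiset ℕ} {L M : Multiset Proc} (h : RS K L M) (J : Multiset ℕ)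
    (N : Multiset Proc) : RS (K + J) (L + N) (M + N) := by
  cases h with
  | ifT => simpa using .ifT _ _ _
  | ifF => simpa using .ifF _ _ _
  | com q v P Q R ha =>
    have := RS.com (K := K + J) q v P Q (R + N) (mem_add.2 (Or.inl ha))
    simpa [add_assoc] using this
  | @case _ _ lab P Q R j ha =>
    have := RS.case (K := K + J) (lab := lab) P Q (R + N) j (mem_add.2 (Or.inl ha))
    simpa [add_assoc] using this

theorem FV_subst_mono {P Q : Proc} (h : P.FV ⊆ Q.FV) (σ : ℕ → Val) :
    (P.subst σ).FV ⊆ (Q.subst σ).FV := by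
  intro y hy
  obtain ⟨x, hx, h'⟩ := P.mem_FV_subst.1 hy
  exact Q.mem_FV_subst.2 ⟨x, h hx, h'⟩

/-- Inversion of the axioms for communication. -/
theorem flat_redex {Red Con R : Proc} {σ : ℕ → Val} {L K} (hFV : Con.FV ⊆ Red.FV)
    (hred : ∀ τ a, τ 0 = .var a → τ 1 = .var (co a) → ∃ Lr Lc : Multiset Proc,
      (∀ L K, Flat (Red.subst τ) L K → L = Lr ∧ K = 0) ∧
      Cong (Con.subst τ) (parM Lc) ∧ ∀ K R, ch a ∈ K → RS K (Lr + R) (Lc + R))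
    (h : Flat ((Proc.res (.par Red R)).subst σ) L K) :
    ∃ M, RS K L M ∧ Cong ((Proc.res (.par Con R)).subst σ) (sys K M) := by
  obtain ⟨a, K, rfl, h1, h2, h3⟩ := flat_res_inv h
  obtain ⟨M, N, J, H, rfl, rfl, g1, g2, g3, g4⟩ := flat_par_inv h1
  simp only [Proc.subst_subst] at g1 g2 g3 g4
  obtain ⟨Lr, Lc, k1, k2, k3⟩ := hred (fun x => (up (up σ) x).subst (opn a)) a rfl rfl
  obtain ⟨rfl, rfl⟩ := k1 _ _ g1
  have hrs := k3 (ch a ::ₘ (0 + H)) N (by simp)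
  refine ⟨_, hrs, ?_⟩
  set τ := fun x => (up (up σ) x).subst (opn a) with hτ
  have hcon : ∀ c ∈ H, Fresh c (Con.subst τ) := by
    exact fun c hc x hx => g4 c hc x (FV_subst_mono hFV _ hx)
  have e : Cong (((Proc.par Con R).subst (up (up σ))).subst (opn a)) (sys H (Lc + N)) := by
    have e1 := Flat.cong g2
    simp only [Proc.subst, Proc.subst_subst]
    refine (Cong.par k2 e1).trans ?_
    have e2 : ∀ c ∈ H, Fresh c (parM Lc) := fun c hc => fresh_congr k2.FV_eq (hcon c hc)
    exact Calculus.trans (par_nuM e2 _) (cong_nuM _ (Calculus.symm (parM_add _ _)))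
  have hf : Fresh (ch a) (Proc.res ((Proc.par Con R).subst (up (up σ)))) := by
    have : (Proc.res (.par Con R)).FV ⊆ (Proc.res (.par Red R)).FV := by
      rintro x (hx | hx)
      · exact Or.inl (hFV hx)
      · exact Or.inr hx
    exact fun x hx => h3 x (FV_subst_mono this σ hx)
  have := nu_opn (P := Proc) hf
  refine Cong.trans (Cong.symm this) ?_
  rw [zero_add]
  exact Calculus.trans (cong_nu (P := Proc) _ e) (Calculus.symm (nuM_cons _ _ _))

theorem FV_inst_subset {v : Val} {Q : Proc} {s : Set ℕ} (hv : v.fv ⊆ s) (hQ : ∀ x, x + 1 ∈ Q.FV → x ∈ s) :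
    (Q.subst (inst v)).FV ⊆ s := by
  intro x hx
  rcases mem_FV_inst hx with rfl | hx
  · aesop
  · grind

theorem subst_inst_comm (v : Val) (Q : Proc) (τ : ℕ → Val) :
    (Q.subst (inst v)).subst τ = (Q.subst (up τ)).subst (inst (v.subst τ)) := by
  rw [Q.subst_subst, Q.subst_subst]
  congr 1
  funext x
  cases x with
  | zero => rfl
  | succ x =>
    simp only [inst_succ, Val.subst_var, up_succ, Val.rename, Val.subst_subst]
    exact (Val.subst_id _).symm

theorem cong_parM_pair (P Q : Proc) : Cong (.par P Q) (parM (P ::ₘ {Q})) :=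
  (Calculus.trans (P := Proc) (parM_cons P {Q})
    (cong_par (P := Proc) (Calculus.refl _) (parM_singleton Q))).symm

theorem Step.FV_subset {P P' : Proc} (h : Step P P') : P'.FV ⊆ P.FV := by
  have key : ∀ {P Q R S : Proc}, (Proc.par P Q).FV ⊆ R.FV →
      (Proc.res (.par (.par P Q) S)).FV ⊆ (Proc.res (.par R S)).FV := by
    rintro P Q R S h x (hx | hx)
    · exact Or.inl (h hx)
    · exact Or.inr hx
  induction h with
  | ifT P Q => exact fun x hx => Or.inl (Or.inr hx)
  | ifF P Q => exact fun x hx => Or.inr hx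
  | linCom v P Q R =>
    refine key ?_
    simp only [Proc.FV, union_subset_iff]
    refine ⟨fun x hx => Or.inl (Or.inr hx), FV_inst_subset (fun x hx => ?_) fun x hx => ?_⟩
    all_goals grind
  | unCom v P Q R =>
    refine key ?_
    simp only [Proc.FV, union_subset_iff]
    refine ⟨⟨fun x hx => Or.inl (Or.inr hx), FV_inst_subset (fun x hx => ?_) fun x hx => ?_⟩,
      fun x hx => Or.inr (Or.inl hx), fun x hx => Or.inr (Or.inr hx)⟩
    all_goals grind
  | case P Q R j =>
    refine key ?_
    simp only [Proc.FV, union_subset_iff]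
    exact ⟨fun x hx => Or.inl (Or.inr hx), fun x hx => Or.inr (Or.inr ⟨j, hx⟩)⟩
  | par Q _ ih =>
    rintro x (hx | hx)
    · exact Or.inl (ih hx)
    · exact Or.inr hx
  | res _ ih => exact fun x hx => ih hx
  | struct h1 _ h2 ih => rw [h1.FV_eq, ← h2.FV_eq]; exact ih

theorem Step.flat {P P' : Proc} (h : Step P P') : ∀ σ L K, Flat (P.subst σ) L K →
    ∃ M, RS K L M ∧ Cong (P'.subst σ) (sys K M) := by
  induction h with
  | ifT P Q =>
    intro σ L K h
    obtain ⟨rfl, rfl⟩ := flat_guard_inv (.ite ..) h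
    exact ⟨_, .ifT _ _ 0, (sys_zero_singleton (P := Proc) _ : Cong _ _).symm⟩
  | ifF P Q =>
    intro σ L K h
    obtain ⟨rfl, rfl⟩ := flat_guard_inv (.ite ..) h
    exact ⟨_, .ifF _ _ 0, (sys_zero_singleton (P := Proc) _ : Cong _ _).symm⟩
  | linCom v P Q R =>
    intro σ L K h
    refine flat_redex ?_ (fun τ a h0 h1 => ?_) h
    · simp only [Proc.FV, union_subset_iff]
      refine ⟨fun x hx => Or.inl (Or.inr hx), FV_inst_subset (fun x hx => ?_) fun x hx => ?_⟩
      all_goals grind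
    · refine ⟨.out (.var a) (v.subst τ) (P.subst τ) ::ₘ {.inp .lin (.var (co a)) (Q.subst (up τ))},
        _, fun L K h => ?_, cong_parM_pair _ _, fun K R ha => ?_⟩
      · obtain ⟨M, N, J, H, rfl, rfl, g1, g2, -, -⟩ := flat_par_inv h
        obtain ⟨rfl, rfl⟩ := flat_guard_inv (.out ..) g1
        obtain ⟨rfl, rfl⟩ := flat_guard_inv (.inp ..) g2
        simp [h0, h1]
      · have := RS.com .lin (v.subst τ) (P.subst τ) (Q.subst (up τ)) R ha
        simpa [keep, subst_inst_comm] using this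
  | unCom v P Q R =>
    intro σ L K h
    refine flat_redex ?_ (fun τ a h0 h1 => ?_) h
    · simp only [Proc.FV, union_subset_iff]
      refine ⟨⟨fun x hx => Or.inl (Or.inr hx), FV_inst_subset (fun x hx => ?_) fun x hx => ?_⟩,
        fun x hx => Or.inr (Or.inl hx), fun x hx => Or.inr (Or.inr hx)⟩
      all_goals grind
    · refine ⟨.out (.var a) (v.subst τ) (P.subst τ) ::ₘ {.inp .un (.var (co a)) (Q.subst (up τ))},
        P.subst τ ::ₘ (Q.subst (inst v)).subst τ ::ₘ {.inp .un (.var (co a)) (Q.subst (up τ))},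
        fun L K h => ?_, ?_, fun K R ha => ?_⟩
      · obtain ⟨M, N, J, H, rfl, rfl, g1, g2, -, -⟩ := flat_par_inv h
        obtain ⟨rfl, rfl⟩ := flat_guard_inv (.out ..) g1
        obtain ⟨rfl, rfl⟩ := flat_guard_inv (.inp ..) g2
        simp [h0, h1]
      · simp only [Proc.subst, Val.subst_var, h1]
        refine (Cong.par_assoc _ _ _).trans ?_
        refine (Cong.par (.refl _) (cong_parM_pair _ _)).trans ?_
        exact (parM_cons (P := Proc) _ _ : Cong _ _).symm
      · have := RS.com .un (v.subst τ) (P.subst τ) (Q.subst (up τ)) R ha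
        simpa [keep, subst_inst_comm] using this
  | @case n lab P Q R j =>
    intro σ L K h
    refine flat_redex ?_ (fun τ a h0 h1 => ?_) h
    · simp only [Proc.FV, union_subset_iff]
      exact ⟨fun x hx => Or.inl (Or.inr hx), fun x hx => Or.inr (Or.inr ⟨j, hx⟩)⟩
    · refine ⟨.sel (.var a) (lab j) (P.subst τ) ::ₘ {.bran (.var (co a)) n lab fun i => (Q i).subst τ},
        _, fun L K h => ?_, cong_parM_pair _ _, fun K R ha => ?_⟩
      · obtain ⟨M, N, J, H, rfl, rfl, g1, g2, -, -⟩ := flat_par_inv h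
        obtain ⟨rfl, rfl⟩ := flat_guard_inv (.sel ..) g1
        obtain ⟨rfl, rfl⟩ := flat_guard_inv (.bran ..) g2
        simp [h0, h1]
      · have := RS.case (P.subst τ) (fun i => (Q i).subst τ) R j ha (lab := lab)
        simpa using this
  | @par P P' Q _ ih =>
    intro σ L K h
    obtain ⟨M, N, J, H, rfl, rfl, h1, h2, h3, h4⟩ := flat_par_inv h
    obtain ⟨M', hrs, hc⟩ := ih σ M J h1
    refine ⟨M' + N, hrs.add H N, ?_⟩
    have e1 : Cong (P'.subst σ) (sys J M') := hc
    have e2 : Cong (Q.subst σ) (sys H N) := Flat.cong h2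
    have f1 : ∀ c ∈ H, ∀ p ∈ M', Fresh c p := by
      intro c hc p hp x hx
      rcases Flat.mem_FV h1 (hrs.mem_FV ⟨p, hp, hx⟩) with h | h
      · aesop
      · grind
    have f2 : ∀ c ∈ J, ∀ r ∈ ({Q.subst σ} : Multiset Proc), Fresh c r := by simp_all
    have s1 : Cong (.par (P'.subst σ) (Q.subst σ)) (sys 0 (sys J M' ::ₘ {Q.subst σ})) :=
      (Cong.par e1 (.refl _)).trans ((sys_zero_singleton (P := Proc) _ : Cong _ _).symm.trans
        (sys_par (P := Proc) 0 _ _ 0))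
    have s2 : Cong (sys 0 (sys J M' ::ₘ {Q.subst σ})) (sys J (Q.subst σ ::ₘ M')) := by
      have := sys_nuM (P := Proc) (C := 0) (L := M') f2
      rw [add_zero, add_comm M', singleton_add] at this
      exact this
    have s3 : Cong (sys J (Q.subst σ ::ₘ M')) (sys (J + H) (M' + N)) := by
      have := (sys_cons_cong (P := Proc) J e2 M' : Cong _ _).trans (sys_nuM (P := Proc) f1)
      rw [add_comm H, add_comm N] at this
      exact this
    exact s1.trans (s2.trans s3)
  | @res P P' hs ih =>
    intro σ L K h
    obtain ⟨a, K, rfl, h1, h2, h3⟩ := flat_res_inv h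
    obtain ⟨M', hrs, hc⟩ := ih _ L K ((Proc.subst_subst P _ _) ▸ h1)
    have hrs' := hrs.add {ch a} 0
    rw [add_zero, add_zero, add_comm, singleton_add] at hrs'
    refine ⟨M', hrs', ?_⟩
    have hf : Fresh (ch a) (Proc.res (P'.subst (up (up σ)))) := by
      have : (Proc.res P').FV ⊆ (Proc.res P).FV := fun x hx => hs.FV_subset hx
      exact fun x hx => h3 x (FV_subst_mono this σ hx)
    refine (nu_opn (P := Proc) hf : Cong _ _).symm.trans ?_
    have e : Cong ((P'.subst (up (up σ))).subst (opn a)) (sys K M') := by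
      rw [Proc.subst_subst]; exact hc
    exact (cong_nu (P := Proc) _ e : Cong _ _).trans (nuM_cons (P := Proc) _ _ _ : Cong _ _).symm
  | @struct P Q Q' P' h1 _ h2 ih =>
    intro σ L K h
    obtain ⟨L', K', g1, g2, g3⟩ := (h1.flatSim σ).1 L K h _ (finite_not_fresh_multiset L)
    obtain ⟨M', hrs, hc⟩ := ih σ L' K' g1
    have hused : ∀ x P, P ∈ L → x ∈ P.FV → ch x ∈ K' → ch x ∈ K := by
      intro x P hP hx hxK
      rcases g3 _ hxK with h | h
      · exact h
      · exact absurd ⟨P, hP, fun hf => hf x hx rfl⟩ h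
    obtain ⟨M, hrs', hM⟩ := hrs.of_rel g2 hused
    refine ⟨M, hrs', (h2.subst σ).symm.trans (hc.trans ?_)⟩
    refine (nuM_congr g1.nodup h.nodup ?_).trans (cong_sys_of_rel K hM : Cong (sys K M) _).symm
    intro x hx
    have hx1 := hrs.mem_FV ((mem_FV_parM (P := Proc)).1 hx)
    have hx2 := (exists_mem_FV_of_rel g2).2 hx1
    refine ⟨fun hk => ?_, fun hk => ?_⟩
    · grind
    · rcases Flat.mem_FV g1 hx1 with h' | h'
      · have : x ∈ (P.subst σ).FV := (h1.subst σ).FV_eq ▸ h'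
        exact absurd rfl (h.fresh _ hk x this)
      · exact h'

/-! ### Barbs -/

@[simp] theorem barb_out {y v P x} : Barb (.out y v P) x ↔ y = .var x :=
  ⟨fun h => by cases h; rfl, fun h => h ▸ .out⟩

@[simp] theorem barb_inp {q y P x} : Barb (.inp q y P) x ↔ y = .var x :=
  ⟨fun h => by cases h; rfl, fun h => h ▸ .inp⟩

@[simp] theorem barb_sel {y l P x} : Barb (.sel y l P) x ↔ y = .var x :=
  ⟨fun h => by cases h; rfl, fun h => h ▸ .sel⟩

@[simp] theorem barb_bran {y n lab P x} : Barb (.bran y n lab P) x ↔ y = .var x :=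
  ⟨fun h => by cases h; rfl, fun h => h ▸ .bran⟩

@[simp] theorem barb_par {P Q x} : Barb (.par P Q) x ↔ Barb P x ∨ Barb Q x :=
  ⟨fun h => by cases h with | parL h => exact .inl h | parR h => exact .inr h,
    fun h => h.elim .parL .parR⟩

@[simp] theorem barb_res {P x} : Barb (.res P) x ↔ Barb P (x + 2) :=
  ⟨fun h => by cases h with | res h => exact h, .res⟩

@[simp] theorem barb_ite {v P Q x} : ¬ Barb (.ite v P Q) x := fun h => by cases h

@[simp] theorem barb_inact {x} : ¬ Barb .inact x := fun h => by cases h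

theorem barb_subst (P : Proc) : ∀ {σ : ℕ → Val} {y : ℕ},
    Barb (P.subst σ) y ↔ ∃ x, Barb P x ∧ σ x = .var y := by
  induction P with
  | out | inp | sel | bran => simp [Proc.subst, Val.subst_eq_var]
  | par P Q ih1 ih2 => simp [Proc.subst, ih1, ih2, or_and_right, exists_or]
  | res P ih =>
    intro σ y
    simp only [Proc.subst, barb_res, ih]
    exact (up_eq_succ (s := {x | Barb P x})).trans (up_eq_succ (s := {x | Barb P (x + 1)}))
  | ite | inact => simp [Proc.subst]

theorem Cong.barb {P Q : Proc} (h : Cong P Q) : ∀ x, Barb P x ↔ Barb Q x := by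
  induction h with
  | refl => simp
  | symm _ ih => exact fun x => (ih x).symm
  | trans _ _ ih1 ih2 => exact fun x => (ih1 x).trans (ih2 x)
  | out | inp | sel | bran | ite | res_inact | par_inact => simp
  | par _ _ ih1 ih2 => simp [ih1, ih2]
  | res _ ih => simp [ih]
  | par_comm => simp [or_comm]
  | par_assoc => simp [or_assoc]
  | extrude P Q => simp [Proc.rename, barb_subst]
  | res_swap P =>
    intro x
    simp only [barb_res, Proc.rename, barb_subst, Val.var.injEq]
    refine ⟨fun h => ⟨x + 2, h, rfl⟩, ?_⟩
    rintro ⟨y, hy, h⟩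
    match y with
    | 0 => simp [swapEnds] at h
    | 1 => simp [swapEnds] at h
    | y + 2 => simp only [swapEnds] at h; rwa [← h]
  | res_comm P =>
    intro x
    simp only [barb_res, Proc.rename, barb_subst, Val.var.injEq]
    refine ⟨fun h => ⟨x + 4, h, rfl⟩, ?_⟩
    rintro ⟨y, hy, h⟩
    match y with
    | 0 => simp [swapRes] at h
    | 1 => simp [swapRes] at h
    | 2 => simp [swapRes] at h
    | 3 => simp [swapRes] at h
    | y + 4 =>
      simp only [swapRes] at h
      have h' : x + 2 + 2 = y + 4 := h.symm
      rwa [h']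

theorem barb_sys {K : Multiset ℕ} {L : Multiset Proc} {x : ℕ} :
    Barb (sys K L) x ↔ (∃ P ∈ L, Barb P x) ∧ ch x ∉ K := by
  have h1 : ∀ L : Multiset Proc, Barb (parM L) x ↔ ∃ P ∈ L, Barb P x := by
    intro L
    induction L using induction_on with
    | empty =>
      rw [parM_zero]
      exact iff_of_false (show ¬ Barb Proc.inact x from barb_inact) (by simp)
    | cons P L ih =>
      have : Cong (parM (P ::ₘ L)) (.par P (parM L)) := parM_cons P L
      rw [this.barb, barb_par, ih]
      simp
  have h2 : ∀ (K : Multiset ℕ) (P : Proc), Barb (nuM K P) x ↔ Barb P x ∧ ch x ∉ K := by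
    intro K P
    induction K using induction_on with
    | empty => simp [nuM_zero]
    | cons c K ih =>
      have : Cong (nuM (c ::ₘ K) P) (.res ((nuM K P).subst (cls (2 * c)))) := nuM_cons c K P
      rw [this.barb, barb_res, barb_subst]
      constructor
      · rintro ⟨y, hy, h⟩
        by_cases hc : ch y = c
        · rcases eq_or_eq_co (show ch y = ch (2 * c) by simpa using hc) with h1 | h1 <;>
          · simp_all
        · rw [cls_of_ne (by simpa using hc)] at h
          simp only [Val.var.injEq, Nat.add_right_cancel_iff] at h
          subst h
          have := ih.1 hy
          simp [this.1, this.2, hc]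
      · rintro ⟨hP, h⟩
        rw [mem_cons, not_or] at h
        exact ⟨x, ih.2 ⟨hP, h.2⟩, cls_of_ne (by simpa using h.1)⟩
  rw [sys, h2, h1]

/-! ### Reduction of systems -/

theorem Step.subst {P P' : Proc} (h : Step P P') : ∀ σ, Step (P.subst σ) (P'.subst σ) := by
  induction h with
  | ifT => exact fun σ => .ifT _ _
  | ifF => exact fun σ => .ifF _ _
  | linCom v P Q R =>
    intro σ
    simp only [Proc.subst, subst_inst_comm]
    exact .linCom _ _ _ _
  | unCom v P Q R =>
    intro σ
    simp only [Proc.subst, subst_inst_comm]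
    exact .unCom _ _ _ _
  | case P Q R j => exact fun σ => .case _ _ _ j
  | par _ _ ih => exact fun σ => .par _ (ih σ)
  | res _ ih => exact fun σ => .res (ih _)
  | struct h1 _ h2 ih => exact fun σ => .struct (h1.subst σ) (ih σ) (h2.subst σ)

theorem Step.nuM (K : Multiset ℕ) {P P' : Proc} (h : Step P P') : Step (nuM K P) (nuM K P') := by
  induction K using induction_on with
  | empty => simpa [nuM_zero] using h
  | cons c K ih =>
    exact .struct (nuM_cons (P := Proc) c K P) (.res (ih.subst (cls (2 * c))))
      (Calculus.symm (P := Proc) (nuM_cons c K P'))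

theorem parM_cons_cons (P Q : Proc) (R : Multiset Proc) :
    Cong (parM (P ::ₘ Q ::ₘ R)) (.par (.par P Q) (parM R)) :=
  (show Cong _ (.par P (parM (Q ::ₘ R))) from parM_cons P _).trans
    ((Cong.par (.refl _) (parM_cons (P := Proc) Q R)).trans (Cong.par_assoc _ _ _).symm)

theorem RS.step {K : Multiset ℕ} {L M : Multiset Proc} (h : RS K L M) :
    Step (sys K L) (sys K M) := by
  have key : ∀ {a K} {X Y : Proc}, ch a ∈ K → Step (.res (X.subst (cls a))) (.res (Y.subst (cls a))) →
      Step (Calculus.nuM K X) (Calculus.nuM K Y) := by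
    intro a K X Y ha h
    obtain ⟨K, rfl⟩ := exists_cons_of_mem ha
    have e : ∀ X : Proc, Cong (Calculus.nuM (ch a ::ₘ K) X)
        (Calculus.nuM K (.res (X.subst (cls a)))) := fun X =>
      (show Cong _ _ from nuM_cons' (P := Proc) _ _ _).trans
        (cong_nuM (P := Proc) K (nu_ch a X))
    exact .struct (e X) (h.nuM K) (e Y).symm
  cases h with
  | ifT P Q R =>
    exact Step.nuM K (.struct (parM_cons (P := Proc) _ _) (.par _ (.ifT _ _))
      (Calculus.symm (P := Proc) (parM_cons _ _)))
  | ifF P Q R =>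
    exact Step.nuM K (.struct (parM_cons (P := Proc) _ _) (.par _ (.ifF _ _))
      (Calculus.symm (P := Proc) (parM_cons _ _)))
  | @com a q v P Q R ha =>
    refine key ha (.struct (.res ((parM_cons_cons _ _ _).subst _)) ?_
      (.res ((parM_cons_cons _ _ _).subst _).symm))
    simp only [Proc.subst, subst_inst_comm, Val.subst_var, cls_self, cls_co]
    cases q with
    | lin =>
      refine .struct (.refl _) (.linCom _ _ _ _) ?_
      simp only [keep, zero_add]
      exact .refl _
    | un =>
      refine .struct (.refl _) (.unCom _ _ _ _) ?_
      refine .res ((Cong.par_assoc _ _ _).trans (.par (.refl _) ?_))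
      have : Cong (parM (keep .un (.inp .un (.var (co a)) Q) + R))
        (.par (.inp .un (.var (co a)) Q) (parM R)) := by
        rw [keep, singleton_add]
        exact parM_cons (P := Proc) _ _
      have := (this.subst (cls a)).symm
      simpa [Proc.subst] using this
  | @case a n lab P Q R j ha =>
    refine key ha (.struct (.res ((parM_cons_cons _ _ _).subst _)) ?_
      (.res ((parM_cons_cons _ _ _).subst _).symm))
    simp only [Proc.subst, Val.subst_var, cls_self, cls_co]
    exact .case _ _ _ j

/-! ### Non-deterministic choices as components of systems -/

/-- A non-deterministic choice that may have been resolved, with the selections that are left. -/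
def bundle (o : Option (List Proc)) (l : List Lab) : Proc :=
  .res (.par
    (match o with
      | some Ps => .bran (.var 0) Ps.length (fun i => .opt i) (fun i => (Ps.get i).rename (· + 2))
      | none => .inact)
    (prod (l.map fun k => .sel (.var 1) k .inact)))

/-- The guarded components of a `bundle` whose endpoints are `b` and `co b`. -/
def threads (b : ℕ) (o : Option (List Proc)) (l : List Lab) : Multiset Proc :=
  (match o with
    | some Ps => {.bran (.var b) Ps.length (fun i => .opt i) Ps.get}
    | none => 0) +
  (l : Multiset Lab).map fun k => .sel (.var (co b)) k .inact

/-- The residual of a non-deterministic choice. -/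
def IsJunk (P : Proc) : Prop := ∃ l, P = bundle none l

theorem nd_eq_bundle (Ps : List Proc) :
    nd Ps = bundle (some Ps) ((List.range Ps.length).map .opt) := by
  simp only [nd, bundle, List.map_map]
  rfl

theorem prod_cong (l : List Proc) : Cong (prod l) (parM (l : Multiset Proc)) := by
  have key : ∀ l : List Proc, Cong (prod l) (parList l) := by
    intro l
    induction l with
    | nil => exact .refl _
    | cons P l ih =>
      cases l with
      | nil => exact (Cong.par_inact P).symm
      | cons Q l => exact .par (.refl _) ih
  exact (key l).trans (parList_perm (P := Proc)
    (by rw [← Multiset.coe_eq_coe, coe_toList]))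

theorem prod_subst (l : List Proc) (σ : ℕ → Val) :
    (prod l).subst σ = prod (l.map (Proc.subst σ)) := by
  induction l with
  | nil => rfl
  | cons P l ih =>
    cases l with
    | nil => rfl
    | cons Q l => simpa [prod, Proc.subst] using ih

theorem mem_FV_prod {l : List Proc} {x : ℕ} : x ∈ (prod l).FV ↔ ∃ P ∈ l, x ∈ P.FV := by
  have := Set.ext_iff.1 (prod_cong l).FV_eq x
  exact this.trans ((mem_FV_parM (P := Proc)).trans (by simp; rfl))

theorem mem_FV_bundle {o l x} (h : x ∈ (bundle o l).FV) :
    ∃ Ps, o = some Ps ∧ ∃ P ∈ Ps, x ∈ P.FV := by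
  rcases h with h | h
  · cases o with
    | none => exact absurd h (Set.notMem_empty _)
    | some Ps =>
      rcases h with h | ⟨i, h⟩
      · simp at h
      · refine ⟨Ps, rfl, Ps.get i, List.get_mem _ _, ?_⟩
        obtain ⟨y, hy, h⟩ := (Proc.mem_FV_subst _).1 h
        simp only [Val.var.injEq, Nat.add_right_cancel_iff] at h
        exact h ▸ hy
  · obtain ⟨P, hP, h⟩ := mem_FV_prod.1 h
    obtain ⟨k, -, rfl⟩ := List.mem_map.1 hP
    rcases h with h | h
    · simp at h
    · exact absurd h (Set.notMem_empty _)

theorem sys_bundle (C : Multiset ℕ) {b : ℕ} {o : Option (List Proc)} {l : List Lab}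
    {M : Multiset Proc} (hM : ∀ Q ∈ M, Fresh (ch b) Q)
    (ho : ∀ Ps, o = some Ps → ∀ P ∈ Ps, Fresh (ch b) P) :
    Cong (sys C (bundle o l ::ₘ M)) (sys (ch b ::ₘ C) (threads b o l + M)) := by
  have hf : Fresh (ch b) (bundle o l) := by
    intro x hx
    obtain ⟨Ps, h, P, hP, hx⟩ := mem_FV_bundle hx
    exact ho Ps h P hP x hx
  refine (sys_res (P := Proc) C hf hM : Cong _ _).trans ?_
  have e1 : ∀ (P Q : Proc), (Proc.par P Q).subst (opn b) = .par (P.subst (opn b)) (Q.subst (opn b)) :=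
    fun _ _ => rfl
  have e2 : ((prod (l.map fun k => .sel (.var 1) k .inact)).subst (opn b)) =
      prod (l.map fun k => .sel (.var (co b)) k .inact) := by
    rw [prod_subst, List.map_map]
    rfl
  have e3 : ∀ (M : Multiset Proc) C, Cong (sys C (prod (l.map fun k => .sel (.var (co b)) k .inact) ::ₘ M))
      (sys C (((l : Multiset Lab).map fun k => Proc.sel (.var (co b)) k .inact) + M)) := by
    intro M C
    refine cong_sys (P := Proc) C ?_
    refine (show Cong _ _ from parM_cons (P := Proc) _ _).trans (.trans ?_
      (parM_add (P := Proc) _ _ : Cong _ _).symm)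
    exact .par (prod_cong _) (.refl _)
  change Cong (sys _ (Proc.subst (opn b) (.par _ _) ::ₘ M)) _
  rw [e1, e2]
  refine (sys_par (P := Proc) _ _ _ _ : Cong _ _).trans ?_
  unfold threads
  cases o with
  | none =>
    refine (sys_inact (P := Proc) _ _ : Cong _ _).trans ?_
    rw [zero_add]
    exact e3 _ _
  | some Ps =>
    rw [cons_swap]
    refine (e3 _ _).trans ?_
    have : (fun i => ((Ps.get i).rename (· + 2)).subst (opn b)) = Ps.get :=
      funext fun i => subst_opn_shift b _
    simp only [Proc.subst, this, Val.subst_var, opn_zero]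
    rw [add_cons, add_assoc, singleton_add]
    exact .refl _

theorem mem_FV_threads {b o l x} (h : ∃ P ∈ threads b o l, x ∈ P.FV) :
    ch x = ch b ∨ ∃ Ps, o = some Ps ∧ ∃ P ∈ Ps, x ∈ P.FV := by
  obtain ⟨P, hP, hx⟩ := h
  rcases mem_add.1 hP with hP | hP
  · cases o with
    | none => exact absurd hP (Multiset.notMem_zero _)
    | some Ps =>
      obtain rfl := mem_singleton.1 hP
      rcases hx with hx | ⟨i, hx⟩
      · simp_all
      · grind
  · obtain ⟨k, -, rfl⟩ := mem_map.1 hP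
    rcases hx with hx | hx
    · simp at hx; exact Or.inl (by rw [← hx, ch_co])
    · exact absurd hx (Set.notMem_empty _)

/-- A bundle together with an endpoint. -/
abbrev NBundle := ℕ × Option (List Proc) × List Lab

theorem sys_bundles {B : Multiset NBundle} : ∀ {C : Multiset ℕ} {M : Multiset Proc},
    (B.map fun p => ch p.1).Nodup → (∀ p ∈ B, ∀ Q ∈ M, Fresh (ch p.1) Q) →
    (∀ p ∈ B, ∀ p' ∈ B, ∀ Ps, p'.2.1 = some Ps → ∀ P ∈ Ps, Fresh (ch p.1) P) →
    Cong (sys C (B.map (fun p => bundle p.2.1 p.2.2) + M))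
      (sys ((B.map fun p => ch p.1) + C) (B.bind (fun p => threads p.1 p.2.1 p.2.2) + M)) := by
  induction B using induction_on with
  | empty => intros; simp only [Multiset.map_zero, Multiset.zero_bind, zero_add]; exact .refl _
  | cons p B ih =>
    intro C M h1 h2 h3
    rw [map_cons, Multiset.nodup_cons] at h1
    simp only [map_cons, Multiset.cons_bind, cons_add]
    refine (sys_bundle C (b := p.1) ?_ ?_).trans ?_
    · intro Q hQ
      rcases mem_add.1 hQ with hQ | hQ
      · obtain ⟨p', hp', rfl⟩ := mem_map.1 hQ
        intro x hx
        obtain ⟨Ps, h, P, hP, hx⟩ := mem_FV_bundle hx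
        exact h3 p (by simp) p' (by simp [hp']) Ps h P hP x hx
      · exact h2 p (by simp) Q hQ
    · exact h3 p (by simp) p (by simp)
    · have e : threads p.1 p.2.1 p.2.2 + (B.map (fun p => bundle p.2.1 p.2.2) + M) =
          B.map (fun p => bundle p.2.1 p.2.2) + (threads p.1 p.2.1 p.2.2 + M) := by
        rw [← add_assoc, ← add_assoc, add_comm (threads _ _ _)]
      rw [e]
      refine (ih h1.2 ?_ fun p hp p' hp' => h3 p (by simp [hp]) p' (by simp [hp'])).trans ?_
      · intro p' hp' Q hQ
        rcases mem_add.1 hQ with hQ | hQ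
        · intro x hx
          rcases mem_FV_threads ⟨Q, hQ, hx⟩ with h | ⟨Ps, h, P, hP, hx⟩
          · rw [h]
            intro e
            exact h1.1 (mem_map.2 ⟨p', hp', e.symm⟩)
          · exact h3 p' (by simp [hp']) p (by simp) Ps h P hP x hx
        · exact h2 p' (by simp [hp']) Q hQ
      · rw [add_cons, ← add_assoc, add_comm (threads _ _ _)]
        exact .refl _

theorem mem_threads {b o l P} : P ∈ threads b o l ↔
    (∃ Ps, o = some Ps ∧ P = .bran (.var b) Ps.length (fun i => .opt i) Ps.get) ∨
      ∃ k ∈ l, P = .sel (.var (co b)) k .inact := by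
  unfold threads
  rw [mem_add, mem_map]
  cases o <;> simp [eq_comm]

theorem bran_inj {y y' : Val} {n m : ℕ} {lab : Fin n → Lab} {lab' : Fin m → Lab}
    {P : Fin n → Proc} {Q : Fin m → Proc} (h : Proc.bran y n lab P = .bran y' m lab' Q) :
    ∃ e : n = m, ∀ i, P i = Q (i.cast e) ∧ lab i = lab' (i.cast e) := by
  aesop

theorem exists_bundle_names (B : Multiset (Option (List Proc) × List Lab)) {F : Set ℕ}
    (hF : F.Finite) : ∃ N : Multiset NBundle, N.map Prod.snd = B ∧ (N.map fun p => ch p.1).Nodup ∧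
      ∀ p ∈ N, ch p.1 ∉ F := by
  induction B using induction_on with
  | empty => exact ⟨0, by simp⟩
  | cons q B ih =>
    obtain ⟨N, h1, h2, h3⟩ := ih
    have hfin : (F ∪ {c | c ∈ N.map fun p => ch p.1}).Finite :=
      hF.union ((N.map fun p => ch p.1).toFinset.finite_toSet.subset
        (by intro c hc; simpa using hc))
    obtain ⟨c, hc⟩ := hfin.exists_notMem
    simp only [mem_union, mem_ofPred_eq, not_or] at hc
    refine ⟨(2 * c, q) ::ₘ N, by simp [h1], ?_, ?_⟩
    all_goals aesop

theorem exists_guards_bundles {L : Multiset Proc}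
    (hL : ∀ P ∈ L, P.IsGuard ∨ (∃ Ps, P = nd Ps) ∨ IsJunk P) :
    ∃ (G : Multiset Proc) (B : Multiset (Option (List Proc) × List Lab)),
      (∀ P ∈ G, P.IsGuard) ∧ L = B.map (fun p => bundle p.1 p.2) + G ∧
      ∀ p ∈ B, p.1 = none ∨ ∃ Ps, p = (some Ps, (List.range Ps.length).map .opt) := by
  induction L using induction_on with
  | empty => exact ⟨0, 0, by simp⟩
  | cons P L ih =>
    obtain ⟨G, B, h1, rfl, h3⟩ := ih fun Q hQ => hL Q (by simp [hQ])
    rcases hL P (by simp) with h | ⟨Ps, rfl⟩ | ⟨l, rfl⟩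
    · refine ⟨P ::ₘ G, B, ?_, by simp, h3⟩
      intro Q hQ
      rcases mem_cons.1 hQ with rfl | hQ
      · exact h
      · exact h1 Q hQ
    · refine ⟨G, (some Ps, (List.range Ps.length).map .opt) ::ₘ B, h1, ?_, ?_⟩
      · simp [nd_eq_bundle]
      · intro p hp
        rcases mem_cons.1 hp with rfl | hp
        · exact Or.inr ⟨Ps, rfl⟩
        · exact h3 p hp
    · refine ⟨G, (none, l) ::ₘ B, h1, by simp, ?_⟩
      intro p hp
      rcases mem_cons.1 hp with rfl | hp
      · exact Or.inl rfl
      · exact h3 p hp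

/-- The reducts of a system of guarded processes, non-deterministic choices and junk. -/
theorem step_inv {K : Multiset ℕ} {L : Multiset Proc} {T T' : Proc} (hK : K.Nodup)
    (hL : ∀ P ∈ L, P.IsGuard ∨ (∃ Ps, P = nd Ps) ∨ IsJunk P) (hT : Cong T (sys K L))
    (h : Step T T') :
    (∃ M, RS K L M ∧ Cong T' (sys K M)) ∨
      ∃ Ps R P J, L = nd Ps ::ₘ R ∧ P ∈ Ps ∧ IsJunk J ∧ Cong T' (sys K (P ::ₘ J ::ₘ R)) := by
  classical
  obtain ⟨G, B, hG, rfl, hB⟩ := exists_guards_bundles hL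
  have finK : {c | c ∈ K}.Finite :=
    K.toFinset.finite_toSet.subset (by intro c hc; simpa using hc)
  have finB : {c | ∃ p ∈ B, ∃ Ps, p.1 = some Ps ∧ ∃ P ∈ Ps, ¬ Fresh c P}.Finite := by
    have : ∀ p ∈ B.toFinset, {c | ∃ Ps, p.1 = some Ps ∧ ∃ P ∈ Ps, ¬ Fresh c P}.Finite := by
      rintro ⟨o, l⟩ -
      cases o with
      | none => simp
      | some Ps =>
        refine (finite_not_fresh_multiset (Ps : Multiset Proc)).subset ?_
        rintro c ⟨_, h0, P, hP, h⟩
        obtain rfl : Ps = _ := Option.some.inj h0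
        exact ⟨P, hP, h⟩
    refine (Set.Finite.biUnion B.toFinset.finite_toSet this).subset ?_
    rintro c ⟨p, hp, h⟩
    exact Set.mem_biUnion (by simpa using hp) h
  obtain ⟨N, rfl, hN, hNF⟩ := exists_bundle_names B
    ((finK.union (finite_not_fresh_multiset G)).union finB)
  have nK : ∀ p ∈ N, ch p.1 ∉ K := fun p hp hk => hNF p hp (Or.inl (Or.inl hk))
  have nG : ∀ p ∈ N, ∀ Q ∈ G, Fresh (ch p.1) Q := fun p hp Q hQ => by
    grind
  have nB : ∀ p ∈ N, ∀ p' ∈ N, ∀ Ps, p'.2.1 = some Ps → ∀ P ∈ Ps, Fresh (ch p.1) P := by aesop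
  have nN : ∀ p ∈ N, ∀ p' ∈ N, ch p.1 = ch p'.1 → p = p' := by
    intro p hp p' hp' h
    exact Multiset.inj_on_of_nodup_map hN p hp p' hp' h
  set S := N.map fun p => ch p.1 with hS
  set Θ := N.bind fun p => threads p.1 p.2.1 p.2.2 with hΘ
  have memΘ : ∀ {P}, P ∈ Θ → ∃ p ∈ N, P ∈ threads p.1 p.2.1 p.2.2 := fun h =>
    Multiset.mem_bind.1 h
  rw [Multiset.map_map] at hT ⊢
  have hcol : ∀ M : Multiset Proc, (∀ p ∈ N, ∀ Q ∈ M, Fresh (ch p.1) Q) →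
      Cong (sys K (N.map (fun p => bundle p.2.1 p.2.2) + M)) (sys (S + K) (Θ + M)) := fun M hM =>
    sys_bundles hN hM nB
  have hT1 : Cong T (sys (S + K) (Θ + G)) := hT.trans (hcol G nG)
  have hstep : Step (sys (S + K) (Θ + G)) T' := .struct hT1.symm h (.refl _)
  have hguard : ∀ P ∈ Θ + G, P.IsGuard := by
    intro P hP
    rcases mem_add.1 hP with hP | hP
    · obtain ⟨p, -, hP⟩ := memΘ hP
      rcases mem_threads.1 hP with ⟨Ps, -, rfl⟩ | ⟨k, -, rfl⟩
      · exact .bran ..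
      · exact .sel ..
    · exact hG P hP
  have hflat := Flat.sys (P := Proc) (K := S + K) hguard
    (Multiset.nodup_add.2 ⟨hN, hK, Multiset.disjoint_left.2 fun {c} hc hc' => by
      obtain ⟨p, hp, rfl⟩ := mem_map.1 hc
      exact nK p hp hc'⟩)
  have hflat' : Flat ((sys (S + K) (Θ + G) : Proc).subst .var) (Θ + G) (S + K) := by
    rw [Proc.subst_id]; exact hflat
  obtain ⟨M, hrs, hM⟩ := hstep.flat _ _ _ hflat'
  rw [Proc.subst_id] at hM
  clear hflat hflat' hstep hT hT1 h
  have hch : ∀ {a P}, P ∈ G → a ∈ P.FV → ch a ∈ S + K → ch a ∈ K := by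
    intro a P hP ha h
    rcases mem_add.1 h with h | h
    · obtain ⟨p, hp, e⟩ := mem_map.1 h
      exact absurd e.symm (nG p hp P hP a ha)
    · exact h
  generalize hX : Θ + G = X at hrs
  have memG : ∀ {P R}, Θ + G = P ::ₘ R → (∀ p ∈ N, P ∉ threads p.1 p.2.1 p.2.2) →
      ∃ G', G = P ::ₘ G' ∧ R = Θ + G' := by
    intro P R h hP
    have : P ∈ Θ + G := h ▸ mem_cons_self _ _
    rcases mem_add.1 this with h' | h'
    · obtain ⟨p, hp, h'⟩ := memΘ h'
      exact absurd h' (hP p hp)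
    · obtain ⟨G', rfl⟩ := exists_cons_of_mem h'
      refine ⟨G', rfl, ?_⟩
      rw [add_cons, cons_inj_right] at h
      exact h.symm
  have finish : ∀ {G1 M1 : Multiset Proc}, RS K G M1 →
      M = Θ + M1 → (∃ M, RS K (N.map ((fun p => bundle p.1 p.2) ∘ Prod.snd) + G) M ∧
        Cong T' (sys K M)) := by
    rintro - M1 h1 rfl
    refine ⟨N.map (fun p => bundle p.2.1 p.2.2) + M1, ?_, hM.trans (hcol M1 ?_).symm⟩
    · have := h1.add 0 (N.map (fun p => bundle p.2.1 p.2.2))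
      rw [add_zero, add_comm G, add_comm M1] at this
      exact this
    · intro p hp Q hQ x hx
      obtain ⟨P, hP, hx⟩ := h1.mem_FV ⟨Q, hQ, hx⟩
      exact nG p hp P hP x hx
  cases hrs with
  | ifT P Q R =>
    obtain ⟨G', rfl, rfl⟩ := memG hX (by simp [mem_threads])
    exact Or.inl (finish (G1 := 0) (.ifT _ _ G') (by simp))
  | ifF P Q R =>
    obtain ⟨G', rfl, rfl⟩ := memG hX (by simp [mem_threads])
    exact Or.inl (finish (G1 := 0) (.ifF _ _ G') (by simp))
  | @com a q v P Q R ha =>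
    obtain ⟨G1, rfl, h2⟩ := memG hX (by simp [mem_threads])
    have hX2 : Θ + (.out (.var a) v P ::ₘ G1) = .inp q (.var (co a)) Q ::ₘ .out (.var a) v P ::ₘ R := by
      rw [hX, cons_swap]
    obtain ⟨G2, h3, h4⟩ := memG hX2 (by simp [mem_threads])
    obtain ⟨G3, rfl⟩ : ∃ G3, G1 = .inp q (.var (co a)) Q ::ₘ G3 := by
      have : Proc.inp q (.var (co a)) Q ∈ .out (.var a) v P ::ₘ G1 := h3 ▸ mem_cons_self _ _
      rw [mem_cons] at this
      exact exists_cons_of_mem (this.resolve_left (by simp))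
    rw [add_cons, cons_inj_right] at h2
    subst h2
    refine Or.inl (finish (G1 := 0) (.com q v P Q G3 (hch (P := .out (.var a) v P) (by simp) (by simp [Proc.FV]) ha)) ?_)
    simp only [add_cons]
    rw [add_left_comm]
  | @case a n lab P Q R j ha =>
    have hmem : Proc.sel (.var a) (lab j) P ∈ Θ + G := hX ▸ mem_cons_self _ _
    have hmem2 : Proc.bran (.var (co a)) n lab Q ∈ Θ + G := hX ▸ by simp
    rcases mem_add.1 hmem with h | h
    · obtain ⟨p, hp, h⟩ := memΘ h
      obtain ⟨b, o, l⟩ := p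
      replace h : Proc.sel (.var a) (lab j) P ∈ threads b o l := h
      rcases mem_threads.1 h with ⟨Ps, -, h⟩ | ⟨k, hk, h⟩
      · cases h
      · injection h with e1 e2 e3
        injection e1 with e1
        subst e1 e3
        try rw [co_co] at hmem2
        try rw [co_co] at hX
        have hmem3 : Proc.bran (.var b) n lab Q ∈ Θ := by
          refine (mem_add.1 hmem2).resolve_right fun hg => ?_
          exact nG _ hp _ hg b (Or.inl (by simp)) rfl
        obtain ⟨⟨b', o', l'⟩, hp', h'⟩ := memΘ hmem3
        have hbb : (b', o', l') = (b, o, l) := by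
          refine nN _ hp' _ hp ?_
          rcases mem_threads.1 h' with ⟨Ps, -, h'⟩ | ⟨k, -, h'⟩
          · injection h' with e; injection e with e; exact congrArg ch e.symm
          · cases h'
        replace h' : Proc.bran (.var b) n lab Q ∈ threads b' o' l' := h'
        injection hbb with e1 e2
        injection e2 with e2 e3
        subst e1 e2 e3
        rcases mem_threads.1 h' with ⟨Ps, rfl, hbr⟩ | ⟨k, -, hbr⟩
        · obtain ⟨rfl, eQ⟩ := bran_inj hbr
          obtain rfl : Q = Ps.get := funext fun i => (eQ i).1
          obtain rfl : lab = fun i => .opt i := funext fun i => (eQ i).2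
          simp only at e2
          subst e2
          obtain ⟨N', rfl⟩ := exists_cons_of_mem hp
          rcases hB (some Ps, l') (by simp) with h0 | ⟨Ps', h0⟩
          · cases h0
          injection h0 with h0 hl'
          injection h0 with h0
          subst h0
          obtain ⟨l'', hl''⟩ : ∃ l'', l'.Perm (.opt j :: l'') :=
            ⟨l'.erase (.opt j), List.perm_cons_erase hk⟩
          right
          refine ⟨Ps, N'.map (fun p => bundle p.2.1 p.2.2) + G, Ps.get j, bundle none l'', ?_,
            List.get_mem _ _, ⟨l'', rfl⟩, ?_⟩
          · rw [map_cons, cons_add, nd_eq_bundle, ← hl']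
            rfl
          · have hR : R = (N'.bind fun p => threads p.1 p.2.1 p.2.2) + threads b' none l'' + G := by
              rw [hΘ, Multiset.cons_bind] at hX
              unfold threads at hX ⊢
              rw [Multiset.coe_eq_coe.2 hl''] at hX
              simp only [← Multiset.cons_coe, map_cons, singleton_add,
                cons_add] at hX
              rw [cons_swap, cons_inj_right, cons_inj_right] at hX
              rw [← hX, zero_add]
              congr 1
              rw [add_comm]
            have old : ∀ p ∈ (b', none, l'') ::ₘ N', ∃ p' ∈ (b', some Ps, l') ::ₘ N',
                ch p.1 = ch p'.1 := by
              intro p hp'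
              rcases mem_cons.1 hp' with rfl | hp'
              · exact ⟨_, mem_cons_self _ _, rfl⟩
              · exact ⟨p, mem_cons_of_mem hp', rfl⟩
            have hc2 := sys_bundles (B := (b', none, l'') ::ₘ N') (C := K) (M := Ps.get j ::ₘ G)
              (by rw [hS] at hN; simpa using hN) ?_ ?_
            · refine hM.trans (.trans ?_ (hc2.symm.trans ?_))
              · refine (sys_inact (P := Proc) _ _ : Cong _ _).trans ?_
                rw [hR, hS]
                simp only [map_cons, Multiset.cons_bind, add_cons]
                rw [add_comm (threads _ _ _)]
                exact .refl _
              · simp only [map_cons, add_cons, cons_add]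
                exact .refl _
            · intro p hp' Q hQ
              obtain ⟨p', hp', e⟩ := old p hp'
              rw [e]
              rcases mem_cons.1 hQ with rfl | hQ
              · exact nB p' hp' _ (mem_cons_self _ _) Ps rfl _ (List.get_mem _ _)
              · exact nG p' hp' Q hQ
            · intro p hp' p'' hp'' Ps' h P hP
              obtain ⟨p', hp', e⟩ := old p hp'
              rw [e]
              rcases mem_cons.1 hp'' with rfl | hp''
              · cases h
              · exact nB p' hp' p'' (mem_cons_of_mem hp'') Ps' h P hP
        · cases hbr
    · have hg2 : Proc.bran (.var (co a)) n lab Q ∈ G := by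
        refine (mem_add.1 hmem2).resolve_left fun hg => ?_
        obtain ⟨p, hp, h'⟩ := memΘ hg
        rcases mem_threads.1 h' with ⟨Ps, -, h'⟩ | ⟨k, -, h'⟩
        · injection h' with e
          injection e with e
          exact nG p hp _ h a (Or.inl (by simp)) (by rw [← e, ch_co])
        · cases h'
      obtain ⟨G1, rfl⟩ := exists_cons_of_mem h
      rw [mem_cons] at hg2
      obtain ⟨G2, rfl⟩ := exists_cons_of_mem (hg2.resolve_left (by simp))
      simp only [add_cons, cons_inj_right] at hX
      subst hX
      exact Or.inl (finish (G1 := 0) (.case P Q G2 j (hch h (by simp [Proc.FV]) ha)) (by simp))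

theorem step_nd (K : Multiset ℕ) {Ps : List Proc} {P : Proc} (hP : P ∈ Ps) (R : Multiset Proc) :
    ∃ J, IsJunk J ∧ Step (sys K (nd Ps ::ₘ R)) (sys K (P ::ₘ J ::ₘ R)) := by
  obtain ⟨j, rfl⟩ := List.mem_iff_get.1 hP
  have hfin := (finite_not_fresh_multiset R).union (finite_not_fresh_multiset (Ps : Multiset Proc))
  obtain ⟨c, hc⟩ := hfin.exists_notMem
  simp only [mem_union, mem_ofPred_eq, not_or, not_exists, not_and, not_not,
    Multiset.mem_coe] at hc
  have hj : Lab.opt j ∈ (List.range Ps.length).map Lab.opt :=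
    List.mem_map.2 ⟨j, by simp, rfl⟩
  obtain ⟨l, hl⟩ : ∃ l, ((List.range Ps.length).map Lab.opt).Perm (.opt j :: l) := by
    classical
    exact ⟨_, List.perm_cons_erase hj⟩
  refine ⟨bundle none l, ⟨l, rfl⟩, ?_⟩
  have e1 := sys_bundle K (b := 2 * c) (o := some Ps) (l := (List.range Ps.length).map Lab.opt)
    (M := R) (by simpa using hc.1) (by rintro _ ⟨⟩; simpa using hc.2)
  have e2 := sys_bundle K (b := 2 * c) (o := none) (l := l)
    (M := Ps.get j ::ₘ R) (by
      intro Q hQ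
      rcases mem_cons.1 hQ with rfl | hQ
      · simpa using hc.2 _ (List.get_mem _ _)
      · simpa using hc.1 Q hQ) (by simp)
  have e3 : threads (2 * c) (some Ps) ((List.range Ps.length).map Lab.opt) =
      .sel (.var (co (2 * c))) (.opt j) .inact ::ₘ
        .bran (.var (co (co (2 * c)))) Ps.length (fun i => .opt i) Ps.get ::ₘ
        threads (2 * c) none l := by
    unfold threads
    rw [Multiset.coe_eq_coe.2 hl, co_co]
    simp only [← Multiset.cons_coe, map_cons, singleton_add, zero_add]
    rw [cons_swap]
  have hrs : RS (ch (2 * c) ::ₘ K) (threads (2 * c) (some Ps)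
      ((List.range Ps.length).map Lab.opt) + R)
      (.inact ::ₘ Ps.get j ::ₘ (threads (2 * c) none l + R)) := by
    rw [e3]
    simp only [cons_add]
    exact .case (lab := fun i : Fin Ps.length => Lab.opt i) _ _ _ j (by simp)
  rw [nd_eq_bundle, cons_swap]
  refine .struct e1 hrs.step (.trans (sys_inact (P := Proc) _ _ : Cong _ _) ?_)
  rw [← add_cons]
  exact e2.symm

end CMV

namespace Mix
open Calculus (Fresh)

/-! ## Annotated processes with mixed choices -/

/-- Processes in which every choice carries the qualifier and the view of the type of its
subject. -/
inductive Ann where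
  | choice (q₁ q₂ : Qual) (vw : View) (y : Val) (n : ℕ) (lab : Fin n → Label) (act : Fin n → Act)
      (P : Fin n → Ann)
  | par (P Q : Ann)
  | res (P : Ann)
  | ite (v : Val) (P Q : Ann)
  | inact

namespace Act

/-- The names of an action. -/
def fv : Act → Set ℕ
  | .send v => v.fv
  | .recv => ∅

/-- The index below an action of a name above it. -/
def lift : Act → ℕ → ℕ
  | .send _ => id
  | .recv => (· + 1)

@[simp] theorem pol_subst (σ : ℕ → Val) (a : Act) : (a.subst σ).pol = a.pol := by cases a <;> rfl

@[simp] theorem under_subst (σ τ : ℕ → Val) (a : Act) : (a.subst σ).under τ = a.under τ := by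
  cases a <;> rfl

theorem subst_subst (σ τ : ℕ → Val) (a : Act) :
    (a.subst σ).subst τ = a.subst fun x => (σ x).subst τ := by
  cases a <;> simp [subst, Val.subst_subst]

@[simp] theorem subst_id (a : Act) : a.subst .var = a := by cases a <;> simp [subst]

@[simp] theorem under_id (a : Act) : a.under .var = .var := by cases a <;> simp [under]

theorem under_comp (σ τ : ℕ → Val) (a : Act) :
    (fun x => (a.under σ x).subst (a.under τ)) = a.under fun x => (σ x).subst τ := by
  cases a
  · rfl
  · exact up_comp σ τ

theorem subst_congr {σ τ : ℕ → Val} {a : Act} (h : ∀ x ∈ a.fv, σ x = τ x) :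
    a.subst σ = a.subst τ := by
  cases a
  · simp only [subst, Act.send.injEq]; exact Val.subst_congr h
  · rfl

theorem under_congr {σ τ : ℕ → Val} {a : Act} {s : Set ℕ} (h : ∀ x, a.lift x ∈ s → σ x = τ x) :
    ∀ x ∈ s, a.under σ x = a.under τ x := by
  cases a
  · exact h
  · exact up_congr h

theorem mem_fv_subst {σ : ℕ → Val} {a : Act} {y : ℕ} :
    y ∈ (a.subst σ).fv ↔ ∃ x ∈ a.fv, σ x = .var y := by
  cases a <;> simp [subst, fv, Val.subst_eq_var]

theorem under_eq_lift {σ : ℕ → Val} {a : Act} {s : Set ℕ} {y : ℕ} :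
    (∃ x ∈ s, a.under σ x = .var (a.lift y)) ↔ ∃ x, a.lift x ∈ s ∧ σ x = .var y := by
  cases a
  · rfl
  · exact up_eq_succ

@[simp] theorem lift_subst (σ : ℕ → Val) (a : Act) : (a.subst σ).lift = a.lift := by cases a <;> rfl

theorem lift_injective (a : Act) : a.lift.Injective := by
  cases a
  · exact Function.injective_id
  · exact add_left_injective 1

end Act

namespace Ann

/-- Simultaneous capture-avoiding substitution of values for names. -/
def subst : (ℕ → Val) → Ann → Ann
  | σ, .choice q₁ q₂ vw y n lab act P =>
      .choice q₁ q₂ vw (y.subst σ) n lab (fun i => (act i).subst σ)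
        (fun i => (P i).subst ((act i).under σ))
  | σ, .par P Q => .par (P.subst σ) (Q.subst σ)
  | σ, .res P => .res (P.subst (up (up σ)))
  | σ, .ite v P Q => .ite (v.subst σ) (P.subst σ) (Q.subst σ)
  | _, .inact => .inact

/-- Removes the annotations. -/
def erase : Ann → Proc
  | .choice q₁ _ _ y n lab act P => .choice q₁ y n lab act fun i => (P i).erase
  | .par P Q => .par P.erase Q.erase
  | .res P => .res P.erase
  | .ite v P Q => .ite v P.erase Q.erase
  | .inact => .inact

/-- Free names. -/
def FV : Ann → Set ℕ
  | .choice _ _ _ y _ _ act P => y.fv ∪ {x | ∃ i, x ∈ (act i).fv ∨ (act i).lift x ∈ (P i).FV}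
  | .par P Q => P.FV ∪ Q.FV
  | .res P => {x | x + 2 ∈ P.FV}
  | .ite v P Q => v.fv ∪ P.FV ∪ Q.FV
  | .inact => ∅

/-- Choices and conditionals. -/
inductive IsGuard : Ann → Prop
  | choice (q₁ q₂ vw y n lab act P) : IsGuard (.choice q₁ q₂ vw y n lab act P)
  | ite (v P Q) : IsGuard (.ite v P Q)

theorem erase_subst (P : Ann) : ∀ σ, (P.subst σ).erase = P.erase.subst σ := by
  induction P <;> intro σ <;> simp_all [subst, erase, Proc.subst]

theorem subst_subst (P : Ann) : ∀ σ τ : ℕ → Val,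
    (P.subst σ).subst τ = P.subst fun x => (σ x).subst τ := by
  induction P <;> intro σ τ <;>
    simp_all [subst, Val.subst_subst, Act.subst_subst, up_comp, Act.under_comp]

theorem subst_id (P : Ann) : P.subst .var = P := by induction P <;> simp_all [subst]

theorem subst_congr (P : Ann) : ∀ {σ τ : ℕ → Val}, (∀ x ∈ P.FV, σ x = τ x) →
    P.subst σ = P.subst τ := by
  have hv : ∀ {σ τ : ℕ → Val} {s : Set ℕ} {v : Val}, (∀ x ∈ s, σ x = τ x) → v.fv ⊆ s →
    v.subst σ = v.subst τ := fun h hs => Val.subst_congr fun x hx => h x (hs hx)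
  induction P with
  | choice q₁ q₂ vw y n lab act P ih =>
    intro σ τ h
    simp only [FV] at h
    simp only [subst, choice.injEq, true_and, heq_eq_eq]
    exact ⟨hv h fun x hx => Or.inl hx,
      funext fun i => Act.subst_congr fun x hx => h x (Or.inr ⟨i, Or.inl hx⟩),
      funext fun i => ih i (Act.under_congr fun x hx => h x (Or.inr ⟨i, Or.inr hx⟩))⟩
  | par P Q ih1 ih2 =>
    intro σ τ h
    simp only [FV] at h
    simp only [subst, par.injEq]
    exact ⟨ih1 fun x hx => h x (Or.inl hx), ih2 fun x hx => h x (Or.inr hx)⟩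
  | res P ih =>
    intro σ τ h
    simp only [FV] at h
    simp only [subst, res.injEq]
    exact ih (up_congr fun x hx => up_congr (s := {x | x + 1 ∈ P.FV}) (fun x hx => h x hx) x hx)
  | ite v P Q ih1 ih2 =>
    intro σ τ h
    simp only [FV] at h
    simp only [subst, ite.injEq]
    exact ⟨hv h fun x hx => Or.inl (Or.inl hx), ih1 fun x hx => h x (Or.inl (Or.inr hx)),
      ih2 fun x hx => h x (Or.inr hx)⟩
  | inact => intros; rfl

theorem mem_FV_subst (P : Ann) : ∀ {σ : ℕ → Val} {y : ℕ},
    y ∈ (P.subst σ).FV ↔ ∃ x ∈ P.FV, σ x = .var y := by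
  induction P with
  | choice q₁ q₂ vw z n lab act P ih =>
    intro σ y
    simp only [subst, FV, mem_union, Val.mem_fv, mem_ofPred_eq, ih, Val.subst_eq_var,
      Act.lift_subst, Act.mem_fv_subst, Act.under_eq_lift]
    simp only [or_and_right, exists_or, ← exists_and_right]
    rw [exists_comm (α := Fin n), exists_comm (α := Fin n)]
  | par P Q ih1 ih2 =>
    intro σ y
    simp only [subst, FV, mem_union, ih1, ih2]
    simp only [or_and_right, exists_or]
  | res P ih =>
    intro σ y
    simp only [subst, FV, mem_ofPred_eq, ih]
    exact up_eq_succ.trans (up_eq_succ (s := {x | x + 1 ∈ P.FV}))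
  | ite v P Q ih1 ih2 =>
    intro σ y
    simp only [subst, FV, mem_union, Val.mem_fv, ih1, ih2, Val.subst_eq_var]
    simp only [or_and_right, exists_or]
  | inact => simp [subst, FV]

theorem FV_finite (P : Ann) : P.FV.Finite := by
  have hv : ∀ v : Val, v.fv.Finite := fun v => by cases v <;> simp [Val.fv]
  have ha : ∀ a : Act, a.fv.Finite := fun a => by cases a <;> simp [Act.fv, hv]
  induction P with
  | choice q₁ q₂ vw z n lab act P ih =>
    refine (hv z).union ((Set.finite_iUnion fun i => (ha (act i)).union
      ((ih i).preimage (act i).lift_injective.injOn)).subset ?_)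
    rintro x ⟨i, hx⟩
    exact Set.mem_iUnion.2 ⟨i, hx⟩
  | par P Q ih1 ih2 => exact ih1.union ih2
  | res P ih => exact ih.preimage (add_left_injective 2).injOn
  | ite v P Q ih1 ih2 => exact ((hv v).union ih1).union ih2
  | inact => exact Set.finite_empty

/-- Structural congruence of annotated processes, not below guards. -/
inductive Cong : Ann → Ann → Prop
  | refl (P) : Cong P P
  | symm {P Q} : Cong P Q → Cong Q P
  | trans {P Q R} : Cong P Q → Cong Q R → Cong P R
  | par {P P' Q Q'} : Cong P P' → Cong Q Q' → Cong (.par P Q) (.par P' Q')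
  | res {P P'} : Cong P P' → Cong (.res P) (.res P')
  | par_comm (P Q) : Cong (.par P Q) (.par Q P)
  | par_assoc (P Q R) : Cong (.par (.par P Q) R) (.par P (.par Q R))
  | par_inact (P) : Cong (.par P .inact) P
  | res_inact : Cong (.res .inact) .inact
  | extrude (P Q) : Cong (.par P (.res Q)) (.res (.par (P.subst (shift 2)) Q))
  | res_swap (P) : Cong (.res P) (.res (P.subst fun x => .var (swapEnds x)))
  | res_comm (P) : Cong (.res (.res P)) (.res (.res (P.subst fun x => .var (swapRes x))))

theorem Cong.erase {P Q : Ann} (h : Cong P Q) : Mix.Cong P.erase Q.erase := by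
  induction h with
  | refl => exact .refl _
  | symm _ ih => exact .symm ih
  | trans _ _ ih1 ih2 => exact .trans ih1 ih2
  | par _ _ ih1 ih2 => exact .par ih1 ih2
  | res _ ih => exact .res ih
  | par_comm => exact .par_comm _ _
  | par_assoc => exact .par_assoc _ _ _
  | par_inact => exact .par_inact _
  | res_inact => exact .res_inact
  | extrude P Q =>
    simp only [Ann.erase, erase_subst]
    exact .extrude _ _
  | res_swap P =>
    simp only [Ann.erase, erase_subst]
    exact .res_swap _
  | res_comm P =>
    simp only [Ann.erase, erase_subst]
    exact .res_comm _

theorem Cong.subst {P Q : Ann} (h : Cong P Q) : ∀ σ, Cong (P.subst σ) (Q.subst σ) := by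
  induction h with
  | refl => exact fun _ => .refl _
  | symm _ ih => exact fun σ => .symm (ih σ)
  | trans _ _ ih1 ih2 => exact fun σ => .trans (ih1 σ) (ih2 σ)
  | par _ _ ih1 ih2 => exact fun σ => .par (ih1 _) (ih2 _)
  | res _ ih => exact fun σ => .res (ih _)
  | par_comm => exact fun σ => .par_comm _ _
  | par_assoc => exact fun σ => .par_assoc _ _ _
  | par_inact => exact fun σ => .par_inact _
  | res_inact => exact fun σ => .res_inact
  | extrude P Q =>
    intro σ
    have : (P.subst (shift 2)).subst (up (up σ)) = (P.subst σ).subst (shift 2) := by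
      simp only [Ann.subst_subst, Val.subst_var, up_up_add_two]
      rfl
    simp only [Ann.subst, this]
    exact .extrude _ _
  | res_swap P =>
    intro σ
    refine .trans (.res_swap _) ?_
    simp only [Ann.subst, Ann.subst_subst]
    have : (fun x => ((up (up σ) x).subst fun x => Val.var (swapEnds x))) =
        fun x => (Val.var (swapEnds x)).subst (up (up σ)) := by
      funext x
      match x with
      | 0 => rfl
      | 1 => rfl
      | x + 2 => simp only [up_up_add_two, swapEnds, Val.subst_var, Val.rename, Val.subst_subst]
    rw [this]
    exact .refl _
  | res_comm P =>
    intro σ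
    refine .trans (.res_comm _) ?_
    simp only [Ann.subst, Ann.subst_subst]
    have : (fun x => ((up (up (up (up σ))) x).subst fun x => Val.var (swapRes x))) =
        fun x => (Val.var (swapRes x)).subst (up (up (up (up σ)))) := by
      funext x
      match x with
      | 0 => rfl
      | 1 => rfl
      | 2 => rfl
      | 3 => rfl
      | x + 4 =>
        simp only [show x + 4 = x + 2 + 2 from rfl, up_up_add_two, swapRes, Val.subst_var,
          Val.rename, Val.subst_subst]
    rw [this]
    exact .refl _

instance : Calculus Ann where
  par := .par
  res := .res
  inact := .inact
  Guard := Ann.IsGuard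
  subst := Ann.subst
  FV := Ann.FV
  Cong := Ann.Cong
  subst_par _ _ _ := rfl
  subst_res _ _ := rfl
  subst_inact _ := rfl
  subst_subst σ τ p := p.subst_subst σ τ
  subst_id := Ann.subst_id
  subst_congr h := Ann.subst_congr _ h
  mem_FV_subst := Ann.mem_FV_subst _
  FV_par _ _ := rfl
  mem_FV_res := Iff.rfl
  FV_inact := rfl
  FV_finite := Ann.FV_finite
  refl := .refl
  symm := .symm
  trans := .trans
  cong_par := .par
  cong_res := .res
  cong_subst σ _ _ h := h.subst σ
  par_comm := .par_comm
  par_assoc := .par_assoc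
  par_inact := .par_inact
  res_inact := .res_inact
  extrude := .extrude
  res_swap := .res_swap
  res_comm := .res_comm

end Ann
end Mix

/-! ## The encoding of annotated processes -/

namespace Enc
open CMV

/-- Prefixes a continuation by an output of the unit value on `u` if `u` is given. -/
def restartV (u : Option Val) (E : Proc) : Proc :=
  match u with
  | none => E
  | some u => .par (.out u .unit .inact) E

/-- The final output or input on `e` of the encoding of a summand. -/
def altV (e : Val) (u : Option Val) (a : Mix.Act) (E : Proc) : Proc :=
  match a with
  | .send v => .out e v (restartV u E)
  | .recv => .inp .lin e (restartV (u.map (·.subst (shift 1))) E)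

/-- A branching with the dual labels of `ks`. -/
def offerL (e : Val) (ks : List (Label × Pol)) (f : Label × Pol → Proc) : Proc :=
  .bran e ks.length (fun i => .tag (ks.get i).1 (ks.get i).2.dual) fun i => f (ks.get i)

section

variable {n : ℕ} (lab : Fin n → Label) (act : Fin n → Mix.Act) (E : Fin n → Proc)

/-- The actions under substitution. -/
abbrev actS (σ : ℕ → Val) : Fin n → Mix.Act := fun j => (act j).subst σ

/-- The encodings of continuations under substitution. -/
abbrev contS (σ : ℕ → Val) : Fin n → Proc := fun j => (E j).subst ((act j).under σ)

/-- Non-deterministic choice among the summands with label and polarity `κ`. -/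
def altsV (e : Val) (u : Option Val) (κ : Label × Pol) : Proc :=
  nd ((members lab act κ).map fun j => altV e u (act j) (E j))

/-- The encoding of a choice up to the treatment of unrestricted choices. -/
def headV (q₂ : Qual) (vw : View) (y : Val) (u : Option Val) : Proc :=
  match q₂, vw with
  | .lin, .int => nd ((keys lab act).map fun κ => .sel y (.tag κ.1 κ.2) (altsV lab act E y u κ))
  | .lin, .ext => offerL y (keys lab act) (altsV lab act E y u)
  | .un, .int => nd ((keys lab act).map fun κ => .res (.out (y.subst (shift 2)) (.var 0)
      (.sel (.var 1) (.tag κ.1 κ.2)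
        (altsV lab (actS act (shift 2)) (contS act E (shift 2)) (.var 1)
          (u.map (·.subst (shift 2))) κ))))
  | .un, .ext => .inp .lin y (offerL (.var 0) (keys lab act)
      (altsV lab (actS act (shift 1)) (contS act E (shift 1)) (.var 0) (u.map (·.subst (shift 1)))))

/-- The encoding of a choice. -/
def choiceV (q₁ q₂ : Qual) (vw : View) (y : Val) : Proc :=
  match q₁ with
  | .lin => headV lab act E q₂ vw y none
  | .un => .res (.par (.out (.var 0) .unit .inact) (.inp .un (.var 1)
      (headV lab (actS act (shift 3)) (contS act E (shift 3)) .un vw (y.subst (shift 3))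
        (some (.var 1)))))

@[simp] theorem keys_subst (σ : ℕ → Val) : keys lab (actS act σ) = keys lab act := by simp [keys]

@[simp] theorem members_subst (σ : ℕ → Val) (κ : Label × Pol) :
    members lab (actS act σ) κ = members lab act κ := by
  simp [members]

theorem contS_contS (σ τ : ℕ → Val) :
    contS (actS act σ) (contS act E σ) τ = contS act E fun x => (σ x).subst τ := by
  funext j
  simp only [contS, Proc.subst_subst, Mix.Act.under_subst, Mix.Act.under_comp]

theorem actS_actS (σ τ : ℕ → Val) :
    actS (actS act σ) τ = actS act fun x => (σ x).subst τ := by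
  funext j
  simp only [Mix.Act.subst_subst]

theorem alt_eq (k x : ℕ) (u : Option ℕ) (a : Mix.Act) (E : Proc) :
    alt k x u a E = altV (.var x) (u.map .var) (a.subst (shift k)) (E.subst (a.under (shift k))) := by
  cases a <;> cases u <;> rfl

theorem alts_eq (k x : ℕ) (u : Option ℕ) (κ : Label × Pol) :
    alts lab act E k x u κ =
      altsV lab (actS act (shift k)) (contS act E (shift k)) (.var x) (u.map .var) κ := by
  simp only [alts, altsV, members_subst, alt_eq]

theorem offer_eq (k x : ℕ) (u : Option ℕ) :
    offer lab act E k x u = offerL (.var x) (keys lab act)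
      (altsV lab (actS act (shift k)) (contS act E (shift k)) (.var x) (u.map .var)) := by
  simp only [offer, offerL, alts_eq]

theorem actS_zero : actS act (shift 0) = act := funext fun j => (act j).subst_id

theorem contS_zero : contS act E (shift 0) = E := by
  funext j
  have : (act j).under (shift 0) = .var := (act j).under_id
  simp only [contS, this, Proc.subst_id]

theorem choice_eq (q₁ q₂ : Qual) (vw : View) (y : ℕ) :
    choice lab act E q₁ q₂ vw y = choiceV lab act E q₁ q₂ vw (.var y) := by
  cases q₁ <;> cases vw
  · cases q₂
    · simp only [choice, linLinInt, choiceV, headV, alts_eq, actS_zero, contS_zero]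
      rfl
    · simp only [choice, linUnInt, choiceV, headV, alts_eq]
      rfl
  · cases q₂
    · simp only [choice, linLinExt, choiceV, headV, offer_eq, actS_zero, contS_zero]
      rfl
    · simp only [choice, linUnExt, choiceV, headV, offer_eq]
      rfl
  · simp only [choice, unInt, choiceV, headV, alts_eq, keys_subst, contS_contS, actS_actS]
    rfl
  · simp only [choice, unExt, choiceV, headV, offer_eq, keys_subst, contS_contS, actS_actS]
    rfl

end

theorem bran_ext {y : Val} {n m : ℕ} {lab : Fin n → Lab} {lab' : Fin m → Lab}
    {P : Fin n → Proc} {Q : Fin m → Proc} (e : n = m)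
    (h : ∀ i, P i = Q (i.cast e) ∧ lab i = lab' (i.cast e)) :
    Proc.bran y n lab P = .bran y m lab' Q := by
  aesop

theorem nd_subst (Ps : List Proc) (σ : ℕ → Val) :
    (nd Ps).subst σ = nd (Ps.map (Proc.subst σ)) := by
  simp only [nd, Proc.subst, prod_subst, List.map_map, List.length_map]
  congr 2
  refine bran_ext (by simp) fun i => ?_
  simp [← subst_shift_two]

theorem restartV_subst (u : Option Val) (E : Proc) (σ : ℕ → Val) :
    (restartV u E).subst σ = restartV (u.map (·.subst σ)) (E.subst σ) := by
  cases u <;> rfl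

theorem val_subst_shift_one (v : Val) (σ : ℕ → Val) :
    (v.subst (shift 1)).subst (up σ) = (v.subst σ).subst (shift 1) := by
  simp only [Val.subst_subst]
  rfl

theorem val_subst_shift_two (v : Val) (σ : ℕ → Val) :
    (v.subst (shift 2)).subst (up (up σ)) = (v.subst σ).subst (shift 2) := by
  simp only [Val.subst_subst, Val.subst_var, up_up_add_two]
  rfl

theorem altV_subst (e : Val) (u : Option Val) (a : Mix.Act) (E : Proc) (σ : ℕ → Val) :
    (altV e u a E).subst σ =
      altV (e.subst σ) (u.map (·.subst σ)) (a.subst σ) (E.subst (a.under σ)) := by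
  cases a with
  | send v => simp [altV, Proc.subst, restartV_subst, Mix.Act.subst, Mix.Act.under]
  | recv =>
    simp only [altV, Proc.subst, restartV_subst, Mix.Act.subst, Mix.Act.under, Option.map_map]
    congr 3
    funext v
    exact val_subst_shift_one v σ

theorem offerL_subst (e : Val) (ks : List (Label × Pol)) (f : Label × Pol → Proc) (σ : ℕ → Val) :
    (offerL e ks f).subst σ = offerL (e.subst σ) ks fun κ => (f κ).subst σ := rfl

section

variable {n : ℕ} (lab : Fin n → Label) (act : Fin n → Mix.Act) (E : Fin n → Proc)

theorem altsV_subst (e : Val) (u : Option Val) (κ : Label × Pol) (σ : ℕ → Val) :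
    (altsV lab act E e u κ).subst σ =
      altsV lab (actS act σ) (contS act E σ) (e.subst σ) (u.map (·.subst σ)) κ := by
  simp only [altsV, nd_subst, List.map_map, members_subst]
  congr 2
  funext j
  exact altV_subst ..

theorem map_subst_shift_one (u : Option Val) (σ : ℕ → Val) :
    (u.map (·.subst (shift 1))).map (·.subst (up σ)) =
      (u.map (·.subst σ)).map (·.subst (shift 1)) := by
  cases u <;> simp [val_subst_shift_one]

theorem map_subst_shift_two (u : Option Val) (σ : ℕ → Val) :
    (u.map (·.subst (shift 2))).map (·.subst (up (up σ))) =
      (u.map (·.subst σ)).map (·.subst (shift 2)) := by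
  cases u <;> simp [val_subst_shift_two]

theorem actS_shift_one (σ : ℕ → Val) :
    actS (actS act (shift 1)) (up σ) = actS (actS act σ) (shift 1) := by
  rw [actS_actS, actS_actS]; rfl

theorem contS_shift_one (σ : ℕ → Val) :
    contS (actS act (shift 1)) (contS act E (shift 1)) (up σ) =
      contS (actS act σ) (contS act E σ) (shift 1) := by
  rw [contS_contS, contS_contS]; rfl

theorem shift_two_up (σ : ℕ → Val) :
    (fun x => (shift 2 x).subst (up (up σ))) = fun x => (σ x).subst (shift 2) := by
  funext x
  exact up_up_add_two σ x

theorem actS_shift_two (σ : ℕ → Val) :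
    actS (actS act (shift 2)) (up (up σ)) = actS (actS act σ) (shift 2) := by
  rw [actS_actS, actS_actS, shift_two_up]

theorem contS_shift_two (σ : ℕ → Val) :
    contS (actS act (shift 2)) (contS act E (shift 2)) (up (up σ)) =
      contS (actS act σ) (contS act E σ) (shift 2) := by
  rw [contS_contS, contS_contS, shift_two_up]

theorem headV_subst (q₂ : Qual) (vw : View) (y : Val) (u : Option Val) (σ : ℕ → Val) :
    (headV lab act E q₂ vw y u).subst σ =
      headV lab (actS act σ) (contS act E σ) q₂ vw (y.subst σ) (u.map (·.subst σ)) := by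
  cases q₂ <;> cases vw
  · simp only [headV, nd_subst, List.map_map, keys_subst]
    congr 2
    funext κ
    simp only [Function.comp, Proc.subst, altsV_subst]
  · simp only [headV, offerL_subst, keys_subst, altsV_subst]
  · simp only [headV, nd_subst, List.map_map, keys_subst]
    congr 2
    funext κ
    simp only [Function.comp, Proc.subst, altsV_subst, val_subst_shift_two, map_subst_shift_two,
      actS_shift_two, contS_shift_two]
    rfl
  · simp only [headV, Proc.subst, offerL_subst, keys_subst, altsV_subst, map_subst_shift_one,
      actS_shift_one, contS_shift_one]
    rfl

theorem shift_three_up (σ : ℕ → Val) :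
    (fun x => (shift 3 x).subst (up (up (up σ)))) = fun x => (σ x).subst (shift 3) := by
  funext x
  change up (up (up σ)) (x + 3) = _
  rw [show x + 3 = x + 2 + 1 from rfl, up_succ, up_up_add_two]
  simp only [Val.rename, Val.subst_subst]
  rfl

theorem choiceV_subst (q₁ q₂ : Qual) (vw : View) (y : Val) (σ : ℕ → Val) :
    (choiceV lab act E q₁ q₂ vw y).subst σ =
      choiceV lab (actS act σ) (contS act E σ) q₁ q₂ vw (y.subst σ) := by
  cases q₁
  · simp only [choiceV, headV_subst]
    rfl
  · simp only [choiceV, Proc.subst, headV_subst, actS_actS, contS_contS, shift_three_up,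
      Val.subst_subst]
    rfl

end
end Enc

namespace Mix

/-- The encoding of annotated processes. -/
def Ann.enc : Ann → CMV.Proc
  | .choice q₁ q₂ vw y _ lab act P => Enc.choiceV lab act (fun j => (P j).enc) q₁ q₂ vw y
  | .par P Q => .par P.enc Q.enc
  | .res P => .res P.enc
  | .ite v P Q => .ite v P.enc Q.enc
  | .inact => .inact

theorem Ann.enc_subst (P : Ann) : ∀ σ, (P.subst σ).enc = P.enc.subst σ := by
  induction P with
  | choice q₁ q₂ vw y n lab act P ih =>
    intro σ
    simp only [Ann.subst, Ann.enc, ih, Enc.choiceV_subst]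
  | par P Q ih1 ih2 => intro σ; simp only [Ann.subst, Ann.enc, ih1, ih2]; rfl
  | res P ih => intro σ; simp only [Ann.subst, Ann.enc, ih]; rfl
  | ite v P Q ih1 ih2 => intro σ; simp only [Ann.subst, Ann.enc, ih1, ih2]; rfl
  | inact => intro σ; rfl

/-- The annotated process of a typing derivation. -/
def Typing.ann : {Γ : Ctx} → {P : Proc} → Typing Γ P → Ann
  | _, _, .inact _ => .inact
  | _, _, .par _ D₁ D₂ => .par D₁.ann D₂.ann
  | _, _, .ite (v := v) _ _ D₁ D₂ => .ite v D₁.ann D₂.ann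
  | _, _, .res _ _ _ D => .res D.ann
  | _, _, .choice (q₁ := q₁) (x := x) (lab := lab) (act := act) q₂ v _ _ _ _ _ _ _ _ _ D =>
      .choice q₁ q₂ v (.var x) _ lab act fun j => (D j).ann

theorem Typing.erase_ann {Γ : Ctx} {P : Proc} (D : Typing Γ P) : D.ann.erase = P := by
  induction D with
  | inact => rfl
  | par _ _ _ ih1 ih2 => simp only [ann, Ann.erase, ih1, ih2]
  | ite _ _ _ _ ih1 ih2 => simp only [ann, Ann.erase, ih1, ih2]
  | res _ _ _ _ ih => simp only [ann, Ann.erase, ih]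
  | choice _ _ _ _ _ _ _ _ _ _ _ _ ih => simp only [ann, Ann.erase, ih]

theorem Typing.enc_ann {Γ : Ctx} {P : Proc} (D : Typing Γ P) : D.ann.enc = D.encode := by
  induction D with
  | inact => rfl
  | par _ _ _ ih1 ih2 => simp only [ann, Ann.enc, encode, ih1, ih2]
  | ite _ _ _ _ ih1 ih2 => simp only [ann, Ann.enc, encode, ih1, ih2]
  | res _ _ _ _ ih => simp only [ann, Ann.enc, encode, ih]
  | choice _ _ _ _ _ _ _ _ _ _ _ _ ih => simp only [ann, Ann.enc, encode, ih, Enc.choice_eq]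

namespace Ty

/-! ## Types: renaming, substitution, unfolding -/

/-- Extension of a renaming under one binder. -/
def upR (f : ℕ → ℕ) : ℕ → ℕ
  | 0 => 0
  | t + 1 => f t + 1

/-- Extension of a substitution under one binder. -/
def upS (σ : ℕ → Ty) : ℕ → Ty
  | 0 => var 0
  | t + 1 => (σ t).rename (· + 1)

theorem rename_mu (f : ℕ → ℕ) (T : Ty) : (mu T).rename f = mu (T.rename (upR f)) := by aesop

theorem subst_mu (σ : ℕ → Ty) (T : Ty) : (mu T).subst σ = mu (T.subst (upS σ)) := by aesop

theorem rename_rename (T : Ty) : ∀ f g : ℕ → ℕ,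
    (T.rename f).rename g = T.rename fun t => g (f t) := by
  induction T with
  | choice q v n lab pol T U hT hU => intro f g; simp only [rename, hT, hU]
  | mu T ih =>
    intro f g
    simp only [rename_mu, ih]
    congr 2
    funext t
    cases t <;> rfl
  | _ => intros; rfl

theorem subst_rename (T : Ty) : ∀ (f : ℕ → ℕ) (σ : ℕ → Ty),
    (T.rename f).subst σ = T.subst fun t => σ (f t) := by
  induction T with
  | choice q v n lab pol T U hT hU => intro f g; simp only [rename, subst, hT, hU]
  | mu T ih =>
    intro f σ
    simp only [rename_mu, subst_mu, ih]
    congr 2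
    funext t
    cases t <;> rfl
  | _ => intros; rfl

theorem rename_subst (T : Ty) : ∀ (σ : ℕ → Ty) (f : ℕ → ℕ),
    (T.subst σ).rename f = T.subst fun t => (σ t).rename f := by
  induction T with
  | choice q v n lab pol T U hT hU => intro f g; simp only [rename, subst, hT, hU]
  | mu T ih =>
    intro f σ
    simp only [rename_mu, subst_mu, ih]
    congr 2
    funext t
    cases t
    · rfl
    · simp only [upS, rename_rename]
      rfl
  | _ => intros; rfl

theorem subst_id (T : Ty) : T.subst var = T := by
  induction T with
  | choice q v n lab pol T U hT hU => simp only [subst, hT, hU]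
  | mu T ih =>
    rw [subst_mu, mu.injEq]
    have : upS var = var := by
      funext t
      cases t <;> rfl
    rw [this, ih]
  | _ => rfl

theorem Un.subst {T : Ty} : T.Un → ∀ σ, (T.subst σ).Un := by
  induction T with
  | choice q v n lab pol T U hT hU => exact fun h _ => h
  | mu T ih => exact fun h _ => ih h _
  | var t => exact fun h => h.elim
  | _ => exact fun _ _ => trivial

theorem headVar_rename {T : Ty} : ∀ {f : ℕ → ℕ} {k : ℕ}, (T.rename f).HeadVar k →
    ∃ t, T.HeadVar t ∧ f t = k := by
  induction T with
  | mu T ih =>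
    intro f k h
    rw [rename_mu] at h
    obtain ⟨t, ht, e⟩ := ih h
    cases t with
    | zero => cases e
    | succ t => exact ⟨t, ht, by simpa [upR] using e⟩
  | var t => exact fun h => ⟨t, rfl, h⟩
  | _ => exact fun h => h.elim

theorem headVar_subst {T : Ty} : ∀ {σ : ℕ → Ty} {k : ℕ}, (T.subst σ).HeadVar k →
    ∃ t, T.HeadVar t ∧ (σ t).HeadVar k := by
  induction T with
  | mu T ih =>
    intro σ k h
    rw [subst_mu] at h
    obtain ⟨t, ht, e⟩ := ih h
    cases t with
    | zero => cases e
    | succ t =>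
      obtain ⟨s, hs, e⟩ := headVar_rename (show ((σ t).rename (· + 1)).HeadVar (k + 1) from e)
      obtain rfl : s = k := by grind
      exact ⟨t, ht, hs⟩
  | var t => exact fun h => ⟨t, rfl, h⟩
  | _ => exact fun h => h.elim

theorem WFAt.rename {T : Ty} : ∀ {f : ℕ → ℕ} {k k' : ℕ}, T.WFAt k → (∀ t < k, f t < k') →
    (T.rename f).WFAt k' := by
  induction T with
  | choice q v n lab pol T U hT hU =>
    intro f k k' h hf
    exact ⟨h.1, h.2.1, fun i => hT i (h.2.2.1 i) hf, fun i => hU i (h.2.2.2 i) hf⟩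
  | mu T ih =>
    intro f k k' h hf
    rw [rename_mu]
    refine ⟨fun hv => ?_, ih h.2 fun t ht => ?_⟩
    · obtain ⟨t, ht, e⟩ := headVar_rename hv
      cases t with
      | zero => exact h.1 ht
      | succ t => cases e
    · cases t with
      | zero => exact Nat.succ_pos _
      | succ t => exact Nat.succ_lt_succ (hf t (Nat.lt_of_succ_lt_succ ht))
  | var t => exact fun h hf => hf _ h
  | _ => exact fun _ _ => trivial

theorem WFAt.subst {T : Ty} : ∀ {σ : ℕ → Ty} {k k' : ℕ}, T.WFAt k → (∀ t < k, (σ t).WFAt k') →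
    (T.subst σ).WFAt k' := by
  induction T with
  | choice q v n lab pol T U hT hU =>
    intro f k k' h hf
    exact ⟨h.1, h.2.1, fun i => hT i (h.2.2.1 i) hf, fun i => hU i (h.2.2.2 i) hf⟩
  | mu T ih =>
    intro σ k k' h hf
    rw [subst_mu]
    refine ⟨fun hv => ?_, ih h.2 fun t ht => ?_⟩
    · obtain ⟨t, ht, e⟩ := headVar_subst hv
      cases t with
      | zero => exact h.1 ht
      | succ t =>
        obtain ⟨s, _, e⟩ := headVar_rename (show ((σ t).rename (· + 1)).HeadVar 0 from e)
        cases e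
    · cases t with
      | zero => exact Nat.succ_pos _
      | succ t => exact (hf t (Nat.lt_of_succ_lt_succ ht)).rename fun s hs => Nat.succ_lt_succ hs
  | var t => exact fun h hf => hf _ h
  | _ => exact fun _ _ => trivial

theorem WF.unfold {T : Ty} (h : (mu T).WF) : T.unfold.WF := by
  refine WFAt.subst h.2 fun t ht => ?_
  cases t with
  | zero => exact h
  | succ t => omega

/-- Below the recursion operators at the top there is no type variable. -/
def NoVar : Ty → Prop
  | mu T => T.NoVar
  | var _ => False
  | _ => True

/-- The number of recursion operators at the top. -/
def mus : Ty → ℕ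
  | mu T => T.mus + 1
  | _ => 0

theorem WFAt.noVar {T : Ty} : ∀ {k : ℕ}, T.WFAt k → (∀ j < k, ¬ T.HeadVar j) → T.NoVar := by
  induction T with
  | mu T ih =>
    intro k h hv
    refine ih h.2 fun j hj => ?_
    cases j with
    | zero => exact h.1
    | succ j => exact hv j (Nat.lt_of_succ_lt_succ hj)
  | var t => exact fun h hv => hv _ h rfl
  | _ => exact fun _ _ => trivial

theorem NoVar.subst {T : Ty} : T.NoVar → ∀ σ, (T.subst σ).NoVar ∧ (T.subst σ).mus = T.mus := by
  induction T with
  | mu T ih =>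
    intro h σ
    obtain ⟨h1, h2⟩ := ih h (upS σ)
    rw [subst_mu]
    exact ⟨h1, congrArg (· + 1) h2⟩
  | var t => exact fun h => h.elim
  | _ => exact fun _ _ => ⟨trivial, rfl⟩

/-- `Head T H` says that `H` is what remains of `T` after unfolding the recursion operators at the
top. -/
inductive Head : Ty → Ty → Prop
  | choice (q v n lab pol T U) : Head (.choice q v n lab pol T U) (.choice q v n lab pol T U)
  | fin : Head .fin .fin
  | unit : Head .unit .unit
  | bool : Head .bool .bool
  | mu {T H} : Head T.unfold H → Head (.mu T) H

theorem Head.unique {T H H' : Ty} (h : Head T H) (h' : Head T H') : H = H' := by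
  induction h with
  | mu _ ih => cases h' with | mu h' => exact ih h'
  | _ => cases h'; rfl

theorem Head.wf {T H : Ty} (h : Head T H) : T.WF → H.WF := by
  induction h with
  | mu _ ih => exact fun hT => ih hT.unfold
  | _ => exact id

theorem Head.un {T H : Ty} (h : Head T H) : T.Un → H.Un := by
  induction h with
  | @mu T _ _ ih => exact fun hT => ih (Un.subst (T := T) hT _)
  | _ => exact id

theorem Head.self {T H : Ty} (h : Head T H) : Head H H := by
  induction h with
  | mu _ ih => exact ih
  | choice => exact .choice ..
  | fin => exact .fin
  | unit => exact .unit
  | bool => exact .bool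

theorem NoVar.exists_head (n : ℕ) : ∀ T : Ty, T.mus = n → T.NoVar → ∃ H, Head T H := by
  induction n with
  | zero =>
    intro T hn h
    cases T with
    | mu T => cases hn
    | var => exact h.elim
    | choice => exact ⟨_, .choice ..⟩
    | fin => exact ⟨_, .fin⟩
    | unit => exact ⟨_, .unit⟩
    | bool => exact ⟨_, .bool⟩
  | succ n ih =>
    intro T hn h
    cases T with
    | mu T =>
      have h1 := NoVar.subst (T := T) h fun | 0 => .mu T | t + 1 => .var t
      obtain ⟨H, hH⟩ := ih T.unfold (h1.2.trans (Nat.succ.inj hn)) h1.1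
      exact ⟨H, .mu hH⟩
    | _ => cases hn

theorem WF.exists_head {T : Ty} (h : T.WF) : ∃ H, Head T H :=
  NoVar.exists_head _ T rfl (WFAt.noVar h fun _ hj => absurd hj (Nat.not_lt_zero _))

/-- The type below the recursion operators at the top, after unfolding. -/
noncomputable def hd (T : Ty) : Ty := open Classical in if h : ∃ H, Head T H then h.choose else T

theorem Head.hd_eq {T H : Ty} (h : Head T H) : T.hd = H := by
  have h' : ∃ H, Head T H := ⟨H, h⟩
  rw [hd, dif_pos h']
  exact h'.choose_spec.unique h

theorem WF.head_hd {T : Ty} (h : T.WF) : Head T T.hd := by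
  obtain ⟨H, hH⟩ := h.exists_head
  rwa [hH.hd_eq]

/-- The head of the type is a linear choice type. -/
def Lin (T : Ty) : Prop := ∃ v n lab pol A V, Head T (.choice .lin v n lab pol A V)

theorem Un.not_lin {T : Ty} (h : T.Un) : ¬ T.Lin := by
  rintro ⟨v, n, lab, pol, A, V, hT⟩
  cases hT.un h

/-! ## Coinductive relations by heads -/

/-- The greatest relation that relates types the heads of which are related by `N`. -/
def Co (N : (Ty → Ty → Prop) → Ty → Ty → Prop) (T U : Ty) : Prop :=
  ∃ R : Ty → Ty → Prop,
    (∀ A B, R A B → ∃ HA HB, Head A HA ∧ Head B HB ∧ N R HA HB) ∧ R T U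

theorem Co.dest {N : (Ty → Ty → Prop) → Ty → Ty → Prop}
    (mono : ∀ {R S A B}, (∀ X Y, R X Y → S X Y) → N R A B → N S A B) {T U : Ty} (h : Co N T U) :
    ∃ HA HB, Head T HA ∧ Head U HB ∧ N (Co N) HA HB := by
  obtain ⟨R, hR, h⟩ := h
  obtain ⟨HA, HB, h1, h2, h3⟩ := hR _ _ h
  exact ⟨HA, HB, h1, h2, mono (fun X Y hXY => ⟨R, hR, hXY⟩) h3⟩

theorem Co.toRule {N F : (Ty → Ty → Prop) → Ty → Ty → Prop}
    (mono : ∀ {R S A B}, (∀ X Y, R X Y → S X Y) → N R A B → N S A B)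
    (hN : ∀ {R A B}, N R A B → F R A B) (muL : ∀ {R T U}, R T.unfold U → F R (.mu T) U)
    (muR : ∀ {R T U}, R T U.unfold → F R T (.mu U)) {T U : Ty} (h : Co N T U) :
    ∃ R : Ty → Ty → Prop, (∀ A B, R A B → F R A B) ∧ R T U := by
  refine ⟨Co N, ?_, h⟩
  intro A B hAB
  obtain ⟨HA, HB, h1, h2, h3⟩ := hAB.dest (N := N) mono
  have hA := h1.self
  have key : ∀ A B, Head A HA → Head B HB → Co N A B := fun A B h1 h2 =>
    ⟨fun A B => Co N A B ∨ (Head A HA ∧ Head B HB), by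
      rintro A B (h | ⟨h1, h2⟩)
      · obtain ⟨HA, HB, h1, h2, h3⟩ := h.dest (N := N) mono
        exact ⟨HA, HB, h1, h2, mono (fun _ _ => .inl) h3⟩
      · exact ⟨HA, HB, h1, h2, mono (fun _ _ => .inl) h3⟩, .inr ⟨h1, h2⟩⟩
  cases h1 with
  | mu h1 => exact muL (key _ _ h1 h2)
  | _ => cases h2 with
    | mu h2 => exact muR (key _ _ hA h2)
    | _ => exact hN h3

theorem Co.intro {N : (Ty → Ty → Prop) → Ty → Ty → Prop}
    (mono : ∀ {R S A B}, (∀ X Y, R X Y → S X Y) → N R A B → N S A B) {A B HA HB : Ty}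
    (h1 : Head A HA) (h2 : Head B HB) (h3 : N (Co N) HA HB) : Co N A B := by
  refine ⟨fun A B => Co N A B ∨ (Head A HA ∧ Head B HB), ?_, .inr ⟨h1, h2⟩⟩
  rintro A B (h | ⟨h1, h2⟩)
  · obtain ⟨HA, HB, h1, h2, h3⟩ := h.dest (N := N) mono
    exact ⟨HA, HB, h1, h2, mono (fun _ _ => .inl) h3⟩
  · grind

theorem Head.ne_mu {T H : Ty} (h : Head T H) : ∀ U, H ≠ Ty.mu U := by
  induction h with
  | mu _ ih => exact ih
  | _ => exact fun _ h => by cases h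

theorem WF.mus_unfold {T : Ty} (h : (mu T).WF) : T.unfold.mus = T.mus :=
  (NoVar.subst (T := T) (WFAt.noVar (T := mu T) h fun _ hj => absurd hj (Nat.not_lt_zero _)) _).2

theorem Co.ofRule {N F : (Ty → Ty → Prop) → Ty → Ty → Prop}
    (inv : ∀ {R A B}, F R A B → A.WF → B.WF →
      (Head A A ∧ Head B B ∧ N (fun X Y => R X Y ∧ X.WF ∧ Y.WF) A B) ∨
      (∃ T, A = .mu T ∧ R T.unfold B) ∨ ∃ U, B = .mu U ∧ R A U.unfold) {T U : Ty}
    (h : ∃ R : Ty → Ty → Prop, (∀ A B, R A B → F R A B) ∧ R T U) (hT : T.WF) (hU : U.WF) :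
    Co N T U := by
  obtain ⟨R, hR, h⟩ := h
  refine ⟨fun X Y => R X Y ∧ X.WF ∧ Y.WF, ?_, h, hT, hU⟩
  have key : ∀ n A B, A.mus + B.mus = n → R A B → A.WF → B.WF → ∃ HA HB, Head A HA ∧ Head B HB ∧
      N (fun X Y => R X Y ∧ X.WF ∧ Y.WF) HA HB := by
    intro n
    induction n with
    | zero =>
      intro A B hn h hA hB
      rcases inv (hR _ _ h) hA hB with h | ⟨T, rfl, h⟩ | ⟨U, rfl, h⟩
      · grind
      all_goals simp [mus] at hn
    | succ n ih =>
      intro A B hn h hA hB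
      rcases inv (hR _ _ h) hA hB with h | ⟨T, rfl, h'⟩ | ⟨U, rfl, h'⟩
      · grind
      · obtain ⟨HA, HB, h1, h2, h3⟩ := ih T.unfold B
          (by rw [hA.mus_unfold]; simp only [mus] at hn; omega) h' hA.unfold hB
        exact ⟨HA, HB, .mu h1, h2, h3⟩
      · obtain ⟨HA, HB, h1, h2, h3⟩ := ih A U.unfold
          (by rw [hB.mus_unfold]; simp only [mus] at hn; omega) h' hA hB.unfold
        exact ⟨HA, HB, h1, .mu h2, h3⟩
  rintro A B ⟨h, hA, hB⟩
  exact key _ A B rfl h hA hB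

/-! ## Subtyping, equivalence and duality by heads -/

/-- Subtyping of payloads. -/
def Pay (R : Ty → Ty → Prop) (p : Pol) (T₁ T₂ : Ty) : Prop :=
  match p with
  | .out => R T₂ T₁
  | .inp => R T₁ T₂

theorem Pay.mono {R S : Ty → Ty → Prop} (h : ∀ X Y, R X Y → S X Y) {p T₁ T₂} :
    Pay R p T₁ T₂ → Pay S p T₁ T₂ := by
  cases p <;> exact h _ _

/-- Subtyping of heads; continuations are compared for the qualifiers with `c`. -/
inductive NSub (c : Qual → Prop) (R : Ty → Ty → Prop) : Ty → Ty → Prop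
  | fin : NSub c R fin fin
  | unit : NSub c R unit unit
  | bool : NSub c R bool bool
  | choice {q v n m lab lab' pol pol'} {T U : Fin n → Ty} {T' U' : Fin m → Ty}
      (hint : v = .int → ∀ j, ∃ i, lab i = lab' j ∧ pol i = pol' j)
      (hext : v = .ext → ∀ i, ∃ j, lab i = lab' j ∧ pol i = pol' j)
      (h : ∀ i j, lab i = lab' j → pol i = pol' j →
        Pay R (pol' j) (T i) (T' j) ∧ (c q → R (U i) (U' j))) :
      NSub c R (choice q v n lab pol T U) (choice q v m lab' pol' T' U')

/-- Equivalence of heads. -/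
inductive NEquiv (R : Ty → Ty → Prop) : Ty → Ty → Prop
  | fin : NEquiv R fin fin
  | unit : NEquiv R unit unit
  | bool : NEquiv R bool bool
  | choice {q v n m lab lab' pol pol'} {T U : Fin n → Ty} {T' U' : Fin m → Ty}
      (hi : Injective fun i => (lab i, pol i))
      (hi' : Injective fun i => (lab' i, pol' i))
      (hl : ∀ j, ∃ i, lab i = lab' j ∧ pol i = pol' j)
      (hr : ∀ i, ∃ j, lab i = lab' j ∧ pol i = pol' j)
      (h : ∀ i j, lab i = lab' j → pol i = pol' j → R (T i) (T' j) ∧ R (U i) (U' j)) :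
      NEquiv R (choice q v n lab pol T U) (choice q v m lab' pol' T' U')

/-- Duality of heads; continuations are compared for the qualifiers with `c`. -/
inductive NDual (c : Qual → Prop) (R : Ty → Ty → Prop) : Ty → Ty → Prop
  | fin : NDual c R fin fin
  | choice {q v n m lab lab' pol pol'} {T U : Fin n → Ty} {T' U' : Fin m → Ty}
      (hi : Injective fun i => (lab i, pol i))
      (hi' : Injective fun i => (lab' i, pol' i))
      (hl : ∀ j, ∃ i, lab i = lab' j ∧ pol' j = (pol i).dual)
      (hr : ∀ i, ∃ j, lab i = lab' j ∧ pol' j = (pol i).dual)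
      (h : ∀ i j, lab i = lab' j → pol' j = (pol i).dual →
        Equiv (T i) (T' j) ∧ (c q → R (U i) (U' j))) :
      NDual c R (choice q v n lab pol T U) (choice q v.dual m lab' pol' T' U')

theorem NSub.mono {c : Qual → Prop} {R S A B} (h : ∀ X Y, R X Y → S X Y) :
    NSub c R A B → NSub c S A B := by
  rintro (_ | _ | _ | ⟨h1, h2, h3⟩)
  · exact .fin
  · exact .unit
  · exact .bool
  · exact .choice h1 h2 fun i j e e' => ⟨(h3 i j e e').1.mono h, fun hc => h _ _ ((h3 i j e e').2 hc)⟩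

theorem NEquiv.mono {R S A B} (h : ∀ X Y, R X Y → S X Y) : NEquiv R A B → NEquiv S A B := by
  rintro (_ | _ | _ | ⟨h1, h2, h3, h4, h5⟩)
  · exact .fin
  · exact .unit
  · exact .bool
  · exact .choice h1 h2 h3 h4 fun i j e e' => ⟨h _ _ (h5 i j e e').1, h _ _ (h5 i j e e').2⟩

theorem NDual.mono {c : Qual → Prop} {R S A B} (h : ∀ X Y, R X Y → S X Y) :
    NDual c R A B → NDual c S A B := by
  rintro (_ | ⟨h1, h2, h3, h4, h5⟩)
  · exact .fin
  · exact .choice h1 h2 h3 h4 fun i j e e' => ⟨(h5 i j e e').1, fun hc => h _ _ ((h5 i j e e').2 hc)⟩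

/-- Subtyping that ignores the continuations of unrestricted choice types. -/
abbrev WSub : Ty → Ty → Prop := Co (NSub (· = .lin))

/-- Duality that ignores the continuations of unrestricted choice types. -/
abbrev WDual : Ty → Ty → Prop := Co (NDual (· = .lin))

theorem key_inj {n : ℕ} {lab : Fin n → Label} {pol : Fin n → Pol}
    (hi : Injective fun i => (lab i, pol i)) {i j : Fin n} (h : lab i = lab j)
    (h' : pol i = pol j) : i = j := hi (by simp only [h, h'])

theorem Sub.wsub {T U : Ty} (h : Sub T U) (hT : T.WF) (hU : U.WF) : WSub T U := by
  refine Co.ofRule ?_ h hT hU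
  rintro R A B h hA hB
  cases h with
  | fin => exact .inl ⟨.fin, .fin, .fin⟩
  | unit => exact .inl ⟨.unit, .unit, .unit⟩
  | bool => exact .inl ⟨.bool, .bool, .bool⟩
  | @int q n m lab lab' pol pol' T U T' U' f hlab hpol h =>
    refine .inl ⟨.choice .., .choice .., .choice (fun _ j => ⟨f j, hlab j, hpol j⟩)
      (fun e => by cases e) fun i j e e' => ?_⟩
    obtain rfl : i = f j := key_inj hA.2.1 (e.trans (hlab j).symm) (e'.trans (hpol j).symm)
    have := h j
    have h1 := hA.2.2.1 (f j)
    have h2 := hA.2.2.2 (f j)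
    have h3 := hB.2.2.1 j
    have h4 := hB.2.2.2 j
    revert this
    cases pol' j
    · exact fun h => ⟨⟨h.1, h3, h1⟩, fun _ => ⟨h.2, h2, h4⟩⟩
    · exact fun h => ⟨⟨h.1, h1, h3⟩, fun _ => ⟨h.2, h2, h4⟩⟩
  | @ext q n m lab lab' pol pol' T U T' U' f hlab hpol h =>
    refine .inl ⟨.choice .., .choice .., .choice (fun e => by cases e)
      (fun _ i => ⟨f i, (hlab i).symm, (hpol i).symm⟩) fun i j e e' => ?_⟩
    obtain rfl : j = f i := key_inj hB.2.1 (e.symm.trans (hlab i).symm) (e'.symm.trans (hpol i).symm)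
    have := h i
    have h1 := hA.2.2.1 i
    have h2 := hA.2.2.2 i
    have h3 := hB.2.2.1 (f i)
    have h4 := hB.2.2.2 (f i)
    revert this
    rw [hpol i]
    cases pol i
    · exact fun h => ⟨⟨h.1, h3, h1⟩, fun _ => ⟨h.2, h2, h4⟩⟩
    · exact fun h => ⟨⟨h.1, h1, h3⟩, fun _ => ⟨h.2, h2, h4⟩⟩
  | muL h => exact .inr (.inl ⟨_, rfl, h⟩)
  | muR h => exact .inr (.inr ⟨_, rfl, h⟩)

theorem Co.sub {T U : Ty} (h : Co (NSub fun _ => True) T U) : Sub T U := by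
  refine Co.toRule (N := NSub fun _ => True) NSub.mono ?_ .muL .muR h
  rintro R A B (_ | _ | _ | @⟨q, v, n, m, lab, lab', pol, pol', T, U, T', U', h1, h2, h3⟩)
  · exact .fin
  · exact .unit
  · exact .bool
  · have key : ∀ i j, lab i = lab' j → pol i = pol' j →
        BranchSub R (pol' j) (T i) (U i) (T' j) (U' j) := by
      intro i j e e'
      have := h3 i j e e'
      revert this
      cases pol' j <;> exact fun h => ⟨h.1, h.2 trivial⟩
    cases v with
    | int =>
      choose f hf hf' using h1 rfl
      exact .int f hf hf' fun j => key _ _ (hf j) (hf' j)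
    | ext =>
      choose f hf hf' using h2 rfl
      refine .ext f (fun i => (hf i).symm) (fun i => (hf' i).symm) fun i => ?_
      rw [hf' i]
      exact key _ _ (hf i) (hf' i)

theorem Equiv.co {T U : Ty} (h : Equiv T U) (hT : T.WF) (hU : U.WF) :
    Co (fun R A B => NEquiv (fun X Y => R X Y ∧ X.WF ∧ Y.WF) A B) T U := by
  refine Co.ofRule ?_ h hT hU
  rintro R A B h hA hB
  cases h with
  | fin => exact .inl ⟨.fin, .fin, .fin⟩
  | unit => exact .inl ⟨.unit, .unit, .unit⟩
  | bool => exact .inl ⟨.bool, .bool, .bool⟩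
  | @choice q v n m lab lab' pol pol' T U T' U' e hlab hpol hT hU =>
    refine .inl ⟨.choice .., .choice .., .choice hA.2.1 hB.2.1
      (fun j => ⟨e.symm j, by grind, by grind⟩)
      (fun i => ⟨e i, (hlab i).symm, (hpol i).symm⟩) fun i j h h' => ?_⟩
    obtain rfl : j = e i := key_inj hB.2.1 (h.symm.trans (hlab i).symm) (h'.symm.trans (hpol i).symm)
    exact ⟨⟨⟨hT i, hA.2.2.1 i, hB.2.2.1 _⟩, hA.2.2.1 i, hB.2.2.1 _⟩,
      ⟨hU i, hA.2.2.2 i, hB.2.2.2 _⟩, hA.2.2.2 i, hB.2.2.2 _⟩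
  | muL h => exact .inr (.inl ⟨_, rfl, h⟩)
  | muR h => exact .inr (.inr ⟨_, rfl, h⟩)

theorem exists_equiv {n m : ℕ} {lab : Fin n → Label} {lab' : Fin m → Label} {pol : Fin n → Pol}
    {pol' : Fin m → Pol} (g : Pol → Pol) (hg : g.Injective)
    (hi : Injective fun i => (lab i, pol i))
    (hi' : Injective fun i => (lab' i, pol' i))
    (hl : ∀ j, ∃ i, lab i = lab' j ∧ pol' j = g (pol i))
    (hr : ∀ i, ∃ j, lab i = lab' j ∧ pol' j = g (pol i)) :
    ∃ e : Fin n ≃ Fin m, (∀ i, lab' (e i) = lab i) ∧ ∀ i, pol' (e i) = g (pol i) := by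
  choose f hf hf' using hr
  have inj : Injective f := by
    intro i j h
    refine key_inj hi ((hf i).trans (h ▸ (hf j).symm)) (hg ?_)
    rw [← hf', ← hf', h]
  have surj : Function.Surjective f := by
    intro j
    obtain ⟨i, h, h'⟩ := hl j
    exact ⟨i, key_inj hi' ((hf i).symm.trans h) ((hf' i).trans h'.symm)⟩
  exact ⟨.ofBijective f ⟨inj, surj⟩, fun i => (hf i).symm, hf'⟩

theorem Co.equiv {T U : Ty} (h : Co NEquiv T U) : Equiv T U := by
  refine Co.toRule (N := NEquiv) NEquiv.mono ?_ .muL .muR h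
  rintro R A B (_ | _ | _ | ⟨h1, h2, h3, h4, h5⟩)
  · exact .fin
  · exact .unit
  · exact .bool
  · obtain ⟨e, he, he'⟩ := exists_equiv id Function.injective_id h1 h2
      (fun j => (h3 j).imp fun i h => ⟨h.1, h.2.symm⟩)
      (fun j => (h4 j).imp fun i h => ⟨h.1, h.2.symm⟩)
    exact .choice e he he' (fun i => (h5 _ _ (he i).symm (he' i).symm).1)
      fun i => (h5 _ _ (he i).symm (he' i).symm).2

theorem dual_dual (p : Pol) : p.dual.dual = p := by cases p <;> rfl

theorem Dual.wdual {T U : Ty} (h : Dual T U) (hT : T.WF) (hU : U.WF) : WDual T U := by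
  refine Co.ofRule ?_ h hT hU
  rintro R A B h hA hB
  cases h with
  | fin => exact .inl ⟨.fin, .fin, .fin⟩
  | @choice q v n m lab lab' pol pol' T U T' U' e hlab hpol hT hU =>
    refine .inl ⟨.choice .., .choice .., .choice hA.2.1 hB.2.1
      (fun j => ⟨e.symm j, by grind, by grind⟩)
      (fun i => ⟨e i, (hlab i).symm, hpol i⟩) fun i j h h' => ?_⟩
    obtain rfl : j = e i := key_inj hB.2.1 (h.symm.trans (hlab i).symm) (h'.trans (hpol i).symm)
    exact ⟨hT i, fun _ => ⟨hU i, hA.2.2.2 i, hB.2.2.2 _⟩⟩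
  | muL h => exact .inr (.inl ⟨_, rfl, h⟩)
  | muR h => exact .inr (.inr ⟨_, rfl, h⟩)

theorem Co.dual {T U : Ty} (h : Co (NDual fun _ => True) T U) : Dual T U := by
  refine Co.toRule (N := NDual fun _ => True) NDual.mono ?_ .muL .muR h
  rintro R A B (_ | ⟨h1, h2, h3, h4, h5⟩)
  · exact .fin
  · obtain ⟨e, he, he'⟩ := exists_equiv Pol.dual (fun p p' h => by
      rw [← dual_dual p, h, dual_dual]) h1 h2 h3 h4
    exact .choice e he he' (fun i => (h5 _ _ (he i).symm (he' i)).1)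
      fun i => (h5 _ _ (he i).symm (he' i)).2 trivial

theorem WF.wsub_refl {T : Ty} (h : T.WF) : WSub T T := by
  refine ⟨fun A B => A = B ∧ A.WF, ?_, rfl, h⟩
  rintro A _ ⟨rfl, hA⟩
  obtain ⟨H, hH⟩ := hA.exists_head
  have hw := hH.wf hA
  refine ⟨H, H, hH, hH, ?_⟩
  have := hH.self
  cases this with
  | choice q v n lab pol T U =>
    refine .choice (fun _ j => ⟨j, rfl, rfl⟩) (fun _ j => ⟨j, rfl, rfl⟩) fun i j h h' => ?_
    obtain rfl := key_inj hw.2.1 h h'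
    refine ⟨?_, fun _ => ⟨rfl, hw.2.2.2 i⟩⟩
    cases pol i <;> exact ⟨rfl, hw.2.2.1 i⟩
  | fin => exact .fin
  | unit => exact .unit
  | bool => exact .bool
  | mu h => exact (hH.ne_mu _ rfl).elim

theorem Pay.comp {R S : Ty → Ty → Prop} {p T₁ T₂ T₃}
    (h : ∀ X Y Z, S X Y → S Y Z → R X Z) :
    Pay S p T₁ T₂ → Pay S p T₂ T₃ → Pay R p T₁ T₃ := by
  cases p
  · aesop
  · aesop

theorem WSub.heads {A B : Ty} (h : WSub A B) :
    ∃ HA HB, Head A HA ∧ Head B HB ∧ NSub (· = .lin) WSub HA HB :=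
  Co.dest (N := NSub (· = .lin)) NSub.mono h

theorem WDual.heads {A B : Ty} (h : WDual A B) :
    ∃ HA HB, Head A HA ∧ Head B HB ∧ NDual (· = .lin) WDual HA HB :=
  Co.dest (N := NDual (· = .lin)) NDual.mono h

theorem WSub.trans {A B C : Ty} (h : WSub A B) (h' : WSub B C) : WSub A C := by
  refine ⟨fun A C => ∃ B, WSub A B ∧ WSub B C, ?_, B, h, h'⟩
  rintro A C ⟨B, h, h'⟩
  obtain ⟨HA, HB, hA, hB, h⟩ := h.heads
  obtain ⟨HB', HC, hB', hC, h'⟩ := h'.heads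
  cases hB.unique hB'
  refine ⟨HA, HC, hA, hC, ?_⟩
  cases h with
  | fin => cases h'; exact .fin
  | unit => cases h'; exact .unit
  | bool => cases h'; exact .bool
  | @choice q v n m lab lab' pol pol' T U T' U' h1 h2 h3 =>
    cases h' with
    | @choice _ _ _ k _ labC _ polC _ _ TC UC h1' h2' h3' =>
      refine .choice ?_ ?_ ?_
      · intro hv k
        obtain ⟨j, e, e'⟩ := h1' hv k
        obtain ⟨i, d, d'⟩ := h1 hv j
        exact ⟨i, d.trans e, d'.trans e'⟩
      · intro hv i
        obtain ⟨j, e, e'⟩ := h2 hv i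
        obtain ⟨k, d, d'⟩ := h2' hv j
        exact ⟨k, e.trans d, e'.trans d'⟩
      · intro i k e e'
        obtain ⟨j, d, d'⟩ : ∃ j, lab' j = labC k ∧ pol' j = polC k := by
          cases v with
          | int => exact h1' rfl k
          | ext => exact (h2 rfl i).imp fun j h => ⟨h.1.symm.trans e, h.2.symm.trans e'⟩
        obtain ⟨a, b⟩ := h3 i j (e.trans d.symm) (e'.trans d'.symm)
        obtain ⟨a', b'⟩ := h3' j k d d'
        rw [d'] at a
        exact ⟨Pay.comp (S := WSub) (fun _ _ _ h h' => ⟨_, h, h'⟩) a a',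
          fun hq => ⟨_, b hq, b' hq⟩⟩

theorem Equiv.wsub {A B : Ty} (h : Equiv A B) (hA : A.WF) (hB : B.WF) :
    WSub A B ∧ WSub B A := by
  have key : ∀ {S : Ty → Ty → Prop} {HA HB}, NEquiv S HA HB →
      NSub (· = .lin) (fun X Y => S X Y ∨ S Y X) HA HB ∧
      NSub (· = .lin) (fun X Y => S X Y ∨ S Y X) HB HA := by
    rintro S _ _ (_ | _ | _ | @⟨q, v, n, m, lab, lab', pol, pol', T, U, T', U', h1, h2, h3, h4, h5⟩)
    · exact ⟨.fin, .fin⟩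
    · exact ⟨.unit, .unit⟩
    · exact ⟨.bool, .bool⟩
    · refine ⟨.choice (fun _ => h3) (fun _ => h4) fun i j e e' => ?_,
        .choice (fun _ j => (h4 j).imp fun i h => ⟨h.1.symm, h.2.symm⟩)
          (fun _ j => (h3 j).imp fun i h => ⟨h.1.symm, h.2.symm⟩) fun i j e e' => ?_⟩
      · obtain ⟨a, b⟩ := h5 i j e e'
        refine ⟨?_, fun _ => .inl b⟩
        cases pol' j
        · exact .inr a
        · exact .inl a
      · obtain ⟨a, b⟩ := h5 j i e.symm e'.symm
        refine ⟨?_, fun _ => .inr b⟩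
        cases pol j
        · exact .inl a
        · exact .inr a
  have h := h.co hA hB
  set E := Co (fun R A B => NEquiv (fun X Y => R X Y ∧ X.WF ∧ Y.WF) A B) with hE
  have hd : ∀ {A B}, E A B → ∃ HA HB, Head A HA ∧ Head B HB ∧ NEquiv E HA HB := by
    intro A B h
    obtain ⟨HA, HB, h1, h2, h3⟩ := Co.dest
      (N := fun R A B => NEquiv (fun X Y => R X Y ∧ X.WF ∧ Y.WF) A B)
      (fun hRS h => NEquiv.mono (fun X Y h => ⟨hRS _ _ h.1, h.2⟩) h) h
    exact ⟨HA, HB, h1, h2, h3.mono fun _ _ h => h.1⟩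
  have : ∀ A B, (E A B ∨ E B A) → ∃ HA HB, Head A HA ∧ Head B HB ∧
      NSub (· = .lin) (fun X Y => E X Y ∨ E Y X) HA HB := by
    grind
  exact ⟨⟨_, this, .inl h⟩, ⟨_, this, .inr h⟩⟩

theorem WSub.lin_iff {A B : Ty} (h : WSub A B) : A.Lin ↔ B.Lin := by
  obtain ⟨HA, HB, hA, hB, h⟩ := h.heads
  constructor
  · rintro ⟨v, n, lab, pol, T, U, h1⟩
    cases hA.unique h1
    cases h
    exact ⟨_, _, _, _, _, _, hB⟩
  · rintro ⟨v, n, lab, pol, T, U, h1⟩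
    cases hB.unique h1
    cases h
    exact ⟨_, _, _, _, _, _, hA⟩

theorem lin_choice_iff {q v n lab pol T U} :
    (Ty.choice q v n lab pol T U).Lin ↔ q = .lin := by
  constructor
  · rintro ⟨_, _, _, _, _, _, h⟩
    cases h
    rfl
  · rintro rfl
    exact ⟨_, _, _, _, _, _, .choice ..⟩

theorem WSub.not_lin_of_bool {A : Ty} (h : WSub A bool) : ¬ A.Lin := by
  rw [h.lin_iff]
  rintro ⟨_, _, _, _, _, _, h⟩
  cases h

theorem WSub.choice_inv {A : Ty} {q v m lab' pol'} {T' U' : Fin m → Ty}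
    (h : WSub A (.choice q v m lab' pol' T' U')) :
    ∃ n lab pol, ∃ T U : Fin n → Ty, Head A (.choice q v n lab pol T U) ∧
      (v = .int → ∀ j, ∃ i, lab i = lab' j ∧ pol i = pol' j) ∧
      (v = .ext → ∀ i, ∃ j, lab i = lab' j ∧ pol i = pol' j) ∧
      ∀ i j, lab i = lab' j → pol i = pol' j →
        Pay WSub (pol' j) (T i) (T' j) ∧ (q = .lin → WSub (U i) (U' j)) := by
  obtain ⟨HA, HB, hA, hB, h⟩ := h.heads
  cases hB
  cases h with
  | choice h1 h2 h3 => exact ⟨_, _, _, _, _, hA, h1, h2, h3⟩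

/-- Choice types above dual types. -/
theorem WDual.choices {A A' : Ty} {q v m lab pol} {T U : Fin m → Ty} {q' v' m' lab' pol'}
    {T' U' : Fin m' → Ty} (hd : WDual A A') (hA : A.WF) (hA' : A'.WF)
    (h : WSub A (.choice q v m lab pol T U)) (h' : WSub A' (.choice q' v' m' lab' pol' T' U')) :
    q' = q ∧ v' = v.dual ∧
      (v = .int → ∀ j, ∃ j', lab j = lab' j' ∧ pol' j' = (pol j).dual) ∧
      ∀ j j', lab j = lab' j' → pol j = .out → pol' j' = .inp → WSub (T j) (T' j') ∧
        (q = .lin → ∃ V V', WDual V V' ∧ V.WF ∧ V'.WF ∧ WSub V (U j) ∧ WSub V' (U' j')) := by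
  obtain ⟨n, labA, polA, TA, UA, hH, h1, h2, h3⟩ := h.choice_inv
  obtain ⟨n', labB, polB, TB, UB, hH', h1', h2', h3'⟩ := h'.choice_inv
  obtain ⟨HA, HB, hA1, hB1, hd⟩ := hd.heads
  have hw := hH.wf hA
  have hw' := hH'.wf hA'
  cases hA1.unique hH
  cases hB1.unique hH'
  cases hd with
  | choice hi hi' hl hr hTU =>
    refine ⟨rfl, rfl, ?_, ?_⟩
    · rintro rfl j
      obtain ⟨i, e, e'⟩ := h1 rfl j
      obtain ⟨i', d, d'⟩ := hr i
      obtain ⟨j', f, f'⟩ := h2' rfl i'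
      exact ⟨j', e.symm.trans (d.trans f), by grind⟩
    · intro j j' e hj hj'
      obtain ⟨i, i', f, g, f', g', k, k'⟩ : ∃ i i', labA i = lab j ∧ polA i = pol j ∧
          labB i' = lab' j' ∧ polB i' = pol' j' ∧ labA i = labB i' ∧ polB i' = (polA i).dual := by
        cases v with
        | int =>
          obtain ⟨i, f, g⟩ := h1 rfl j
          obtain ⟨i', d, d'⟩ := hr i
          exact ⟨i, i', f, g, d.symm.trans (f.trans e), by rw [d', g, hj, hj']; rfl, d, d'⟩
        | ext =>
          obtain ⟨i', f, g⟩ := h1' rfl j'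
          obtain ⟨i, d, d'⟩ := hl i'
          refine ⟨i, i', d.trans (f.trans e.symm), ?_, f, g, d, d'⟩
          rw [hj, ← dual_dual (polA i), ← d', g, hj']
          rfl
      obtain ⟨p1, c1⟩ := h3 i j f g
      obtain ⟨p2, c2⟩ := h3' i' j' f' g'
      obtain ⟨p3, c3⟩ := hTU i i' k k'
      rw [hj] at p1
      rw [hj'] at p2
      refine ⟨WSub.trans (show WSub (T j) (TA i) from p1)
        (WSub.trans (p3.wsub (hw.2.2.1 i) (hw'.2.2.1 i')).1 (show WSub (TB i') (T' j') from p2)), ?_⟩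
      intro hq
      exact ⟨_, _, c3 hq, hw.2.2.2 i, hw'.2.2.2 i', c1 hq, c2 hq⟩

theorem WDual.symm {A B : Ty} (h : WDual A B) (hA : A.WF) (hB : B.WF) : WDual B A := by
  refine ⟨fun B A => WDual A B ∧ A.WF ∧ B.WF, ?_, h, hA, hB⟩
  rintro B A ⟨h, hA, hB⟩
  obtain ⟨HA, HB, h1, h2, h⟩ := h.heads
  refine ⟨HB, HA, h2, h1, ?_⟩
  have hA := h1.wf hA
  have hB := h2.wf hB
  cases h with
  | fin => exact .fin
  | @choice q v n m lab lab' pol pol' T U T' U' hi hi' hl hr h =>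
    have sw : ∀ {p p' : Pol}, p' = p.dual → p = p'.dual := by
      rintro p _ rfl
      exact (dual_dual p).symm
    have := NDual.choice (c := (· = .lin)) (R := fun B A => WDual A B ∧ A.WF ∧ B.WF) (q := q)
      (v := v.dual) (U := U') (U' := U) hi' hi
      (fun j => (hr j).imp fun i h => ⟨h.1.symm, sw h.2⟩)
      (fun j => (hl j).imp fun i h => ⟨h.1.symm, sw h.2⟩)
      (T := T') (T' := T) (fun i j e e' => by
        obtain ⟨a, b⟩ := h j i e.symm (sw e')
        refine ⟨?_, fun hq => ⟨b hq, hA.2.2.2 j, hB.2.2.2 i⟩⟩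
        obtain ⟨R, hR, h⟩ := a
        refine ⟨fun X Y => R Y X, fun X Y hXY => ?_, h⟩
        have := hR _ _ hXY
        cases this with
        | fin => exact .fin
        | unit => exact .unit
        | bool => exact .bool
        | muL h => exact .muR h
        | muR h => exact .muL h
        | choice e h1 h2 h3 h4 =>
          exact .choice e.symm (fun i => by grind)
            (fun i => by grind)
            (fun i => by have := h3 (e.symm i); rwa [e.apply_symm_apply] at this)
            (fun i => by have := h4 (e.symm i); rwa [e.apply_symm_apply] at this))
    have e : v.dual.dual = v := by cases v <;> rfl
    rwa [e] at this

/-! ## Uniform types -/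

/-- Makes the continuations of unrestricted choice types trivial. -/
def uni : Ty → Ty
  | choice .un v n lab pol T _ =>
      mu (choice .un v n lab pol (fun i => ((T i).uni).rename (· + 1)) fun _ => var 0)
  | choice .lin v n lab pol T U => choice .lin v n lab pol (fun i => (T i).uni) fun i => (U i).uni
  | fin => fin
  | unit => unit
  | bool => bool
  | mu T => mu T.uni
  | var t => var t

theorem uni_rename (T : Ty) : ∀ f, (T.rename f).uni = T.uni.rename f := by
  induction T with
  | choice q v n lab pol T U hT hU =>
    intro f
    cases q
    · simp only [rename, uni, hT, hU]
    · rw [rename, uni, uni, rename_mu]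
      simp only [rename, hT, rename_rename]
      rfl
  | mu T ih => intro f; rw [rename_mu, uni, uni, rename_mu, ih]
  | _ => intros; rfl

theorem uni_subst (T : Ty) : ∀ σ : ℕ → Ty, (T.subst σ).uni = T.uni.subst fun t => (σ t).uni := by
  induction T with
  | choice q v n lab pol T U hT hU =>
    intro f
    cases q
    · simp only [subst, uni, hT, hU]
    · rw [subst, uni, uni, subst_mu]
      simp only [subst, hT, rename_subst, subst_rename]
      rfl
  | mu T ih =>
    intro σ
    rw [subst_mu, uni, uni, subst_mu, ih]
    congr 2
    funext t
    cases t
    · rfl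
    · exact uni_rename _ _
  | _ => intros; rfl

theorem uni_unfold (T : Ty) : T.unfold.uni = T.uni.unfold := by
  rw [unfold, uni_subst, unfold]
  congr 1
  funext t
  cases t <;> rfl

theorem headVar_uni {T : Ty} : ∀ {k}, T.uni.HeadVar k ↔ T.HeadVar k := by
  induction T with
  | choice q v n lab pol T U => intro k; cases q <;> exact Iff.rfl
  | mu T ih => exact ih
  | _ => exact Iff.rfl

theorem WFAt.uni {T : Ty} : ∀ {k}, T.WFAt k → T.uni.WFAt k := by
  induction T with
  | choice q v n lab pol T U hT hU =>
    intro k h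
    cases q
    · exact ⟨h.1, h.2.1, fun i => hT i (h.2.2.1 i), fun i => hU i (h.2.2.2 i)⟩
    · exact ⟨id, h.1, h.2.1, fun i => (hT i (h.2.2.1 i)).rename fun t ht => Nat.succ_lt_succ ht,
        fun i => Nat.succ_pos _⟩
  | mu T ih => exact fun h => ⟨fun h' => h.1 (headVar_uni.1 h'), ih h.2⟩
  | _ => exact id

/-- The head of the uniform type of a type with the given head. -/
def uniHead : Ty → Ty
  | choice .un v n lab pol T U =>
      choice .un v n lab pol (fun i => (T i).uni) fun _ => (choice .un v n lab pol T U).uni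
  | T => T.uni

theorem Head.uni {T H : Ty} (h : Head T H) : Head T.uni H.uniHead := by
  induction h with
  | choice q v n lab pol T U =>
    cases q
    · exact .choice ..
    · refine .mu ?_
      have : ∀ (σ : ℕ → Ty) (X : Ty), (X.rename (· + 1)).subst σ = X.subst fun t => σ (t + 1) :=
        fun σ X => subst_rename X _ _
      simp only [Ty.unfold, Ty.subst, this]
      have : (fun t => Ty.var t) = Ty.var := rfl
      simp only [this, subst_id]
      exact .choice ..
  | fin => exact .fin
  | unit => exact .unit
  | bool => exact .bool
  | mu _ ih =>
    rw [uni_unfold] at ih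
    exact .mu ih

/-- The uniform type of the head of a type. -/
noncomputable def real (T : Ty) : Ty := T.hd.uni

theorem WF.real {T : Ty} (h : T.WF) : T.real.WF := WFAt.uni (h.head_hd.wf h)

theorem WF.head_real {T : Ty} (h : T.WF) : Head T.real T.hd.uniHead := h.head_hd.self.uni

theorem WF.real_un {T : Ty} (h : T.WF) (hT : ¬ T.Lin) : T.real.Un := by
  have := h.head_hd
  rw [Ty.real]
  have hs := this.self
  generalize T.hd = H at this hs
  cases hs with
  | choice q => cases q
                · exact (hT ⟨_, _, _, _, _, _, this⟩).elim
                · rfl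
  | fin => trivial
  | unit => trivial
  | bool => trivial
  | mu => exact (this.ne_mu _ rfl).elim

/-- `X` has the same head as the uniform type of `T`. -/
def IsUni (T X : Ty) : Prop := ∃ H, Head T H ∧ Head X H.uniHead

theorem WF.isUni {T : Ty} (h : T.WF) : IsUni T T.uni := ⟨_, h.head_hd, h.head_hd.uni⟩

theorem WF.isUni_real {T : Ty} (h : T.WF) : IsUni T T.real := ⟨_, h.head_hd, h.head_real⟩

theorem WSub.uni {T U X Y : Ty} (h : WSub T U) (hT : T.WF) (hU : U.WF) (hX : IsUni T X)
    (hY : IsUni U Y) : Co (NSub fun _ => True) X Y := by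
  refine ⟨fun X Y => ∃ T U, WSub T U ∧ T.WF ∧ U.WF ∧ IsUni T X ∧ IsUni U Y, ?_,
    T, U, h, hT, hU, hX, hY⟩
  rintro X Y ⟨T, U, h, hT, hU, ⟨H, hTH, hX⟩, ⟨H', hUH, hY⟩⟩
  refine ⟨_, _, hX, hY, ?_⟩
  have hh : WSub H H' := by
    obtain ⟨HA, HB, h1, h2, h⟩ := h.heads
    cases h1.unique hTH
    cases h2.unique hUH
    exact Co.intro (N := NSub (· = .lin)) NSub.mono hTH.self hUH.self h
  obtain ⟨HA, HB, h1, h2, h⟩ := h.heads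
  cases h1.unique hTH
  cases h2.unique hUH
  have wT := hTH.wf hT
  have wU := hUH.wf hU
  cases h with
  | fin => exact .fin
  | unit => exact .unit
  | bool => exact .bool
  | @choice q v n m lab lab' pol pol' T U T' U' g1 g2 h3 =>
    have key : ∀ i j, lab i = lab' j → pol i = pol' j →
        Pay (fun X Y => ∃ T U, WSub T U ∧ T.WF ∧ U.WF ∧ IsUni T X ∧ IsUni U Y) (pol' j)
          (T i).uni (T' j).uni := by
      intro i j e e'
      have := (h3 i j e e').1
      revert this
      cases pol' j
      · exact fun h => ⟨_, _, h, wU.2.2.1 j, wT.2.2.1 i, WF.isUni (wU.2.2.1 j), WF.isUni (wT.2.2.1 i)⟩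
      · exact fun h => ⟨_, _, h, wT.2.2.1 i, wU.2.2.1 j, WF.isUni (wT.2.2.1 i), WF.isUni (wU.2.2.1 j)⟩
    cases q
    · exact .choice g1 g2 fun i j e e' => ⟨key i j e e', fun _ => ⟨_, _, (h3 i j e e').2 rfl,
        wT.2.2.2 i, wU.2.2.2 j, WF.isUni (wT.2.2.2 i), WF.isUni (wU.2.2.2 j)⟩⟩
    · exact .choice g1 g2 fun i j e e' => ⟨key i j e e', fun _ => ⟨_, _, hh, wT, wU,
        wT.isUni, wU.isUni⟩⟩

theorem WSub.real {T U : Ty} (h : WSub T U) (hT : T.WF) (hU : U.WF) : Sub T.real U.real :=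
  (h.uni hT hU hT.isUni_real hU.isUni_real).sub

theorem WSub.real_choice {A : Ty} {q v m lab pol} {T U W : Fin m → Ty}
    (h : WSub A (.choice q v m lab pol T U)) (hA : A.WF)
    (hC : (Ty.choice q v m lab pol T U).WF) (hW : q = .lin → ∀ i, W i = (U i).real)
    (hW' : q = .un → ∀ i, W i = A.real) :
    Sub A.real (.choice q v m lab pol (fun i => (T i).real) W) := by
  obtain ⟨HA, HB, h1, h2, hN⟩ := h.heads
  have hr := hA.head_real
  rw [h1.hd_eq] at hr
  have wT := h1.wf hA
  cases h2
  refine Co.sub (Co.intro (N := NSub fun _ => True) NSub.mono hr (.choice ..) ?_)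
  cases hN with
  | @choice _ _ n _ labA _ polA _ TA UA _ _ h1' h2' h3' =>
    have key : ∀ i j, labA i = lab j → polA i = pol j →
        Pay (Co (NSub fun _ => True)) (pol j) (TA i).uni (T j).real := by
      intro i j e e'
      have a := wT.2.2.1 i
      have b := hC.2.2.1 j
      have := (h3' i j e e').1
      revert this
      cases pol j
      · exact fun h => WSub.uni h b a (WF.isUni_real b) (WF.isUni a)
      · exact fun h => WSub.uni h a b (WF.isUni a) (WF.isUni_real b)
    cases q
    · refine .choice h1' h2' fun i j e e' => ⟨key i j e e', fun _ => ?_⟩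
      rw [hW rfl]
      exact WSub.uni ((h3' i j e e').2 rfl) (wT.2.2.2 i) (hC.2.2.2 j) (WF.isUni (wT.2.2.2 i))
        (WF.isUni_real (hC.2.2.2 j))
    · refine .choice h1' h2' fun i j e e' => ⟨key i j e e', fun _ => ?_⟩
      rw [hW' rfl, Ty.real, h1.hd_eq]
      exact WSub.uni (WF.wsub_refl wT) wT wT wT.isUni wT.isUni

theorem Equiv.uni {A B : Ty} (h : Equiv A B) (hA : A.WF) (hB : B.WF) : Equiv A.uni B.uni := by
  refine Co.equiv ⟨fun X Y => ∃ T U, Equiv T U ∧ T.WF ∧ U.WF ∧ IsUni T X ∧ IsUni U Y, ?_,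
    A, B, h, hA, hB, hA.isUni, hB.isUni⟩
  rintro X Y ⟨T, U, h, hT, hU, ⟨H, hTH, hX⟩, ⟨H', hUH, hY⟩⟩
  refine ⟨_, _, hX, hY, ?_⟩
  obtain ⟨HA, HB, h1, h2, h⟩ := Co.dest
    (N := fun R A B => NEquiv (fun X Y => R X Y ∧ X.WF ∧ Y.WF) A B)
    (fun hRS h => NEquiv.mono (fun X Y h => ⟨hRS _ _ h.1, h.2⟩) h) (h.co hT hU)
  have mono : ∀ {X Y : Ty}, Co (fun R A B => NEquiv (fun X Y => R X Y ∧ X.WF ∧ Y.WF) A B) X Y →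
      Equiv X Y := by
    rintro X Y ⟨R, hR, h⟩
    refine Co.equiv ⟨R, fun A B h => ?_, h⟩
    obtain ⟨HA, HB, h1, h2, h3⟩ := hR _ _ h
    exact ⟨HA, HB, h1, h2, h3.mono fun _ _ h => h.1⟩
  cases h1.unique hTH
  cases h2.unique hUH
  have wT := hTH.wf hT
  have wU := hUH.wf hU
  cases h with
  | fin => exact .fin
  | unit => exact .unit
  | bool => exact .bool
  | @choice q v n m lab lab' pol pol' T U T' U' g1 g2 h3 h4 h5 =>
    have hh : Equiv (.choice q v n lab pol T U) (.choice q v m lab' pol' T' U') :=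
      Co.equiv (Co.intro (N := NEquiv) NEquiv.mono hTH.self hUH.self (.choice g1 g2 h3 h4 fun i j e e' => by
        obtain ⟨⟨a, _⟩, ⟨b, _⟩⟩ := h5 i j e e'
        have mono' : ∀ {X Y : Ty},
            Co (fun R A B => NEquiv (fun X Y => R X Y ∧ X.WF ∧ Y.WF) A B) X Y → Co NEquiv X Y := by
          rintro X Y ⟨R, hR, h⟩
          refine ⟨R, fun A B h => ?_, h⟩
          obtain ⟨HA, HB, h1, h2, h3⟩ := hR _ _ h
          exact ⟨HA, HB, h1, h2, h3.mono fun _ _ h => h.1⟩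
        exact ⟨mono' a, mono' b⟩))
    have wf : ∀ {X Y : Ty}, Equiv X Y → X.WF → Y.WF →
        ∃ T U, Equiv T U ∧ T.WF ∧ U.WF ∧ IsUni T X.uni ∧ IsUni U Y.uni := fun h hX hY =>
      ⟨_, _, h, hX, hY, hX.isUni, hY.isUni⟩
    cases q
    · exact .choice g1 g2 h3 h4 fun i j e e' =>
        ⟨wf (mono (h5 i j e e').1.1) (wT.2.2.1 i) (wU.2.2.1 j),
          wf (mono (h5 i j e e').2.1) (wT.2.2.2 i) (wU.2.2.2 j)⟩
    · exact .choice g1 g2 h3 h4 fun i j e e' =>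
        ⟨wf (mono (h5 i j e e').1.1) (wT.2.2.1 i) (wU.2.2.1 j), wf hh wT wU⟩

theorem WDual.real {A B : Ty} (h : WDual A B) (hA : A.WF) (hB : B.WF) : Dual A.real B.real := by
  refine Co.dual ⟨fun X Y => ∃ T U, WDual T U ∧ T.WF ∧ U.WF ∧ IsUni T X ∧ IsUni U Y, ?_,
    A, B, h, hA, hB, hA.isUni_real, hB.isUni_real⟩
  rintro X Y ⟨T, U, h, hT, hU, ⟨H, hTH, hX⟩, ⟨H', hUH, hY⟩⟩
  refine ⟨_, _, hX, hY, ?_⟩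
  obtain ⟨HA, HB, h1, h2, h⟩ := h.heads
  cases h1.unique hTH
  cases h2.unique hUH
  have hh : WDual H H' := Co.intro (N := NDual (· = .lin)) NDual.mono hTH.self hUH.self h
  have wT := hTH.wf hT
  have wU := hUH.wf hU
  cases h with
  | fin => exact .fin
  | @choice q v n m lab lab' pol pol' T U T' U' g1 g2 h3 h4 h5 =>
    cases q
    · exact .choice g1 g2 h3 h4 fun i j e e' =>
        ⟨(h5 i j e e').1.uni (wT.2.2.1 i) (wU.2.2.1 j), fun _ => ⟨_, _, (h5 i j e e').2 rfl,
          wT.2.2.2 i, wU.2.2.2 j, WF.isUni (wT.2.2.2 i), WF.isUni (wU.2.2.2 j)⟩⟩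
    · exact .choice g1 g2 h3 h4 fun i j e e' =>
        ⟨(h5 i j e e').1.uni (wT.2.2.1 i) (wU.2.2.1 j), fun _ => ⟨_, _, hh, wT, wU,
          wT.isUni, wU.isUni⟩⟩

end Ty

open Ty (WSub WDual)

/-! ## A typing relation for annotated processes -/

/-- All types of a context are well-formed. -/
def CWF (Γ : Ctx) : Prop := ∀ x T, Γ x = some T → T.WF

/-- The names whose type is a linear choice type. -/
def linNames (Γ : Ctx) : Set ℕ := {x | ∃ T, Γ x = some T ∧ T.Lin}

/-- The value `v` has type `T` and owns the linear names `o`. -/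
def VT (Γ : Ctx) (v : Val) (T : Ty) (o : Set ℕ) : Prop :=
  match v with
  | .var x => ∃ S, Γ x = some S ∧ WSub S T ∧ o = {y | y = x ∧ S.Lin}
  | .unit => WSub .unit T ∧ o = ∅
  | _ => WSub .bool T ∧ o = ∅

/-- Owned names below a binder of a name of type `T`. -/
def liftO (T : Ty) (o : Set ℕ) : Set ℕ := {x | (x = 0 ∧ T.Lin) ∨ ∃ y ∈ o, x = y + 1}

/-- Typing of the continuation of an action. -/
def BranchWT (a : Act) (T : Ty) (W : Ctx → Set ℕ → Prop) (Γ : Ctx) (o : Set ℕ) : Prop :=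
  match a with
  | .send v => ∃ o₁ o₂, o = o₁ ∪ o₂ ∧ Disjoint o₁ o₂ ∧ VT Γ v T o₁ ∧ W Γ o₂
  | .recv => W (Γ.cons T) (liftO T o)

/-- The names owned by the subject of a choice. -/
def subjO (q : Qual) (x : ℕ) : Set ℕ := {y | y = x ∧ q = .lin}

/-- The context of the continuation of a choice. -/
def contC (q : Qual) (Γ : Ctx) (x : ℕ) (U : Ty) : Ctx :=
  match q with
  | .lin => update Γ x (some U)
  | .un => Γ

/-- The names owned by the continuation of a choice. -/
def contO (q : Qual) (o : Set ℕ) (x : ℕ) (U : Ty) : Set ℕ :=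
  match q with
  | .lin => o ∪ {y | y = x ∧ U.Lin}
  | .un => o

/-- Typing of choices. -/
inductive ChoiceWT (Γ : Ctx) (q₁ q₂ : Qual) (vw : View) {n : ℕ} (lab : Fin n → Label)
    (act : Fin n → Act) (W : Fin n → Ctx → Set ℕ → Prop) : Val → Set ℕ → Prop
  | mk {x S m} {lab' : Fin m → Label} {pol' : Fin m → Pol} {T U : Fin m → Ty} {k : Fin n → Fin m}
      {o : Set ℕ} (hx : Γ x = some S) (hC : (Ty.choice q₂ vw m lab' pol' T U).WF)
      (hS : WSub S (.choice q₂ vw m lab' pol' T U)) (hk : Function.Surjective k)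
      (hlab : ∀ j, lab' (k j) = lab j) (hpol : ∀ j, pol' (k j) = (act j).pol)
      (hq : q₁ = .un → o = ∅ ∧ q₂ = .un) (ho : Disjoint o (subjO q₂ x))
      (h : ∀ j, BranchWT (act j) (T (k j)) (W j) (contC q₂ Γ x (U (k j)))
        (contO q₂ o x (U (k j)))) :
      ChoiceWT Γ q₁ q₂ vw lab act W (.var x) (o ∪ subjO q₂ x)

/-- The annotated process is typable and owns the linear names `o`. -/
def WT : Ann → Ctx → Set ℕ → Prop
  | .choice q₁ q₂ vw y _ lab act P, Γ, o => ChoiceWT Γ q₁ q₂ vw lab act (fun j => WT (P j)) y o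
  | .par P Q, Γ, o => ∃ o₁ o₂, o = o₁ ∪ o₂ ∧ Disjoint o₁ o₂ ∧ WT P Γ o₁ ∧ WT Q Γ o₂
  | .res P, Γ, o => ∃ T U, T.WF ∧ U.WF ∧ WDual T U ∧
      WT P ((Γ.cons U).cons T) (liftO T (liftO U o))
  | .ite v P Q, Γ, o => VT Γ v .bool ∅ ∧ WT P Γ o ∧ WT Q Γ o
  | .inact, _, o => o = ∅

theorem CWF.cons {Γ : Ctx} (h : CWF Γ) {T : Ty} (hT : T.WF) : CWF (Γ.cons T) := by
  intro x S hx
  cases x with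
  | zero => cases hx; exact hT
  | succ x => exact h x S hx

theorem CWF.update {Γ : Ctx} (h : CWF Γ) {T : Ty} (hT : T.WF) (x : ℕ) :
    CWF (update Γ x (some T)) := by
  intro y S hy
  by_cases e : y = x
  · grind
  · aesop

theorem CWF.contC {Γ : Ctx} (h : CWF Γ) {T : Ty} (hT : T.WF) (q : Qual) (x : ℕ) :
    CWF (contC q Γ x T) := by
  cases q
  · exact h.update hT x
  · exact h

theorem mem_liftO_succ {T : Ty} {o : Set ℕ} {x : ℕ} : x + 1 ∈ liftO T o ↔ x ∈ o := by simp [liftO]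

theorem mem_liftO_zero {T : Ty} {o : Set ℕ} : 0 ∈ liftO T o ↔ T.Lin := by simp [liftO]

theorem VT.own {Γ : Ctx} {v T o} (h : VT Γ v T o) : ∀ x ∈ o, x ∈ v.fv ∧ x ∈ linNames Γ := by
  cases v with
  | var y =>
    obtain ⟨S, hS, _, rfl⟩ := h
    rintro x ⟨rfl, hx⟩
    exact ⟨rfl, S, hS, hx⟩
  | _ => rw [h.2]; exact fun x hx => hx.elim

theorem exists_branch {n m : ℕ} {lab' : Fin m → Label} {pol' : Fin m → Pol} {T U : Fin m → Ty}
    {k : Fin n → Fin m} {q vw} (hC : (Ty.choice q vw m lab' pol' T U).WF)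
    (hk : Function.Surjective k) : ∃ _ : Fin n, True :=
  (hk ⟨0, hC.1⟩).imp fun _ _ => trivial

/-- Owned names are free and linear. -/
theorem WT.own (A : Ann) : ∀ {Γ o}, WT A Γ o → ∀ x ∈ o, x ∈ A.FV ∧ x ∈ linNames Γ := by
  induction A with
  | choice q₁ q₂ vw y n lab act P ih =>
    rintro Γ _ @⟨z, S, m, lab', pol', T, U, k, o, hx, hC, hS, hk, hlab, hpol, hq, ho, h⟩ x hxo
    have subj : q₂ = .lin → z ∈ linNames Γ := by
      rintro rfl
      exact ⟨S, hx, hS.lin_iff.2 (Ty.lin_choice_iff.2 rfl)⟩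
    rcases hxo with hxo | ⟨rfl, hl⟩
    · obtain ⟨j, _⟩ := exists_branch hC hk
      have hne : q₂ = .lin → x ≠ z := by
        rintro hq rfl
        exact Set.disjoint_left.1 ho hxo ⟨rfl, hq⟩
      have h1 : x ∈ contO q₂ o z (U (k j)) := by
        cases q₂
        · exact .inl hxo
        · exact hxo
      have h2 : x ∈ linNames (contC q₂ Γ z (U (k j))) → x ∈ linNames Γ := by
        cases q₂
        · rintro ⟨T, hT, hl⟩
          exact ⟨T, by rwa [contC, update_of_ne (hne rfl)] at hT, hl⟩
        · exact id
      have key : (x ∈ (act j).fv ∨ (act j).lift x ∈ (P j).FV) ∧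
          x ∈ linNames (contC q₂ Γ z (U (k j))) := by
        have := h j
        have ihj := @ih j
        revert this ihj
        cases act j with
        | send v =>
          rintro ⟨o₁, o₂, e, _, hv, hP⟩ ihj
          rw [e] at h1
          rcases h1 with h1 | h1
          · exact ⟨.inl (hv.own x h1).1, (hv.own x h1).2⟩
          · exact ⟨.inr (ihj hP x h1).1, (ihj hP x h1).2⟩
        | recv =>
          intro hP ihj
          have := ihj hP (x + 1) (mem_liftO_succ.2 h1)
          exact ⟨.inr this.1, this.2⟩
      exact ⟨.inr ⟨j, key.1⟩, h2 key.2⟩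
    · exact ⟨.inl rfl, subj hl⟩
  | par P Q ih1 ih2 =>
    rintro Γ o ⟨o₁, o₂, rfl, _, h1, h2⟩ x (hx | hx)
    · exact ⟨.inl (ih1 h1 x hx).1, (ih1 h1 x hx).2⟩
    · exact ⟨.inr (ih2 h2 x hx).1, (ih2 h2 x hx).2⟩
  | res P ih =>
    rintro Γ o ⟨T, U, _, _, _, h⟩ x hx
    exact ih h (x + 2) (mem_liftO_succ.2 (mem_liftO_succ.2 hx))
  | ite v P Q ih1 ih2 =>
    rintro Γ o ⟨hv, h1, h2⟩ x hx
    exact ⟨.inl (.inr (ih1 h1 x hx).1), (ih1 h1 x hx).2⟩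
  | inact =>
    rintro Γ _ rfl x hx
    exact hx.elim

/-! ## Substitution -/

/-- The substitution `σ` replaces the free names in `s` and the owned names `o` of a process typed in
`Γ` in accordance with the context `Γ'`. -/
structure SubstOK (σ : ℕ → Val) (s : Set ℕ) (Γ : Ctx) (o : Set ℕ) (Γ' : Ctx) : Prop where
  un : ∀ x ∈ s, ∀ T, Γ x = some T → ¬ T.Lin → VT Γ' (σ x) T ∅
  lin : ∀ x ∈ o, ∃ T x' T', Γ x = some T ∧ T.Lin ∧ σ x = .var x' ∧ Γ' x' = some T' ∧ WSub T' T
  inj : ∀ x ∈ o, ∀ y ∈ o, ∀ z, σ x = .var z → σ y = .var z → x = y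

/-- The names that replace owned names. -/
def imgO (σ : ℕ → Val) (o : Set ℕ) : Set ℕ := {z | ∃ x ∈ o, σ x = .var z}

theorem imgO_union (σ : ℕ → Val) (o₁ o₂ : Set ℕ) : imgO σ (o₁ ∪ o₂) = imgO σ o₁ ∪ imgO σ o₂ := by
  ext z
  simp [imgO, or_and_right, exists_or]

theorem SubstOK.mono {σ s Γ o Γ' s' o'} (h : SubstOK σ s Γ o Γ') (hs : s' ⊆ s) (ho : o' ⊆ o) :
    SubstOK σ s' Γ o' Γ' :=
  ⟨fun x hx => h.un x (hs hx), fun x hx => h.lin x (ho hx),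
    fun x hx y hy => h.inj x (ho hx) y (ho hy)⟩

theorem SubstOK.disjoint {σ s Γ o Γ' o₁ o₂} (h : SubstOK σ s Γ o Γ') (h1 : o₁ ⊆ o) (h2 : o₂ ⊆ o)
    (hd : Disjoint o₁ o₂) : Disjoint (imgO σ o₁) (imgO σ o₂) := by
  rw [Set.disjoint_left]
  rintro z ⟨x, hx, hxz⟩ ⟨y, hy, hyz⟩
  obtain rfl := h.inj x (h1 hx) y (h2 hy) z hxz hyz
  exact Set.disjoint_left.1 hd hx hy

theorem imgO_up (σ : ℕ → Val) (T : Ty) (o : Set ℕ) :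
    imgO (up σ) (liftO T o) = liftO T (imgO σ o) := by
  ext z
  constructor
  · rintro ⟨x, hx, hz⟩
    cases x with
    | zero =>
      cases hz
      exact mem_liftO_zero.2 (mem_liftO_zero.1 hx)
    | succ x =>
      rw [up_succ, Val.rename_eq_var] at hz
      obtain ⟨w, hw, rfl⟩ := hz
      exact mem_liftO_succ.2 ⟨x, mem_liftO_succ.1 hx, hw⟩
  · intro hz
    cases z with
    | zero => exact ⟨0, mem_liftO_zero.2 (mem_liftO_zero.1 hz), rfl⟩
    | succ z =>
      obtain ⟨x, hx, hz⟩ := mem_liftO_succ.1 hz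
      exact ⟨x + 1, mem_liftO_succ.2 hx, by rw [up_succ, hz]; rfl⟩

theorem VT.rename_succ {Γ : Ctx} {v T} (h : VT Γ v T ∅) (S : Ty) :
    VT (Γ.cons S) (v.rename (· + 1)) T ∅ := by
  cases v with
  | var x =>
    obtain ⟨T', hT', hs, e⟩ := h
    refine ⟨T', hT', hs, ?_⟩
    ext y
    constructor
    · grind
    · aesop
  | _ => exact h

theorem SubstOK.up {σ s Γ o Γ'} (h : SubstOK σ s Γ o Γ') {s' : Set ℕ} (hs : ∀ x, x + 1 ∈ s' → x ∈ s)
    {T : Ty} (hT : T.WF) : SubstOK (up σ) s' (Γ.cons T) (liftO T o) (Γ'.cons T) := by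
  refine ⟨?_, ?_, ?_⟩
  · intro x hx S hS hl
    cases x with
    | zero =>
      cases hS
      refine ⟨T, rfl, hT.wsub_refl, ?_⟩
      ext y
      exact ⟨fun h => h.elim, fun h => (hl h.2).elim⟩
    | succ x => exact (h.un x (hs x hx) S hS hl).rename_succ T
  · intro x hx
    cases x with
    | zero => exact ⟨T, 0, T, rfl, mem_liftO_zero.1 hx, rfl, rfl, hT.wsub_refl⟩
    | succ x =>
      obtain ⟨S, x', S', h1, h2, h3, h4, h5⟩ := h.lin x (mem_liftO_succ.1 hx)
      exact ⟨S, x' + 1, S', h1, h2, by rw [up_succ, h3]; rfl, h4, h5⟩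
  · intro x hx y hy z hxz hyz
    cases x with
    | zero =>
      cases y with
      | zero => rfl
      | succ y =>
        cases hxz
        rw [up_succ, Val.rename_eq_var] at hyz
        obtain ⟨_, _, h⟩ := hyz
        cases h
    | succ x =>
      rw [up_succ, Val.rename_eq_var] at hxz
      obtain ⟨w, hw, rfl⟩ := hxz
      cases y with
      | zero => cases hyz
      | succ y =>
        rw [up_succ, Val.rename_eq_var] at hyz
        obtain ⟨w', hw', e⟩ := hyz
        obtain rfl : w' = w := by grind
        rw [h.inj x (mem_liftO_succ.1 hx) y (mem_liftO_succ.1 hy) w' hw hw']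

theorem VT.subst {σ s Γ o Γ' v T o'} (hv : VT Γ v T o') (h : SubstOK σ s Γ o Γ') (hs : v.fv ⊆ s)
    (ho : o' ⊆ o) : VT Γ' (v.subst σ) T (imgO σ o') := by
  cases v with
  | var x =>
    obtain ⟨S, hS, hsub, rfl⟩ := hv
    by_cases hl : S.Lin
    · obtain ⟨S', x', T', h1, h2, h3, h4, h5⟩ := h.lin x (ho ⟨rfl, hl⟩)
      rw [hS] at h1
      cases h1
      rw [Val.subst_var, h3]
      refine ⟨T', h4, h5.trans hsub, ?_⟩
      ext y
      constructor
      · rintro ⟨_, ⟨rfl, _⟩, hy⟩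
        rw [h3] at hy
        cases hy
        exact ⟨rfl, h5.lin_iff.2 hl⟩
      · rintro ⟨rfl, _⟩
        exact ⟨x, ⟨rfl, hl⟩, h3⟩
    · have e : imgO σ {y | y = x ∧ S.Lin} = ∅ := by
        ext y
        exact ⟨fun ⟨_, h, _⟩ => (hl h.2).elim, fun h => h.elim⟩
      rw [e, Val.subst_var]
      have := h.un x (hs rfl) S hS hl
      revert this
      cases σ x with
      | var z => exact fun ⟨S', h1, h2, h3⟩ => ⟨S', h1, h2.trans hsub, h3⟩
      | _ => exact fun ⟨h1, h2⟩ => ⟨h1.trans hsub, h2⟩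
  | _ =>
    obtain ⟨h1, rfl⟩ := hv
    exact ⟨h1, by ext; simp [imgO]⟩

theorem SubstOK.cont {σ s Γ o Γ' x x' S S' U q} (h : SubstOK σ s Γ (o ∪ subjO q x) Γ')
    (ho : Disjoint o (subjO q x)) (hx : Γ x = some S) (hS : S.Lin ↔ q = .lin) (hσ : σ x = .var x')
    (hx' : Γ' x' = some S') (hS' : WSub S' S) (hU : U.WF) :
    SubstOK σ s (contC q Γ x U) (contO q o x U) (contC q Γ' x' U) ∧
      imgO σ (contO q o x U) = contO q (imgO σ o) x' U := by
  cases q with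
  | un => exact ⟨h.mono le_rfl subset_union_left, rfl⟩
  | lin =>
    have hl := hS.2 rfl
    have hxo : x ∉ o := fun hx => Set.disjoint_left.1 ho hx ⟨rfl, rfl⟩
    have inj := h.inj
    have hlin := h.lin
    refine ⟨⟨?_, ?_, ?_⟩, ?_⟩
    · intro z hz T hT hTl
      by_cases e : z = x
      · subst e
        rw [contC, update_self] at hT
        cases hT
        rw [hσ]
        refine ⟨U, by rw [contC, update_self], hU.wsub_refl, ?_⟩
        ext y
        exact ⟨fun h => h.elim, fun h => (hTl h.2).elim⟩
      · rw [contC, update_of_ne e] at hT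
        have := h.un z hz T hT hTl
        revert this
        cases σ z with
        | var w =>
          rintro ⟨T', h1, h2, h3⟩
          have : w ≠ x' := by
            rintro rfl
            rw [hx'] at h1
            cases h1
            exact hTl (h2.lin_iff.1 (hS'.lin_iff.2 hl))
          exact ⟨T', by rw [contC, update_of_ne this, h1], h2, h3⟩
        | _ => exact id
    · rintro z (hz | ⟨rfl, hUl⟩)
      · have hzx : z ≠ x := fun e => hxo (e ▸ hz)
        obtain ⟨T, z', T', h1, h2, h3, h4, h5⟩ := hlin z (.inl hz)
        have : z' ≠ x' := by
          rintro rfl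
          exact hzx (inj z (.inl hz) x (.inr ⟨rfl, rfl⟩) z' h3 hσ)
        exact ⟨T, z', T', by rw [contC, update_of_ne hzx, h1], h2, h3,
          by rw [contC, update_of_ne this, h4], h5⟩
      · exact ⟨U, x', U, by rw [contC, update_self], hUl, hσ,
          by rw [contC, update_self], hU.wsub_refl⟩
    · have : contO .lin o x U ⊆ o ∪ subjO .lin x :=
        Set.union_subset_union_right _ fun y hy => ⟨hy.1, rfl⟩
      exact fun a ha b hb => inj a (this ha) b (this hb)
    · rw [contO, contO, imgO_union]
      congr 1
      ext y
      constructor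
      · rintro ⟨_, ⟨rfl, hUl⟩, hy⟩
        rw [hσ] at hy
        cases hy
        exact ⟨rfl, hUl⟩
      · rintro ⟨rfl, hUl⟩
        exact ⟨x, ⟨rfl, hUl⟩, hσ⟩

theorem BranchWT.subst {a : Act} {P : Ann} {T σ s Γ o Γ'}
    (ih : ∀ {σ Γ o Γ'}, WT P Γ o → CWF Γ → SubstOK σ P.FV Γ o Γ' → WT (P.subst σ) Γ' (imgO σ o))
    (h : BranchWT a T (WT P) Γ o) (hΓ : CWF Γ) (hT : T.WF) (hσ : SubstOK σ s Γ o Γ')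
    (hs : ∀ x, x ∈ a.fv ∨ a.lift x ∈ P.FV → x ∈ s) :
    BranchWT (a.subst σ) T (WT (P.subst (a.under σ))) Γ' (imgO σ o) := by
  cases a with
  | send v =>
    obtain ⟨o₁, o₂, rfl, hd, hv, hP⟩ := h
    exact ⟨_, _, imgO_union _ _ _,
      hσ.disjoint subset_union_left subset_union_right hd,
      hv.subst hσ (fun x hx => hs x (.inl hx)) subset_union_left,
      ih hP hΓ (hσ.mono (fun x hx => hs x (.inr hx)) subset_union_right)⟩
  | recv =>
    have := ih (σ := up σ) h (hΓ.cons hT) (hσ.up (fun x hx => hs x (.inr hx)) hT)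
    rw [imgO_up] at this
    exact this

theorem WT.subst (A : Ann) : ∀ {σ Γ o Γ'}, WT A Γ o → CWF Γ → SubstOK σ A.FV Γ o Γ' →
    WT (A.subst σ) Γ' (imgO σ o) := by
  induction A with
  | choice q₁ q₂ vw y n lab act P ih =>
    rintro σ Γ _ Γ' @⟨x, S, m, lab', pol', T, U, k, o, hx, hC, hS, hk, hlab, hpol, hq, ho, h⟩ hΓ hσ
    have hSl : S.Lin ↔ q₂ = .lin := hS.lin_iff.trans Ty.lin_choice_iff
    obtain ⟨x', S', hx', hΓ', hSS⟩ : ∃ x' S', σ x = .var x' ∧ Γ' x' = some S' ∧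
        WSub S' S := by
      by_cases hl : S.Lin
      · obtain ⟨T, x', T', h1, h2, h3, h4, h5⟩ := hσ.lin x (.inr ⟨rfl, hSl.1 hl⟩)
        rw [hx] at h1
        cases h1
        exact ⟨x', T', h3, h4, h5⟩
      · have := hσ.un x (.inl rfl) S hx hl
        revert this
        cases σ x with
        | var z => exact fun ⟨S', h1, h2, _⟩ => ⟨z, S', rfl, h1, h2⟩
        | _ =>
          rintro ⟨h1, _⟩
          obtain ⟨_, _, _, _, _, h, _⟩ := (h1.trans hS).choice_inv
          cases h
    have hcont := fun j => hσ.cont ho hx hSl hx' hΓ' hSS (hC.2.2.2 (k j))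
    have e : imgO σ (o ∪ subjO q₂ x) = imgO σ o ∪ subjO q₂ x' := by
      rw [imgO_union]
      congr 1
      ext z
      constructor
      · rintro ⟨_, ⟨rfl, hl⟩, hz⟩
        rw [hx'] at hz
        cases hz
        exact ⟨rfl, hl⟩
      · rintro ⟨rfl, hl⟩
        exact ⟨x, ⟨rfl, hl⟩, hx'⟩
    rw [e, Ann.subst, Val.subst_var, hx']
    refine .mk hΓ' hC (hSS.trans hS) hk hlab (by simpa using hpol) (fun h => ?_) ?_ fun j => ?_
    · obtain ⟨rfl, h'⟩ := hq h
      exact ⟨by ext; simp [imgO], h'⟩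
    · have := hσ.disjoint subset_union_left subset_union_right ho
      rw [Set.disjoint_left]
      rintro z hz ⟨rfl, hl⟩
      exact Set.disjoint_left.1 this hz ⟨x, ⟨rfl, hl⟩, hx'⟩
    · rw [← (hcont j).2]
      exact (h j).subst (ih j) (hΓ.contC (hC.2.2.2 _) _ _) (hC.2.2.1 _) (hcont j).1
        fun x hx => .inr ⟨j, hx⟩
  | par P Q ih1 ih2 =>
    rintro σ Γ _ Γ' ⟨o₁, o₂, rfl, hd, h1, h2⟩ hΓ hσ
    exact ⟨_, _, imgO_union _ _ _,
      hσ.disjoint subset_union_left subset_union_right hd,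
      ih1 h1 hΓ (hσ.mono subset_union_left subset_union_left),
      ih2 h2 hΓ (hσ.mono subset_union_right subset_union_right)⟩
  | res P ih =>
    rintro σ Γ o Γ' ⟨T, U, hT, hU, hd, h⟩ hΓ hσ
    refine ⟨T, U, hT, hU, hd, ?_⟩
    have := ih h ((hΓ.cons hU).cons hT)
      ((hσ.up (s' := {x | x + 1 ∈ P.FV}) (fun x hx => hx) hU).up (fun x hx => hx) hT)
    rwa [imgO_up, imgO_up] at this
  | ite v P Q ih1 ih2 =>
    rintro σ Γ o Γ' ⟨hv, h1, h2⟩ hΓ hσ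
    have := hv.subst hσ (fun x hx => .inl (.inl hx)) (Set.empty_subset _)
    have e : imgO σ ∅ = ∅ := by ext; simp [imgO]
    rw [e] at this
    exact ⟨this, ih1 h1 hΓ (hσ.mono (fun x hx => .inl (.inr hx)) le_rfl),
      ih2 h2 hΓ (hσ.mono (fun x hx => .inr hx) le_rfl)⟩
  | inact =>
    rintro σ Γ _ Γ' rfl _ _
    exact show imgO σ ∅ = ∅ by ext; simp [imgO]

theorem WT.subst_eq {A : Ann} {σ Γ o Γ' o'} (h : WT A Γ o) (hΓ : CWF Γ)
    (hσ : SubstOK σ A.FV Γ o Γ') (e : imgO σ o = o') : WT (A.subst σ) Γ' o' :=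
  e ▸ WT.subst A h hΓ hσ

theorem imgO_var (o : Set ℕ) : imgO .var o = o := by
  ext z
  simp [imgO]

theorem WT.weaken {A : Ann} {Γ o Γ'} (h : WT A Γ o) (hΓ : CWF Γ)
    (hσ : SubstOK .var A.FV Γ o Γ') : WT A Γ' o := by
  have := h.subst_eq hΓ hσ (imgO_var o)
  rwa [Ann.subst_id] at this

theorem SubstOK.var {s : Set ℕ} {Γ Γ' : Ctx} {o : Set ℕ}
    (hs : ∀ x ∈ s, ∀ T, Γ x = some T → ¬ T.Lin → ∃ T', Γ' x = some T' ∧ WSub T' T)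
    (ho : ∀ x ∈ o, ∃ T T', Γ x = some T ∧ T.Lin ∧ Γ' x = some T' ∧ WSub T' T) :
    SubstOK .var s Γ o Γ' := by
  refine ⟨?_, ?_, ?_⟩
  · intro x hx T hT hl
    obtain ⟨T', h1, h2⟩ := hs x hx T hT hl
    refine ⟨T', h1, h2, ?_⟩
    ext y
    exact ⟨fun h => h.elim, fun h => (hl (h2.lin_iff.1 h.2)).elim⟩
  · grind
  · grind

/-! ## From typing derivations to the typing relation -/

theorem linNames_eq_empty {Γ : Ctx} (h : Γ.Un) : linNames Γ = ∅ := by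
  ext x
  exact ⟨fun ⟨T, hT, hl⟩ => (h x T hT).not_lin hl, fun h => h.elim⟩

theorem linNames_cons (Γ : Ctx) (T : Ty) : linNames (Γ.cons T) = liftO T (linNames Γ) := by
  ext x
  cases x with
  | zero => exact ⟨fun ⟨S, hS, hl⟩ => by cases hS; exact mem_liftO_zero.2 hl,
      fun h => ⟨T, rfl, mem_liftO_zero.1 h⟩⟩
  | succ x => exact (mem_liftO_succ (T := T) (o := linNames Γ)).symm

theorem SplitAt.left_eq {a b c : Option Ty} (h : Ctx.SplitAt a b c) {T} (hb : b = some T) :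
    a = some T := by
  cases h <;> simp_all

theorem SplitAt.right_eq {a b c : Option Ty} (h : Ctx.SplitAt a b c) {T} (hb : c = some T) :
    a = some T := by
  cases h <;> simp_all

theorem Split.linNames {Γ Γ₁ Γ₂ : Ctx} (h : Γ.Split Γ₁ Γ₂) :
    linNames Γ = Mix.linNames Γ₁ ∪ Mix.linNames Γ₂ ∧ Disjoint (Mix.linNames Γ₁) (Mix.linNames Γ₂) := by
  constructor
  · ext x
    constructor
    · rintro ⟨T, hT, hl⟩
      have := h x
      rw [hT] at this
      generalize ha : Γ₁ x = a at this
      generalize hb : Γ₂ x = b at this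
      cases this with
      | un => exact .inl ⟨T, ha, hl⟩
      | left => exact .inl ⟨_, ha, hl⟩
      | right => exact .inr ⟨_, hb, hl⟩
    · rintro (⟨T, hT, hl⟩ | ⟨T, hT, hl⟩)
      · exact ⟨T, SplitAt.left_eq (h x) hT, hl⟩
      · exact ⟨T, SplitAt.right_eq (h x) hT, hl⟩
  · rw [Set.disjoint_left]
    rintro x ⟨T, hT, hl⟩ ⟨S, hS, _⟩
    have := h x
    rw [hT, hS] at this
    generalize Γ x = a at this
    cases this with
    | un hu => exact hu.not_lin hl

theorem ValTyping.vt {Γ : Ctx} {v T} (h : ValTyping Γ v T) : ∀ {Γ' : Ctx}, CWF Γ' →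
    (∀ x T, Γ x = some T → Γ' x = some T) → VT Γ' v T (linNames Γ) ∧ T.WF := by
  induction h with
  | unit h => exact fun _ _ => ⟨⟨Ty.WF.wsub_refl trivial, linNames_eq_empty h⟩, trivial⟩
  | tt h => exact fun _ _ => ⟨⟨Ty.WF.wsub_refl trivial, linNames_eq_empty h⟩, trivial⟩
  | ff h => exact fun _ _ => ⟨⟨Ty.WF.wsub_refl trivial, linNames_eq_empty h⟩, trivial⟩
  | @var x T hx hu =>
    intro Γ' hΓ hle
    have hT := hΓ x T (hle x T hx)
    refine ⟨⟨T, hle x T hx, hT.wsub_refl, ?_⟩, hT⟩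
    ext y
    constructor
    · rintro ⟨S, hS, hl⟩
      by_cases e : y = x
      · grind
      · exact ((hu y S e hS).not_lin hl).elim
    · rintro ⟨rfl, hl⟩
      exact ⟨T, hx, hl⟩
  | @sub v T U _ hs hU ih =>
    intro Γ' hΓ hle
    obtain ⟨h, hT⟩ := ih hΓ hle
    have hs := hs.wsub hT hU
    refine ⟨?_, hU⟩
    cases v with
    | var x =>
      obtain ⟨S, h1, h2, h3⟩ := h
      exact ⟨S, h1, h2.trans hs, h3⟩
    | _ => exact ⟨h.1.trans hs, h.2⟩

theorem Typing.wt {Γ : Ctx} {P : Proc} (D : Typing Γ P) : ∀ {Γ' : Ctx}, CWF Γ' →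
    (∀ x T, Γ x = some T → Γ' x = some T) → WT D.ann Γ' (linNames Γ) := by
  induction D with
  | inact h => exact fun _ _ => linNames_eq_empty h
  | par hs D₁ D₂ ih1 ih2 =>
    intro Γ' hΓ hle
    obtain ⟨h1, h2⟩ := Split.linNames hs
    exact ⟨_, _, h1, h2, ih1 hΓ fun x T h => hle x T (SplitAt.left_eq (hs x) h),
      ih2 hΓ fun x T h => hle x T (SplitAt.right_eq (hs x) h)⟩
  | @ite Γ Γ₁ Γ₂ v P Q hs hv D₁ D₂ ih1 ih2 =>
    intro Γ' hΓ hle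
    obtain ⟨h1, h2⟩ := Split.linNames hs
    obtain ⟨hv, _⟩ := hv.vt hΓ fun x T h => hle x T (SplitAt.left_eq (hs x) h)
    have e : linNames Γ₁ = ∅ := by
      cases v with
      | var x =>
        obtain ⟨S, _, h2, h3⟩ := hv
        rw [h3]
        ext y
        exact ⟨fun h => h2.not_lin_of_bool h.2, fun h => h.elim⟩
      | _ => exact hv.2
    rw [e] at hv
    rw [h1, e, Set.empty_union]
    exact ⟨hv, ih1 hΓ fun x T h => hle x T (SplitAt.right_eq (hs x) h),
      ih2 hΓ fun x T h => hle x T (SplitAt.right_eq (hs x) h)⟩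
  | @res Γ P T U hT hU hd D ih =>
    intro Γ' hΓ hle
    refine ⟨T, U, hT, hU, hd.wdual hT hU, ?_⟩
    rw [← linNames_cons, ← linNames_cons]
    refine ih ((hΓ.cons hU).cons hT) fun x S h => ?_
    match x, h with
    | 0, h => exact h
    | 1, h => exact h
    | x + 2, h => exact hle x S h
  | @choice Γ Γ₁ Γ₂ q₁ x n lab act P q₂ v m lab' pol' T U k Δ Θ hs hq hx hk hlab hpol hadd hbr D ih =>
    intro Γ' hΓ hle
    obtain ⟨h1, h2⟩ := Split.linNames hs
    have hle1 : ∀ x T, Γ₁ x = some T → Γ' x = some T := fun x T h =>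
      hle x T (SplitAt.left_eq (hs x) h)
    have hle2 : ∀ x T, Γ₂ x = some T → Γ' x = some T := fun x T h =>
      hle x T (SplitAt.right_eq (hs x) h)
    obtain ⟨⟨S, hxS, hS, e⟩, hC⟩ := hx.vt hΓ hle1
    have hSl : S.Lin ↔ q₂ = .lin := hS.lin_iff.trans Ty.lin_choice_iff
    have e' : linNames Γ₁ = subjO q₂ x := by
      rw [e]
      ext y
      simp only [subjO, hSl]
    rw [h1, e', Set.union_comm]
    have hxx : ∃ S', Γ₁ x = some S' := by
      clear * - hx
      generalize hv : Val.var x = w at hx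
      generalize Ty.choice q₂ v m lab' pol' T U = C at hx
      induction hx with
      | var h => cases hv; exact ⟨_, h⟩
      | sub _ _ _ ih => exact ih hv
      | _ => cases hv
    obtain ⟨S', hS'⟩ := hxx
    obtain rfl : S = S' := by
      have := hle1 x S' hS'
      rw [hxS] at this
      exact Option.some.inj this
    refine .mk hxS hC hS hk hlab hpol ?_ ?_ fun j => ?_
    · rintro rfl
      constructor
      · ext y
        exact ⟨fun ⟨T, hT, hl⟩ => (hq rfl y T (SplitAt.right_eq (hs y) hT)).not_lin hl, fun h => h.elim⟩
      · have := hq rfl x S (SplitAt.left_eq (hs x) hS')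
        cases q₂ with
        | lin => exact (this.not_lin (hSl.2 rfl)).elim
        | un => rfl
    · rw [← e']
      exact h2.symm
    · obtain ⟨hn, hΔ⟩ := hadd j
      have hU := hC.2.2.2 (k j)
      have key : (∀ y T, Δ j y = some T → contC q₂ Γ' x (U (k j)) y = some T) ∧
          linNames (Δ j) = contO q₂ (linNames Γ₂) x (U (k j)) := by
        cases q₂ with
        | lin =>
          have hl := hSl.2 rfl
          have hn' : Γ₂ x = none := by
            have := hs x
            rw [hS'] at this
            generalize hb : Γ x = b at this
            generalize hc : Γ₂ x = c at this
            cases this with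
            | un hu => exact (hu.not_lin hl).elim
            | left => rfl
          rw [hΔ]
          constructor
          · intro y T hT
            by_cases e : y = x
            · subst e
              rwa [contC, update_self] at *
            · rw [update_of_ne e] at hT
              rw [contC, update_of_ne e]
              exact hle2 y T hT
          · ext y
            by_cases e : y = x
            · subst e
              simp [linNames, contO, hn']
            · simp [linNames, contO, e, update_of_ne]
        | un =>
          have hl : ¬ S.Lin := fun h => by cases hSl.1 h
          have hn' : Γ₂ x = some S := by
            have := hs x
            rw [hS'] at this
            generalize hb : Γ x = b at this
            generalize hc : Γ₂ x = c at this
            cases this with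
            | un hu => rfl
            | left => exact (hl ⟨_, _, _, _, _, _, .choice ..⟩).elim
          have hU : U (k j) = S := by
            rcases hn with h | h
            · rw [hn'] at h
              cases h
            · have := h.1
              rw [hn'] at this
              exact (Option.some.inj this).symm
          have : Δ j = Γ₂ := by rw [hΔ, hU, ← hn', Function.update_eq_self]
          rw [this]
          exact ⟨hle2, rfl⟩
      have hb := hbr j
      have ihj := @ih j
      have hT := hC.2.2.1 (k j)
      rw [← key.2]
      have hΓ' := hΓ.contC hU q₂ x
      change BranchWT (act j) (T (k j)) (WT (D j).ann) _ _
      revert hb ihj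
      generalize act j = a
      generalize D j = D
      intro hb ihj
      generalize Δ j = Δ at *
      generalize Θ j = Θ at *
      generalize T (k j) = T at *
      cases hb with
      | send hs' hv =>
        obtain ⟨g1, g2⟩ := Split.linNames hs'
        exact ⟨_, _, g1, g2, (hv.vt hΓ' fun x T h => key.1 x T (SplitAt.left_eq (hs' x) h)).1,
          ihj hΓ' fun x T h => key.1 x T (SplitAt.right_eq (hs' x) h)⟩
      | recv =>
        have := ihj (Γ' := (contC q₂ Γ' x (U (k j))).cons T) (hΓ'.cons hT) fun x S h => by
          cases x with
          | zero => exact h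
          | succ x => exact key.1 x S h
        rw [linNames_cons] at this
        exact this

/-! ## From the typing relation to typing derivations -/

open Classical in
/-- The context of the owned names and of the names without linear choice types, with uniform
types. -/
noncomputable def realCtx (Γ : Ctx) (o : Set ℕ) : Ctx := fun x =>
  (Γ x).bind fun T => if T.Lin → x ∈ o then some T.real else none

theorem realCtx_eq {Γ : Ctx} {o x T} : realCtx Γ o x = some T ↔
    ∃ S, Γ x = some S ∧ (S.Lin → x ∈ o) ∧ S.real = T := by
  classical
  rw [realCtx, Option.bind_eq_some_iff]
  constructor
  · grind
  · grind

theorem realCtx_none {Γ : Ctx} {o x} : realCtx Γ o x = none ↔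
    ∀ S, Γ x = some S → S.Lin ∧ x ∉ o := by
  rw [Option.eq_none_iff_forall_not_mem]
  simp only [Option.mem_def, realCtx_eq, not_exists, not_and]
  constructor
  · grind
  · grind

theorem realCtx_un {Γ : Ctx} (hΓ : CWF Γ) {o : Set ℕ}
    (h : ∀ x T, Γ x = some T → T.Lin → x ∉ o) : (realCtx Γ o).Un := by
  intro x T hx
  obtain ⟨S, hS, ho, rfl⟩ := realCtx_eq.1 hx
  exact (hΓ x S hS).real_un fun hl => h x S hS hl (ho hl)

theorem realCtx_split {Γ : Ctx} (hΓ : CWF Γ) {o₁ o₂ : Set ℕ} (hd : Disjoint o₁ o₂) :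
    (realCtx Γ (o₁ ∪ o₂)).Split (realCtx Γ o₁) (realCtx Γ o₂) := by
  intro x
  cases hx : Γ x with
  | none =>
    have : ∀ o, realCtx Γ o x = none := fun o => realCtx_none.2 fun S hS => by
      grind
    rw [this, this, this]
    exact .none
  | some S =>
    by_cases hl : S.Lin
    · obtain ⟨v, n, lab, pol, A, V, hh⟩ := id hl
      have hr : S.real = .choice .lin v n lab pol (fun i => (A i).uni) fun i => (V i).uni := by
        rw [Ty.real, hh.hd_eq]
        rfl
      have hin : ∀ o, x ∈ o → realCtx Γ o x = some S.real := fun o h =>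
        realCtx_eq.2 ⟨S, hx, fun _ => h, rfl⟩
      have hnot : ∀ o, x ∉ o → realCtx Γ o x = none := fun o h =>
        realCtx_none.2 fun S' hS' => by
          grind
      by_cases h1 : x ∈ o₁
      · have h2 := Set.disjoint_left.1 hd h1
        rw [hin _ (.inl h1), hin _ h1, hnot _ h2, hr]
        exact .left
      · by_cases h2 : x ∈ o₂
        · rw [hin _ (.inr h2), hin _ h2, hnot _ h1, hr]
          exact .right
        · rw [hnot _ h1, hnot _ h2, hnot _ (fun h => h.elim h1 h2)]
          exact .none
    · have : ∀ o, realCtx Γ o x = some S.real := fun o =>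
        realCtx_eq.2 ⟨S, hx, fun h => (hl h).elim, rfl⟩
      rw [this, this, this]
      exact .un ((hΓ x S hx).real_un hl)

theorem realCtx_cons (Γ : Ctx) (o : Set ℕ) (T : Ty) :
    realCtx (Γ.cons T) (liftO T o) = (realCtx Γ o).cons T.real := by
  funext x
  cases x with
  | zero => exact realCtx_eq.2 ⟨T, rfl, mem_liftO_zero.2, rfl⟩
  | succ x =>
    ext S
    exact realCtx_eq.trans (Iff.trans (by simp only [mem_liftO_succ, Ctx.cons]) realCtx_eq.symm)

theorem VT.typing {Γ : Ctx} (hΓ : CWF Γ) {v T o} (h : VT Γ v T o) (hT : T.WF) :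
    ValTyping (realCtx Γ o) v T.real := by
  cases v with
  | var x =>
    obtain ⟨S, hS, hs, rfl⟩ := h
    refine .sub (.var (realCtx_eq.2 ⟨S, hS, fun hl => ⟨rfl, hl⟩, rfl⟩) fun y T hy hT => ?_)
      (hs.real (hΓ x S hS) hT) hT.real
    obtain ⟨T', h1, h2, rfl⟩ := realCtx_eq.1 hT
    exact (hΓ y T' h1).real_un fun hl => hy (h2 hl).1
  | unit =>
    obtain ⟨hs, rfl⟩ := h
    have : Ty.real .unit = .unit := by rw [Ty.real, Ty.Head.unit.hd_eq]; rfl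
    have h := hs.real trivial hT
    rw [this] at h
    exact .sub (.unit (realCtx_un hΓ fun _ _ _ _ h => h)) h hT.real
  | tt =>
    obtain ⟨hs, rfl⟩ := h
    have : Ty.real .bool = .bool := by rw [Ty.real, Ty.Head.bool.hd_eq]; rfl
    have h := hs.real trivial hT
    rw [this] at h
    exact .sub (.tt (realCtx_un hΓ fun _ _ _ _ h => h)) h hT.real
  | ff =>
    obtain ⟨hs, rfl⟩ := h
    have : Ty.real .bool = .bool := by rw [Ty.real, Ty.Head.bool.hd_eq]; rfl
    have h := hs.real trivial hT
    rw [this] at h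
    exact .sub (.ff (realCtx_un hΓ fun _ _ _ _ h => h)) h hT.real

theorem WT.typing (A : Ann) : ∀ {Γ o}, CWF Γ → WT A Γ o →
    ∃ D : Typing (realCtx Γ o) A.erase, D.encode = A.enc := by
  induction A with
  | inact =>
    rintro Γ _ hΓ rfl
    exact ⟨.inact (realCtx_un hΓ fun _ _ _ _ h => h), rfl⟩
  | par P Q ih1 ih2 =>
    rintro Γ _ hΓ ⟨o₁, o₂, rfl, hd, h1, h2⟩
    obtain ⟨D₁, e₁⟩ := ih1 hΓ h1
    obtain ⟨D₂, e₂⟩ := ih2 hΓ h2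
    exact ⟨.par (realCtx_split hΓ hd) D₁ D₂, by
      change CMV.Proc.par _ _ = CMV.Proc.par _ _; rw [e₁, e₂]⟩
  | ite v P Q ih1 ih2 =>
    rintro Γ o hΓ ⟨hv, h1, h2⟩
    obtain ⟨D₁, e₁⟩ := ih1 hΓ h1
    obtain ⟨D₂, e₂⟩ := ih2 hΓ h2
    have hs := realCtx_split (o₂ := o) hΓ (Set.empty_disjoint o)
    rw [Set.empty_union] at hs
    have hv := hv.typing hΓ trivial
    have : Ty.real .bool = .bool := by rw [Ty.real, Ty.Head.bool.hd_eq]; rfl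
    rw [this] at hv
    exact ⟨.ite hs hv D₁ D₂, by change CMV.Proc.ite _ _ _ = CMV.Proc.ite _ _ _; rw [e₁, e₂]⟩
  | res P ih =>
    rintro Γ o hΓ ⟨T, U, hT, hU, hd, h⟩
    obtain ⟨D, e⟩ := ih ((hΓ.cons hU).cons hT) h
    have h1 := realCtx_cons (Γ.cons U) (liftO U o) T
    have h2 := realCtx_cons Γ o U
    revert D
    rw [h1, h2]
    intro D e
    exact ⟨.res hT.real hU.real (hd.real hT hU) D, by
      change CMV.Proc.res _ = CMV.Proc.res _; rw [e]⟩
  | choice q₁ q₂ vw y n lab act P ih =>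
    rintro Γ _ hΓ @⟨x, S, m, lab', pol', T, U, k, o, hx, hC, hS, hk, hlab, hpol, hq, ho, h⟩
    have hSl : S.Lin ↔ q₂ = .lin := hS.lin_iff.trans Ty.lin_choice_iff
    have hSw := hΓ x S hx
    let W : Fin m → Ty := fun i => match q₂ with | .lin => (U i).real | .un => S.real
    have hW : ∀ i, (W i).WF := by
      intro i
      cases q₂
      · exact Ty.WF.real (hC.2.2.2 i)
      · exact hSw.real
    have hsub : Ty.Sub S.real (.choice q₂ vw m lab' pol' (fun i => (T i).real) W) :=
      hS.real_choice hSw hC (by rintro rfl i; rfl) (by rintro rfl i; rfl)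
    have hΓ' : ∀ j, CWF (contC q₂ Γ x (U (k j))) := fun j => hΓ.contC (hC.2.2.2 _) _ _
    have key : ∀ j, ∃ Θ, BranchTyping (realCtx (contC q₂ Γ x (U (k j))) (contO q₂ o x (U (k j))))
        (act j) (T (k j)).real Θ ∧ ∃ D : Typing Θ (P j).erase, D.encode = (P j).enc := by
      intro j
      have hj := h j
      have ihj := @ih j
      revert hj
      cases act j with
      | send v =>
        rintro ⟨o₁, o₂, e, hd, hv, hP⟩
        rw [e]
        exact ⟨_, .send (realCtx_split (hΓ' j) hd) (hv.typing (hΓ' j) (hC.2.2.1 _)), ihj (hΓ' j) hP⟩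
      | recv =>
        intro hP
        have := ihj ((hΓ' j).cons (hC.2.2.1 _)) hP
        rw [realCtx_cons] at this
        exact ⟨_, .recv, this⟩
    choose Θ hΘ D hD using key
    refine ⟨.choice q₂ vw (lab' := lab') (pol' := pol') (T := fun i => (T i).real) (U := W) k
      (Γ₁ := realCtx Γ (subjO q₂ x)) (Γ₂ := realCtx Γ o)
      (Δ := fun j => realCtx (contC q₂ Γ x (U (k j))) (contO q₂ o x (U (k j)))) ?_ ?_ ?_ hk hlab hpol
      ?_ hΘ D, ?_⟩
    · rw [Set.union_comm]
      exact realCtx_split hΓ ho.symm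
    · intro h1
      obtain ⟨rfl, rfl⟩ := hq h1
      refine realCtx_un hΓ fun _ _ _ _ h => ?_
      rcases h with h | h
      · exact h
      · cases h.2
    · refine .sub (.var (realCtx_eq.2 ⟨S, hx, fun hl => ⟨rfl, hSl.1 hl⟩, rfl⟩) fun y T hy hT => ?_)
        hsub ⟨hC.1, hC.2.1, fun i => Ty.WF.real (hC.2.2.1 i), hW⟩
      obtain ⟨T', h1, h2, rfl⟩ := realCtx_eq.1 hT
      exact (hΓ y T' h1).real_un fun hl => hy (h2 hl).1
    · intro j
      cases q₂ with
      | lin =>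
        have hl := hSl.2 rfl
        have hxo : x ∉ o := fun hx => Set.disjoint_left.1 ho hx ⟨rfl, rfl⟩
        refine ⟨.inl (realCtx_none.2 fun S' hS' => ?_), ?_⟩
        · rw [hx] at hS'
          cases hS'
          exact ⟨hl, hxo⟩
        · funext y
          by_cases e : y = x
          · subst e
            rw [update_self]
            exact realCtx_eq.2 ⟨U (k j), by rw [contC, update_self],
              fun hl => .inr ⟨rfl, hl⟩, rfl⟩
          · rw [update_of_ne e]
            ext S'
            exact realCtx_eq.trans (Iff.trans
              (by simp [contC, contO, e]) realCtx_eq.symm)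
      | un =>
        have hl : ¬ S.Lin := fun h => by cases hSl.1 h
        have hxx : realCtx Γ o x = some S.real := realCtx_eq.2 ⟨S, hx, fun h => (hl h).elim, rfl⟩
        refine ⟨.inr ⟨hxx, hSw.real_un hl⟩, ?_⟩
        change realCtx Γ o = update (realCtx Γ o) x (some S.real)
        rw [← hxx, Function.update_eq_self]
    · change Enc.choice lab act (fun j => (D j).encode) q₁ q₂ vw x = _
      rw [Ann.enc, Enc.choice_eq]
      simp only [hD]

open Calculus (Fresh Flat sys parM nuM parList nuList parM_cons finite_not_fresh finite_not_fresh_multiset sys_par nuM_zero sys_zero_singleton sys_nuM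
  nuM_cons sys_res sys_inact sys_flat sys_cons_cong)

/-! ## Reduction of annotated processes -/

namespace Ann

/-- Adds an unrestricted choice to its reduct. -/
def keepPar (q : Qual) (X Z : Ann) : Ann :=
  match q with
  | .lin => Z
  | .un => .par Z X

/-- Reduction of annotated processes. -/
inductive Step : Ann → Ann → Prop
  | ifT (P Q) : Step (.ite .tt P Q) P
  | ifF (P Q) : Step (.ite .ff P Q) Q
  | com {q q' q₂ q₂' vw vw' n m lab lab' act act'} {P : Fin n → Ann} {Q : Fin m → Ann} (R) {v}
      {i : Fin n} {j : Fin m} (hi : act i = .send v) (hj : act' j = .recv) (hl : lab i = lab' j) :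
      Step (.res (.par (.par (.choice q q₂ vw (.var 0) n lab act P)
          (.choice q' q₂' vw' (.var 1) m lab' act' Q)) R))
        (.res (.par (keepPar q' (.choice q' q₂' vw' (.var 1) m lab' act' Q)
          (keepPar q (.choice q q₂ vw (.var 0) n lab act P)
            (.par (P i) ((Q j).subst (inst v))))) R))
  | par {P P'} (Q) : Step P P' → Step (.par P Q) (.par P' Q)
  | res {P P'} : Step P P' → Step (.res P) (.res P')
  | struct {P Q Q' P'} : Cong P Q → Step Q Q' → Cong Q' P' → Step P P'

theorem Step.erase {P Q : Ann} (h : Step P Q) : Mix.Step P.erase Q.erase := by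
  induction h with
  | ifT => exact .ifT _ _
  | ifF => exact .ifF _ _
  | @com q q' _ _ _ _ _ _ _ _ _ _ _ _ _ _ _ _ hi hj hl =>
    cases q <;> cases q' <;> simp only [Ann.erase, keepPar, erase_subst]
    · exact .linLin hi hj hl
    · exact .linUn hi hj hl
    · exact .unLin hi hj hl
    · exact .unUn hi hj hl
  | par _ _ ih => exact .par _ ih
  | res _ ih => exact .res ih
  | struct h1 _ h2 ih => exact .struct h1.erase ih h2.erase

theorem subst_inst_comm (v : Val) (Q : Ann) (τ : ℕ → Val) :
    (Q.subst (inst v)).subst τ = (Q.subst (up τ)).subst (inst (v.subst τ)) := by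
  rw [subst_subst, subst_subst]
  congr 1
  funext x
  cases x with
  | zero => rfl
  | succ x =>
    simp only [inst_succ, Val.subst_var, up_succ, Val.rename, Val.subst_subst]
    exact (Val.subst_id _).symm

theorem keepPar_subst (q : Qual) (X Z : Ann) (σ : ℕ → Val) :
    (keepPar q X Z).subst σ = keepPar q (X.subst σ) (Z.subst σ) := by cases q <;> rfl

theorem Step.subst {P Q : Ann} (h : Step P Q) : ∀ σ, Step (P.subst σ) (Q.subst σ) := by
  induction h with
  | ifT => exact fun _ => .ifT _ _
  | ifF => exact fun _ => .ifF _ _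
  | @com q q' q₂ q₂' vw vw' n m lab lab' act act' P Q R v i j hi hj hl =>
    intro σ
    have := @Step.com q q' q₂ q₂' vw vw' n m lab lab' (fun i => (act i).subst (up (up σ)))
      (fun i => (act' i).subst (up (up σ))) (fun i => (P i).subst ((act i).under (up (up σ))))
      (fun i => (Q i).subst ((act' i).under (up (up σ)))) (R.subst (up (up σ)))
      (v.subst (up (up σ))) i j (by rw [hi]; rfl) (by rw [hj]; rfl) hl
    simp only [hi, hj, Act.under] at this
    simp only [Ann.subst, keepPar_subst, subst_inst_comm]
    exact this
  | par _ _ ih => exact fun σ => .par _ (ih σ)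
  | res _ ih => exact fun σ => .res (ih _)
  | struct h1 _ h2 ih => exact fun σ => .struct (h1.subst σ) (ih σ) (h2.subst σ)

theorem Step.nuM (K : Multiset ℕ) {P P' : Ann} (h : Step P P') :
    Step (Calculus.nuM K P) (Calculus.nuM K P') := by
  induction K using induction_on with
  | empty => simpa [nuM_zero] using h
  | cons c K ih =>
    exact .struct (nuM_cons (P := Ann) c K P) (.res (ih.subst (cls (2 * c))))
      (Calculus.symm (P := Ann) (nuM_cons c K P'))

end Ann

/-- Choices on a name. -/
structure Br where
  (q₁ q₂ : Qual)
  vw : View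
  y : ℕ
  n : ℕ
  lab : Fin n → Label
  act : Fin n → Act
  P : Fin n → Ann

namespace Br

/-- A choice as a process. -/
def ann (X : Br) : Ann := .choice X.q₁ X.q₂ X.vw (.var X.y) X.n X.lab X.act X.P

/-- What remains of a choice that has been used. -/
def keep (X : Br) : Multiset Ann :=
  match X.q₁ with
  | .lin => 0
  | .un => {X.ann}

theorem ann_injective : Injective ann := by
  rintro ⟨⟩ ⟨⟩ h
  simp only [ann, Ann.choice.injEq, Val.var.injEq] at h
  obtain ⟨rfl, rfl, rfl, rfl, rfl, h1, h2, h3⟩ := h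
  cases h1
  cases h2
  cases h3
  rfl

end Br

/-- The channels `K` are new. -/
def New (C : Multiset ℕ) (L : Multiset Ann) (K : Multiset ℕ) : Prop :=
  ∀ c ∈ K, Even c ∧ c ∉ C ∧ ∀ A ∈ L, Fresh c A

/-- Reduction of the parallel composition of guarded processes `L` under restrictions `C`. -/
inductive SStep : Multiset ℕ → Multiset Ann → Multiset ℕ → Multiset Ann → Prop
  | ite {C v A B R X G K} : (v = .tt ∧ X = A ∨ v = .ff ∧ X = B) → Flat X G K →
      New C (.ite v A B ::ₘ R) K → SStep C (.ite v A B ::ₘ R) (K + C) (G + R)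
  | com {C R G K v} (X Y : Br) {i j} : Y.y = co X.y → ch X.y ∈ C → X.act i = .send v →
      Y.act j = .recv → X.lab i = Y.lab j → Flat (.par (X.P i) ((Y.P j).subst (inst v))) G K →
      New C (X.ann ::ₘ Y.ann ::ₘ R) K →
      SStep C (X.ann ::ₘ Y.ann ::ₘ R) (K + C) (G + (X.keep + Y.keep + R))

namespace Ann

theorem mem_FV_inst {x : ℕ} {v : Val} {Q : Ann} (h : x ∈ (Q.subst (inst v)).FV) :
    x ∈ v.fv ∨ x + 1 ∈ Q.FV := by
  obtain ⟨y, hy, e⟩ := (Ann.mem_FV_subst Q).1 h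
  cases y with
  | zero => exact .inl (Val.mem_fv.2 e)
  | succ y => simp_all

theorem parM_cons_cons (P Q : Ann) (R : Multiset Ann) :
    Cong (parM (P ::ₘ Q ::ₘ R)) (.par (.par P Q) (parM R)) :=
  (show Cong _ (.par P (parM (Q ::ₘ R))) from parM_cons P _).trans
    ((Cong.par (.refl _) (parM_cons (P := Ann) Q R)).trans (Cong.par_assoc _ _ _).symm)

end Ann

theorem Br.mem_FV_cont {X : Br} {i x} (h : x ∈ (X.act i).fv ∨ (X.act i).lift x ∈ (X.P i).FV) :
    x ∈ X.ann.FV := .inr ⟨i, h⟩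

theorem Br.com_FV {X Y : Br} {i j v x} (hi : X.act i = .send v) (hj : Y.act j = .recv)
    (h : x ∈ (Ann.par (X.P i) ((Y.P j).subst (inst v))).FV) : x ∈ X.ann.FV ∨ x ∈ Y.ann.FV := by
  rcases h with h | h
  · exact .inl (X.mem_FV_cont (i := i) (.inr (by rw [hi]; exact h)))
  · rcases Ann.mem_FV_inst h with h | h
    · exact .inl (X.mem_FV_cont (i := i) (.inl (by rw [hi]; exact h)))
    · exact .inr (Y.mem_FV_cont (i := j) (.inr (by rw [hj]; exact h)))

theorem Br.mem_keep {X : Br} {A : Ann} (h : A ∈ X.keep) : A = X.ann ∧ X.q₁ = .un := by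
  unfold keep at h
  split at h
  · simp at h
  · simp_all

theorem Ann.ite_names {v A B X R} (h : v = .tt ∧ X = A ∨ v = .ff ∧ X = B) :
    ∀ Z ∈ X ::ₘ R, ∀ x ∈ Z.FV, ∃ W ∈ Ann.ite v A B ::ₘ R, x ∈ W.FV := by
  intro Z hZ x hx
  rcases mem_cons.1 hZ with rfl | hZ
  · refine ⟨_, mem_cons_self _ _, ?_⟩
    rcases h with ⟨_, rfl⟩ | ⟨_, rfl⟩
    · exact .inl (.inr hx)
    · exact .inr hx
  · grind

theorem Br.com_names {X Y : Br} {i j v R} (hi : X.act i = .send v) (hj : Y.act j = .recv) :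
    ∀ Z ∈ Ann.par (X.P i) ((Y.P j).subst (inst v)) ::ₘ (X.keep + Y.keep + R), ∀ x ∈ Z.FV,
      ∃ A ∈ X.ann ::ₘ Y.ann ::ₘ R, x ∈ A.FV := by
  intro Z hZ x hx
  simp only [mem_cons, mem_add] at hZ
  rcases hZ with rfl | (hZ | hZ) | hZ
  · have := Br.com_FV hi hj hx
    grind
  · exact ⟨X.ann, by simp, (Br.mem_keep hZ).1 ▸ hx⟩
  · exact ⟨Y.ann, by simp, (Br.mem_keep hZ).1 ▸ hx⟩
  · grind

theorem fresh_of_names {L M : Multiset Ann} {c : ℕ} (h : ∀ Z ∈ M, ∀ x ∈ Z.FV, ∃ A ∈ L, x ∈ A.FV)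
    (hc : ∀ A ∈ L, Fresh c A) : ∀ Z ∈ M, Fresh c Z := fun Z hZ x hx =>
  let ⟨A, hA, hx⟩ := h Z hZ x hx
  hc A hA x hx

/-- The restrictions of a reduct are the old ones and new ones, and names that are new in a reduct
belong to new channels. -/
theorem SStep.names {C L C' L'} (h : SStep C L C' L') : ∃ K, C' = K + C ∧ K.Nodup ∧ New C L K ∧
    (∀ A ∈ L', A.IsGuard ∨ A ∈ L) ∧
    ∀ A ∈ L', ∀ x ∈ A.FV, (∃ B ∈ L, x ∈ B.FV) ∨ ch x ∈ K := by
  have key : ∀ {W G M K}, Flat W G K → New C L K → (∀ Z ∈ M, Z ∈ L) →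
      (∀ Z ∈ W ::ₘ M, ∀ x ∈ Z.FV, ∃ A ∈ L, x ∈ A.FV) →
      ∃ K', K + C = K' + C ∧ K'.Nodup ∧ New C L K' ∧ (∀ A ∈ G + M, A.IsGuard ∨ A ∈ L) ∧
        ∀ A ∈ G + M, ∀ x ∈ A.FV, (∃ B ∈ L, x ∈ B.FV) ∨ ch x ∈ K' := by
    intro W G M K hX hK hM h
    refine ⟨K, rfl, hX.nodup, hK, fun Z hZ => ?_, fun Z hZ x hx => ?_⟩
    · exact (mem_add.1 hZ).imp (hX.guards Z) (hM Z)
    · rcases mem_add.1 hZ with hZ | hZ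
      · exact (hX.mem_FV ⟨Z, hZ, hx⟩).imp_left (h W (mem_cons_self _ _) x)
      · exact .inl ⟨Z, hM Z hZ, hx⟩
  cases h with
  | ite hv hX hK => exact key hX hK (by simp +contextual) (Ann.ite_names hv)
  | com X Y hy hc hi hj hl hX hK =>
    refine key hX hK (fun Z hZ => ?_) (Br.com_names hi hj)
    simp only [mem_add] at hZ
    rcases hZ with (hZ | hZ) | hZ
    · simp [(Br.mem_keep hZ).1]
    · simp [(Br.mem_keep hZ).1]
    · simp [hZ]

theorem Br.keep_par (X : Br) (Z : Ann) (R : Multiset Ann) :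
    Ann.Cong (.par (Ann.keepPar X.q₁ X.ann Z) (parM R)) (.par Z (parM (X.keep + R))) := by
  unfold Br.keep
  cases X.q₁ with
  | lin => simp only [Ann.keepPar, zero_add]; exact .refl _
  | un =>
    simp only [Ann.keepPar, singleton_add]
    exact (Ann.Cong.par_assoc _ _ _).trans
      (.par (.refl _) (Calculus.symm (P := Ann) (parM_cons _ _)))

theorem SStep.step {C L C' L'} (h : SStep C L C' L') : Ann.Step (sys C L) (sys C' L') := by
  cases h with
  | @ite v A B R X G K hv hX hK =>
    refine .struct (.refl _) (Ann.Step.nuM C (P' := parM (X ::ₘ R))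
      (.struct (parM_cons (P := Ann) _ _) (.par _ ?_)
        (Calculus.symm (P := Ann) (parM_cons _ _))))
      (sys_flat (P := Ann) C hX fun c hc q hq => (hK c hc).2.2 q (by simp [hq]))
    rcases hv with ⟨rfl, rfl⟩ | ⟨rfl, rfl⟩
    · exact .ifT _ _
    · exact .ifF _ _
  | @com R G K v X Y i j hy hc hi hj hl hX hK =>
    refine .struct (.refl _) (Q' := sys C (.par (X.P i) ((Y.P j).subst (inst v)) ::ₘ
      (X.keep + Y.keep + R))) ?_ (sys_flat (P := Ann) C hX fun c hc q hq => ?_)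
    · obtain ⟨C, rfl⟩ := exists_cons_of_mem hc
      have e : ∀ Z : Ann, Ann.Cong (nuM (ch X.y ::ₘ C) Z)
          (nuM C (.res (Z.subst (cls X.y)))) := fun Z =>
        (show Ann.Cong _ _ from Calculus.nuM_cons' (P := Ann) _ _ _).trans
          (Calculus.cong_nuM (P := Ann) C (Calculus.nu_ch X.y Z))
      refine .struct (e _) (Ann.Step.nuM C ?_) (e _).symm
      refine .struct (.res ((Ann.parM_cons_cons _ _ _).subst _)) ?_
        (.res (((show Ann.Cong _ _ from
          parM_cons (P := Ann) (.par (X.P i) ((Y.P j).subst (inst v))) _).trans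
            (?_ : Ann.Cong _ (.par (Ann.keepPar Y.q₁ Y.ann (Ann.keepPar X.q₁ X.ann
              (.par (X.P i) ((Y.P j).subst (inst v))))) (parM R)))).symm.subst _))
      · have := @Ann.Step.com X.q₁ Y.q₁ X.q₂ Y.q₂ X.vw Y.vw X.n Y.n X.lab Y.lab
          (fun i => (X.act i).subst (cls X.y)) (fun i => (Y.act i).subst (cls X.y))
          (fun i => (X.P i).subst ((X.act i).under (cls X.y)))
          (fun i => (Y.P i).subst ((Y.act i).under (cls X.y))) ((parM R).subst (cls X.y))
          (v.subst (cls X.y)) i j (by rw [hi]; rfl) (by rw [hj]; rfl) hl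
        simp only [hi, hj, Act.under, ← Ann.subst_inst_comm] at this
        simp only [Ann.subst, Ann.keepPar_subst, Br.ann, hy, Val.subst_var, cls_self, cls_co]
        exact this
      · refine .trans ?_ (Y.keep_par _ R).symm
        have h1 := X.keep_par (.par (X.P i) ((Y.P j).subst (inst v))) (Y.keep + R)
        rw [add_assoc]
        exact h1.symm.trans ((Ann.Cong.par (.refl _) (.refl _)))
    · simp at hq
      have := (hK c hc).2.2
      rcases hq with (hq | hq) | hq
      · exact this q (by simp [(Br.mem_keep hq).1])
      · exact this q (by simp [(Br.mem_keep hq).1])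
      · grind

/-! ## Flattening with prescribed channels -/

theorem Ann.exists_flat (A : Ann) : ∀ (σ : ℕ → Val) {S : Set ℕ}, S.Infinite →
    ∃ G K, Flat (A.subst σ) G K ∧ ∀ c ∈ K, c ∈ S := by
  induction A with
  | choice => exact fun σ S _ => ⟨_, _, .guard (Ann.IsGuard.choice ..), by simp⟩
  | ite => exact fun σ S _ => ⟨_, _, .guard (Ann.IsGuard.ite ..), by simp⟩
  | inact => exact fun σ S _ => ⟨_, _, Flat.inact (P := Ann), by simp⟩
  | par P Q ih1 ih2 =>
    intro σ S hS
    obtain ⟨G, K, h1, hK⟩ := ih1 σ (hS.sdiff (finite_not_fresh (Q.subst σ)))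
    obtain ⟨G', K', h2, hK'⟩ := ih2 σ (hS.sdiff ((finite_not_fresh (P.subst σ)).union
      (K.toFinset.finite_toSet)))
    refine ⟨_, _, Flat.par (P := Ann) h1 h2 (fun c hc => ⟨?_, fun hc' => ?_⟩) fun c hc => ?_, ?_⟩
    · grind
    · grind
    all_goals grind
  | res P ih =>
    intro σ S hS
    obtain ⟨c, hc, hc'⟩ := (hS.sdiff (finite_not_fresh ((Ann.res P).subst σ))).nonempty
    obtain ⟨G, K, h1, hK⟩ := ih (fun x => (up (up σ) x).subst (opn (2 * c)))
      (hS.sdiff (Set.finite_singleton c))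
    refine ⟨G, c ::ₘ K, ?_, ?_⟩
    · have := Flat.res (P := Ann) (p := P.subst (up (up σ))) (M := G) (K := K) (2 * c)
        (by
          change Flat ((P.subst (up (up σ))).subst (opn (2 * c))) G K
          rwa [Ann.subst_subst]) (by
          rw [ch_two_mul]
          exact fun h => (hK c h).2 rfl) (by
          rw [ch_two_mul]
          exact not_not.1 hc')
      rwa [ch_two_mul] at this
    · grind

theorem exists_flat_new (A : Ann) (C : Multiset ℕ) (L : Multiset Ann) :
    ∃ G K, Flat A G K ∧ New C L K := by
  have hE : {c : ℕ | Even c}.Infinite := by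
    refine Set.infinite_of_injective_forall_mem (f := fun n : ℕ => 2 * n)
      (fun a b h => by grind) fun n => ?_
    exact even_two_mul n
  obtain ⟨G, K, h, hK⟩ := A.exists_flat .var (hE.sdiff ((C.toFinset.finite_toSet).union
    (finite_not_fresh_multiset L)))
  rw [Ann.subst_id] at h
  refine ⟨G, K, h, fun c hc => ⟨(hK c hc).1, fun h => (hK c hc).2 (.inl (by grind)),
    fun A hA => not_not.1 fun h => (hK c hc).2 (.inr ⟨A, hA, h⟩)⟩⟩

/-! ## Typing of systems -/

/-- Typing of parallel compositions. -/
inductive SoupWT (Γ : Ctx) : Set ℕ → Multiset Ann → Prop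
  | nil : SoupWT Γ ∅ 0
  | cons {A L o₁ o₂} : WT A Γ o₁ → SoupWT Γ o₂ L → Disjoint o₁ o₂ → SoupWT Γ (o₁ ∪ o₂) (A ::ₘ L)

theorem SoupWT.extract {Γ o M} (h : SoupWT Γ o M) : ∀ {A L}, M = A ::ₘ L →
    ∃ o₁ o₂, o = o₁ ∪ o₂ ∧ Disjoint o₁ o₂ ∧ WT A Γ o₁ ∧ SoupWT Γ o₂ L := by
  induction h with
  | nil => intro A L h; exact absurd h.symm (Multiset.cons_ne_zero)
  | @cons B M o₁ o₂ hB hM hd ih =>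
    intro A L h
    rcases Multiset.cons_eq_cons.1 h with ⟨rfl, rfl⟩ | ⟨_, N, rfl, rfl⟩
    · exact ⟨o₁, o₂, rfl, hd, hB, hM⟩
    · obtain ⟨p₁, p₂, rfl, hd', hA, hN⟩ := ih rfl
      rw [Set.disjoint_union_right] at hd
      refine ⟨p₁, o₁ ∪ p₂, by grind, ?_, hA, .cons hB hN hd.2⟩
      rw [Set.disjoint_union_right]
      exact ⟨hd.1.symm, hd'⟩

theorem SoupWT.own {Γ o M} (h : SoupWT Γ o M) :
    ∀ x ∈ o, (∃ A ∈ M, x ∈ A.FV) ∧ x ∈ linNames Γ := by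
  induction h with
  | nil => exact fun x hx => hx.elim
  | @cons B M o₁ o₂ hB hM hd ih =>
    rintro x (hx | hx)
    · exact ⟨⟨B, by simp, (hB.own _ x hx).1⟩, (hB.own _ x hx).2⟩
    · grind

theorem SoupWT.add {Γ o M o' M'} (h : SoupWT Γ o M) (h' : SoupWT Γ o' M') (hd : Disjoint o o') :
    SoupWT Γ (o ∪ o') (M + M') := by
  induction h with
  | nil => simpa using h'
  | @cons B M o₁ o₂ hB hM hd' ih =>
    rw [Set.disjoint_union_left] at hd
    rw [cons_add, Set.union_assoc]
    refine .cons hB (ih hd.2) ?_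
    rw [Set.disjoint_union_right]
    exact ⟨hd', hd.1⟩

theorem SoupWT.map {Γ Γ' o M} (h : SoupWT Γ o M)
    (hm : ∀ A ∈ M, ∀ o' ⊆ o, WT A Γ o' → WT A Γ' o') : SoupWT Γ' o M := by
  induction h with
  | nil => exact .nil
  | @cons B M o₁ o₂ hB hM hd ih =>
    exact .cons (hm B (by simp) o₁ subset_union_left hB) (ih fun A hA o' ho' =>
      hm A (by simp [hA]) o' (ho'.trans subset_union_right)) hd

theorem WT.congr {A : Ann} {Γ Γ' o} (h : WT A Γ o) (hΓ : CWF Γ)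
    (he : ∀ x ∈ A.FV, Γ' x = Γ x) : WT A Γ' o := by
  refine h.weaken hΓ (.var (fun x hx T hT _ => ⟨T, by grind, (hΓ x T hT).wsub_refl⟩) ?_)
  intro x hx
  obtain ⟨hxA, T, hT, hl⟩ := h.own _ x hx
  exact ⟨T, T, hT, hl, by grind, (hΓ x T hT).wsub_refl⟩

theorem SoupWT.congr {M : Multiset Ann} {Γ Γ' o} (h : SoupWT Γ o M) (hΓ : CWF Γ)
    (he : ∀ A ∈ M, ∀ x ∈ A.FV, Γ' x = Γ x) : SoupWT Γ' o M :=
  h.map fun A hA _ _ hw => hw.congr hΓ (he A hA)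

/-- The two ends of channel `ch a` have dual types. -/
def DualAt (Γ : Ctx) (a : ℕ) : Prop :=
  ∃ T T', Γ a = some T ∧ Γ (co a) = some T' ∧ WDual T T'

theorem finite_update {Γ : Ctx} (h : {x | Γ x ≠ none}.Finite) (a : ℕ) (T : Option Ty) :
    {x | update Γ a T x ≠ none}.Finite := by
  refine (h.union (Set.finite_singleton a)).subset fun x hx => ?_
  by_cases e : x = a
  · grind
  · grind

theorem WT.opn {P : Ann} {Γ : Ctx} {o : Set ℕ} {T U : Ty} {a : ℕ}
    (h : WT P ((Γ.cons U).cons T) (liftO T (liftO U o))) (hΓ : CWF Γ) (hT : T.WF) (hU : U.WF)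
    (hf : ∀ x, x + 2 ∈ P.FV → ch x ≠ ch a) :
    WT (P.subst (opn a)) (update (update Γ (co a) (some U)) a (some T))
      (o ∪ {x | x = a ∧ T.Lin} ∪ {x | x = co a ∧ U.Lin}) := by
  set Γ' := update (update Γ (co a) (some U)) a (some T) with hΓ'
  have e0 : Γ' a = some T := by grind
  have e1 : Γ' (co a) = some U := by rw [hΓ', update_of_ne (co_ne a), update_self]
  have e2 : ∀ x, ch x ≠ ch a → Γ' x = Γ x := by
    intro x hx
    rw [hΓ', update_of_ne (by rintro rfl; exact hx rfl),
      update_of_ne (by rintro rfl; exact hx (ch_co a))]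
  have hown := WT.own _ h
  refine h.subst_eq ((hΓ.cons hU).cons hT) ⟨?_, ?_, ?_⟩ ?_
  · intro x hx S hS hl
    have emp : ∀ (z : ℕ) (S : Ty), ¬ S.Lin → (∅ : Set ℕ) = {y | y = z ∧ S.Lin} := by grind
    match x, hx, hS with
    | 0, _, hS => cases hS; exact ⟨T, e0, hT.wsub_refl, emp _ _ hl⟩
    | 1, _, hS => cases hS; exact ⟨U, e1, hU.wsub_refl, emp _ _ hl⟩
    | x + 2, hx, hS => exact ⟨S, (e2 x (hf x hx)).trans hS, (hΓ x S hS).wsub_refl, emp _ _ hl⟩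
  · intro x hx
    obtain ⟨hxP, S, hS, hl⟩ := hown x hx
    match x, hxP, hS with
    | 0, _, hS => cases hS; exact ⟨T, a, T, rfl, hl, rfl, e0, hT.wsub_refl⟩
    | 1, _, hS => cases hS; exact ⟨U, co a, U, rfl, hl, rfl, e1, hU.wsub_refl⟩
    | x + 2, hxP, hS =>
      exact ⟨S, x, S, hS, hl, rfl, (e2 x (hf x hxP)).trans hS, (hΓ x S hS).wsub_refl⟩
  · intro x hx y hy z hxz hyz
    have hx' := fun y (e : x = y + 2) => hf y (e ▸ (hown x hx).1)
    have hy' := fun x (e : y = x + 2) => hf x (e ▸ (hown y hy).1)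
    match x, y, hxz, hyz with
    | 0, 0, _, _ => rfl
    | 1, 1, _, _ => rfl
    | 0, 1, hxz, hyz => cases hxz; simp at hyz; exact absurd hyz (co_ne a)
    | 1, 0, hxz, hyz => cases hyz; simp at hxz; exact absurd hxz (co_ne a)
    | 0, y + 2, hxz, hyz => cases hxz; cases hyz; exact absurd rfl (hy' _ rfl)
    | x + 2, 0, hxz, hyz => cases hxz; cases hyz; exact absurd rfl (hx' _ rfl)
    | 1, y + 2, hxz, hyz => cases hxz; cases hyz; exact absurd (ch_co a) (hy' _ rfl)
    | x + 2, 1, hxz, hyz => cases hyz; cases hxz; exact absurd (ch_co a) (hx' _ rfl)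
    | x + 2, y + 2, hxz, hyz => cases hxz; cases hyz; rfl
  · ext z
    constructor
    · rintro ⟨x, hx, hz⟩
      match x, hx, hz with
      | 0, hx, hz => cases hz; exact .inl (.inr ⟨rfl, mem_liftO_zero.1 hx⟩)
      | 1, hx, hz =>
        cases hz
        exact .inr ⟨rfl, mem_liftO_zero.1 ((mem_liftO_succ (x := 0)).1 hx)⟩
      | x + 2, hx, hz =>
        cases hz
        exact .inl (.inl (mem_liftO_succ.1 ((mem_liftO_succ (x := z + 1)).1 hx)))
    · rintro ((hz | ⟨rfl, hl⟩) | ⟨rfl, hl⟩)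
      · exact ⟨z + 2, (mem_liftO_succ (x := z + 1)).2 (mem_liftO_succ.2 hz), rfl⟩
      · exact ⟨0, mem_liftO_zero.2 hl, rfl⟩
      · exact ⟨1, (mem_liftO_succ (x := 0)).2 (mem_liftO_zero.2 hl), rfl⟩

/-- Flattening preserves typing. -/
theorem flat_soup {A : Ann} {G K} (h : Flat A G K) : ∀ {Γ : Ctx} {o}, CWF Γ →
    {x | Γ x ≠ none}.Finite → WT A Γ o → ∃ Γ', CWF Γ' ∧ {x | Γ' x ≠ none}.Finite ∧
      (∀ x, ch x ∉ K → Γ' x = Γ x) ∧ (∀ a, ch a ∈ K → DualAt Γ' a) ∧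
      SoupWT Γ' (o ∪ {x | ch x ∈ K ∧ x ∈ linNames Γ'}) G := by
  induction h with
  | @guard A hA =>
    intro Γ o hΓ hfin h
    refine ⟨Γ, hΓ, hfin, fun _ _ => rfl, by simp, ?_⟩
    have := SoupWT.cons h .nil (Set.disjoint_empty o)
    simpa using this
  | inact =>
    intro Γ o hΓ hfin h
    obtain rfl : o = ∅ := h
    refine ⟨Γ, hΓ, hfin, fun _ _ => rfl, by simp, ?_⟩
    have := SoupWT.nil (Γ := Γ)
    simpa using this
  | @par p q M N K J hp hq h1 h2 ih1 ih2 =>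
    rintro Γ _ hΓ hfin ⟨o₁, o₂, rfl, hd, hwp, hwq⟩
    obtain ⟨Γ₁, hΓ₁, hfin₁, he₁, hdual₁, hM⟩ := ih1 hΓ hfin hwp
    have hwq' : WT q Γ₁ o₂ := hwq.congr hΓ fun x hx => he₁ x fun hc => (h1 _ hc).1 x hx rfl
    obtain ⟨Γ₂, hΓ₂, hfin₂, he₂, hdual₂, hN⟩ := ih2 hΓ₁ hfin₁ hwq'
    have hKJ : ∀ x, ch x ∈ K → ch x ∉ J := fun x hx => (h1 _ hx).2
    have hM' := hM.congr (Γ' := Γ₂) hΓ₁ fun A hA x hx => he₂ x fun hc => by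
      rcases hp.mem_FV ⟨A, hA, hx⟩ with h | h
      · exact h2 _ hc x h rfl
      · exact hKJ x h hc
    have e : {x | ch x ∈ K ∧ x ∈ linNames Γ₁} = {x | ch x ∈ K ∧ x ∈ linNames Γ₂} := by
      ext x
      simp only [mem_ofPred_eq, and_congr_right_iff]
      intro hx
      simp only [linNames, mem_ofPred_eq, he₂ x (hKJ x hx)]
    rw [e] at hM'
    refine ⟨Γ₂, hΓ₂, hfin₂, fun x hx => ?_, fun a ha => ?_, ?_⟩
    · rw [mem_add, not_or] at hx
      rw [he₂ x hx.2, he₁ x hx.1]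
    · rcases mem_add.1 ha with ha | ha
      · obtain ⟨T, T', h, h', h''⟩ := hdual₁ a ha
        exact ⟨T, T', by grind,
          by rw [he₂ _ (hKJ _ (by rwa [ch_co])), h'], h''⟩
      · exact hdual₂ a ha
    · have := hM'.add hN (by
        rw [Set.disjoint_left]
        rintro x (hx | ⟨hx, _⟩) (hx' | ⟨hx', _⟩)
        · exact Set.disjoint_left.1 hd hx hx'
        · exact h2 _ hx' x (hwp.own _ x hx).1 rfl
        · exact (h1 _ hx).1 x (hwq.own _ x hx').1 rfl
        · exact hKJ x hx hx')
      have e : o₁ ∪ o₂ ∪ {x | ch x ∈ K + J ∧ x ∈ linNames Γ₂} =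
          o₁ ∪ {x | ch x ∈ K ∧ x ∈ linNames Γ₂} ∪ (o₂ ∪ {x | ch x ∈ J ∧ x ∈ linNames Γ₂}) := by
        ext x
        simp only [mem_union, mem_ofPred_eq, mem_add]
        tauto
      rwa [e]
  | @res p M K a hp hK hf ih =>
    rintro Γ o hΓ hfin ⟨T, U, hT, hU, hd, h⟩
    have h' := h.opn (a := a) hΓ hT hU fun x hx => hf x hx
    obtain ⟨Γ', hΓ', hfin', he, hdual, hM⟩ := ih ((hΓ.update hU _).update hT _)
      (finite_update (finite_update hfin _ _) _ _) h'
    have ea : Γ' a = some T := by grind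
    have eb : Γ' (co a) = some U := by
      rw [he _ (by rwa [ch_co]), update_of_ne (co_ne a), update_self]
    refine ⟨Γ', hΓ', hfin', fun x hx => ?_, fun b hb => ?_, ?_⟩
    · rw [mem_cons, not_or] at hx
      rw [he x hx.2, update_of_ne (by rintro rfl; exact hx.1 rfl),
        update_of_ne (by rintro rfl; exact hx.1 (ch_co a))]
    · rcases mem_cons.1 hb with hb | hb
      · rcases eq_or_eq_co hb with rfl | rfl
        · exact ⟨T, U, ea, eb, hd⟩
        · exact ⟨U, T, eb, by rw [co_co, ea], hd.symm hT hU⟩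
      · exact hdual b hb
    · convert hM using 1
      ext x
      simp only [mem_union, mem_ofPred_eq, mem_cons]
      constructor
      · rintro (hx | ⟨hx | hx, hl⟩)
        · exact .inl (.inl (.inl hx))
        · obtain ⟨S, hS, hl⟩ := hl
          rcases eq_or_eq_co hx with rfl | rfl
          · rw [ea] at hS
            cases hS
            exact .inl (.inl (.inr ⟨rfl, hl⟩))
          · rw [eb] at hS
            cases hS
            exact .inl (.inr ⟨rfl, hl⟩)
        · exact .inr ⟨hx, hl⟩
      · rintro (((hx | ⟨rfl, hl⟩) | ⟨rfl, hl⟩) | ⟨hx, hl⟩)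
        · exact .inl hx
        · exact .inr ⟨.inl rfl, T, ea, hl⟩
        · exact .inr ⟨.inl (ch_co a), U, eb, hl⟩
        · exact .inr ⟨.inr hx, hl⟩

/-- The system is typable in a context with the same domain as `Γ₀` up to the restricted names. -/
def Good (Γ₀ : Ctx) (C : Multiset ℕ) (L : Multiset Ann) : Prop :=
  ∃ Γ : Ctx, CWF Γ ∧ {x | Γ x ≠ none}.Finite ∧ SoupWT Γ (linNames Γ) L ∧
    (∀ a, ch a ∈ C → DualAt Γ a) ∧ ∀ x, ch x ∉ C → (Γ x = none ↔ Γ₀ x = none)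

theorem Good.flat {Γ₀ C A R G K} (h : Good Γ₀ C (A ::ₘ R)) (hA : Flat A G K)
    (hK : ∀ c ∈ K, c ∉ C ∧ ∀ B ∈ A ::ₘ R, Fresh c B) : Good Γ₀ (K + C) (G + R) := by
  obtain ⟨Γ, hΓ, hfin, hs, hdual, hdom⟩ := h
  obtain ⟨o₁, o₂, e, hd, hw, hR⟩ := hs.extract rfl
  obtain ⟨Γ', hΓ', hfin', he, hdual', hG⟩ := flat_soup hA hΓ hfin hw
  have hR' := hR.congr (Γ' := Γ') hΓ fun B hB x hx => he x fun hc =>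
    (hK _ hc).2 B (by simp [hB]) x hx rfl
  have ho : ∀ x ∈ o₁ ∪ o₂, ch x ∉ K := by
    rw [← e]
    intro x hx hc
    obtain ⟨⟨B, hB, hxB⟩, _⟩ := hs.own x hx
    exact (hK _ hc).2 B hB x hxB rfl
  refine ⟨Γ', hΓ', hfin', ?_, fun a ha => ?_, fun x hx => ?_⟩
  · have := hG.add hR' (by
      rw [Set.disjoint_left]
      rintro x (hx | ⟨hx, _⟩) hx'
      · exact Set.disjoint_left.1 hd hx hx'
      · exact ho x (.inr hx') hx)
    convert this using 1
    ext x
    constructor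
    · intro hx
      by_cases hc : ch x ∈ K
      · exact .inl (.inr ⟨hc, hx⟩)
      · obtain ⟨T, hT, hl⟩ := hx
        rw [he x hc] at hT
        have : x ∈ o₁ ∪ o₂ := e ▸ ⟨T, hT, hl⟩
        exact this.elim (fun h => .inl (.inl h)) .inr
    · rintro ((hx | ⟨_, hx⟩) | hx)
      · have hx' : x ∈ linNames Γ := e ▸ .inl hx
        obtain ⟨T, hT, hl⟩ := hx'
        exact ⟨T, by grind, hl⟩
      · exact hx
      · have hx' : x ∈ linNames Γ := e ▸ .inr hx
        obtain ⟨T, hT, hl⟩ := hx'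
        exact ⟨T, by grind, hl⟩
  · by_cases hc : ch a ∈ K
    · exact hdual' a hc
    · obtain ⟨T, T', h1, h2, h3⟩ := hdual a ((mem_add.1 ha).resolve_left hc)
      exact ⟨T, T', by grind, by rw [he _ (by rwa [ch_co]), h2], h3⟩
  · rw [mem_add, not_or] at hx
    rw [he x hx.1]
    exact hdom x hx.2

theorem VT.own_lin {Γ v T o} (h : VT Γ v T o) (hT : T.Lin) : ∃ z S, v = .var z ∧ Γ z = some S ∧
    WSub S T ∧ o = {z} := by
  cases v with
  | var z =>
    obtain ⟨S, hS, hs, rfl⟩ := h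
    refine ⟨z, S, rfl, hS, hs, ?_⟩
    ext y
    simp [hs.lin_iff.2 hT]
  | _ =>
    obtain ⟨_, _, _, _, _, _, h⟩ := h.1.lin_iff.2 hT
    cases h

theorem VT.own_un {Γ v T o} (h : VT Γ v T o) (hT : ¬ T.Lin) : o = ∅ := by
  cases v with
  | var z =>
    obtain ⟨S, hS, hs, rfl⟩ := h
    ext y
    exact ⟨fun h => hT (hs.lin_iff.1 h.2), fun h => h.elim⟩
  | _ => exact h.2

theorem WT.inst {Q : Ann} {Γ : Ctx} {o o₁ : Set ℕ} {T : Ty} {v : Val}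
    (h : WT Q (Γ.cons T) (liftO T o)) (hΓ : CWF Γ) (hT : T.WF) (hv : VT Γ v T o₁)
    (hd : Disjoint o₁ o) : WT (Q.subst (inst v)) Γ (o₁ ∪ o) := by
  have hown := WT.own _ h
  refine h.subst_eq (hΓ.cons hT) ⟨?_, ?_, ?_⟩ ?_
  · intro x hx S hS hl
    cases x with
    | zero =>
      cases hS
      rwa [← hv.own_un hl]
    | succ x =>
      refine ⟨S, hS, (hΓ x S hS).wsub_refl, ?_⟩
      ext y
      exact ⟨fun h => h.elim, fun h => (hl h.2).elim⟩
  · intro x hx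
    obtain ⟨_, S, hS, hl⟩ := hown x hx
    cases x with
    | zero =>
      cases hS
      obtain ⟨z, S', rfl, hz, hs, _⟩ := hv.own_lin hl
      exact ⟨T, z, S', rfl, hl, rfl, hz, hs⟩
    | succ x => exact ⟨S, x, S, hS, hl, rfl, hS, (hΓ x S hS).wsub_refl⟩
  · have key : ∀ y z, 0 ∈ liftO T o → y + 1 ∈ liftO T o → v = .var z → y = z → False := by
      rintro y z h0 hy rfl rfl
      obtain ⟨z, S', e, _, _, rfl⟩ := hv.own_lin (mem_liftO_zero.1 h0)
      cases e
      exact Set.disjoint_left.1 hd rfl (mem_liftO_succ.1 hy)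
    intro x hx y hy z hxz hyz
    cases x with
    | zero =>
      cases y with
      | zero => rfl
      | succ y => cases hyz; exact (key _ _ hx hy hxz rfl).elim
    | succ x =>
      cases y with
      | zero => cases hxz; exact (key _ _ hy hx hyz rfl).elim
      | succ y => cases hxz; cases hyz; rfl
  · ext z
    constructor
    · rintro ⟨x, hx, hz⟩
      cases x with
      | zero =>
        obtain ⟨z', S', rfl, _, _, rfl⟩ := hv.own_lin (mem_liftO_zero.1 hx)
        cases hz
        exact .inl rfl
      | succ x => cases hz; exact .inr (mem_liftO_succ.1 hx)
    · rintro (hz | hz)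
      · by_cases hl : T.Lin
        · obtain ⟨z', S', rfl, _, _, rfl⟩ := hv.own_lin hl
          cases hz
          exact ⟨0, mem_liftO_zero.2 hl, rfl⟩
        · rw [hv.own_un hl] at hz
          exact hz.elim
      · exact ⟨z + 1, mem_liftO_succ.2 hz, rfl⟩

/-! ## Subject reduction -/

theorem SubstOK.refl {s : Set ℕ} {Γ : Ctx} {o : Set ℕ} (hΓ : CWF Γ) (ho : o ⊆ linNames Γ) :
    SubstOK .var s Γ o Γ := by
  refine .var (fun x _ T hT _ => ⟨T, hT, (hΓ x T hT).wsub_refl⟩) fun x hx => ?_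
  obtain ⟨T, hT, hl⟩ := ho hx
  exact ⟨T, T, hT, hl, hT, (hΓ x T hT).wsub_refl⟩

theorem SubstOK.update {s : Set ℕ} {Γ : Ctx} {o : Set ℕ} {a b : ℕ} {U V V' : Ty} (hΓ : CWF Γ)
    (ho : o ⊆ linNames Γ) (hab : a ≠ b) (ha : a ∉ o) (hb : b ∉ o) (hbl : b ∈ linNames Γ)
    (hU : WSub V U) :
    SubstOK .var s (update Γ a (some U)) (o ∪ {y | y = a ∧ U.Lin})
      (update (update Γ b (some V')) a (some V)) := by
  refine .var (fun x _ T hT hl => ?_) fun x hx => ?_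
  · by_cases e : x = a
    · grind
    · rw [update_of_ne e] at hT ⊢
      have : x ≠ b := by
        rintro rfl
        obtain ⟨T', hT', hl'⟩ := hbl
        rw [hT] at hT'
        cases hT'
        exact hl hl'
      rw [update_of_ne this]
      exact ⟨T, hT, (hΓ x T hT).wsub_refl⟩
  · rcases hx with hx | ⟨rfl, hl⟩
    · obtain ⟨T, hT, hl⟩ := ho hx
      have h1 : x ≠ a := fun e => ha (e ▸ hx)
      have h2 : x ≠ b := fun e => hb (e ▸ hx)
      rw [update_of_ne h1, update_of_ne h1, update_of_ne h2]
      exact ⟨T, T, hT, hl, hT, (hΓ x T hT).wsub_refl⟩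
    · grind

theorem VT.sub {Γ v T T' o} (h : VT Γ v T o) (hs : WSub T T') : VT Γ v T' o := by
  cases v with
  | var x =>
    obtain ⟨S, h1, h2, h3⟩ := h
    exact ⟨S, h1, h2.trans hs, h3⟩
  | _ => exact ⟨h.1.trans hs, h.2⟩

theorem VT.weaken {Γ v T o Γ'} (h : VT Γ v T o) (hσ : SubstOK .var Set.univ Γ o Γ') :
    VT Γ' v T o := by
  have := h.subst hσ (Set.subset_univ _) le_rfl
  rwa [Val.subst_id, imgO_var] at this

theorem WT.com {Γ ΓX ΓY : Ctx} {P Q : Ann} {v : Val} {T T' : Ty} {oX oY : Set ℕ}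
    (hX : BranchWT (.send v) T (WT P) ΓX oX) (hY : BranchWT .recv T' (WT Q) ΓY oY)
    (hΓ : CWF Γ) (hΓX : CWF ΓX) (hΓY : CWF ΓY) (hT' : T'.WF) (hs : WSub T T')
    (sX : SubstOK .var Set.univ ΓX oX Γ) (sY : SubstOK .var Set.univ ΓY oY Γ)
    (hd : Disjoint oX oY) : WT (.par P (Q.subst (MixedSessions.inst v))) Γ (oX ∪ oY) := by
  obtain ⟨o₁, o₂, rfl, hd', hv, hP⟩ := hX
  rw [Set.disjoint_union_left] at hd
  have hv' := (hv.weaken (sX.mono le_rfl subset_union_left)).sub hs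
  have hP' := hP.weaken hΓX (sX.mono (Set.subset_univ _) subset_union_right)
  have hup : SubstOK .var Set.univ (ΓY.cons T') (liftO T' oY) (Γ.cons T') := by
    have := sY.up (s' := Set.univ) (fun x _ => trivial) hT'
    rwa [up_id] at this
  have hQ : WT Q (Γ.cons T') (liftO T' oY) :=
    WT.weaken hY (hΓY.cons hT') (hup.mono (Set.subset_univ _) le_rfl)
  refine ⟨o₂, o₁ ∪ oY, ?_, ?_, hP', hQ.inst hΓ hT' hv' hd.1⟩
  · grind
  · grind

theorem SoupWT.keep {Γ o} {X : Br} (h : WT X.ann Γ o) (ho : X.q₁ = .un → o = ∅) :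
    SoupWT Γ ∅ X.keep := by
  unfold Br.keep
  split
  · exact .nil
  · rename_i e
    rw [ho e] at h
    have := SoupWT.cons h .nil (Set.disjoint_empty _)
    simpa using this

theorem Good.ite {Γ₀ C v A B R X} (h : Good Γ₀ C (.ite v A B ::ₘ R))
    (hX : v = .tt ∧ X = A ∨ v = .ff ∧ X = B) : Good Γ₀ C (X ::ₘ R) := by
  obtain ⟨Γ, hΓ, hfin, hs, hdual, hdom⟩ := h
  obtain ⟨o₁, o₂, e, hd, hw, hR⟩ := hs.extract rfl
  refine ⟨Γ, hΓ, hfin, ?_, hdual, hdom⟩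
  rw [e]
  refine .cons ?_ hR hd
  rcases hX with ⟨_, rfl⟩ | ⟨_, rfl⟩
  · exact hw.2.1
  · exact hw.2.2

theorem Br.lin_of_Ok {X : Br} (hX : X.q₁ = .un → X.q₂ = .un) (hq : X.q₂ = .lin) :
    X.q₁ = .lin := by
  cases h : X.q₁ with
  | lin => rfl
  | un => exact absurd ((hX h).symm.trans hq) (by simp)

theorem Good.com {Γ₀ C R v} {X Y : Br} {i j} (h : Good Γ₀ C (X.ann ::ₘ Y.ann ::ₘ R))
    (hy : Y.y = co X.y) (hc : ch X.y ∈ C) (hi : X.act i = .send v) (hj : Y.act j = .recv)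
    (hl : X.lab i = Y.lab j) :
    Good Γ₀ C (.par (X.P i) ((Y.P j).subst (inst v)) ::ₘ (X.keep + Y.keep + R)) := by
  obtain ⟨Γ, hΓ, hfin, hs, hdual, hdom⟩ := h
  obtain ⟨o₁, o₂, e, hd, hX, hR0⟩ := hs.extract rfl
  obtain ⟨p₁, p₂, rfl, hd', hY, hR⟩ := hR0.extract rfl
  clear hR0 hs
  have hXw := hX
  have hYw := hY
  have oXl := fun x (hx : x ∈ o₁) => (hX.own _ x hx).2
  have oYl := fun x (hx : x ∈ p₁) => (hY.own _ x hx).2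
  obtain ⟨S, S', hS, hS', hdd⟩ := hdual _ hc
  change ChoiceWT Γ X.q₁ X.q₂ X.vw X.lab X.act (fun j => WT (X.P j)) (.var X.y) o₁ at hX
  change ChoiceWT Γ Y.q₁ Y.q₂ Y.vw Y.lab Y.act (fun j => WT (Y.P j)) (.var Y.y) p₁ at hY
  rw [hy] at hY
  obtain @⟨_, S₁, m, labX, polX, TX, UX, kX, oX, hSX, hCX, hsX, hkX, hlX, hpX, hqX, hoX, hbX⟩ := hX
  obtain @⟨_, S₂, m', labY, polY, TY, UY, kY, oY, hSY, hCY, hsY, hkY, hlY, hpY, hqY, hoY, hbY⟩ := hY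
  rw [hS] at hSX
  cases hSX
  rw [hS'] at hSY
  cases hSY
  obtain ⟨hq, hv, hex, hpay⟩ := hdd.choices (hΓ _ _ hS) (hΓ _ _ hS') hsX hsY
  obtain ⟨hT, hV⟩ := hpay (kX i) (kY j) (by rw [hlX, hlY, hl]) (by rw [hpX, hi]; rfl)
    (by rw [hpY, hj]; rfl)
  have hbi := hbX i
  have hbj := hbY j
  rw [hi] at hbi
  rw [hj] at hbj
  rw [hq] at hbj hoY hqY hd' hd e oYl hYw
  obtain ⟨hda, hdb⟩ := Set.disjoint_union_right.1 hd
  have hXl := SoupWT.keep hXw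
  have hYl := SoupWT.keep hYw
  have nX := hΓ.contC (hCX.2.2.2 (kX i)) X.q₂ X.y
  have nY := hΓ.contC (hCY.2.2.2 (kY j)) X.q₂ (co X.y)
  cases hq₂ : X.q₂ with
  | un =>
    have emp : ∀ x, subjO .un x = ∅ := fun x => by
      ext y
      exact ⟨fun h => (Qual.noConfusion h.2), fun h => h.elim⟩
    simp only [hq₂, emp, Set.union_empty, contC, contO] at *
    have hcom := WT.com hbi hbj hΓ hΓ hΓ (hCY.2.2.1 _) hT (.refl hΓ oXl) (.refl hΓ oYl) hda
    refine ⟨Γ, hΓ, hfin, ?_, hdual, hdom⟩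
    rw [e, ← Set.union_assoc]
    refine .cons hcom ?_ (Set.disjoint_union_left.2 ⟨hdb, hd'⟩)
    have := ((hXl fun h => (hqX h).1).add (hYl fun h => (hqY h).1) (Set.disjoint_empty _)).add hR
      (by simp)
    simpa using this
  | lin =>
    have kX' : X.keep = 0 := by rw [Br.keep, Br.lin_of_Ok (fun h => (hqX h).2) hq₂]
    have kY' : Y.keep = 0 := by rw [Br.keep, Br.lin_of_Ok (fun h => hq.trans (hqY h).2) (hq.trans hq₂)]
    rw [kX', kY', zero_add, zero_add]
    simp only [hq₂, contC, contO] at *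
    obtain ⟨V, V', hVV, hVw, hVw', hVU, hVU'⟩ := hV trivial
    set a := X.y
    have hab : a ≠ co a := (co_ne a).symm
    have haX : a ∈ subjO .lin a := ⟨rfl, rfl⟩
    have hbY' : co a ∈ subjO .lin (co a) := ⟨rfl, rfl⟩
    have haoX : a ∉ oX := fun h => Set.disjoint_left.1 hoX h haX
    have hboY : co a ∉ oY := fun h => Set.disjoint_left.1 hoY h hbY'
    have hboX : co a ∉ oX := fun h => Set.disjoint_left.1 hda (.inl h) (.inr hbY')
    have haoY : a ∉ oY := fun h => Set.disjoint_left.1 hda (.inr haX) (.inl h)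
    have hal := oXl a (.inr haX)
    have hbl := oYl _ (.inr hbY')
    have sX := SubstOK.update (s := Set.univ) (V' := V') hΓ (fun x hx => oXl x (.inl hx)) hab haoX
      hboX hbl hVU
    have sY := SubstOK.update (s := Set.univ) (V' := V) hΓ (fun x hx => oYl x (.inl hx)) hab.symm
      hboY haoY hal hVU'
    rw [Function.update_comm hab] at sY
    have wU : ∀ x, x ∈ oX ∪ {y | y = a ∧ (UX (kX i)).Lin} → x ∈ oX ∪ subjO .lin a := by
      rintro x (h | h)
      · exact .inl h
      · exact .inr ⟨h.1, rfl⟩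
    have wU' : ∀ x, x ∈ oY ∪ {y | y = co a ∧ (UY (kY j)).Lin} → x ∈ oY ∪ subjO .lin (co a) := by
      rintro x (h | h)
      · exact .inl h
      · exact .inr ⟨h.1, rfl⟩
    have hdU : Disjoint (oX ∪ {y | y = a ∧ (UX (kX i)).Lin})
        (oY ∪ {y | y = co a ∧ (UY (kY j)).Lin}) :=
      Set.disjoint_left.2 fun x h h' => Set.disjoint_left.1 hda (wU x h) (wU' x h')
    have hcom := WT.com hbi hbj ((hΓ.update hVw' _).update hVw _) nX nY (hCY.2.2.1 _) hT sX sY hdU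
    have hap : a ∉ p₂ := fun h => Set.disjoint_left.1 hdb (.inr haX) h
    have hbp : co a ∉ p₂ := fun h => Set.disjoint_left.1 hd' (.inr hbY') h
    set Γ1 := update (update Γ (co a) (some V')) a (some V) with hΓ1
    have e1 : Γ1 a = some V := update_self ..
    have e2 : Γ1 (co a) = some V' := by
      rw [hΓ1, update_of_ne hab.symm, update_self]
    have e3 : ∀ x, x ≠ a → x ≠ co a → Γ1 x = Γ x := fun x h1 h2 => by
      rw [hΓ1, update_of_ne h1, update_of_ne h2]
    have hR' : SoupWT Γ1 p₂ R := by
      refine hR.map fun A hA o ho hw => hw.weaken hΓ (.var (fun x hx T hT hl => ?_) fun x hx => ?_)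
      · have hne : ∀ z, z ∈ linNames Γ → x ≠ z := by
          rintro z ⟨T', hT', hl'⟩ rfl
          rw [hT] at hT'
          cases hT'
          exact hl hl'
        exact ⟨T, by rw [e3 x (hne _ hal) (hne _ hbl), hT], (hΓ x T hT).wsub_refl⟩
      · obtain ⟨T, hT, hl⟩ := (hw.own _ x hx).2
        refine ⟨T, T, hT, hl, ?_, (hΓ x T hT).wsub_refl⟩
        rw [e3 x (fun e => hap (e ▸ ho hx)) (fun e => hbp (e ▸ ho hx)), hT]
    have hsoup := SoupWT.cons hcom hR' (Set.disjoint_left.2 fun x h h' => by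
      rcases h with h | h
      · exact Set.disjoint_left.1 hdb (wU x h) h'
      · exact Set.disjoint_left.1 hd' (wU' x h) h')
    refine ⟨Γ1, (hΓ.update hVw' _).update hVw _, finite_update (finite_update hfin _ _) _ _, ?_,
      fun c hcC => ?_, fun x hx => ?_⟩
    · convert hsoup using 1
      refine Set.Subset.antisymm (fun x hx => ?_) fun x hx => (hsoup.own x hx).2
      obtain ⟨T, hT, hl⟩ := hx
      by_cases xa : x = a
      · subst xa
        rw [e1] at hT
        cases hT
        exact .inl (.inl (.inr ⟨rfl, hVU.lin_iff.1 hl⟩))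
      · by_cases xb : x = co a
        · subst xb
          rw [e2] at hT
          cases hT
          exact .inl (.inr (.inr ⟨rfl, hVU'.lin_iff.1 hl⟩))
        · rw [e3 x xa xb] at hT
          have : x ∈ linNames Γ := ⟨T, hT, hl⟩
          rw [e] at this
          rcases this with (h | h) | (h | h) | h
          · exact .inl (.inl (.inl h))
          · exact absurd h.1 xa
          · exact .inl (.inr (.inl h))
          · exact absurd h.1 xb
          · exact .inr h
    · by_cases hca : ch c = ch a
      · rcases eq_or_eq_co hca with rfl | rfl
        · exact ⟨V, V', e1, e2, hVV⟩
        · exact ⟨V', V, e2, by rw [co_co, e1], hVV.symm hVw hVw'⟩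
      · obtain ⟨T, T', h1, h2, h3⟩ := hdual c hcC
        refine ⟨T, T', ?_, ?_, h3⟩
        · rw [e3 c (by rintro rfl; exact hca rfl) (by rintro rfl; exact hca (ch_co a)), h1]
        · rw [e3, h2]
          · intro h
            exact hca (by rw [← h, ch_co])
          · intro h
            exact hca (by rw [← ch_co c, h, ch_co])
    · rw [e3, hdom x hx]
      · rintro rfl
        exact hx hc
      · rintro rfl
        exact hx (by rwa [ch_co])

theorem Good.sstep {Γ₀ C L C' L'} (h : Good Γ₀ C L) (hs : SStep C L C' L') : Good Γ₀ C' L' := by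
  cases hs with
  | ite hv hX hK =>
    exact (h.ite hv).flat hX fun c hc =>
      ⟨(hK c hc).2.1, fresh_of_names (Ann.ite_names hv) (hK c hc).2.2⟩
  | com X Y hy hc hi hj hl hX hK =>
    exact (h.com hy hc hi hj hl).flat hX fun c hc =>
      ⟨(hK c hc).2.1, fresh_of_names (Br.com_names hi hj) (hK c hc).2.2⟩

/-! ## Consequences of typing -/

theorem Good.dual {Γ₀ C R} {X Y : Br} (h : Good Γ₀ C (X.ann ::ₘ Y.ann ::ₘ R))
    (hy : Y.y = co X.y) (hc : ch X.y ∈ C) :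
    Y.q₂ = X.q₂ ∧ Y.vw = X.vw.dual ∧
      (X.vw = .int → ∀ i, ∃ j, X.lab i = Y.lab j ∧ (Y.act j).pol = (X.act i).pol.dual) := by
  obtain ⟨Γ, hΓ, hfin, hs, hdual, hdom⟩ := h
  obtain ⟨o₁, o₂, e, hd, hX, hR⟩ := hs.extract rfl
  obtain ⟨p₁, p₂, rfl, hd', hY, hR⟩ := hR.extract rfl
  obtain ⟨S, S', hS, hS', hdd⟩ := hdual _ hc
  change ChoiceWT Γ X.q₁ X.q₂ X.vw X.lab X.act (fun j => WT (X.P j)) (.var X.y) o₁ at hX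
  change ChoiceWT Γ Y.q₁ Y.q₂ Y.vw Y.lab Y.act (fun j => WT (Y.P j)) (.var Y.y) p₁ at hY
  rw [hy] at hY
  obtain @⟨_, S₁, m, labX, polX, TX, UX, kX, oX, hSX, hCX, hsX, hkX, hlX, hpX, hqX, hoX, hbX⟩ := hX
  obtain @⟨_, S₂, m', labY, polY, TY, UY, kY, oY, hSY, hCY, hsY, hkY, hlY, hpY, hqY, hoY, hbY⟩ := hY
  rw [hS] at hSX
  cases hSX
  rw [hS'] at hSY
  cases hSY
  obtain ⟨hq, hv, hex, hpay⟩ := hdd.choices (hΓ _ _ hS) (hΓ _ _ hS') hsX hsY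
  refine ⟨hq, hv, fun hint i => ?_⟩
  obtain ⟨j', h1, h2⟩ := hex hint (kX i)
  obtain ⟨j, rfl⟩ := hkY j'
  exact ⟨j, by rw [← hlX, h1, hlY], by rw [← hpY, h2, hpX]⟩

theorem Good.excl {Γ₀ C R} {X Y : Br} (h : Good Γ₀ C (X.ann ::ₘ Y.ann ::ₘ R))
    (hy : Y.y = X.y) : X.q₂ = .un := by
  obtain ⟨Γ, hΓ, hfin, hs, hdual, hdom⟩ := h
  obtain ⟨o₁, o₂, e, hd, hX, hR⟩ := hs.extract rfl
  obtain ⟨p₁, p₂, rfl, hd', hY, hR⟩ := hR.extract rfl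
  change ChoiceWT Γ X.q₁ X.q₂ X.vw X.lab X.act (fun j => WT (X.P j)) (.var X.y) o₁ at hX
  change ChoiceWT Γ Y.q₁ Y.q₂ Y.vw Y.lab Y.act (fun j => WT (Y.P j)) (.var Y.y) p₁ at hY
  rw [hy] at hY
  obtain @⟨_, S₁, m, labX, polX, TX, UX, kX, oX, hSX, hCX, hsX, hkX, hlX, hpX, hqX, hoX, hbX⟩ := hX
  obtain @⟨_, S₂, m', labY, polY, TY, UY, kY, oY, hSY, hCY, hsY, hkY, hlY, hpY, hqY, hoY, hbY⟩ := hY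
  rw [hSX] at hSY
  cases hSY
  cases hq : X.q₂ with
  | un => rfl
  | lin =>
    have h2 : Y.q₂ = .lin := Ty.lin_choice_iff.1 (hsY.lin_iff.1 (hsX.lin_iff.2
      (Ty.lin_choice_iff.2 hq)))
    exact (Set.disjoint_left.1 hd (Or.inr ⟨rfl, hq⟩) (.inl (.inr ⟨rfl, h2⟩))).elim

theorem Good.guard {Γ₀ C L A} (h : Good Γ₀ C L) (hA : A ∈ L) (hg : A.IsGuard) :
    (∃ v P Q, A = .ite v P Q) ∨ ∃ X : Br, A = X.ann ∧ (X.q₁ = .un → X.q₂ = .un) := by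
  obtain ⟨R, rfl⟩ := exists_cons_of_mem hA
  obtain ⟨Γ, hΓ, hfin, hs, hdual, hdom⟩ := h
  obtain ⟨o₁, o₂, e, hd, hw, hR⟩ := hs.extract rfl
  cases hg with
  | choice =>
    obtain @⟨y, S₁, m, labX, polX, TX, UX, kX, oX, hSX, hCX, hsX, hkX, hlX, hpX, hqX, hoX, hbX⟩ := hw
    exact .inr ⟨⟨_, _, _, y, _, _, _, _⟩, rfl, fun h => (hqX h).2⟩
  | ite => exact .inl ⟨_, _, _, rfl⟩

/-! ## Typing of the process of a system -/

theorem SoupWT.parList {Γ : Ctx} (l : List Ann) : ∀ {o}, SoupWT Γ o (l : Multiset Ann) →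
    WT (parList l) Γ o := by
  induction l with
  | nil =>
    intro o h
    generalize e : (([] : List Ann) : Multiset Ann) = M at h
    cases h with
    | nil => rfl
    | cons => exact absurd e.symm Multiset.cons_ne_zero
  | cons A l ih =>
    intro o h
    obtain ⟨o₁, o₂, rfl, hd, hA, hl⟩ := h.extract (Multiset.cons_coe A l).symm
    exact ⟨o₁, o₂, rfl, hd, hA, ih hl⟩

theorem WT.nu {A : Ann} {Γ Γ' : Ctx} {c : ℕ} (h : WT A Γ (linNames Γ)) (hΓ : CWF Γ)
    (hd : DualAt Γ (2 * c)) (he : ∀ x, ch x ≠ c → Γ' x = Γ x)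
    (hc : ∀ x, ch x = c → x ∉ linNames Γ') : WT (Calculus.nu c A) Γ' (linNames Γ') := by
  obtain ⟨T, U, hT, hU, hd⟩ := hd
  refine ⟨T, U, hΓ _ _ hT, hΓ _ _ hU, hd, ?_⟩
  change WT (A.subst (cls (2 * c))) _ _
  have case : ∀ x, (x = 2 * c ∧ cls (2 * c) x = .var 0) ∨ (x = co (2 * c) ∧ cls (2 * c) x = .var 1) ∨
      (ch x ≠ c ∧ cls (2 * c) x = .var (x + 2)) := by
    intro x
    by_cases hx : ch x = c
    · rcases eq_or_eq_co (show ch x = ch (2 * c) by simpa using hx) with rfl | rfl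
      all_goals simp_all
    · exact .inr (.inr ⟨hx, cls_of_ne (by simpa using hx)⟩)
  have emp : ∀ (z : ℕ) (S : Ty), ¬ S.Lin → (∅ : Set ℕ) = {y | y = z ∧ S.Lin} := by grind
  refine h.subst_eq hΓ ⟨?_, ?_, ?_⟩ ?_
  · intro x _ S hS hl
    rcases case x with ⟨rfl, e⟩ | ⟨rfl, e⟩ | ⟨hx, e⟩ <;> rw [e]
    · rw [hT] at hS
      cases hS
      exact ⟨T, rfl, (hΓ _ _ hT).wsub_refl, emp _ _ hl⟩
    · rw [hU] at hS
      cases hS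
      exact ⟨U, rfl, (hΓ _ _ hU).wsub_refl, emp _ _ hl⟩
    · exact ⟨S, (he x hx).trans hS, (hΓ _ _ hS).wsub_refl, emp _ _ hl⟩
  · rintro x ⟨S, hS, hl⟩
    rcases case x with ⟨rfl, e⟩ | ⟨rfl, e⟩ | ⟨hx, e⟩ <;> rw [e]
    · rw [hT] at hS
      cases hS
      exact ⟨T, 0, T, hT, hl, rfl, rfl, (hΓ _ _ hT).wsub_refl⟩
    · rw [hU] at hS
      cases hS
      exact ⟨U, 1, U, hU, hl, rfl, rfl, (hΓ _ _ hU).wsub_refl⟩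
    · exact ⟨S, x + 2, S, hS, hl, rfl, (he x hx).trans hS, (hΓ _ _ hS).wsub_refl⟩
  · grind
  · ext z
    constructor
    · rintro ⟨x, ⟨S, hS, hl⟩, hz⟩
      rcases case x with ⟨rfl, e⟩ | ⟨rfl, e⟩ | ⟨hx, e⟩ <;> rw [e] at hz <;> cases hz
      · rw [hT] at hS
        cases hS
        exact mem_liftO_zero.2 hl
      · rw [hU] at hS
        cases hS
        exact (mem_liftO_succ (x := 0)).2 (mem_liftO_zero.2 hl)
      · exact (mem_liftO_succ (x := x + 1)).2 (mem_liftO_succ.2 ⟨S, (he x hx).trans hS, hl⟩)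
    · intro hz
      match z, hz with
      | 0, hz => exact ⟨2 * c, ⟨T, hT, mem_liftO_zero.1 hz⟩, cls_self _⟩
      | 1, hz => exact ⟨co (2 * c), ⟨U, hU, mem_liftO_zero.1 ((mem_liftO_succ (x := 0)).1 hz)⟩,
          cls_co _⟩
      | z + 2, hz =>
        have hz := mem_liftO_succ.1 ((mem_liftO_succ (x := z + 1)).1 hz)
        have hne : ch z ≠ c := fun h => hc z h hz
        obtain ⟨S, hS, hl⟩ := hz
        exact ⟨z, ⟨S, (he z hne).symm.trans hS, hl⟩, cls_of_ne (by simpa using hne)⟩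

/-- Replaces the types of the ends of the channels `l`. -/
noncomputable def closeCtx (Γ₀ Γ : Ctx) (l : List ℕ) : Ctx := fun x =>
  if ch x ∈ l then (Γ₀ x).map fun _ => .fin else Γ x

theorem closeCtx_of_mem {Γ₀ Γ : Ctx} {l : List ℕ} {x T} (h : ch x ∈ l)
    (hx : closeCtx Γ₀ Γ l x = some T) : T = .fin := by
  rw [closeCtx, if_pos h, Option.map_eq_some_iff] at hx
  obtain ⟨_, _, h⟩ := hx
  exact h.symm

theorem CWF.closeCtx {Γ₀ Γ : Ctx} (h : CWF Γ) (l : List ℕ) : CWF (closeCtx Γ₀ Γ l) := by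
  intro x T hx
  by_cases hc : ch x ∈ l
  · rw [closeCtx_of_mem hc hx]
    trivial
  · rw [Mix.closeCtx, if_neg hc] at hx
    exact h x T hx

theorem not_mem_linNames_closeCtx {Γ₀ Γ : Ctx} {l : List ℕ} {x} (h : ch x ∈ l) :
    x ∉ linNames (closeCtx Γ₀ Γ l) := by
  rintro ⟨T, hT, hl⟩
  rw [closeCtx_of_mem h hT] at hl
  obtain ⟨_, _, _, _, _, _, h⟩ := hl
  cases h

theorem WT.nuList {A : Ann} {Γ₀ Γ : Ctx} (h : WT A Γ (linNames Γ)) (hΓ : CWF Γ) (l : List ℕ) :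
    l.Nodup → (∀ c ∈ l, DualAt Γ (2 * c)) →
    WT (nuList l A) (closeCtx Γ₀ Γ l) (linNames (closeCtx Γ₀ Γ l)) := by
  induction l with
  | nil => aesop
  | cons c l ih =>
    intro hl hd
    rw [List.nodup_cons] at hl
    have hne : ∀ x, ch x = c → closeCtx Γ₀ Γ l x = Γ x := by
      rintro x rfl
      rw [closeCtx, if_neg hl.1]
    refine (ih hl.2 fun d hd' => hd d (by simp [hd'])).nu (hΓ.closeCtx l) (c := c) ?_ ?_ ?_
    · obtain ⟨T, T', h1, h2, h3⟩ := hd c (by simp)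
      exact ⟨T, T', by rw [hne _ (by simp), h1], by rw [hne _ (by simp), h2], h3⟩
    · intro x hx
      simp only [closeCtx, List.mem_cons, hx, false_or]
    · intro x hx
      exact not_mem_linNames_closeCtx (by simp [hx])

theorem Good.typing {Γ₀ C L} (h : Good Γ₀ C L) (hC : C.Nodup) (hfin₀ : {x | Γ₀ x ≠ none}.Finite) :
    ∃ (Γ : Ctx) (D : Typing Γ (sys C L).erase), Γ.WF ∧ (∀ x, Γ x = none ↔ Γ₀ x = none) ∧
      D.encode = (sys C L).enc := by
  obtain ⟨Γ, hΓ, hfin, hs, hdual, hdom⟩ := h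
  rw [← coe_toList L] at hs
  have hw := (hs.parList).nuList (Γ₀ := Γ₀) hΓ C.toList
    (by rw [← Multiset.coe_nodup, coe_toList]; exact hC)
    fun c hc => hdual _ (by simpa using hc)
  have hwf := hΓ.closeCtx (Γ₀ := Γ₀) C.toList
  obtain ⟨D, hD⟩ := WT.typing _ hwf hw
  have hnone : ∀ x, realCtx (closeCtx Γ₀ Γ C.toList) (linNames (closeCtx Γ₀ Γ C.toList)) x = none ↔
      Γ₀ x = none := by
    intro x
    have h1 : closeCtx Γ₀ Γ C.toList x = none ↔ Γ₀ x = none := by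
      by_cases hx : ch x ∈ C
      · rw [closeCtx, if_pos (by simpa using hx), Option.map_eq_none_iff]
      · rw [closeCtx, if_neg (by simpa using hx), hdom x hx]
    rw [← h1, realCtx_none, Option.eq_none_iff_forall_not_mem]
    refine forall_congr' fun S => ⟨fun h hS => ?_, fun h hS => (h hS).elim⟩
    exact (h hS).2 ⟨S, hS, (h hS).1⟩
  refine ⟨_, D, ⟨?_, ?_⟩, hnone, hD⟩
  · grind
  · intro x T hT
    obtain ⟨S, hS, _, rfl⟩ := realCtx_eq.1 hT
    exact (hwf x S hS).real

theorem Typing.good {Γ : Ctx} {P : Proc} (hΓ : Γ.WF) (D : Typing Γ P) : Good Γ 0 {D.ann} := by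
  refine ⟨Γ, hΓ.2, hΓ.1, ?_, by simp, fun _ _ => .rfl⟩
  have := SoupWT.cons (D.wt hΓ.2 fun x T hx => hx) .nil (Set.disjoint_empty _)
  simpa using this

open CMV Enc

/-! ## States of encoded choices -/

/-- The pair of label and polarity that matches `κ`. -/
def dualKey (κ : Label × Pol) : Label × Pol := (κ.1, κ.2.dual)

namespace Br

/-- The encoded continuations. -/
def encP (X : Br) : Fin X.n → CMV.Proc := fun j => (X.P j).enc

/-- The endpoint by which a choice restarts itself, if it is unrestricted; `u` is its server. -/
def uv (X : Br) (u : ℕ) : Option Val :=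
  match X.q₁ with
  | .lin => none
  | .un => some (.var (2 * u))

/-- The private channel of an unrestricted choice. -/
def upriv (X : Br) (u : ℕ) : Multiset ℕ :=
  match X.q₁ with
  | .lin => 0
  | .un => {u}

/-- The pairs of label and polarity of a choice. -/
def keys (X : Br) : List (Label × Pol) := Enc.keys X.lab X.act

/-- The pair of label and polarity of a summand. -/
def key (X : Br) (j : Fin X.n) : Label × Pol := (X.lab j, (X.act j).pol)

/-- The encoded choice ready to communicate. -/
def head (X : Br) (u : ℕ) : CMV.Proc := headV X.lab X.act X.encP X.q₂ X.vw (.var X.y) (X.uv u)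

/-- The choice among the summands with label and polarity `κ`. -/
def alts (X : Br) (u e : ℕ) (κ : Label × Pol) : CMV.Proc :=
  altsV X.lab X.act X.encP (.var e) (X.uv u) κ

/-- A summand. -/
def alt (X : Br) (u e : ℕ) (j : Fin X.n) : CMV.Proc := altV (.var e) (X.uv u) (X.act j) (X.encP j)

/-- The branching of an external choice. -/
def offer (X : Br) (u e : ℕ) : CMV.Proc := offerL (.var e) X.keys (X.alts u e)

/-- The replicated input of an unrestricted choice. -/
def server (X : Br) (u : ℕ) : CMV.Proc :=
  .inp .un (.var (co (2 * u))) (headV X.lab (actS X.act (shift 1)) (contS X.act X.encP (shift 1)) .un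
    X.vw (.var (X.y + 1)) (some (.var (2 * u + 1))))

/-- The server of a choice, if it is unrestricted. -/
def srv (X : Br) (u : ℕ) : Multiset CMV.Proc :=
  match X.q₁ with
  | .lin => 0
  | .un => {X.server u}

/-- The server of an unrestricted choice together with the message that starts it. -/
def ready (X : Br) (u : ℕ) : Multiset CMV.Proc :=
  match X.q₁ with
  | .lin => 0
  | .un => {.out (.var (2 * u)) .unit .inact, X.server u}

/-- A choice among summands before or after it has been resolved. -/
def Half (X : Br) (u e : ℕ) (κ : Label × Pol) (P : CMV.Proc) : Prop :=
  P = X.alts u e κ ∨ ∃ j, X.key j = κ ∧ P = X.alt u e j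

/-- Unrestricted choices have unrestricted types. -/
def Ok (X : Br) : Prop := X.q₁ = .un → X.q₂ = .un

/-- The selection of a branch. -/
abbrev pick (X : Br) (u e : ℕ) (κ : Label × Pol) : CMV.Proc :=
  .sel (.var e) (.tag κ.1 κ.2) (X.alts u e κ)

/-- The invitation to a session for a branch. -/
abbrev call (X : Br) (u c : ℕ) (κ : Label × Pol) : CMV.Proc :=
  .out (.var X.y) (.var (2 * c)) (X.pick u (co (2 * c)) κ)

/-- The subject of `X` after the selection is `e`. -/
def SessAt (X : Br) (e : ℕ) (B : Multiset ℕ) : Prop :=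
  X.q₂ = .lin ∧ e = X.y ∧ B = 0 ∨ X.q₂ = .un ∧ B = {ch e}

end Br

/-- `Item C S p E w`: the private channels `p` and target processes `E` implement the source
processes `S`; `w` is the number of communications that have been started. -/
inductive Item (C : Multiset ℕ) : Multiset Ann → Multiset ℕ → Multiset CMV.Proc → ℕ → Prop
  | ite (v A B) : Item C {.ite v A B} 0 {.ite v A.enc B.enc} 0
  | load (X : Br) (u) : X.q₁ = .un → X.q₂ = .un → Item C {X.ann} (X.upriv u) (X.ready u) 0
  | idle (X : Br) (u) : X.Ok → Item C {X.ann} (X.upriv u) (X.head u ::ₘ X.srv u) 0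
  | comL (X : Br) (u κ) : X.q₁ = .lin → X.q₂ = .lin → X.vw = .int → κ ∈ X.keys →
      Item C {X.ann} 0 {X.pick u X.y κ} 1
  | comU (X : Br) (u c κ) : X.q₂ = .un → X.vw = .int → κ ∈ X.keys →
      Item C {X.ann} (c ::ₘ X.upriv u) (X.call u c κ ::ₘ X.srv u) 1
  | sb (X Y : Br) (u u' c κ) : X.q₂ = .un → Y.q₂ = .un → Y.y = co X.y → ch X.y ∈ C →
      κ ∈ X.keys → dualKey κ ∈ Y.keys →
      Item C (X.ann ::ₘ {Y.ann}) (c ::ₘ (X.upriv u + Y.upriv u'))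
        (X.pick u (co (2 * c)) κ ::ₘ
          Y.offer u' (2 * c) ::ₘ (X.srv u + Y.srv u')) 1
  | pair (X Y : Br) (u u' e κ B) {P Q} : X.Ok → Y.Ok → Y.q₂ = X.q₂ → Y.y = co X.y → ch X.y ∈ C →
      κ ∈ X.keys → dualKey κ ∈ Y.keys → X.SessAt e B → X.Half u e κ P →
      Y.Half u' (co e) (dualKey κ) Q →
      Item C (X.ann ::ₘ {Y.ann}) (B + (X.upriv u + Y.upriv u'))
        (P ::ₘ Q ::ₘ (X.srv u + Y.srv u')) 1

/-- The representation of the source processes `L` by target processes `E` with private channels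
`D`. -/
inductive Rep (C : Multiset ℕ) : Multiset Ann → Multiset ℕ → Multiset CMV.Proc → ℕ → Prop
  | nil (D) : Rep C 0 D 0 0
  | cons {S L p D e E w n} : Item C S p e w → Rep C L D E n →
      Rep C (S + L) (p + D) (e + E) (w + n)

/-! ### Free names -/

/-- The substitution that removes a name. -/
def kill (x z : ℕ) : Val := if z = x then .tt else .var z

theorem kill_of_ne {x z : ℕ} (h : z ≠ x) : kill x z = .var z := if_neg h

theorem not_mem_FV_of_kill {x : ℕ} {P : CMV.Proc} (h : P.subst (kill x) = P) : x ∉ P.FV := by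
  rw [← h, CMV.Proc.mem_FV_subst]
  rintro ⟨y, _, hy⟩
  by_cases e : y = x
  · simp [kill, e] at hy
  · rw [kill_of_ne e] at hy
    cases hy
    exact e rfl

theorem kill_eq_of_not_mem {x : ℕ} {A : Ann} (h : x ∉ A.FV) : A.subst (kill x) = A :=
  (A.subst_congr fun z hz => kill_of_ne (by rintro rfl; exact h hz)).trans A.subst_id

theorem Ann.mem_FV_of_mem_enc {A : Ann} {x : ℕ} (h : x ∈ A.enc.FV) : x ∈ A.FV := by
  by_contra hx
  refine not_mem_FV_of_kill ?_ h
  rw [← Ann.enc_subst, kill_eq_of_not_mem hx]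

namespace Br

variable {X : Br} {x u e : ℕ}

theorem kill_ann (h : x ∉ X.ann.FV) : X.y ≠ x ∧ actS X.act (kill x) = X.act ∧
    contS X.act X.encP (kill x) = X.encP := by
  have := kill_eq_of_not_mem h
  simp only [ann, Ann.subst, Val.subst_var, Ann.choice.injEq, heq_eq_eq, true_and] at this
  obtain ⟨h1, h2, h3⟩ := this
  refine ⟨?_, h2, ?_⟩
  · intro e
    rw [e] at h1
    simp [kill] at h1
  · funext j
    have := congrArg Ann.enc (congrFun h3 j)
    rwa [Ann.enc_subst] at this

theorem kill_uv (h : ∀ c ∈ X.upriv u, ch x ≠ c) : (X.uv u).map (·.subst (kill x)) = X.uv u := by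
  unfold upriv at h
  unfold uv
  cases hq : X.q₁ with
  | lin => rfl
  | un =>
    rw [hq] at h
    simp only [mem_singleton, forall_eq] at h
    have : 2 * u ≠ x := by rintro rfl; simp at h
    simp [kill_of_ne this]

theorem kill_alts (h : x ∉ X.ann.FV) (hu : ∀ c ∈ X.upriv u, ch x ≠ c) (he : e ≠ x)
    (κ : Label × Pol) : (X.alts u e κ).subst (kill x) = X.alts u e κ := by
  obtain ⟨_, h2, h3⟩ := kill_ann h
  rw [alts, altsV_subst, h2, h3, kill_uv hu, Val.subst_var, kill_of_ne he]

theorem kill_alt (h : x ∉ X.ann.FV) (hu : ∀ c ∈ X.upriv u, ch x ≠ c) (he : e ≠ x)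
    (j : Fin X.n) : (X.alt u e j).subst (kill x) = X.alt u e j := by
  obtain ⟨_, h2, h3⟩ := kill_ann h
  have h2 : (X.act j).subst (kill x) = X.act j := congrFun h2 j
  have h3 : (X.encP j).subst ((X.act j).under (kill x)) = X.encP j := congrFun h3 j
  rw [alt, altV_subst, h2, h3, kill_uv hu, Val.subst_var, kill_of_ne he]

theorem kill_offer (h : x ∉ X.ann.FV) (hu : ∀ c ∈ X.upriv u, ch x ≠ c) (he : e ≠ x) :
    (X.offer u e).subst (kill x) = X.offer u e := by
  rw [offer, offerL_subst, Val.subst_var, kill_of_ne he]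
  simp only [kill_alts h hu he]

theorem kill_head (h : x ∉ X.ann.FV) (hu : ∀ c ∈ X.upriv u, ch x ≠ c) :
    (X.head u).subst (kill x) = X.head u := by
  obtain ⟨h1, h2, h3⟩ := kill_ann h
  rw [head, headV_subst, h2, h3, kill_uv hu, Val.subst_var, kill_of_ne h1]

theorem up_kill (x : ℕ) : up (kill x) = kill (x + 1) := by
  funext z
  cases z with
  | zero => simp [kill]
  | succ z =>
    by_cases h : z = x
    · subst h; simp [kill]; rfl
    · rw [up_succ, kill_of_ne h, kill_of_ne (by simpa using h)]; rfl

theorem kill_server (h : x ∉ X.ann.FV) (hu : ch x ≠ u) :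
    (X.server u).subst (kill x) = X.server u := by
  obtain ⟨h1, h2, h3⟩ := kill_ann h
  have hx : 2 * u ≠ x := by rintro rfl; simp at hu
  have hx' : co (2 * u) ≠ x := by rintro rfl; simp at hu
  rw [server, CMV.Proc.subst, Val.subst_var, kill_of_ne hx', headV_subst, actS_shift_one,
    contS_shift_one, h2, h3, up_kill, Val.subst_var, kill_of_ne (by simpa using h1)]
  simp [kill_of_ne (show 2 * u + 1 ≠ x + 1 by simpa using hx)]

theorem mem_srv {P : CMV.Proc} (h : P ∈ X.srv u) : X.q₁ = .un ∧ P = X.server u := by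
  unfold srv at h
  split at h
  · simp at h
  · simp_all

theorem mem_upriv {c : ℕ} : c ∈ X.upriv u ↔ X.q₁ = .un ∧ c = u := by
  unfold upriv
  cases X.q₁ <;> simp

theorem kill_srv (h : x ∉ X.ann.FV) (hu : ∀ c ∈ X.upriv u, ch x ≠ c) {P : CMV.Proc}
    (hP : P ∈ X.srv u) : P.subst (kill x) = P := by
  obtain ⟨hq, rfl⟩ := mem_srv hP
  exact kill_server h (hu u (mem_upriv.2 ⟨hq, rfl⟩))

theorem kill_half (h : x ∉ X.ann.FV) (hu : ∀ c ∈ X.upriv u, ch x ≠ c) (he : e ≠ x)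
    {κ : Label × Pol} {P : CMV.Proc} (hP : X.Half u e κ P) : P.subst (kill x) = P := by
  rcases hP with rfl | ⟨j, _, rfl⟩
  · exact kill_alts h hu he κ
  · exact kill_alt h hu he j

theorem y_mem_FV (X : Br) : X.y ∈ X.ann.FV := .inl rfl

end Br

theorem Item.mem_FV {C S p e w} (h : Item C S p e w) {P : CMV.Proc} (hP : P ∈ e) {x : ℕ}
    (hx : x ∈ P.FV) : (∃ A ∈ S, x ∈ A.FV) ∨ ch x ∈ p := by
  by_contra hn
  rw [not_or, not_exists] at hn
  obtain ⟨h0, h2⟩ := hn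
  have h1 : ∀ X : Br, X.ann ∈ S → x ∉ X.ann.FV := fun X hA hx => h0 _ ⟨hA, hx⟩
  have h2 : ∀ s ⊆ p, ∀ c ∈ s, ch x ≠ c := fun s hs c hc e => h2 (e ▸ hs hc)
  have hk : ∀ c ∈ p, 2 * c ≠ x ∧ co (2 * c) ≠ x := fun c hc => by
    have := h2 {c} (by simpa using hc) c (by simp)
    constructor <;> rintro rfl <;> simp at this
  have one : ∀ {X : Br} {u : ℕ}, X.ann ∈ S → X.upriv u ⊆ p → x ∉ X.ann.FV ∧
      (∀ c ∈ X.upriv u, ch x ≠ c) ∧ X.y ≠ x ∧ P ∉ X.srv u := fun {X u} hX hu =>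
    ⟨h1 X hX, h2 _ hu, (Br.kill_ann (h1 X hX)).1, fun hP =>
      not_mem_FV_of_kill (Br.kill_srv (h1 X hX) (h2 _ hu) hP) hx⟩
  cases h with
  | ite v A B =>
    obtain rfl := mem_singleton.1 hP
    exact h0 _ ⟨by simp, Ann.mem_FV_of_mem_enc (A := .ite v A B) hx⟩
  | load X u hq =>
    obtain ⟨hX, hu, -, hs⟩ := one (X := X) (u := u) (by simp) (by simp)
    rw [Br.ready, hq] at hP
    rw [Br.srv, hq] at hs
    simp only [Multiset.insert_eq_cons, mem_cons, hs, or_false] at hP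
    subst hP
    have := hk u (Br.mem_upriv.2 ⟨hq, rfl⟩)
    simp_all [CMV.Proc.FV, Val.fv]
  | idle X u =>
    obtain ⟨hX, hu, -, hs⟩ := one (X := X) (u := u) (by simp) (by simp)
    obtain rfl := (mem_cons.1 hP).resolve_right hs
    exact not_mem_FV_of_kill (Br.kill_head hX hu) hx
  | comL X u κ hq =>
    obtain ⟨hX, hu, hy, -⟩ := one (X := X) (u := u) (by simp) (by simp [Br.upriv, hq])
    obtain rfl := mem_singleton.1 hP
    refine not_mem_FV_of_kill ?_ hx
    rw [CMV.Proc.subst, Val.subst_var, kill_of_ne hy, Br.kill_alts hX hu hy]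
  | comU X u c κ hq =>
    obtain ⟨hX, hu, hy, hs⟩ := one (X := X) (u := u) (by simp) (Multiset.subset_cons _ _)
    obtain ⟨hc1, hc2⟩ := hk c (by simp)
    obtain rfl := (mem_cons.1 hP).resolve_right hs
    refine not_mem_FV_of_kill ?_ hx
    simp only [CMV.Proc.subst, Val.subst_var, kill_of_ne hy, kill_of_ne hc1, kill_of_ne hc2,
      Br.kill_alts hX hu hc2]
  | sb X Y u u' c κ =>
    obtain ⟨hX, hu, -, hs⟩ := one (X := X) (u := u) (by simp) fun _ => by simp +contextual
    obtain ⟨hY, hu', -, hs'⟩ := one (X := Y) (u := u') (by simp) fun _ => by simp +contextual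
    obtain ⟨hc1, hc2⟩ := hk c (by simp)
    refine not_mem_FV_of_kill ?_ hx
    simp only [mem_cons, mem_add, hs, hs', or_false] at hP
    rcases hP with rfl | rfl
    · simp only [CMV.Proc.subst, Val.subst_var, kill_of_ne hc2, Br.kill_alts hX hu hc2]
    · exact Br.kill_offer hY hu' hc1
  | pair X Y u u' e κ B _ _ _ hy _ _ _ he hX' hY' =>
    obtain ⟨hX, hu, hyX, hs⟩ := one (X := X) (u := u) (by simp) fun _ => by simp +contextual
    obtain ⟨hY, hu', hyY, hs'⟩ := one (X := Y) (u := u') (by simp) fun _ => by simp +contextual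
    have hex : e ≠ x ∧ co e ≠ x := by
      rcases he with ⟨_, rfl, _⟩ | ⟨_, rfl⟩
      · exact ⟨hyX, hy ▸ hyY⟩
      · have hc : ch x ≠ ch e := h2 {ch e} (by simp) _ (by simp)
        constructor <;> rintro rfl <;> simp at hc
    refine not_mem_FV_of_kill ?_ hx
    simp only [mem_cons, mem_add, hs, hs', or_false] at hP
    rcases hP with rfl | rfl
    · exact Br.kill_half hX hu hex.1 hX'
    · exact Br.kill_half hY hu' hex.2 hY'

theorem Rep.mem_FV {C L D E n} (h : Rep C L D E n) {P : CMV.Proc} (hP : P ∈ E) {x : ℕ}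
    (hx : x ∈ P.FV) : (∃ A ∈ L, x ∈ A.FV) ∨ ch x ∈ D := by
  induction h with
  | nil => simp at hP
  | cons h _ ih =>
    rcases mem_add.1 hP with hP | hP
    · exact (h.mem_FV hP hx).imp (fun ⟨A, hA, h⟩ => ⟨A, by simp [hA], h⟩) (by simp +contextual)
    · grind

/-! ### Operations on representations -/

theorem Item.mono {C C' S p e w} (h : Item C S p e w) (hC : ∀ c ∈ C, c ∈ C') :
    Item C' S p e w := by
  cases h <;> constructor <;> first | assumption | exact hC _ ‹_›

theorem Rep.mono {C C' L D E n} (h : Rep C L D E n) (hC : ∀ c ∈ C, c ∈ C') : Rep C' L D E n := by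
  induction h with
  | nil => exact .nil _
  | cons h _ ih => exact .cons (h.mono hC) ih

theorem Rep.add {C L D E n L' D' E' n'} (h : Rep C L D E n) (h' : Rep C L' D' E' n') :
    Rep C (L + L') (D + D') (E + E') (n + n') := by
  induction h with
  | nil D =>
    have : ∀ {L' D' E' n'}, Rep C L' D' E' n' → Rep C L' (D + D') E' n' := by
      intro L' D' E' n' h
      induction h with
      | nil => exact .nil _
      | cons h _ ih =>
        rw [add_left_comm]
        exact .cons h ih
    simpa using this h'
  | cons h _ ih =>
    rw [add_assoc, add_assoc, add_assoc, add_assoc]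
    exact .cons h ih

theorem Rep.garbage {C L D E n} (h : Rep C L D E n) (B : Multiset ℕ) : Rep C L (B + D) E n := by
  simpa using (Rep.nil (C := C) B).add h

theorem Item.rep {C S p e w} (h : Item C S p e w) : Rep C S p e w := by
  simpa using Rep.cons h (.nil 0)

/-- A representation with an item in focus. -/
structure Focus (C : Multiset ℕ) (L : Multiset Ann) (D : Multiset ℕ) (E : Multiset CMV.Proc) (n : ℕ)
    (S : Multiset Ann) (p : Multiset ℕ) (e : Multiset CMV.Proc) (w : ℕ)
    (L' : Multiset Ann) (D' : Multiset ℕ) (E' : Multiset CMV.Proc) (n' : ℕ) : Prop where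
  item : Item C S p e w
  rep : Rep C L' D' E' n'
  src : L = S + L'
  priv : D = p + D'
  elems : E = e + E'
  weight : n = w + n'

theorem Rep.focus {C L D E n} (h : Rep C L D E n) (Q : Multiset Ann → Multiset CMV.Proc → Prop)
    (h0 : ¬ Q 0 0) (hQ : ∀ S e L E, Q (S + L) (e + E) → Q S e ∨ Q L E) (hL : Q L E) :
    ∃ S p e w L' D' E' n', Focus C L D E n S p e w L' D' E' n' ∧ Q S e := by
  induction h with
  | nil => exact absurd hL h0
  | @cons S L p D e E w n h hr ih =>
    rcases hQ _ _ _ _ hL with hL | hL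
    · exact ⟨_, _, _, _, _, _, _, _, ⟨h, hr, rfl, rfl, rfl, rfl⟩, hL⟩
    · obtain ⟨S', p', e', w', L', D', E', n', ⟨h1, h2, rfl, rfl, rfl, rfl⟩, hm⟩ := ih hL
      exact ⟨S', p', e', w', S + L', p + D', e + E', w + n', ⟨h1, .cons h h2, add_left_comm _ _ _,
        add_left_comm _ _ _, add_left_comm _ _ _, add_left_comm _ _ _⟩, hm⟩

theorem Rep.focus_elem {C L D E n} (h : Rep C L D E n) {P : CMV.Proc} (hP : P ∈ E) :
    ∃ S p e w L' D' E' n', Focus C L D E n S p e w L' D' E' n' ∧ P ∈ e :=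
  h.focus (fun _ e => P ∈ e) (by simp) (by simp) hP

theorem Rep.focus_src {C L D E n} (h : Rep C L D E n) {A : Ann} (hA : A ∈ L) :
    ∃ S p e w L' D' E' n', Focus C L D E n S p e w L' D' E' n' ∧ A ∈ S :=
  h.focus (fun S _ => A ∈ S) (by simp) (by simp) hA

/-! ## Encodings of flattened processes -/

theorem fresh_enc {A : Ann} {c : ℕ} (h : Fresh c A) : Fresh c A.enc := fun x hx =>
  h x (Ann.mem_FV_of_mem_enc hx)

theorem flat_enc {A : Ann} {G K} (h : Flat A G K) : CMV.Cong A.enc (sys K (G.map Ann.enc)) := by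
  induction h with
  | guard => exact (sys_zero_singleton (P := CMV.Proc) _ : CMV.Cong _ _).symm
  | inact =>
    change CMV.Cong .inact _
    rw [Multiset.map_zero, Calculus.sys, nuM_zero, Calculus.parM_zero]
    exact .refl _
  | @par p q M N K J hp hq h1 h2 ih1 ih2 =>
    have h3 : ∀ c ∈ K, ∀ r ∈ ({sys J (N.map Ann.enc)} : Multiset CMV.Proc), Fresh c r := by
      simp only [mem_singleton, forall_eq]
      intro c hc x hx
      obtain ⟨⟨P, hP, hx⟩, _⟩ := (Calculus.mem_FV_sys (P := CMV.Proc)).1 hx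
      obtain ⟨A, hA, rfl⟩ := mem_map.1 hP
      rcases hq.mem_FV ⟨A, hA, Ann.mem_FV_of_mem_enc hx⟩ with hx | hx
      · exact (h1 c hc).1 x hx
      · grind
    have h4 : ∀ c ∈ J, ∀ r ∈ M.map Ann.enc, Fresh c r := by
      intro c hc r hr
      obtain ⟨A, hA, rfl⟩ := mem_map.1 hr
      refine fresh_enc fun x hx => ?_
      rcases hp.mem_FV ⟨A, hA, hx⟩ with hx | hx
      · aesop
      · grind
    refine (CMV.Cong.par ih1 ih2).trans ?_
    refine (sys_zero_singleton (P := CMV.Proc) _ : CMV.Cong _ _).symm.trans ?_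
    refine (sys_par (P := CMV.Proc) 0 _ _ 0 : CMV.Cong _ _).trans ?_
    refine (sys_nuM (P := CMV.Proc) h3 : CMV.Cong _ _).trans ?_
    rw [add_comm (M.map _), singleton_add]
    refine (sys_nuM (P := CMV.Proc) h4 : CMV.Cong _ _).trans ?_
    rw [add_zero, add_comm J, ← Multiset.map_add, add_comm N]
    exact .refl _
  | @res p M K a hp _ h ih =>
    have e : (Calculus.subst (opn a) p : Ann).enc = p.enc.subst (opn a) := p.enc_subst _
    rw [e] at ih
    have hf : Fresh (ch a) (CMV.Proc.res p.enc) := fresh_enc (A := .res p) h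
    refine (Calculus.nu_opn (P := CMV.Proc) hf : CMV.Cong _ _).symm.trans ?_
    refine (Calculus.cong_nu (P := CMV.Proc) (ch a) ih : CMV.Cong _ _).trans ?_
    exact (nuM_cons (P := CMV.Proc) _ _ _ : CMV.Cong _ _).symm

namespace Br

variable {X : Br} {u : ℕ}

theorem enc_lin (h : X.q₁ = .lin) (u : ℕ) : X.ann.enc = X.head u := by
  simp only [ann, Ann.enc, h, choiceV, head, uv]
  rfl

theorem shift_opn (k a : ℕ) : (fun x => (shift (k + 2) x).subst (up^[k] (opn a))) = shift k := by
  induction k with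
  | zero => rfl
  | succ k ih =>
    funext x
    have := congrFun ih x
    rw [Function.iterate_succ', Function.comp]
    change up _ (x + (k + 2) + 1) = _
    rw [up_succ]
    change (Val.rename _ (Val.subst _ (.var (x + (k + 2))))) = _
    rw [this]
    rfl

theorem enc_un (h : X.q₁ = .un) : ∃ p, X.ann.enc = .res p ∧
    ∀ u, p.subst (opn (2 * u)) = .par (.out (.var (2 * u)) .unit .inact) (X.server u) := by
  refine ⟨_, by simp only [ann, Ann.enc, h, choiceV]; rfl, fun u => ?_⟩
  have e : (fun x => (shift 3 x).subst (up (opn (2 * u)))) = shift 1 := shift_opn 1 (2 * u)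
  simp only [CMV.Proc.subst, headV_subst, actS_actS, contS_contS, server, e]
  rfl

theorem shift_inst (v : Val) : (fun x => (shift 1 x).subst (inst v)) = Val.var := rfl

theorem actS_id (act : Fin X.n → Act) : actS act .var = act := actS_zero act

theorem contS_id (E : Fin X.n → CMV.Proc) : contS X.act E .var = E := contS_zero X.act E

theorem server_inst (h : X.q₁ = .un) (hX : X.Ok) :
    (headV X.lab (actS X.act (shift 1)) (contS X.act X.encP (shift 1)) .un X.vw (.var (X.y + 1))
      (some (.var (2 * u + 1)))).subst (inst .unit) = X.head u := by
  rw [headV_subst, actS_actS, contS_contS, shift_inst, actS_id, contS_id, head, hX h, uv, h]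
  rfl

theorem head_lin_int (h : X.q₂ = .lin) (hv : X.vw = .int) :
    X.head u = nd (X.keys.map fun κ => X.pick u X.y κ) := by
  simp only [head, h, hv, headV]
  rfl

theorem head_lin_ext (h : X.q₂ = .lin) (hv : X.vw = .ext) : X.head u = X.offer u X.y := by
  simp only [head, h, hv, headV]
  rfl

theorem head_un_int (h : X.q₂ = .un) (hv : X.vw = .int) :
    ∃ f : Label × Pol → CMV.Proc, X.head u = nd (X.keys.map fun κ => .res (f κ)) ∧
      ∀ κ c, (f κ).subst (opn (2 * c)) = X.call u c κ := by
  refine ⟨_, by simp only [head, h, hv, headV]; rfl, fun κ c => ?_⟩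
  have e : (fun x => (shift 2 x).subst (opn (2 * c))) = Val.var := shift_opn 0 (2 * c)
  simp only [call, pick, CMV.Proc.subst, altsV_subst, actS_actS, contS_contS, e, actS_id, contS_id, alts]
  unfold uv
  cases X.q₁ <;> rfl

theorem head_un_ext (h : X.q₂ = .un) (hv : X.vw = .ext) :
    ∃ Q, X.head u = .inp .lin (.var X.y) Q ∧ ∀ c, Q.subst (inst (.var c)) = X.offer u c := by
  refine ⟨_, by simp only [head, h, hv, headV]; rfl, fun c => ?_⟩
  simp only [offerL_subst, altsV_subst, actS_actS, contS_contS, shift_inst, actS_id, contS_id]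
  change _ = offerL (.var c) (Enc.keys X.lab X.act) fun κ =>
    altsV X.lab X.act X.encP (.var c) (X.uv u) κ
  unfold uv
  cases X.q₁ <;> rfl

theorem fresh_server {c : ℕ} (h : Fresh c X.ann) (hc : c ≠ u) : Fresh c (X.server u) := by
  rintro x hx rfl
  exact not_mem_FV_of_kill (kill_server (fun hx => h x hx rfl) hc) hx

end Br

/-- A source component that can occur in typed systems. -/
def Valid (A : Ann) : Prop := (∃ v P Q, A = .ite v P Q) ∨ ∃ X : Br, A = X.ann ∧ X.Ok

theorem infinite_odd : {c : ℕ | Odd c}.Infinite := by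
  refine Set.infinite_of_injective_forall_mem (f := fun n : ℕ => 2 * n + 1)
    (fun a b h => by grind) fun n => ?_
  exact odd_two_mul_add_one n

theorem fresh_unit_out {c u : ℕ} (h : c ≠ u) :
    Fresh c (CMV.Proc.out (.var (2 * u)) .unit .inact) := by
  rintro x ((hx | hx) | hx)
  · aesop
  · simp_all
  · aesop

theorem Rep.enc {C : Multiset ℕ} (G : Multiset Ann) (hG : ∀ A ∈ G, Valid A) :
    ∀ F : Set ℕ, F.Finite → ∃ D E, Rep C G D E 0 ∧ D.Nodup ∧
      (∀ d ∈ D, Odd d ∧ d ∉ F ∧ ∀ A ∈ G, Fresh d A) ∧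
      ∀ K M, (∀ d ∈ D, ∀ P ∈ M, Fresh d P) →
        CMV.Cong (sys K (G.map Ann.enc + M)) (sys (D + K) (E + M)) := by
  induction G using induction_on with
  | empty => exact fun F _ => ⟨0, 0, .nil 0, by simp, by simp, fun K M _ => by simp; exact .refl _⟩
  | cons A G ih =>
    intro F hF
    obtain ⟨D, E, hr, hD, hF', hc⟩ := ih (fun B hB => hG B (by simp [hB]))
      (F ∪ {c | ¬ Fresh c A}) (hF.union (finite_not_fresh A))
    have fA : ∀ d ∈ D, Fresh d A := fun d hd => not_not.1 fun h => (hF' d hd).2.1 (.inr h)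
    have fF : ∀ d ∈ D, d ∉ F := fun d hd h => (hF' d hd).2.1 (.inl h)
    have lin : ∀ P, Item C {A} 0 {P} 0 → A.enc = P → ∃ D E, Rep C (A ::ₘ G) D E 0 ∧ D.Nodup ∧
        (∀ d ∈ D, Odd d ∧ d ∉ F ∧ ∀ B ∈ A ::ₘ G, Fresh d B) ∧
        ∀ K M, (∀ d ∈ D, ∀ P ∈ M, Fresh d P) →
          CMV.Cong (sys K ((A ::ₘ G).map Ann.enc + M)) (sys (D + K) (E + M)) := by
      intro P hP e
      refine ⟨D, P ::ₘ E, by simpa using Rep.cons hP hr, hD, fun d hd => ⟨(hF' d hd).1, fF d hd, ?_⟩,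
        fun K M hM => ?_⟩
      · intro B hB
        rcases mem_cons.1 hB with rfl | hB
        · exact fA d hd
        · exact (hF' d hd).2.2 B hB
      · rw [map_cons, cons_add, cons_add, e, ← add_cons,
          ← add_cons]
        refine hc K _ fun d hd Q hQ => ?_
        rcases mem_cons.1 hQ with rfl | hQ
        · exact e ▸ fresh_enc (fA d hd)
        · exact hM d hd Q hQ
    rcases hG A (by simp) with ⟨v, P, Q, rfl⟩ | ⟨X, rfl, hX⟩
    · exact lin _ (.ite v P Q) rfl
    · cases hq : X.q₁ with
      | lin =>
        refine lin _ ?_ (X.enc_lin hq 0)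
        have := Item.idle (C := C) X 0 hX
        simpa only [Br.upriv, Br.srv, hq, Multiset.cons_zero] using this
      | un =>
        obtain ⟨u, hu, hu'⟩ := (infinite_odd.sdiff (((hF.union D.toFinset.finite_toSet).union
          (finite_not_fresh X.ann)).union
          (finite_not_fresh_multiset G))).nonempty
        simp only [mem_union, not_or, SetLike.mem_coe, Multiset.mem_toFinset,
          mem_ofPred_eq, not_not, not_exists, not_and] at hu'
        obtain ⟨⟨⟨h1, h2⟩, h3⟩, h4⟩ := hu'
        obtain ⟨p, hp, hp'⟩ := X.enc_un hq
        have item := Item.load (C := C) X u hq (hX hq)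
        simp only [Br.upriv, Br.ready, hq] at item
        refine ⟨u ::ₘ D, .out (.var (2 * u)) .unit .inact ::ₘ X.server u ::ₘ E,
          by simpa using Rep.cons item hr, Multiset.nodup_cons.2 ⟨h2, hD⟩, ?_, ?_⟩
        · intro d hd
          rcases mem_cons.1 hd with rfl | hd
          · refine ⟨hu, h1, fun B hB => ?_⟩
            rcases mem_cons.1 hB with rfl | hB
            · exact h3
            · exact h4 B hB
          · refine ⟨(hF' d hd).1, fF d hd, fun B hB => ?_⟩
            rcases mem_cons.1 hB with rfl | hB
            · exact fA d hd
            · exact (hF' d hd).2.2 B hB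
        · intro K M hM
          have hf := fresh_enc h3
          rw [hp] at hf
          rw [map_cons, cons_add, hp]
          have e1 := sys_res (P := CMV.Proc) K (a := 2 * u) (p := p)
            (M := G.map Ann.enc + M) (by simp; exact hf) (by
              rw [ch_two_mul]
              intro Q hQ
              rcases mem_add.1 hQ with hQ | hQ
              · obtain ⟨B, hB, rfl⟩ := mem_map.1 hQ
                exact fresh_enc (h4 B hB)
              · exact hM u (by simp) Q hQ)
          change CMV.Cong _ (sys _ (p.subst (opn (2 * u)) ::ₘ _)) at e1
          rw [hp', ch_two_mul] at e1
          refine e1.trans ((sys_par (P := CMV.Proc) _ _ _ _ : CMV.Cong _ _).trans ?_)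
          have e2 := hc (u ::ₘ K) (.out (.var (2 * u)) .unit .inact ::ₘ X.server u ::ₘ M) (by
            intro d hd Q hQ
            have hdu : d ≠ u := by rintro rfl; exact h2 hd
            simp only [mem_cons] at hQ
            rcases hQ with rfl | rfl | hQ
            · exact fresh_unit_out hdu
            · exact Br.fresh_server (fA d hd) hdu
            · exact hM d (by simp [hd]) Q hQ)
          simpa only [add_cons, cons_add] using e2

/-! ## Systems that implement source systems -/

/-- The private channels `D` of an implementation are odd and new. -/
structure Env (C : Multiset ℕ) (L : Multiset Ann) (D : Multiset ℕ) : Prop where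
  even : ∀ c ∈ C, Even c
  nodupC : C.Nodup
  nodup : D.Nodup
  odd : ∀ d ∈ D, Odd d
  fresh : ∀ d ∈ D, ∀ A ∈ L, Fresh d A

/-- All components have been discarded. -/
abbrev Junk (J : Multiset CMV.Proc) : Prop := ∀ P ∈ J, IsJunk P

/-- The target process `T` implements the source system, where `n` communications have been
started. -/
def St (T : CMV.Proc) (C : Multiset ℕ) (L : Multiset Ann) (n : ℕ) : Prop :=
  ∃ D E J, Rep C L D E n ∧ Env C L D ∧ Junk J ∧ CMV.Cong T (sys (D + C) (E + J))

theorem _root_.MixedSessions.CMV.IsJunk.FV {P : CMV.Proc} (h : IsJunk P) (x : ℕ) : x ∉ P.FV := by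
  obtain ⟨l, rfl⟩ := h
  intro hx
  obtain ⟨_, h, _⟩ := mem_FV_bundle hx
  cases h

theorem Env.nodup_add {C L D} (h : Env C L D) : (D + C).Nodup := by
  refine Multiset.nodup_add.2 ⟨h.nodup, h.nodupC, Multiset.disjoint_left.2 fun {d} hd hc => ?_⟩
  exact Nat.not_even_iff_odd.2 (h.odd d hd) (h.even d hc)

/-- A continuation is split into its components. -/
theorem St.unfold {T C L L₀ D E n J} {A : Ann} {G K} (hA : Flat A G K) (hG : ∀ B ∈ G, Valid B)
    (mem : ∀ Z ∈ A ::ₘ L, ∀ x ∈ Z.FV, ∃ B ∈ L₀, x ∈ B.FV)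
    (hr : Rep C L D E n) (he : Env C L₀ D) (hK : New C L₀ K)
    (hJ : Junk J) (hT : CMV.Cong T (sys (D + C) (A.enc ::ₘ (E + J)))) :
    St T (K + C) (G + L) n := by
  have hKD : ∀ c ∈ K, c ∉ D := fun c hc hd => Nat.not_even_iff_odd.2 (he.odd c hd) (hK c hc).1
  have fK : ∀ c ∈ K, ∀ P ∈ E + J, Fresh c P := by
    rintro _ hc P hP x hx rfl
    rcases mem_add.1 hP with hP | hP
    · rcases hr.mem_FV hP hx with ⟨B, hB, h⟩ | h
      · exact fresh_of_names mem (hK _ hc).2.2 B (by simp [hB]) x h rfl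
      · exact hKD _ hc h
    · exact (hJ P hP).FV x hx
  obtain ⟨D', E', hr', hD', hF, hc⟩ := Rep.enc (C := K + C) G hG
    (((D.toFinset : Set ℕ) ∪ {c | ∃ B ∈ L, ¬ Fresh c B}) ∪ {c | ∃ P ∈ E + J, ¬ Fresh c P})
    (((D.toFinset.finite_toSet).union (finite_not_fresh_multiset L)).union
      (finite_not_fresh_multiset (E + J)))
  simp only [mem_union, not_or, SetLike.mem_coe, Multiset.mem_toFinset,
    mem_ofPred_eq, not_not, not_exists, not_and] at hF
  refine ⟨D' + D, E' + E, J, ?_, ⟨?_, ?_, ?_, ?_, ?_⟩, hJ, ?_⟩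
  · have := hr'.add (hr.mono fun c hc => mem_add.2 (.inr hc))
    rwa [zero_add] at this
  · intro c hc
    rcases mem_add.1 hc with hc | hc
    · exact (hK c hc).1
    · exact he.even c hc
  · exact Multiset.nodup_add.2 ⟨hA.nodup, he.nodupC, Multiset.disjoint_left.2 fun {c} hc => (hK c hc).2.1⟩
  · exact Multiset.nodup_add.2 ⟨hD', he.nodup, Multiset.disjoint_left.2 fun {d} hd => (hF d hd).2.1.1.1⟩
  · intro d hd
    rcases mem_add.1 hd with hd | hd
    · exact (hF d hd).1
    · exact he.odd d hd
  · intro d hd B hB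
    rcases mem_add.1 hd with hd | hd <;> rcases mem_add.1 hB with hB | hB
    · exact (hF d hd).2.2 B hB
    · exact (hF d hd).2.1.1.2 B hB
    · rintro x hx rfl
      rcases hA.mem_FV ⟨B, hB, hx⟩ with h | h
      · exact fresh_of_names mem (he.fresh _ hd) A (by simp) x h rfl
      · exact hKD _ h hd
    · exact fresh_of_names mem (he.fresh d hd) B (by simp [hB])
  · refine hT.trans ?_
    refine (sys_cons_cong (P := CMV.Proc) _ (flat_enc hA) _ : CMV.Cong _ _).trans ?_
    refine (sys_nuM (P := CMV.Proc) fK : CMV.Cong _ _).trans ?_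
    refine (hc _ _ fun d hd P hP => (hF d hd).2.1.2 P hP).trans ?_
    rw [show D' + (K + (D + C)) = D' + D + (K + C) by abel, add_assoc E']
    exact .refl _

/-! ## The components of items -/

@[simp] theorem dualKey_dualKey (κ : Label × Pol) : dualKey (dualKey κ) = κ := by
  obtain ⟨l, p⟩ := κ
  cases p <;> rfl

theorem barb_nd {Ps : List CMV.Proc} {a : ℕ} : ¬ Barb (nd Ps) a := by
  intro ha
  rw [nd] at ha
  have : ∀ {l : List ℕ}, ¬ Barb (prod (l.map fun i => CMV.Proc.sel (.var 1) (.opt i) .inact))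
      (a + 2) := by
    intro l h
    rw [(prod_cong _).barb] at h
    have := (barb_sys (K := 0) (L := ↑(l.map fun i => CMV.Proc.sel (.var 1) (.opt i) .inact))
      (x := a + 2)).1 (by rw [Calculus.sys, nuM_zero]; exact h)
    obtain ⟨⟨P, hP, hb⟩, _⟩ := this
    simp only [Multiset.mem_coe, List.mem_map] at hP
    obtain ⟨i, _, rfl⟩ := hP
    simp at hb
  rw [barb_res, barb_par] at ha
  rcases ha with ha | ha
  · simp at ha
  · grind

namespace Br

variable {X : Br} {u e : ℕ} {κ : Label × Pol} {P : CMV.Proc}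

theorem mem_keys : κ ∈ X.keys ↔ ∃ j, X.key j = κ := by simp [keys, Enc.keys, key]

theorem alts_eq_nd (X : Br) (u e : ℕ) (κ : Label × Pol) :
    X.alts u e κ = nd ((members X.lab X.act κ).map fun j => X.alt u e j) := rfl

theorem mem_members {j : Fin X.n} : j ∈ members X.lab X.act κ ↔ X.key j = κ := by
  simp [members, key]

theorem alt_send {j : Fin X.n} {v : Val} (h : X.act j = .send v) :
    X.alt u e j = .out (.var e) v (restartV (X.uv u) (X.encP j)) := by
  rw [alt, h]
  rfl

theorem alt_recv {j : Fin X.n} (h : X.act j = .recv) : X.alt u e j =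
    .inp .lin (.var e) (restartV ((X.uv u).map (·.subst (shift 1))) (X.encP j)) := by
  rw [alt, h]
  rfl

theorem Half.cases (h : X.Half u e κ P) : (P = X.alts u e κ ∧ ∃ Ps, P = nd Ps) ∨
    (∃ i v, X.key i = κ ∧ X.act i = .send v ∧
      P = .out (.var e) v (restartV (X.uv u) (X.encP i))) ∨
    ∃ i, X.key i = κ ∧ X.act i = .recv ∧
      P = .inp .lin (.var e) (restartV ((X.uv u).map (·.subst (shift 1))) (X.encP i)) := by
  rcases h with h | ⟨j, hj, h⟩
  · aesop
  · cases ha : X.act j with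
    | send v => exact .inr (.inl ⟨j, v, hj, ha, h.trans (alt_send ha)⟩)
    | recv => exact .inr (.inr ⟨j, hj, ha, h.trans (alt_recv ha)⟩)

theorem Half.barb (h : X.Half u e κ P) {a : ℕ} (ha : Barb P a) : a = e := by
  rcases h.cases with ⟨_, Ps, rfl⟩ | ⟨i, v, _, _, rfl⟩ | ⟨i, _, _, rfl⟩
  · exact absurd ha barb_nd
  all_goals simp_all

end Br

/-- The data of a pair of source choices in communication. -/
structure PairData (C : Multiset ℕ) (X Y : Br) (u u' e : ℕ) (κ : Label × Pol) (B : Multiset ℕ)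
    (P Q : CMV.Proc) : Prop where
  okX : X.Ok
  okY : Y.Ok
  q₂ : Y.q₂ = X.q₂
  y : Y.y = co X.y
  mem : ch X.y ∈ C
  key : κ ∈ X.keys
  key' : dualKey κ ∈ Y.keys
  sess : X.SessAt e B
  half : X.Half u e κ P
  half' : Y.Half u' (co e) (dualKey κ) Q

theorem PairData.symm {C X Y u u' e κ B P Q} (h : PairData C X Y u u' e κ B P Q) :
    PairData C Y X u' u (co e) (dualKey κ) B Q P := by
  obtain ⟨h1, h2, h3, h4, h5, h6, h7, h8, h9, h10⟩ := h
  refine ⟨h2, h1, h3.symm, by rw [h4, co_co], by rwa [h4, ch_co], h7, by rwa [dualKey_dualKey], ?_,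
    h10, by rwa [co_co, dualKey_dualKey]⟩
  rcases h8 with ⟨h, rfl, h'⟩ | ⟨h, h'⟩
  · exact .inl ⟨h3.trans h, h4.symm, h'⟩
  · exact .inr ⟨h3.trans h, by rwa [ch_co]⟩

theorem PairData.item {C X Y u u' e κ B P Q} (h : PairData C X Y u u' e κ B P Q) :
    Item C (X.ann ::ₘ {Y.ann}) (B + (X.upriv u + Y.upriv u'))
      (P ::ₘ Q ::ₘ (X.srv u + Y.srv u')) 1 :=
  .pair X Y u u' e κ B h.okX h.okY h.q₂ h.y h.mem h.key h.key' h.sess h.half h.half'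

/-- The components of a pair, in any order. -/
def IsPair (C : Multiset ℕ) (S : Multiset Ann) (p : Multiset ℕ) (E : Multiset CMV.Proc) (w : ℕ)
    (X Y : Br) (u u' e : ℕ) (κ : Label × Pol) (B : Multiset ℕ) (P Q : CMV.Proc) : Prop :=
  PairData C X Y u u' e κ B P Q ∧ S = X.ann ::ₘ {Y.ann} ∧ p = B + (X.upriv u + Y.upriv u') ∧
    E = P ::ₘ Q ::ₘ (X.srv u + Y.srv u') ∧ w = 1

theorem IsPair.symm {C S p E w X Y u u' e κ B P Q}
    (h : IsPair C S p E w X Y u u' e κ B P Q) :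
    IsPair C S p E w Y X u' u (co e) (dualKey κ) B Q P := by
  obtain ⟨h, rfl, rfl, rfl, rfl⟩ := h
  refine ⟨h.symm, Multiset.pair_comm _ _, by grind, ?_, rfl⟩
  rw [add_comm (X.srv u), cons_swap]

/-- The possible shapes of a component `P` of an item. -/
inductive Part (C : Multiset ℕ) (S : Multiset Ann) (p : Multiset ℕ) (E : Multiset CMV.Proc) (w : ℕ)
    (P : CMV.Proc) : Prop
  | srv (X : Br) (u : ℕ) : u ∈ p → P = X.server u → Part C S p E w P
  | ite (v A B) : S = {.ite v A B} → p = 0 → E = {P} → w = 0 → P = .ite v A.enc B.enc →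
      Part C S p E w P
  | trig (X : Br) (u : ℕ) : X.q₁ = .un → X.q₂ = .un → S = {X.ann} → p = X.upriv u →
      E = X.ready u → w = 0 → P = .out (.var (2 * u)) .unit .inact → Part C S p E w P
  | headN (X : Br) (u Ps) : X.Ok → X.vw = .int → S = {X.ann} → p = X.upriv u → E = P ::ₘ X.srv u →
      w = 0 → P = X.head u → P = nd Ps → Part C S p E w P
  | headB (X : Br) (u) : X.Ok → X.q₂ = .lin → X.vw = .ext → S = {X.ann} → p = X.upriv u →
      E = P ::ₘ X.srv u → w = 0 → P = X.offer u X.y → Part C S p E w P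
  | headI (X : Br) (u Q) : X.Ok → X.q₂ = .un → X.vw = .ext → S = {X.ann} → p = X.upriv u →
      E = P ::ₘ X.srv u → w = 0 → (∀ c, Q.subst (inst (.var c)) = X.offer u c) →
      P = .inp .lin (.var X.y) Q → Part C S p E w P
  | comL (X : Br) (u κ) : X.q₁ = .lin → X.q₂ = .lin → X.vw = .int → κ ∈ X.keys → S = {X.ann} →
      p = 0 → E = {P} → w = 1 → P = X.pick u X.y κ →
      Part C S p E w P
  | comU (X : Br) (u c κ) : X.q₂ = .un → X.vw = .int → κ ∈ X.keys → S = {X.ann} →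
      p = c ::ₘ X.upriv u → E = P ::ₘ X.srv u → w = 1 → P = X.call u c κ → Part C S p E w P
  | sel (X Y : Br) (u u' c κ) : X.q₂ = .un → Y.q₂ = .un → Y.y = co X.y → ch X.y ∈ C →
      κ ∈ X.keys → dualKey κ ∈ Y.keys → S = X.ann ::ₘ {Y.ann} →
      p = c ::ₘ (X.upriv u + Y.upriv u') →
      E = P ::ₘ Y.offer u' (2 * c) ::ₘ (X.srv u + Y.srv u') → w = 1 →
      P = X.pick u (co (2 * c)) κ → Part C S p E w P
  | offer (Y : Br) (u' c) : c ∈ p → P = Y.offer u' (2 * c) → Part C S p E w P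
  | halfN (X Y u u' e κ B Q Ps) : IsPair C S p E w X Y u u' e κ B P Q → P = X.alts u e κ →
      P = nd Ps → Part C S p E w P
  | halfO (X Y u u' e κ B Q i v) : IsPair C S p E w X Y u u' e κ B P Q → X.key i = κ →
      X.act i = .send v → P = .out (.var e) v (restartV (X.uv u) (X.encP i)) → Part C S p E w P
  | halfI (X Y u u' e κ B Q) (R : CMV.Proc) : IsPair C S p E w X Y u u' e κ B P Q →
      P = .inp .lin (.var e) R → Part C S p E w P

theorem IsPair.part {C S p E w X Y u u' e κ B P Q} (h : IsPair C S p E w X Y u u' e κ B P Q) :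
    Part C S p E w P := by
  rcases h.1.half.cases with ⟨e, Ps, e'⟩ | ⟨i, v, hi, ha, e⟩ | ⟨_, _, _, e⟩
  · exact .halfN _ _ _ _ _ _ _ _ Ps h e e'
  · exact .halfO _ _ _ _ _ _ _ _ i v h hi ha e
  · exact .halfI _ _ _ _ _ _ _ _ _ h e

theorem Item.part {C S p E w} (h : Item C S p E w) {P : CMV.Proc} (hP : P ∈ E) :
    Part C S p E w P := by
  have srv : ∀ {X : Br} {u}, P ∈ X.srv u → X.upriv u ⊆ p → Part C S p E w P := fun h hs =>
    .srv _ _ (hs (Br.mem_upriv.2 ⟨(Br.mem_srv h).1, rfl⟩)) (Br.mem_srv h).2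
  cases h with
  | ite v A B =>
    obtain rfl := mem_singleton.1 hP
    exact .ite v A B rfl rfl rfl rfl rfl
  | load X u hq hq₂ =>
    have hP' := hP
    rw [Br.ready, hq] at hP'
    simp only [Multiset.insert_eq_cons, mem_cons, mem_singleton] at hP'
    rcases hP' with rfl | rfl
    · exact .trig X u hq hq₂ rfl rfl rfl rfl rfl
    · exact .srv X u (Br.mem_upriv.2 ⟨hq, rfl⟩) rfl
  | idle X u hX =>
    rcases mem_cons.1 hP with rfl | hP
    · cases hq : X.q₂ <;> cases hv : X.vw
      · exact .headN X u _ hX hv rfl rfl rfl rfl rfl (Br.head_lin_int hq hv)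
      · exact .headB X u hX hq hv rfl rfl rfl rfl (Br.head_lin_ext hq hv)
      · obtain ⟨f, h, _⟩ := Br.head_un_int (u := u) hq hv
        exact .headN X u _ hX hv rfl rfl rfl rfl rfl h
      · obtain ⟨Q, h, hQ⟩ := Br.head_un_ext (u := u) hq hv
        exact .headI X u Q hX hq hv rfl rfl rfl rfl hQ h
    · exact srv hP (by simp)
  | comL X u κ h1 h2 h3 h4 =>
    obtain rfl := mem_singleton.1 hP
    exact .comL X u κ h1 h2 h3 h4 rfl rfl rfl rfl rfl
  | comU X u c κ h1 h2 h3 =>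
    rcases mem_cons.1 hP with rfl | hP
    · exact .comU X u c κ h1 h2 h3 rfl rfl rfl rfl rfl
    · exact srv hP (Multiset.subset_cons _ _)
  | sb X Y u u' c κ h1 h2 h3 h4 h5 h6 =>
    simp only [mem_cons, mem_add] at hP
    rcases hP with rfl | rfl | hP | hP
    · exact .sel X Y u u' c κ h1 h2 h3 h4 h5 h6 rfl rfl rfl rfl rfl
    · exact .offer Y u' c (by simp) rfl
    all_goals exact srv hP fun _ => by simp +contextual
  | @pair X Y u u' e κ B P' Q h1 h2 h3 h4 h5 h6 h7 h8 h9 h10 =>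
    have hd : IsPair C _ _ _ _ X Y u u' e κ B P' Q :=
      ⟨⟨h1, h2, h3, h4, h5, h6, h7, h8, h9, h10⟩, rfl, rfl, rfl, rfl⟩
    simp only [mem_cons, mem_add] at hP
    rcases hP with rfl | rfl | hP | hP
    · exact hd.part
    · exact hd.symm.part
    all_goals exact srv hP fun _ => by simp +contextual

theorem IsPair.subj {C S p E w X Y u u' e κ B P Q} (h : IsPair C S p E w X Y u u' e κ B P Q) :
    ch e ∈ p ∨ ∃ Z : Br, Z.ann ∈ S ∧ Z.y = e ∧ Z.q₂ = .lin := by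
  obtain ⟨h, rfl, rfl, -⟩ := h
  rcases h.sess with ⟨hl, rfl, _⟩ | ⟨_, rfl⟩
  · exact .inr ⟨X, by simp, rfl, hl⟩
  · simp

/-- The subject of a component belongs to a private channel or to a source process. -/
theorem Item.barb {C S p E w} (h : Item C S p E w) {P : CMV.Proc} (hP : P ∈ E) {a : ℕ}
    (ha : Barb P a) : ch a ∈ p ∨ ∃ X : Br, X.ann ∈ S ∧ X.y = a := by
  cases h.part hP with
  | srv X u hu h =>
    subst h
    simp only [Br.server, barb_inp, Val.var.injEq] at ha
    simpa [← ha] using .inl hu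
  | ite => simp_all
  | trig X u hq _ _ hp _ _ h =>
    subst h hp
    simp only [barb_out, Val.var.injEq] at ha
    exact .inl (Br.mem_upriv.2 ⟨hq, by simp [← ha]⟩)
  | headN | halfN => rename_i h; rw [h] at ha; exact absurd ha barb_nd
  | headB X | headI X | comL X | comU X => exact .inr ⟨X, by simp_all [Br.offer, offerL]⟩
  | sel X Y u u' c _ _ _ _ _ _ _ _ hp _ _ h =>
    subst h hp
    simp only [barb_sel, Val.var.injEq] at ha
    simp [← ha]
  | offer Y u' c hc h =>
    subst h
    simp only [Br.offer, offerL, barb_bran, Val.var.injEq] at ha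
    simpa [← ha] using .inl hc
  | halfO X Y u u' e κ B Q i v h | halfI X Y u u' e κ B Q R h =>
    obtain rfl := h.1.half.barb ha
    exact h.subj.imp_right fun ⟨Z, h⟩ => ⟨Z, h.1, h.2.1⟩

theorem Rep.barb {C L D E n} (h : Rep C L D E n) {P : CMV.Proc} (hP : P ∈ E) {a : ℕ}
    (ha : Barb P a) : ch a ∈ D ∨ ∃ X : Br, X.ann ∈ L ∧ X.y = a := by
  obtain ⟨S, p, e, w, L', D', E', n', ⟨h1, _, rfl, rfl, _, _⟩, hP⟩ := h.focus_elem hP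
  exact (h1.barb hP ha).imp (by simp +contextual) fun ⟨X, hX, h⟩ => ⟨X, by simp [hX], h⟩

theorem Env.no_clash {C S L' p D' E' n'} (he : Env C (S + L') (p + D')) (h : Rep C L' D' E' n')
    {P : CMV.Proc} (hP : P ∈ E') {a : ℕ} (ha : Barb P a) : ch a ∉ p := by
  intro hp
  rcases h.barb hP ha with h | ⟨X, hX, rfl⟩
  · exact Multiset.disjoint_left.1 (Multiset.nodup_add.1 he.nodup).2.2 hp h
  · exact he.fresh _ (by simp [hp]) X.ann (by simp [hX]) _ X.y_mem_FV rfl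

theorem Env.y_not_mem {C L D} (he : Env C L D) {X : Br} (hX : X.ann ∈ L) : ch X.y ∉ D := fun h =>
  he.fresh _ h X.ann hX _ X.y_mem_FV rfl

theorem Item.out_inv {C S p E w} (h : Item C S p E w) {y v : Val} {R : CMV.Proc}
    (hP : .out y v R ∈ E) :
    (∃ (X : Br) (u : ℕ), X.q₁ = .un ∧ X.q₂ = .un ∧ S = {X.ann} ∧ p = X.upriv u ∧ E = X.ready u ∧
      w = 0 ∧ y = .var (2 * u) ∧ v = .unit ∧ R = .inact) ∨
    (∃ (X : Br) (u c : ℕ) (κ : Label × Pol), X.q₂ = .un ∧ X.vw = .int ∧ κ ∈ X.keys ∧ S = {X.ann} ∧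
      p = c ::ₘ X.upriv u ∧ E = .out y v R ::ₘ X.srv u ∧ w = 1 ∧ y = .var X.y ∧ v = .var (2 * c) ∧
      R = X.pick u (co (2 * c)) κ) ∨
    ∃ X Y u u' e κ B Q, IsPair C S p E w X Y u u' e κ B (.out y v R) Q ∧ y = .var e ∧
      ∃ i, X.key i = κ ∧ X.act i = .send v ∧ R = restartV (X.uv u) (X.encP i) := by
  cases h.part hP with
  | trig X u hq hq₂ h1 h2 h3 h4 h => cases h; exact .inl ⟨X, u, hq, hq₂, h1, h2, h3, h4, rfl, rfl, rfl⟩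
  | comU X u c κ h1 h2 h3 h4 h5 h6 h7 h =>
    cases h
    exact .inr (.inl ⟨X, u, c, κ, h1, h2, h3, h4, h5, h6, h7, rfl, rfl, rfl⟩)
  | halfO X Y u u' a κ B Q i _ h hi ha e =>
    cases e
    exact .inr (.inr ⟨X, Y, u, u', a, κ, B, Q, h, rfl, i, hi, ha, rfl⟩)
  | _ => rename_i h; cases h

theorem Item.inp_inv {C S p E w} (h : Item C S p E w) {q : Qual} {a : ℕ} {R : CMV.Proc}
    (hP : .inp q (.var a) R ∈ E) :
    ch a ∈ p ∨
    (∃ (X : Br) (u : ℕ), X.Ok ∧ X.q₂ = .un ∧ X.vw = .ext ∧ S = {X.ann} ∧ p = X.upriv u ∧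
      E = .inp q (.var a) R ::ₘ X.srv u ∧ w = 0 ∧ a = X.y ∧ q = .lin ∧
      ∀ c, R.subst (inst (.var c)) = X.offer u c) ∨
    ∃ X : Br, X.ann ∈ S ∧ X.y = a ∧ X.q₂ = .lin := by
  cases h.part hP with
  | srv X u hu e => cases e; exact .inl (by simpa using hu)
  | headI X u Q h1 hq hv h2 h3 h4 h5 hQ e =>
    cases e
    exact .inr (.inl ⟨X, u, h1, hq, hv, h2, h3, h4, h5, rfl, rfl, hQ⟩)
  | halfI X Y u u' a κ B Q R h =>
    obtain rfl := h.1.half.barb .inp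
    exact h.subj.imp_right .inr
  | _ => rename_i h; cases h

theorem Item.sel_inv {C S p E w} (h : Item C S p E w) {y : Val} {l : Lab} {R : CMV.Proc}
    (hP : .sel y l R ∈ E) :
    (∃ (X : Br) (u : ℕ) (κ : Label × Pol), X.q₁ = .lin ∧ X.q₂ = .lin ∧ X.vw = .int ∧ κ ∈ X.keys ∧
      S = {X.ann} ∧ p = 0 ∧ E = {.sel y l R} ∧ w = 1 ∧ y = .var X.y ∧ l = .tag κ.1 κ.2 ∧
      R = X.alts u X.y κ) ∨
    ∃ (X Y : Br) (u u' c : ℕ) (κ : Label × Pol), X.q₂ = .un ∧ Y.q₂ = .un ∧ Y.y = co X.y ∧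
      ch X.y ∈ C ∧ κ ∈ X.keys ∧ dualKey κ ∈ Y.keys ∧ S = X.ann ::ₘ {Y.ann} ∧
      p = c ::ₘ (X.upriv u + Y.upriv u') ∧
      E = .sel y l R ::ₘ Y.offer u' (2 * c) ::ₘ (X.srv u + Y.srv u') ∧ w = 1 ∧
      y = .var (co (2 * c)) ∧ l = .tag κ.1 κ.2 ∧ R = X.alts u (co (2 * c)) κ := by
  cases h.part hP with
  | comL X u κ h1 h2 h3 h4 h5 h6 h7 h8 e =>
    cases e
    exact .inl ⟨X, u, κ, h1, h2, h3, h4, h5, h6, h7, h8, rfl, rfl, rfl⟩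
  | sel X Y u u' c κ h1 h2 h3 h4 h5 h6 h7 h8 h9 h10 e =>
    cases e
    exact .inr ⟨X, Y, u, u', c, κ, h1, h2, h3, h4, h5, h6, h7, h8, h9, h10, rfl, rfl, rfl⟩
  | _ => rename_i h; cases h

theorem Item.bran_inv {C S p E w} (h : Item C S p E w) {a n : ℕ} {lab : Fin n → Lab}
    {R : Fin n → CMV.Proc} (hP : .bran (.var a) n lab R ∈ E) :
    ch a ∈ p ∨
    ∃ (X : Br) (u : ℕ), X.Ok ∧ X.q₂ = .lin ∧ X.vw = .ext ∧ S = {X.ann} ∧ p = X.upriv u ∧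
      E = .bran (.var a) n lab R ::ₘ X.srv u ∧ w = 0 ∧ a = X.y ∧
      .bran (.var a) n lab R = X.offer u X.y := by
  cases h.part hP with
  | headB X u h1 hq hv h2 h3 h4 h5 e =>
    refine .inr ⟨X, u, h1, hq, hv, h2, h3, h4, h5, ?_, e⟩
    simpa using (CMV.Proc.bran.inj e).1
  | offer Y u c hc e =>
    obtain rfl : a = 2 * c := by simpa using (CMV.Proc.bran.inj e).1
    simpa using .inl hc
  | _ => rename_i h; cases h

theorem Item.nd_inv {C S p E w} (h : Item C S p E w) {Ps : List CMV.Proc} (hP : nd Ps ∈ E) :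
    (∃ (X : Br) (u : ℕ), X.Ok ∧ X.vw = .int ∧ S = {X.ann} ∧ p = X.upriv u ∧
      E = nd Ps ::ₘ X.srv u ∧ w = 0 ∧ nd Ps = X.head u) ∨
    ∃ X Y u u' e κ B Q, IsPair C S p E w X Y u u' e κ B (nd Ps) Q ∧ nd Ps = X.alts u e κ := by
  cases h.part hP with
  | headN X u _ h1 hv h2 h3 h4 h5 e => exact .inl ⟨X, u, h1, hv, h2, h3, h4, h5, e⟩
  | halfN X Y u u' a κ B Q _ h e => exact .inr ⟨X, Y, u, u', a, κ, B, Q, h, e⟩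
  | _ => rename_i h; cases h

theorem Item.ite_inv {C S p E w} (h : Item C S p E w) {v : Val} {P Q : CMV.Proc}
    (hP : .ite v P Q ∈ E) : ∃ A B, S = {.ite v A B} ∧ p = 0 ∧ E = {.ite v P Q} ∧ w = 0 ∧
      P = A.enc ∧ Q = B.enc := by
  cases h.part hP with
  | ite v A B h1 h2 h3 h4 e => cases e; exact ⟨A, B, h1, h2, h3, h4, rfl, rfl⟩
  | _ => rename_i h; cases h

/-- Components are guarded or non-deterministic choices. -/
theorem Item.guard {C S p E w} (h : Item C S p E w) {P : CMV.Proc} (hP : P ∈ E) :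
    P.IsGuard ∨ ∃ Ps, P = nd Ps := by
  cases h.part hP with
  | headN | halfN => exact .inr ⟨_, by assumption⟩
  | _ => rename_i h; rw [h]; exact .inl (by constructor)

theorem Rep.guard {C L D E n} (h : Rep C L D E n) {P : CMV.Proc} (hP : P ∈ E) :
    P.IsGuard ∨ ∃ Ps, P = nd Ps := by
  obtain ⟨S, p, e, w, L', D', E', n', ⟨h1, _, rfl, rfl, _, _⟩, hP⟩ := h.focus_elem hP
  exact h1.guard hP

/-! ## Transitions of implementations -/

theorem St.intro {T C L D E J n K M} (hr : Rep C L D E n) (he : Env C L D)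
    (hJ : Junk J) (hT : CMV.Cong T (sys K M)) (hK : K = D + C) (hM : M = E + J) :
    St T C L n := by
  subst hK hM
  exact ⟨D, E, J, hr, he, hJ, hT⟩

theorem Env.congr {C L D L' D'} (he : Env C L D) (hL : ∀ A ∈ L', A ∈ L) (hD : D' = D) :
    Env C L' D' := by
  subst hD
  exact ⟨he.even, he.nodupC, he.nodup, he.odd, fun d hd A hA => he.fresh d hd A (hL A hA)⟩

theorem junk_cons {J : Multiset CMV.Proc} {P : CMV.Proc} (hP : IsJunk P) (hJ : Junk J) :
    ∀ Q ∈ P ::ₘ J, IsJunk Q := by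
  grind

section

variable {T : CMV.Proc} {C : Multiset ℕ} {L' : Multiset Ann} {D' : Multiset ℕ}
  {E' J : Multiset CMV.Proc} {n' : ℕ}

theorem Br.ready_un {X : Br} {u : ℕ} (h : X.q₁ = .un) :
    X.ready u = .out (.var (2 * u)) .unit .inact ::ₘ {X.server u} := by
  rw [Br.ready, h]
  rfl

theorem Br.srv_un {X : Br} {u : ℕ} (h : X.q₁ = .un) : X.srv u = {X.server u} := by rw [Br.srv, h]

theorem St.idle {X : Br} {u : ℕ} (hX : X.Ok) (hr : Rep C L' D' E' n')
    (he : Env C ({X.ann} + L') (X.upriv u + D')) (hJ : Junk J)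
    (hT : CMV.Cong T (sys (X.upriv u + D' + C) (.inact ::ₘ X.head u ::ₘ (X.srv u + (E' + J))))) :
    St T C ({X.ann} + L') (0 + n') := by
  refine .intro (.cons (.idle X u hX) hr) he hJ
    (hT.trans (sys_inact (P := CMV.Proc) _ _ : CMV.Cong _ _)) rfl ?_
  rw [cons_add, cons_add, add_assoc]

theorem St.comL {X : Br} {u : ℕ} {κ : Label × Pol} {Q : CMV.Proc} (hX : X.Ok) (hq : X.q₂ = .lin)
    (hv : X.vw = .int) (hκ : κ ∈ X.keys) (hQ : IsJunk Q) (hr : Rep C L' D' E' n')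
    (he : Env C ({X.ann} + L') (X.upriv u + D')) (hJ : Junk J)
    (hT : CMV.Cong T (sys (X.upriv u + D' + C)
      (X.pick u X.y κ ::ₘ Q ::ₘ (X.srv u + (E' + J))))) :
    St T C ({X.ann} + L') (1 + n') := by
  have hq₁ := Br.lin_of_Ok hX hq
  rw [Br.upriv, hq₁] at he hT
  rw [Br.srv, hq₁] at hT
  refine .intro (.cons (.comL X u κ hq₁ hq hv hκ) hr) he (junk_cons hQ hJ) hT rfl ?_
  simp only [← singleton_add]
  abel

/-- A private channel is opened. -/
theorem Env.exists_open {L D} (he : Env C L D) (P : CMV.Proc) (R : Multiset CMV.Proc) :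
    ∃ c, Env C L (c ::ₘ D) ∧ ∀ T, CMV.Cong T (sys (D + C) (.res P ::ₘ R)) →
      CMV.Cong T (sys (c ::ₘ D + C) (P.subst (opn (2 * c)) ::ₘ R)) := by
  obtain ⟨c, hc, hc'⟩ := (infinite_odd.sdiff (((D.toFinset.finite_toSet).union
    (finite_not_fresh (CMV.Proc.res P))).union
    ((finite_not_fresh_multiset L).union (finite_not_fresh_multiset R)))).nonempty
  simp only [mem_union, not_or, SetLike.mem_coe, Multiset.mem_toFinset,
    mem_ofPred_eq, not_not, not_exists, not_and] at hc'
  obtain ⟨⟨h1, h2⟩, h3, h4⟩ := hc'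
  refine ⟨c, ⟨he.even, he.nodupC, Multiset.nodup_cons.2 ⟨h1, he.nodup⟩, ?_, ?_⟩, fun T hT => ?_⟩
  · intro d hd
    rcases mem_cons.1 hd with rfl | hd
    · exact hc
    · exact he.odd d hd
  · intro d hd
    rcases mem_cons.1 hd with rfl | hd
    · exact h3
    · exact he.fresh d hd
  · have e1 := sys_res (P := CMV.Proc) (D + C) (a := 2 * c) (p := P)
      (M := R) (by simp; exact h2) (by simp; exact h4)
    change CMV.Cong _ (sys _ (P.subst (opn (2 * c)) ::ₘ _)) at e1
    rw [ch_two_mul] at e1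
    rw [cons_add]
    exact hT.trans e1

theorem St.comU {X : Br} {u : ℕ} {κ : Label × Pol} {P Q : CMV.Proc} (hq : X.q₂ = .un)
    (hv : X.vw = .int) (hκ : κ ∈ X.keys) (hQ : IsJunk Q) (hr : Rep C L' D' E' n')
    (he : Env C ({X.ann} + L') (X.upriv u + D')) (hJ : Junk J)
    (hP : ∀ c, P.subst (opn (2 * c)) = X.call u c κ)
    (hT : CMV.Cong T (sys (X.upriv u + D' + C) (.res P ::ₘ Q ::ₘ (X.srv u + (E' + J))))) :
    St T C ({X.ann} + L') (1 + n') := by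
  obtain ⟨c, hc, h⟩ := he.exists_open P (Q ::ₘ (X.srv u + (E' + J)))
  have hT := h T hT
  rw [hP] at hT
  refine .intro (.cons (.comU X u c κ hq hv hκ) hr) ?_ (junk_cons hQ hJ) hT ?_ ?_
  · simp_all
  · simp_all
  · simp only [← singleton_add]
    abel

theorem St.sb {X Y : Br} {u u' c : ℕ} {κ : Label × Pol} {R : CMV.Proc} (hq : X.q₂ = .un)
    (hq' : Y.q₂ = .un) (hy : Y.y = co X.y) (hc : ch X.y ∈ C) (hκ : κ ∈ X.keys)
    (hκ' : dualKey κ ∈ Y.keys) (hr : Rep C L' D' E' n')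
    (he : Env C ({X.ann} + ({Y.ann} + L')) ((c ::ₘ X.upriv u) + (Y.upriv u' + D')))
    (hJ : Junk J) (hR : R = Y.offer u' (2 * c))
    (hT : CMV.Cong T (sys ((c ::ₘ X.upriv u) + (Y.upriv u' + D') + C)
      (X.pick u (co (2 * c)) κ ::ₘ R ::ₘ
        (X.srv u + (Y.srv u' + (E' + J)))))) :
    St T C ({X.ann} + ({Y.ann} + L')) (1 + n') := by
  subst hR
  have hL : X.ann ::ₘ {Y.ann} + L' = {X.ann} + ({Y.ann} + L') := by
    rw [← singleton_add, add_assoc]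
  rw [← hL]
  refine .intro (.cons (.sb X Y u u' c κ hq hq' hy hc hκ hκ') hr) (he.congr ?_ ?_) hJ hT ?_ ?_
  · grind
  all_goals
    simp
    abel

theorem PairData.st {X Y : Br} {u u' e : ℕ} {κ : Label × Pol} {B : Multiset ℕ} {P Q : CMV.Proc}
    {D M} (h : PairData C X Y u u' e κ B P Q) (hr : Rep C L' D' E' n')
    (he : Env C ({X.ann} + ({Y.ann} + L')) D) (hJ : Junk J)
    (hD : D = B + (X.upriv u + Y.upriv u') + D')
    (hM : M = P ::ₘ Q ::ₘ (X.srv u + Y.srv u') + E' + J)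
    (hT : CMV.Cong T (sys (D + C) M)) : St T C ({X.ann} + ({Y.ann} + L')) (1 + n') := by
  have hL : X.ann ::ₘ {Y.ann} + L' = {X.ann} + ({Y.ann} + L') := by
    rw [← singleton_add, add_assoc]
  rw [← hL] at he ⊢
  exact .intro (.cons h.item hr) (he.congr (fun _ => id) hD.symm) hJ hT (by rw [hD]) hM

theorem Rep.keep {X : Br} (hX : X.Ok) (u : ℕ) : Rep C X.keep (X.upriv u) (X.ready u) 0 := by
  have := fun h => (Item.load (C := C) X u h (hX h)).rep
  unfold Br.keep Br.upriv Br.ready at *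
  cases hq : X.q₁ with
  | lin => exact .nil 0
  | un => grind

theorem restartV_inst (o : Option Val) (P : CMV.Proc) (v : Val) :
    (restartV (o.map (·.subst (shift 1))) P).subst (inst v) = restartV o (P.subst (inst v)) := by
  cases o with
  | none => rfl
  | some w => cases w <;> rfl

theorem sys_restart (X : Br) (u : ℕ) (K : Multiset ℕ) (P : CMV.Proc) (M : Multiset CMV.Proc) :
    CMV.Cong (sys K (restartV (X.uv u) P ::ₘ (X.srv u + M))) (sys K (P ::ₘ (X.ready u + M))) := by
  unfold Br.uv Br.srv Br.ready
  cases X.q₁ with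
  | lin => exact .refl _
  | un =>
    refine (sys_par (P := CMV.Proc) _ _ _ _ : CMV.Cong _ _).trans ?_
    rw [Multiset.insert_eq_cons, cons_add, cons_swap]
    exact .refl _

/-- Two summands communicate. -/
theorem St.finish {X Y : Br} {u u' : ℕ} {B : Multiset ℕ} {i j v G K D} (hX : X.Ok) (hY : Y.Ok)
    (hi : X.act i = .send v) (hj : Y.act j = .recv)
    (hA : Flat (.par (X.P i) ((Y.P j).subst (inst v))) G K) (hG : ∀ A ∈ G, Valid A)
    (hK : New C (X.ann ::ₘ Y.ann ::ₘ L') K) (hr : Rep C L' D' E' n')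
    (he : Env C (X.ann ::ₘ Y.ann ::ₘ L') D) (hD : D = B + (X.upriv u + Y.upriv u') + D')
    (hJ : Junk J)
    (hT : CMV.Cong T (sys (D + C) (restartV (X.uv u) (X.encP i) ::ₘ
        (restartV ((Y.uv u').map (·.subst (shift 1))) (Y.encP j)).subst (inst v) ::ₘ
        (X.srv u + Y.srv u' + (E' + J))))) :
    St T (K + C) (G + (X.keep + Y.keep + L')) n' := by
  have hrep : Rep C (X.keep + Y.keep + L') D (X.ready u + Y.ready u' + E') n' := by
    have := ((((Rep.keep hX u).add (Rep.keep hY u')).add hr).garbage B)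
    rw [zero_add, zero_add] at this
    rwa [hD, add_assoc B]
  refine St.unfold (J := J) hA hG (Br.com_names hi hj) hrep he hK hJ (hT.trans ?_)
  rw [restartV_inst]
  set P := restartV (Y.uv u') ((Y.encP j).subst (inst v))
  rw [show restartV (X.uv u) (X.encP i) ::ₘ P ::ₘ (X.srv u + Y.srv u' + (E' + J)) =
    restartV (X.uv u) (X.encP i) ::ₘ (X.srv u + (P ::ₘ (Y.srv u' + (E' + J)))) by
      simp only [← singleton_add]; abel]
  refine (sys_restart X u _ _ _).trans ?_
  rw [show X.encP i ::ₘ (X.ready u + (P ::ₘ (Y.srv u' + (E' + J)))) =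
    P ::ₘ (Y.srv u' + (X.encP i ::ₘ (X.ready u + (E' + J)))) by
      simp only [← singleton_add]; abel]
  refine (sys_restart Y u' _ _ _).trans ?_
  have e : (Ann.par (X.P i) ((Y.P j).subst (inst v))).enc =
      .par (X.encP i) ((Y.encP j).subst (inst v)) := by
    rw [Ann.enc, Ann.enc_subst]
    rfl
  rw [e]
  refine .trans ?_ (sys_par (P := CMV.Proc) _ _ _ _ : CMV.Cong _ _).symm
  rw [show (Y.encP j).subst (inst v) ::ₘ (Y.ready u' + (X.encP i ::ₘ (X.ready u + (E' + J)))) =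
    X.encP i ::ₘ (Y.encP j).subst (inst v) ::ₘ (X.ready u + Y.ready u' + E' + J) by
      simp only [← singleton_add]; abel]
  exact .refl _

theorem St.branch {v A B X G K} (hX : v = .tt ∧ X = A ∨ v = .ff ∧ X = B) (hA : Flat X G K)
    (hG : ∀ A ∈ G, Valid A) (hK : New C (.ite v A B ::ₘ L') K) (hr : Rep C L' D' E' n')
    (he : Env C ({.ite v A B} + L') (0 + D')) (hJ : Junk J)
    (hT : CMV.Cong T (sys (0 + D' + C) (X.enc ::ₘ (E' + J)))) : St T (K + C) (G + L') n' := by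
  rw [zero_add] at he hT
  rw [singleton_add] at he
  exact St.unfold hA hG (Ann.ite_names hX) hr he hK hJ hT

end

/-! ## Reductions of implementations -/

theorem _root_.MixedSessions.CMV.Proc.IsGuard.not_isJunk {P : CMV.Proc} (h : P.IsGuard) :
    ¬ IsJunk P := by
  rintro ⟨l, rfl⟩
  cases h

theorem not_isJunk_nd {Ps : List CMV.Proc} : ¬ IsJunk (nd Ps) := by
  rintro ⟨l, h⟩
  rw [nd_eq_bundle] at h
  simp [bundle] at h

theorem nd_injective {Ps Qs : List CMV.Proc} (h : nd Ps = nd Qs) : Ps = Qs := by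
  simp only [nd, CMV.Proc.res.injEq, CMV.Proc.par.injEq, CMV.Proc.bran.injEq] at h
  obtain ⟨⟨-, hl, -, hg⟩, -⟩ := h
  refine List.ext_get hl fun i h1 h2 => ?_
  have key : ∀ {n m : ℕ} {f : Fin n → CMV.Proc} {g : Fin m → CMV.Proc}, n = m → f ≍ g →
      ∀ h1 h2, f ⟨i, h1⟩ = g ⟨i, h2⟩ := by
    aesop
  have := congrArg (CMV.Proc.subst fun x => .var (x - 2)) (key hl hg h1 h2)
  simp only [CMV.Proc.rename, CMV.Proc.subst_subst, Val.subst_var, Nat.add_sub_cancel] at this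
  rwa [CMV.Proc.subst_id, CMV.Proc.subst_id] at this

theorem Good.valid {Γ₀ C A G K R} (h : Good Γ₀ C (G + R)) (hA : Flat A G K) :
    ∀ B ∈ G, Valid B := fun B hB =>
  h.guard (by simp [hB]) (Flat.guards (P := Ann) hA B hB)

theorem Br.lab_eq_of_key {X Y : Br} {i j} (h : Y.key j = dualKey (X.key i)) :
    X.lab i = Y.lab j := by
  simp only [Br.key, dualKey, Prod.mk.injEq] at h
  exact h.1.symm

theorem Good.dualKey_mem {Γ₀ C R} {X Y : Br} (h : Good Γ₀ C (X.ann ::ₘ Y.ann ::ₘ R))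
    (hy : Y.y = co X.y) (hc : ch X.y ∈ C) (hv : X.vw = .int) {κ : Label × Pol}
    (hκ : κ ∈ X.keys) : dualKey κ ∈ Y.keys := by
  obtain ⟨i, rfl⟩ := Br.mem_keys.1 hκ
  obtain ⟨j, h1, h2⟩ := (h.dual hy hc).2.2 hv i
  exact Br.mem_keys.2 ⟨j, by simp [Br.key, dualKey, h1, h2]⟩

theorem Env.mem_of_mem_add {C L D} (he : Env C L D) {X : Br} (hX : X.ann ∈ L)
    (h : ch X.y ∈ D + C) : ch X.y ∈ C :=
  (mem_add.1 h).resolve_left (he.y_not_mem hX)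

section

variable {T : CMV.Proc} {Γ₀ : Ctx} {C D' : Multiset ℕ} {L' : Multiset Ann} {E' J : Multiset CMV.Proc}
  {n' : ℕ} {X Y : Br} {u u' e : ℕ} {κ : Label × Pol} {B : Multiset ℕ} {P Q : CMV.Proc}

theorem PairData.finish {i j v G K D} (h : PairData C X Y u u' e κ B P Q) (hi : X.act i = .send v)
    (hj : Y.act j = .recv) (hl : X.lab i = Y.lab j)
    (hA : Flat (.par (X.P i) ((Y.P j).subst (inst v))) G K)
    (hK : New C (X.ann ::ₘ Y.ann ::ₘ L') K) (hg : Good Γ₀ C (X.ann ::ₘ Y.ann ::ₘ L'))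
    (hr : Rep C L' D' E' n') (he : Env C (X.ann ::ₘ Y.ann ::ₘ L') D)
    (hD : D = B + (X.upriv u + Y.upriv u') + D') (hJ : Junk J)
    (hT : CMV.Cong T (sys (D + C) (restartV (X.uv u) (X.encP i) ::ₘ
        (restartV ((Y.uv u').map (·.subst (shift 1))) (Y.encP j)).subst (inst v) ::ₘ
        (X.srv u + Y.srv u' + (E' + J))))) :
    SStep C (X.ann ::ₘ Y.ann ::ₘ L') (K + C) (G + (X.keep + Y.keep + L')) ∧
      St T (K + C) (G + (X.keep + Y.keep + L')) n' := by
  have hs := SStep.com X Y h.y h.mem hi hj hl hA hK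
  exact ⟨hs, St.finish h.okX h.okY hi hj hA (Good.valid (hg.sstep hs) hA) hK hr he hD hJ hT⟩

/-- The other half of a pair is the only component that communicates with it. -/
theorem PairData.inp_mem {q : Qual} {R : CMV.Proc} (h : PairData C X Y u u' e κ B P Q)
    (hr : Rep C L' D' E' n') (he : Env C (X.ann ::ₘ Y.ann ::ₘ L') (B + (X.upriv u + Y.upriv u') + D'))
    (hg : Good Γ₀ C (X.ann ::ₘ Y.ann ::ₘ L')) (hJ : Junk J)
    (hP : .inp q (.var (co e)) R ∈ Q ::ₘ (X.srv u + Y.srv u') + (E' + J)) :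
    .inp q (.var (co e)) R = Q := by
  have srv : ∀ {Z : Br} {w}, Z.ann ∈ X.ann ::ₘ Y.ann ::ₘ L' → (∀ c ∈ Z.upriv w, c ∈ X.upriv u + Y.upriv u') →
      .inp q (.var (co e)) R ∉ Z.srv w := by
    intro Z w hZ hu hm
    obtain ⟨hq, hm⟩ := Br.mem_srv hm
    simp only [Br.server, CMV.Proc.inp.injEq, Val.var.injEq] at hm
    have hew : ch e = w := by have := congrArg ch hm.2.1; simpa using this
    have hw : w ∈ X.upriv u + Y.upriv u' := hu w (Br.mem_upriv.2 ⟨hq, rfl⟩)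
    rcases h.sess with ⟨_, rfl, _⟩ | ⟨_, rfl⟩
    · exact he.y_not_mem (X := X) (by simp) (by rw [hew, mem_add, mem_add]; simp [hw])
    · have := (Multiset.nodup_add.1 (Multiset.nodup_add.1 he.nodup).1).2.2
      exact Multiset.disjoint_left.1 this (by simp [hew]) hw
  simp only [mem_add, mem_cons] at hP
  rcases hP with (hP | hP | hP) | hP | hP
  · exact hP
  · grind
  · grind
  · exfalso
    rcases h.sess with ⟨hq, rfl, _⟩ | ⟨_, rfl⟩
    · rcases hr.barb hP .inp with hm | ⟨Z, hZ, hZy⟩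
      · rw [ch_co] at hm
        exact he.y_not_mem (X := X) (by simp) (by simp [hm])
      · obtain ⟨L', rfl⟩ := exists_cons_of_mem hZ
        rw [show X.ann ::ₘ Y.ann ::ₘ Z.ann ::ₘ L' = Y.ann ::ₘ Z.ann ::ₘ X.ann ::ₘ L' by
          simp only [← singleton_add]; abel] at hg
        have := hg.excl (by rw [hZy, h.y])
        rw [h.q₂, hq] at this
        cases this
    · refine Env.no_clash (S := X.ann ::ₘ {Y.ann}) (p := {ch e} + (X.upriv u + Y.upriv u')) ?_ hr hP .inp (by simp)
      simpa using he
  · exact absurd (hJ _ hP) (CMV.Proc.IsGuard.inp _ _ _).not_isJunk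

end

/-- The outcome of a reduction of an implementation. -/
def Advances (T : CMV.Proc) (C : Multiset ℕ) (L : Multiset Ann) : Prop :=
  (∃ n, St T C L n) ∨ ∃ C' L' n, SStep C L C' L' ∧ St T C' L' n

section

variable {T : CMV.Proc} {Γ₀ : Ctx} {C D : Multiset ℕ} {L : Multiset Ann} {E J R : Multiset CMV.Proc}
  {n : ℕ}

theorem Rep.focus_cons (hr : Rep C L D E n) (hJ : Junk J) {P : CMV.Proc}
    (hM : P ::ₘ R = E + J) (hP : ¬ IsJunk P) :
    ∃ S p e w L' D' E' n', Focus C L D E n S p e w L' D' E' n' ∧ P ∈ e :=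
  hr.focus_elem ((mem_add.1 (hM ▸ mem_cons_self P R)).resolve_right
    fun h => hP (hJ _ h))

theorem Rep.step_ite {v : Val} {P Q Z : CMV.Proc} (hr : Rep C L D E n) (he : Env C L D)
    (hg : Good Γ₀ C L) (hJ : Junk J) (hM : .ite v P Q ::ₘ R = E + J)
    (hv : v = .tt ∧ Z = P ∨ v = .ff ∧ Z = Q) (hT : CMV.Cong T (sys (D + C) (Z ::ₘ R))) :
    Advances T C L := by
  obtain ⟨S, p, e, w, L', D', E', n', ⟨h1, h2, rfl, rfl, rfl, rfl⟩, hP⟩ :=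
    hr.focus_cons hJ hM (CMV.Proc.IsGuard.ite _ _ _).not_isJunk
  obtain ⟨A, B, rfl, rfl, rfl, rfl, rfl, rfl⟩ := h1.ite_inv hP
  rw [add_assoc, singleton_add, cons_inj_right] at hM
  subst hM
  obtain ⟨W, hW, rfl⟩ : ∃ W : Ann, (v = .tt ∧ W = A ∨ v = .ff ∧ W = B) ∧ Z = W.enc := by grind
  obtain ⟨G, K, hF, hK⟩ := exists_flat_new W C (.ite v A B ::ₘ L')
  have hs := SStep.ite hW hF hK
  rw [singleton_add] at hg
  exact .inr ⟨_, _, _, by simp; exact hs,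
    St.branch hW hF (Good.valid (hg.sstep hs) hF) hK h2 he hJ hT⟩

theorem Rep.step_com {a : ℕ} {q : Qual} {v : Val} {P Q : CMV.Proc} (hr : Rep C L D E n)
    (he : Env C L D) (hg : Good Γ₀ C L) (hJ : Junk J)
    (hM : .out (.var a) v P ::ₘ .inp q (.var (co a)) Q ::ₘ R = E + J) (ha : ch a ∈ D + C)
    (hT : CMV.Cong T (sys (D + C) (P ::ₘ Q.subst (inst v) ::ₘ
      (CMV.keep q (.inp q (.var (co a)) Q) + R)))) : Advances T C L := by
  obtain ⟨S, p, e, w, L', D', E', n', ⟨h1, h2, rfl, rfl, rfl, rfl⟩, hP⟩ :=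
    hr.focus_cons hJ hM (CMV.Proc.IsGuard.out _ _ _).not_isJunk
  rcases h1.out_inv hP with ⟨X, u, hq₁, hq₂, rfl, rfl, rfl, rfl, hy, rfl, rfl⟩ |
    ⟨X, u, c, κ, hq, hv, hκ, rfl, rfl, rfl, rfl, hy, rfl, rfl⟩ |
    ⟨X, Y, u, u', e, κ, B, Q', ⟨hd, rfl, rfl, rfl, rfl⟩, hy, i, hi, ha', rfl⟩
  · cases hy
    rw [Br.ready_un hq₁, cons_add, cons_add, cons_inj_right, add_assoc,
      singleton_add] at hM
    have hm : .inp q (.var (co (2 * u))) Q ∈ X.server u ::ₘ (E' + J) := by rw [← hM]; simp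
    simp only [mem_cons, mem_add] at hm
    rcases hm with hm | hm | hm
    · rw [hm, cons_inj_right] at hM
      subst hM
      cases hm
      rw [Br.server_inst hq₁ fun _ => hq₂] at hT
      refine .inl ⟨_, St.idle (fun _ => hq₂) h2 he hJ ?_⟩
      rwa [Br.srv_un hq₁]
    · exact absurd (Br.mem_upriv.2 ⟨hq₁, by simp⟩) (he.no_clash h2 hm .inp)
    · exact absurd (hJ _ hm) (CMV.Proc.IsGuard.inp _ _ _).not_isJunk
  · cases hy
    have hc := he.mem_of_mem_add (X := X) (by simp) ha
    rw [cons_add, cons_add, cons_inj_right, add_assoc] at hM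
    have hm : .inp q (.var (co X.y)) Q ∈ X.srv u + (E' + J) := by rw [← hM]; simp
    simp only [mem_add] at hm
    rcases hm with hm | hm | hm
    · obtain ⟨hq₁, hm⟩ := Br.mem_srv hm
      simp only [Br.server, CMV.Proc.inp.injEq, Val.var.injEq] at hm
      have hew : ch X.y = u := by have := congrArg ch hm.2.1; simpa using this
      exact absurd (by simp [Br.mem_upriv, hq₁, hew]) (he.y_not_mem (X := X) (by simp))
    · obtain ⟨S', p', e', w', L'', D'', E'', n'', ⟨h3, h4, rfl, rfl, rfl, rfl⟩, hm'⟩ := h2.focus_elem hm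
      have dual : ∀ Y : Br, Y.ann ∈ S' → Y.y = co X.y → Y.q₂ = .un ∧ dualKey κ ∈ Y.keys := by
        intro Y hY hy
        obtain ⟨S', rfl⟩ := exists_cons_of_mem hY
        rw [singleton_add, cons_add] at hg
        exact ⟨(hg.dual hy hc).1.trans hq, hg.dualKey_mem hy hc hv hκ⟩
      rcases h3.inp_inv hm' with hm | ⟨Y, u', hX, hq', hv', rfl, rfl, rfl, rfl, hy, rfl, hQ⟩ |
        ⟨Y, hY, hy, hq'⟩
      · rw [ch_co] at hm
        exact absurd (by simp [hm]) (he.y_not_mem (X := X) (by simp))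
      · obtain ⟨_, hκ'⟩ := dual Y (by simp) hy.symm
        rw [show ∀ Z, X.srv u + (Z ::ₘ Y.srv u' + E'' + J) = Z ::ₘ (X.srv u + (Y.srv u' + (E'' + J))) by
            intro Z; simp; abel, cons_inj_right] at hM
        subst hM
        refine .inl ⟨_, St.sb hq hq' hy.symm hc hκ hκ' h4 he hJ (hQ _) ?_⟩
        simpa [CMV.keep] using hT
      · grind
    · exact absurd (hJ _ hm) (CMV.Proc.IsGuard.inp _ _ _).not_isJunk
  · cases hy
    have e1 : X.ann ::ₘ {Y.ann} + L' = X.ann ::ₘ Y.ann ::ₘ L' := by simp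
    rw [e1] at hg he ⊢
    rw [cons_add, cons_add, cons_inj_right, add_assoc] at hM
    have hm := hd.inp_mem (q := q) (R := Q) h2 he hg hJ (by rw [← hM]; simp)
    subst hm
    rw [cons_add, cons_inj_right] at hM
    subst hM
    rcases hd.half'.cases with ⟨_, Ps, hm⟩ | ⟨j, v', _, _, hm⟩ | ⟨j, hj, hb, hm⟩
    · cases hm
    · cases hm
    · cases hm
      obtain ⟨G, K, hF, hK⟩ := exists_flat_new (.par (X.P i) ((Y.P j).subst (inst v))) C
        (X.ann ::ₘ Y.ann ::ₘ L')
      obtain ⟨h3, h4⟩ := hd.finish ha' hb (Br.lab_eq_of_key (by grind)) hF hK hg h2 he rfl hJ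
        (by simpa [CMV.keep] using hT)
      exact .inr ⟨_, _, _, h3, h4⟩

theorem Rep.step_case {a m : ℕ} {lab : Fin m → Lab} {P : CMV.Proc} {Q : Fin m → CMV.Proc} {j : Fin m}
    (hr : Rep C L D E n) (he : Env C L D) (hg : Good Γ₀ C L) (hJ : Junk J)
    (hM : .sel (.var a) (lab j) P ::ₘ .bran (.var (co a)) m lab Q ::ₘ R = E + J)
    (ha : ch a ∈ D + C) (hT : CMV.Cong T (sys (D + C) (P ::ₘ Q j ::ₘ R))) : Advances T C L := by
  have offer : ∀ {Y : Br} {u' b} {κ : Label × Pol}, .bran (.var (co a)) m lab Q = Y.offer u' b →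
      lab j = .tag κ.1 κ.2 → dualKey κ ∈ Y.keys ∧ Q j = Y.alts u' b (dualKey κ) := by
    intro Y u' b κ h hl
    rw [Br.offer, offerL] at h
    obtain ⟨-, rfl, h2, h3⟩ := CMV.Proc.bran.inj h
    cases h2
    cases h3
    simp at hl
    have : Y.keys.get j = dualKey κ := by
      refine Prod.ext hl.1 ?_
      rw [dualKey, ← hl.2]
      cases (Y.keys.get j).2 <;> rfl
    exact ⟨this ▸ List.get_mem _ _, congrArg _ this⟩
  obtain ⟨S, p, e, w, L', D', E', n', ⟨h1, h2, rfl, rfl, rfl, rfl⟩, hP⟩ :=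
    hr.focus_cons hJ hM (CMV.Proc.IsGuard.sel _ _ _).not_isJunk
  rcases h1.sel_inv hP with ⟨X, u, κ, hq₁, hq₂, hv, hκ, rfl, rfl, rfl, rfl, hy, hl, rfl⟩ |
    ⟨X, Y, u, u', c, κ, hq, hq', hy', hc, hκ, hκ', rfl, rfl, rfl, rfl, hy, hl, rfl⟩
  · cases hy
    have hc := he.mem_of_mem_add (X := X) (by simp) ha
    rw [singleton_add, cons_add, cons_inj_right] at hM
    have hm : .bran (.var (co X.y)) m lab Q ∈ E' + J := by rw [← hM]; simp
    rcases mem_add.1 hm with hm | hm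
    · obtain ⟨S', p', e', w', L'', D'', E'', n'', ⟨h3, h4, rfl, rfl, rfl, rfl⟩, hm'⟩ := h2.focus_elem hm
      rcases h3.bran_inv hm' with hm | ⟨Y, u', hY, hq', hv', rfl, rfl, rfl, rfl, hy, hQ⟩
      · rw [ch_co] at hm
        exact absurd (by simp [hm]) (he.y_not_mem (X := X) (by simp))
      · obtain ⟨hκ', hQj⟩ := offer hQ hl
        rw [cons_add, cons_add, cons_inj_right] at hM
        subst hM
        have hX : X.Ok := fun h => by rw [hq₁] at h; cases h
        have hd : PairData C X Y u u' X.y κ 0 (X.alts u X.y κ) (Q j) :=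
          ⟨hX, hY, hq'.trans hq₂.symm, hy.symm, hc, hκ, hκ', .inl ⟨hq₂, rfl, rfl⟩, .inl rfl,
            .inl (by grind)⟩
        refine .inl ⟨_, hd.st h4 he hJ ?_ ?_ hT⟩
        · simp [Br.upriv, hq₁]
        · simp only [Br.srv, hq₁, cons_add, zero_add]
    · exact absurd (hJ _ hm) (CMV.Proc.IsGuard.bran _ _ _ _).not_isJunk
  · cases hy
    rw [cons_add, cons_add, cons_inj_right, cons_add,
      cons_add] at hM
    have hm : .bran (.var (co (co (2 * c)))) m lab Q ∈
        Y.offer u' (2 * c) ::ₘ (X.srv u + Y.srv u' + E' + J) := by rw [← hM]; simp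
    simp only [mem_cons, mem_add] at hm
    rcases hm with hm | ((hm | hm) | hm) | hm
    · rw [hm, cons_inj_right] at hM
      subst hM
      obtain ⟨_, hQj⟩ := offer hm hl
      have hd : PairData C X Y u u' (co (2 * c)) κ {c} (X.alts u (co (2 * c)) κ) (Q j) :=
        ⟨fun _ => hq, fun _ => hq', hq'.trans hq.symm, hy', hc, hκ, hκ', .inr ⟨hq, by simp⟩, .inl rfl,
          .inl (by rw [hQj, co_co])⟩
      rw [← singleton_add, add_assoc] at he ⊢
      refine .inl ⟨_, hd.st h2 he hJ ?_ ?_ hT⟩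
      · simp
      · simp only [cons_add]
    · cases (Br.mem_srv hm).2
    · cases (Br.mem_srv hm).2
    · exact absurd (by simp) (he.no_clash h2 hm .bran)
    · exact absurd (hJ _ hm) (CMV.Proc.IsGuard.bran _ _ _ _).not_isJunk

theorem Rep.step_nd {Ps : List CMV.Proc} {P Q : CMV.Proc} (hr : Rep C L D E n) (he : Env C L D)
    (hJ : Junk J) (hM : nd Ps ::ₘ R = E + J) (hPs : P ∈ Ps) (hQ : IsJunk Q)
    (hT : CMV.Cong T (sys (D + C) (P ::ₘ Q ::ₘ R))) : ∃ n, St T C L n := by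
  obtain ⟨S, p, e, w, L', D', E', n', ⟨h1, h2, rfl, rfl, rfl, rfl⟩, hP⟩ :=
    hr.focus_cons hJ hM not_isJunk_nd
  rcases h1.nd_inv hP with ⟨X, u, hX, hv, rfl, rfl, rfl, rfl, hh⟩ |
    ⟨X, Y, u, u', e, κ, B, Q', ⟨hd, rfl, rfl, rfl, rfl⟩, hh⟩
  · rw [cons_add, cons_add, cons_inj_right, add_assoc] at hM
    subst hM
    cases hq : X.q₂ with
    | lin =>
      rw [Br.head_lin_int hq hv] at hh
      rw [nd_injective hh, List.mem_map] at hPs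
      obtain ⟨κ, hκ, rfl⟩ := hPs
      exact ⟨_, St.comL hX hq hv hκ hQ h2 he hJ hT⟩
    | un =>
      obtain ⟨f, hf, hf'⟩ := Br.head_un_int (u := u) hq hv
      rw [hf] at hh
      rw [nd_injective hh, List.mem_map] at hPs
      obtain ⟨κ, hκ, rfl⟩ := hPs
      exact ⟨_, St.comU hq hv hκ hQ h2 he hJ (hf' κ) hT⟩
  · rw [cons_add, cons_add, cons_inj_right, cons_add,
      cons_add] at hM
    subst hM
    rw [Br.alts_eq_nd] at hh
    rw [nd_injective hh, List.mem_map] at hPs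
    obtain ⟨j, hj, rfl⟩ := hPs
    have hd' : PairData C X Y u u' e κ B (X.alt u e j) Q' :=
      { hd with half := .inr ⟨j, Br.mem_members.1 hj, rfl⟩ }
    rw [← singleton_add, add_assoc] at he ⊢
    refine ⟨_, hd'.st h2 he (junk_cons hQ hJ) rfl ?_ hT⟩
    simp only [← singleton_add]
    abel

end

/-- Every reduction of an implementation implements the source system or a reduct of it. -/
theorem St.step {T T' C L n Γ₀} (h : St T C L n) (hg : Good Γ₀ C L) (hs : CMV.Step T T') :
    Advances T' C L := by
  obtain ⟨D, E, J, hr, he, hJ, hT⟩ := h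
  have hL : ∀ P ∈ E + J, P.IsGuard ∨ (∃ Ps, P = nd Ps) ∨ IsJunk P := by
    intro P hP
    rcases mem_add.1 hP with hP | hP
    · exact (hr.guard hP).imp_right .inl
    · grind
  rcases step_inv he.nodup_add hL hT hs with ⟨M, hM, hT'⟩ |
    ⟨Ps, R, P, Q, hM, hP, hQ, hT'⟩
  · generalize hL : E + J = N at hM
    cases hM with
    | ifT P Q R => exact hr.step_ite he hg hJ hL.symm (.inl ⟨rfl, rfl⟩) hT'
    | ifF P Q R => exact hr.step_ite he hg hJ hL.symm (.inr ⟨rfl, rfl⟩) hT'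
    | com q v P Q R ha => exact hr.step_com he hg hJ hL.symm ha hT'
    | case P Q R j ha => exact hr.step_case he hg hJ hL.symm ha hT'
  · exact .inl (hr.step_nd he hJ hM.symm hP hQ hT')

/-! ## Runs of implementations -/

/-- `T` reduces to the system of `M` under restrictions `K`. -/
def Runs (T : CMV.Proc) (K : Multiset ℕ) (M : Multiset CMV.Proc) : Prop :=
  ∃ T', CMV.Steps T T' ∧ CMV.Cong T' (sys K M)

section

variable {T : CMV.Proc} {K : Multiset ℕ} {M M' : Multiset CMV.Proc}

theorem Runs.refl (h : CMV.Cong T (sys K M)) : Runs T K M := ⟨T, .refl, h⟩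

theorem Runs.step (h : Runs T K M) (hs : CMV.Step (sys K M) (sys K M')) : Runs T K M' := by
  obtain ⟨T', h1, h2⟩ := h
  exact ⟨_, h1.tail (.struct h2 hs (.refl _)), .refl _⟩

theorem Runs.rs (h : Runs T K M) (hs : RS K M M') : Runs T K M' := h.step hs.step

theorem Runs.nd {Ps : List CMV.Proc} {P : CMV.Proc} (h : Runs T K (CMV.nd Ps ::ₘ M)) (hP : P ∈ Ps) :
    ∃ J, IsJunk J ∧ Runs T K (P ::ₘ J ::ₘ M) := by
  obtain ⟨J, hJ, hs⟩ := step_nd K hP M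
  exact ⟨J, hJ, h.step hs⟩

theorem Runs.cong (h : Runs T K M) {K' M'} (hc : ∀ T, CMV.Cong T (sys K M) → CMV.Cong T (sys K' M')) :
    Runs T K' M' := by
  obtain ⟨T', h1, h2⟩ := h
  exact ⟨T', h1, hc _ h2⟩

theorem Runs.congr (h : Runs T K M) {K' M'} (hK : K' = K) (hM : M' = M) : Runs T K' M' := by grind

end

theorem rs_select {K : Multiset ℕ} {a : ℕ} {κ : Label × Pol} {P : CMV.Proc} {Y : Br} {u' : ℕ}
    (ha : ch a ∈ K) (hκ : dualKey κ ∈ Y.keys) (R : Multiset CMV.Proc) :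
    RS K (.sel (.var a) (.tag κ.1 κ.2) P ::ₘ Y.offer u' (co a) ::ₘ R)
      (P ::ₘ Y.alts u' (co a) (dualKey κ) ::ₘ R) := by
  obtain ⟨j, hj⟩ := List.get_of_mem hκ
  have := RS.case (lab := fun i => Lab.tag (Y.keys.get i).1 (Y.keys.get i).2.dual) P
    (fun i => Y.alts u' (co a) (Y.keys.get i)) R j ha
  simp only [hj] at this
  rw [show (dualKey κ).2.dual = κ.2 from congrArg Prod.snd (dualKey_dualKey κ)] at this
  exact this

/-- A choice that may have been started. -/
def Br.Asleep (X : Br) (u : ℕ) (e : Multiset CMV.Proc) : Prop :=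
  X.q₁ = .un ∧ e = X.ready u ∨ e = X.head u ::ₘ X.srv u

theorem Br.Asleep.wake {X : Br} {u : ℕ} {e : Multiset CMV.Proc} (h : X.Asleep u e) (hX : X.Ok)
    {T K M} (hT : Runs T K (e + M)) (hu : ∀ c ∈ X.upriv u, c ∈ K) :
    Runs T K (X.head u ::ₘ (X.srv u + M)) := by
  rcases h with ⟨hq, rfl⟩ | rfl
  · rw [Br.ready_un hq, cons_add, singleton_add] at hT
    have := hT.rs (.com (a := 2 * u) _ _ _ _ _ (hu _ (Br.mem_upriv.2 ⟨hq, by simp⟩)))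
    rw [Br.server_inst hq hX] at this
    refine (this.cong (K' := K) fun T h =>
      h.trans (sys_inact (P := CMV.Proc) _ _ : CMV.Cong _ _)).congr rfl ?_
    rw [Br.srv_un hq]
    rfl
  · simp_all

/-- The items of a single choice. -/
def Br.Single (X : Br) (S : Multiset Ann) (p : Multiset ℕ) (e : Multiset CMV.Proc) (w : ℕ) : Prop :=
  (S = {X.ann} ∧ w = 0 ∧ ∃ u, X.Ok ∧ p = X.upriv u ∧ X.Asleep u e) ∨
  (S = {X.ann} ∧ w = 1 ∧ ∃ u κ, X.q₁ = .lin ∧ X.q₂ = .lin ∧ X.vw = .int ∧ κ ∈ X.keys ∧ p = 0 ∧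
    e = {X.pick u X.y κ}) ∨
  (S = {X.ann} ∧ w = 1 ∧ ∃ u c κ, X.q₂ = .un ∧ X.vw = .int ∧ κ ∈ X.keys ∧ p = c ::ₘ X.upriv u ∧
    e = X.call u c κ ::ₘ X.srv u)

theorem Item.src_inv {C S p e w} (h : Item C S p e w) {X : Br} (hX : X.ann ∈ S) :
    X.Single S p e w ∨
    (∃ (X Y : Br) (u u' c : ℕ) (κ : Label × Pol), X.q₂ = .un ∧ Y.q₂ = .un ∧ Y.y = co X.y ∧
      ch X.y ∈ C ∧ κ ∈ X.keys ∧ dualKey κ ∈ Y.keys ∧ S = X.ann ::ₘ {Y.ann} ∧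
      p = c ::ₘ (X.upriv u + Y.upriv u') ∧
      e = X.pick u (co (2 * c)) κ ::ₘ
        Y.offer u' (2 * c) ::ₘ (X.srv u + Y.srv u') ∧ w = 1) ∨
    ∃ X Y u u' a κ B P Q, IsPair C S p e w X Y u u' a κ B P Q := by
  cases h with
  | ite => cases mem_singleton.1 hX
  | load X' u h1 h2 =>
    obtain rfl := Br.ann_injective (mem_singleton.1 hX)
    exact .inl (.inl ⟨rfl, rfl, u, fun _ => h2, rfl, .inl ⟨h1, rfl⟩⟩)
  | idle X' u h1 =>
    obtain rfl := Br.ann_injective (mem_singleton.1 hX)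
    exact .inl (.inl ⟨rfl, rfl, u, h1, rfl, .inr rfl⟩)
  | comL X' u κ h1 h2 h3 h4 =>
    obtain rfl := Br.ann_injective (mem_singleton.1 hX)
    exact .inl (.inr (.inl ⟨rfl, rfl, u, κ, h1, h2, h3, h4, rfl, rfl⟩))
  | comU X' u c κ h1 h2 h3 =>
    obtain rfl := Br.ann_injective (mem_singleton.1 hX)
    exact .inl (.inr (.inr ⟨rfl, rfl, u, c, κ, h1, h2, h3, rfl, rfl⟩))
  | sb X Y u u' c κ h1 h2 h3 h4 h5 h6 =>
    exact .inr (.inl ⟨X, Y, u, u', c, κ, h1, h2, h3, h4, h5, h6, rfl, rfl, rfl, rfl⟩)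
  | pair X Y u u' e κ B h1 h2 h3 h4 h5 h6 h7 h8 h9 h10 =>
    exact .inr (.inr ⟨X, Y, u, u', e, κ, B, _, _,
      ⟨h1, h2, h3, h4, h5, h6, h7, h8, h9, h10⟩, rfl, rfl, rfl, rfl⟩)

theorem Focus.swap {C L D E n S p e w L' D' E' n' S₂ p₂ e₂ w₂ L₂ D₂ E₂ n₂}
    (h : Focus C L D E n S p e w L' D' E' n') (h' : Focus C L' D' E' n' S₂ p₂ e₂ w₂ L₂ D₂ E₂ n₂) :
    Focus C L D E n S₂ p₂ e₂ w₂ (S + L₂) (p + D₂) (e + E₂) (w + n₂) := by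
  obtain ⟨h1, _, rfl, rfl, rfl, rfl⟩ := h
  obtain ⟨h3, h4, rfl, rfl, rfl, rfl⟩ := h'
  exact ⟨h3, .cons h1 h4, add_left_comm _ _ _, add_left_comm _ _ _, add_left_comm _ _ _,
    add_left_comm _ _ _⟩

section

variable {T : CMV.Proc} {Γ₀ : Ctx} {C D' : Multiset ℕ} {L' : Multiset Ann} {E' J : Multiset CMV.Proc}
  {n' : ℕ} {X Y : Br} {u u' e : ℕ} {κ : Label × Pol} {B : Multiset ℕ} {P Q : CMV.Proc}

theorem PairData.ch_mem (h : PairData C X Y u u' e κ B P Q) {D : Multiset ℕ} : ch e ∈ B + D + C := by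
  rcases h.sess with ⟨_, rfl, _⟩ | ⟨_, rfl⟩
  · simp [h.mem]
  · simp

/-- A pair whose summands are fixed communicates. -/
theorem PairData.run_alt {i j v G K} (h : PairData C X Y u u' e κ B P Q) (hi : X.act i = .send v)
    (hj : Y.act j = .recv) (hl : X.lab i = Y.lab j)
    (hA : Flat (.par (X.P i) ((Y.P j).subst (inst v))) G K)
    (hK : New C (X.ann ::ₘ Y.ann ::ₘ L') K) (hg : Good Γ₀ C (X.ann ::ₘ Y.ann ::ₘ L'))
    (hr : Rep C L' D' E' n') (he : Env C (X.ann ::ₘ Y.ann ::ₘ L') (B + (X.upriv u + Y.upriv u') + D'))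
    (hJ : Junk J)
    (hT : Runs T (B + (X.upriv u + Y.upriv u') + D' + C)
      (X.alt u e i ::ₘ Y.alt u' (co e) j ::ₘ (X.srv u + Y.srv u' + (E' + J)))) :
    ∃ T', CMV.Steps T T' ∧ St T' (K + C) (G + (X.keep + Y.keep + L')) n' := by
  rw [Br.alt_send hi, Br.alt_recv hj] at hT
  obtain ⟨T', h1, h2⟩ := hT.rs (.com _ _ _ _ _ (by rw [add_assoc B]; exact h.ch_mem))
  exact ⟨T', h1, (h.finish hi hj hl hA hK hg hr he rfl hJ (by simpa [CMV.keep] using h2)).2⟩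

theorem Br.Half.run (h : X.Half u e κ P) (hκ : κ ∈ X.keys) {K M} (hT : Runs T K (P ::ₘ M)) :
    ∃ i J, X.key i = κ ∧ Junk J ∧ Runs T K (X.alt u e i ::ₘ (J + M)) := by
  rcases h with rfl | ⟨i, hi, rfl⟩
  · obtain ⟨i, hi⟩ := Br.mem_keys.1 hκ
    rw [Br.alts_eq_nd] at hT
    obtain ⟨J, hJ, hT⟩ := hT.nd (List.mem_map.2 ⟨i, Br.mem_members.2 hi, rfl⟩)
    exact ⟨i, {J}, hi, by simpa [Junk] using hJ, hT⟩
  · exact ⟨i, 0, hi, by simp [Junk], by simpa using hT⟩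

theorem Br.run_alts {i : Fin X.n} {K M} (hT : Runs T K (X.alts u e (X.key i) ::ₘ M)) :
    ∃ J, Junk J ∧ Runs T K (X.alt u e i ::ₘ (J + M)) := by
  rw [Br.alts_eq_nd] at hT
  obtain ⟨J, hJ, hT⟩ := hT.nd (List.mem_map.2 ⟨i, Br.mem_members.2 rfl, rfl⟩)
  exact ⟨{J}, by simpa [Junk] using hJ, hT⟩

theorem junk_add {J J' : Multiset CMV.Proc} (hJ : Junk J) (hJ' : Junk J') :
    Junk (J + J') := fun P hP => (mem_add.1 hP).elim (hJ P) (hJ' P)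

/-- A pair whose summands are not yet fixed can perform any of its communications. -/
theorem PairData.run_to {i j v G K} (h : PairData C X Y u u' e κ B P Q) (hi : X.act i = .send v)
    (hj : Y.act j = .recv) (hl : X.lab i = Y.lab j) (hP : P = X.alts u e (X.key i))
    (hQ : Q = Y.alts u' (co e) (Y.key j))
    (hA : Flat (.par (X.P i) ((Y.P j).subst (inst v))) G K)
    (hK : New C (X.ann ::ₘ Y.ann ::ₘ L') K) (hg : Good Γ₀ C (X.ann ::ₘ Y.ann ::ₘ L'))
    (hr : Rep C L' D' E' n') (he : Env C (X.ann ::ₘ Y.ann ::ₘ L') (B + (X.upriv u + Y.upriv u') + D'))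
    (hJ : Junk J)
    (hT : Runs T (B + (X.upriv u + Y.upriv u') + D' + C)
      (P ::ₘ Q ::ₘ (X.srv u + Y.srv u' + (E' + J)))) :
    ∃ T', CMV.Steps T T' ∧ St T' (K + C) (G + (X.keep + Y.keep + L')) n' := by
  subst hP hQ
  obtain ⟨J₁, hJ₁, hT⟩ := Br.run_alts hT
  obtain ⟨J₂, hJ₂, hT⟩ := Br.run_alts (i := j) (M := X.alt u e i ::ₘ (J₁ + (X.srv u + Y.srv u' + (E' + J))))
    (hT.congr rfl (by simp only [← singleton_add]; abel))
  refine h.run_alt hi hj hl hA hK hg hr he (junk_add hJ₁ (junk_add hJ₂ hJ)) (hT.congr rfl ?_)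
  simp only [← singleton_add]
  abel

/-- A pair communicates. -/
theorem PairData.run (h : PairData C X Y u u' e κ B P Q)
    (hg : Good Γ₀ C (X.ann ::ₘ Y.ann ::ₘ L'))
    (hr : Rep C L' D' E' n') (he : Env C (X.ann ::ₘ Y.ann ::ₘ L') (B + (X.upriv u + Y.upriv u') + D'))
    (hJ : Junk J)
    (hT : Runs T (B + (X.upriv u + Y.upriv u') + D' + C)
      (P ::ₘ Q ::ₘ (X.srv u + Y.srv u' + (E' + J)))) :
    ∃ T' C₁ L₁, CMV.Steps T T' ∧ SStep C (X.ann ::ₘ Y.ann ::ₘ L') C₁ L₁ ∧ St T' C₁ L₁ n' := by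
  obtain ⟨i, J₁, hi, hJ₁, hT⟩ := h.half.run h.key hT
  obtain ⟨j, J₂, hj, hJ₂, hT⟩ := h.half'.run h.key'
    (M := X.alt u e i ::ₘ (J₁ + (X.srv u + Y.srv u' + (E' + J))))
    (hT.congr rfl (by simp only [← singleton_add]; abel))
  have hJ' := junk_add hJ₁ (junk_add hJ₂ hJ)
  have hl : X.lab i = Y.lab j := Br.lab_eq_of_key (by grind)
  have hpol : (Y.act j).pol = (X.act i).pol.dual := by
    subst hi
    exact congrArg Prod.snd hj
  cases ha : X.act i with
  | send v =>
    cases hb : Y.act j with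
    | send w => simp [ha, hb, Act.pol, Pol.dual] at hpol
    | recv =>
      obtain ⟨G, K, hA, hK⟩ := exists_flat_new (.par (X.P i) ((Y.P j).subst (inst v))) C
        (X.ann ::ₘ Y.ann ::ₘ L')
      obtain ⟨T', h1, h2⟩ := h.run_alt ha hb hl hA hK hg hr he hJ' (hT.congr rfl
        (by simp only [← singleton_add]; abel))
      exact ⟨T', _, _, h1, .com X Y h.y h.mem ha hb hl hA hK, h2⟩
  | recv =>
    cases hb : Y.act j with
    | recv => simp [ha, hb, Act.pol, Pol.dual] at hpol
    | send v =>
      rw [cons_swap] at hg he ⊢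
      rw [add_comm (X.upriv u)] at hT he
      obtain ⟨G, K, hA, hK⟩ := exists_flat_new (.par (Y.P j) ((X.P i).subst (inst v))) C
        (Y.ann ::ₘ X.ann ::ₘ L')
      obtain ⟨T', h1, h2⟩ := h.symm.run_alt hb ha hl.symm hA hK hg hr he hJ' (hT.congr rfl
        (by rw [co_co]; simp only [← singleton_add]; abel))
      exact ⟨T', _, _, h1, .com Y X h.symm.y h.symm.mem hb ha hl.symm hA hK, h2⟩

end

/-- A communication that has been started can be completed. -/
def Finishes (T : CMV.Proc) (C : Multiset ℕ) (L : Multiset Ann) (n : ℕ) : Prop :=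
  ∃ T' C₁ L₁ n', n' < n ∧ CMV.Steps T T' ∧ SStep C L C₁ L₁ ∧ St T' C₁ L₁ n'

section

variable {T : CMV.Proc} {Γ₀ : Ctx} {C D D' p : Multiset ℕ} {S L L' : Multiset Ann}
  {e E E' J : Multiset CMV.Proc} {n n' w : ℕ}

theorem Focus.single (h : Focus C L D E n S p e w L' D' E' n') (hg : Good Γ₀ C L)
    (he : Env C L D) (hJ : Junk J) (hT : CMV.Cong T (sys (D + C) (E + J))) {X : Br}
    (hX : X.ann ∈ S) : Finishes T C L n ∨
    X.Single S p e w := by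
  obtain ⟨hi, hr, rfl, rfl, rfl, rfl⟩ := h
  rcases hi.src_inv hX with h | ⟨X, Y, u, u', c, κ, h1, h2, h3, h4, h5, h6, rfl, rfl, rfl, rfl⟩ |
    ⟨X, Y, u, u', a, κ, B, P, Q, hd, rfl, rfl, rfl, rfl⟩
  · exact .inr h
  · have hd : PairData C X Y u u' (co (2 * c)) κ {c} (X.alts u (co (2 * c)) κ)
        (Y.alts u' (co (co (2 * c))) (dualKey κ)) :=
      ⟨fun _ => h1, fun _ => h2, h2.trans h1.symm, h3, h4, h5, h6, .inr ⟨h1, by simp⟩, .inl rfl, .inl rfl⟩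
    have e1 : X.ann ::ₘ {Y.ann} + L' = X.ann ::ₘ Y.ann ::ₘ L' := by simp
    rw [e1] at hg he ⊢
    have hT := (Runs.refl (hT)).congr (M' := X.pick u (co (2 * c)) κ ::ₘ Y.offer u' (co (co (2 * c))) ::ₘ (X.srv u + Y.srv u' + (E' + J))) rfl
      (by rw [co_co]; simp only [← singleton_add]; abel)
    obtain ⟨T', C₁, L₁, k1, k2, k3⟩ := hd.run hg hr he hJ (hT.rs (rs_select (by simp) h6 _))
    exact .inl ⟨T', C₁, L₁, n', by omega, k1, k2, k3⟩
  · have e1 : X.ann ::ₘ {Y.ann} + L' = X.ann ::ₘ Y.ann ::ₘ L' := by simp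
    rw [e1] at hg he ⊢
    obtain ⟨T', C₁, L₁, k1, k2, k3⟩ := hd.run hg hr he hJ ((Runs.refl hT).congr rfl
      (by simp; abel))
    exact .inl ⟨T', C₁, L₁, n', by omega, k1, k2, k3⟩

end

/-! ## Progress of implementations -/

/-- The choices `X` and `Y` have met, where `κ` is the selected branch. -/
structure Meets (T : CMV.Proc) (C : Multiset ℕ) (L' : Multiset Ann) (D' : Multiset ℕ)
    (E' : Multiset CMV.Proc) (X Y : Br) (u u' e : ℕ) (κ : Label × Pol) (B : Multiset ℕ)
    (J : Multiset CMV.Proc) : Prop where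
  data : PairData C X Y u u' e κ B (X.alts u e κ) (Y.alts u' (co e) (dualKey κ))
  junk : Junk J
  env : Env C (X.ann ::ₘ Y.ann ::ₘ L') (B + (X.upriv u + Y.upriv u') + D')
  runs : Runs T (B + (X.upriv u + Y.upriv u') + D' + C)
    (X.alts u e κ ::ₘ Y.alts u' (co e) (dualKey κ) ::ₘ (X.srv u + Y.srv u' + (E' + J)))

theorem Meets.symm {T C L' D' E' X Y u u' e κ B J} (h : Meets T C L' D' E' X Y u u' e κ B J) :
    Meets T C L' D' E' Y X u' u (co e) (dualKey κ) B J := by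
  refine ⟨?_, h.junk, ?_, h.runs.congr ?_ ?_⟩
  · have := h.data.symm
    simpa only [co_co, dualKey_dualKey] using this
  · rw [cons_swap, add_comm (Y.upriv u')]
    exact h.env
  · grind
  · rw [co_co, dualKey_dualKey]
    simp only [← singleton_add]
    abel

section

variable {T : CMV.Proc} {Γ₀ : Ctx} {C D' p p' : Multiset ℕ} {L' : Multiset Ann}
  {e e' E' J : Multiset CMV.Proc} {n' : ℕ} {X Y : Br} {u u' : ℕ} {κ : Label × Pol}

theorem Br.Asleep.head (h : X.Asleep u e) (hX : X.Ok) (hq : X.q₂ = .lin) : e = {X.head u} := by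
  have := Br.lin_of_Ok hX hq
  rcases h with ⟨h, _⟩ | rfl
  · grind
  · rw [Br.srv, this]; rfl

/-- A started linear choice meets its partner. -/
theorem meets_comL (hX : X.q₁ = .lin) (hq : X.q₂ = .lin) (hY : Y.Ok) (hq' : Y.q₂ = .lin)
    (hv' : Y.vw = .ext) (hy : Y.y = co X.y) (hc : ch X.y ∈ C) (hκ : κ ∈ X.keys)
    (hκ' : dualKey κ ∈ Y.keys) (he : Env C (X.ann ::ₘ Y.ann ::ₘ L') D') (hJ : Junk J)
    (hT : Runs T (D' + C) (X.pick u X.y κ ::ₘ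
      (Y.head u' ::ₘ (E' + J)))) : Meets T C L' D' E' X Y u u' X.y κ 0 J := by
  have hX' : X.Ok := fun h => by rw [hX] at h; cases h
  have h1 : X.upriv u = 0 := by rw [Br.upriv, hX]
  have h2 : X.srv u = 0 := by rw [Br.srv, hX]
  have h3 : Y.upriv u' = 0 := by rw [Br.upriv, Br.lin_of_Ok hY hq']
  have h4 : Y.srv u' = 0 := by rw [Br.srv, Br.lin_of_Ok hY hq']
  rw [Br.head_lin_ext hq' hv', hy] at hT
  refine ⟨⟨hX', hY, hq'.trans hq.symm, hy, hc, hκ, hκ', .inl ⟨hq, rfl, rfl⟩, .inl rfl, .inl rfl⟩,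
    hJ, ?_, ?_⟩
  · grind
  · have := hT.rs (rs_select (by simp [hc]) hκ' _)
    simpa [h1, h2, h3, h4] using this

/-- A started unrestricted choice meets its partner. -/
theorem meets_comU {c : ℕ} (hX : X.Ok) (hq : X.q₂ = .un) (hY : Y.Ok) (hq' : Y.q₂ = .un)
    (hv' : Y.vw = .ext) (hy : Y.y = co X.y) (hc : ch X.y ∈ C) (hκ : κ ∈ X.keys)
    (hκ' : dualKey κ ∈ Y.keys)
    (he : Env C (X.ann ::ₘ Y.ann ::ₘ L') ({c} + (X.upriv u + Y.upriv u') + D'))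
    (hJ : Junk J)
    (hT : Runs T ({c} + (X.upriv u + Y.upriv u') + D' + C) (X.call u c κ ::ₘ
      (Y.head u' ::ₘ (X.srv u + Y.srv u' + (E' + J))))) :
    Meets T C L' D' E' X Y u u' (co (2 * c)) κ {c} J := by
  refine ⟨⟨hX, hY, hq'.trans hq.symm, hy, hc, hκ, hκ', .inr ⟨hq, by simp⟩, .inl rfl, .inl rfl⟩,
    hJ, he, ?_⟩
  obtain ⟨Q, hQ, hQ'⟩ := Br.head_un_ext (u := u') hq' hv'
  rw [hQ, hy] at hT
  have := hT.rs (.com _ _ _ _ _ (by simp [hc]))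
  rw [hQ'] at this
  rw [show (2 * c) = co (co (2 * c)) from (co_co _).symm] at this
  have := (this.congr (M' := X.pick u (co (2 * c)) κ ::ₘ
    Y.offer u' (co (co (2 * c))) ::ₘ (X.srv u + Y.srv u' + (E' + J))) rfl (by simp [CMV.keep])).rs
      (rs_select (by simp) hκ' _)
  exact this

/-- A choice that has not been started meets its partner on any branch. -/
theorem meets_asleep (hX : X.Ok) (hv : X.vw = .int) (hY : Y.Ok) (hq : Y.q₂ = X.q₂)
    (hv' : Y.vw = .ext) (hy : Y.y = co X.y) (hc : ch X.y ∈ C) (hκ : κ ∈ X.keys)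
    (hκ' : dualKey κ ∈ Y.keys)
    (he : Env C (X.ann ::ₘ Y.ann ::ₘ L') (X.upriv u + Y.upriv u' + D')) (hJ : Junk J)
    (hX' : X.Asleep u e) (hY' : Y.Asleep u' e')
    (hT : Runs T (X.upriv u + Y.upriv u' + D' + C) (e + e' + (E' + J))) :
    ∃ a B J', Meets T C L' D' E' X Y u u' a κ B J' := by
  have hT := hX'.wake hX (hT.congr (M' := e + (e' + (E' + J))) rfl (by abel))
    (fun c hc => by simp [hc])
  have hT := hY'.wake hY (hT.congr (M' := e' + (X.head u ::ₘ (X.srv u + (E' + J)))) rfl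
    (by simp; abel)) (fun c hc => by simp [hc])
  have hT := hT.congr (M' := X.head u ::ₘ (Y.head u' ::ₘ (X.srv u + Y.srv u' + (E' + J)))) rfl
    (by simp only [← singleton_add]; abel)
  cases hq' : X.q₂ with
  | lin =>
    have hX₁ := Br.lin_of_Ok hX hq'
    have hY₁ := Br.lin_of_Ok hY (hq.trans hq')
    rw [Br.head_lin_int hq' hv] at hT
    obtain ⟨Q, hQ, hT⟩ := hT.nd (List.mem_map.2 ⟨κ, hκ, rfl⟩)
    refine ⟨_, _, Q ::ₘ J, meets_comL hX₁ hq' hY (hq.trans hq') hv' hy hc hκ hκ' ?_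
      (junk_cons hQ hJ) (hT.congr ?_ ?_)⟩
    · simpa [Br.upriv, hX₁, hY₁] using he
    · simp [Br.upriv, hX₁, hY₁]
    · simp only [Br.srv, hX₁, hY₁, ← singleton_add]
      abel
  | un =>
    obtain ⟨f, hf, hf'⟩ := Br.head_un_int (u := u) hq' hv
    rw [hf] at hT
    obtain ⟨Q, hQ, hT⟩ := hT.nd (List.mem_map.2 ⟨κ, hκ, rfl⟩)
    obtain ⟨c, hc', hopen⟩ := he.exists_open (f κ)
      (Q ::ₘ (Y.head u' ::ₘ (X.srv u + Y.srv u' + (E' + J))))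
    have hT := hT.cong hopen
    rw [hf'] at hT
    refine ⟨_, _, Q ::ₘ J, meets_comU (c := c) hX hq' hY (hq.trans hq') hv' hy hc hκ hκ' ?_
      (junk_cons hQ hJ) (hT.congr ?_ ?_)⟩
    · simp_all
    · simp_all
    · simp only [← singleton_add]
      abel

end

section

variable {T : CMV.Proc} {Γ₀ : Ctx} {C D : Multiset ℕ} {L L' : Multiset Ann}
  {E J : Multiset CMV.Proc} {n : ℕ} {X Y : Br}

/-- Two choices that can communicate meet, on any branch or else on one that has been chosen
before. -/
theorem Rep.meets {κ : Label × Pol} (hr : Rep C (X.ann ::ₘ Y.ann ::ₘ L') D E n)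
    (hg : Good Γ₀ C (X.ann ::ₘ Y.ann ::ₘ L')) (he : Env C (X.ann ::ₘ Y.ann ::ₘ L') D)
    (hJ : Junk J) (hT : CMV.Cong T (sys (D + C) (E + J))) (hv : X.vw = .int)
    (hy : Y.y = co X.y) (hc : ch X.y ∈ C) (hκ : κ ∈ X.keys) :
    Finishes T C (X.ann ::ₘ Y.ann ::ₘ L') n ∨ ∃ D' E' n' u u' a κ' B J',
      Rep C L' D' E' n' ∧ Meets T C L' D' E' X Y u u' a κ' B J' ∧ (κ' = κ ∧ n' ≤ n ∨ n' < n) := by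
  obtain ⟨hq, hv', -⟩ := hg.dual hy hc
  have hκ' := fun {κ} => hg.dualKey_mem (κ := κ) hy hc hv
  rw [hv] at hv'
  obtain ⟨S, p, e, w, L₁, D₁, E₁, n₁, hf, hX⟩ := hr.focus_src (A := X.ann) (by simp)
  rcases hf.single hg he hJ hT hX with h | h
  · grind
  have hS : S = {X.ann} := by rcases h with h | h | h <;> exact h.1
  obtain rfl : Y.ann ::ₘ L' = L₁ := by
    have := hf.src
    rw [hS, singleton_add, cons_inj_right] at this
    exact this
  obtain ⟨S₂, p₂, e₂, w₂, L₂, D₂, E₂, n₂, hf₂, hY⟩ := hf.rep.focus_src (A := Y.ann) (by simp)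
  rcases (hf.swap hf₂).single hg he hJ hT hY with h' | ⟨rfl, rfl, u', hYok, rfl, hY'⟩ |
    ⟨_, _, _, _, _, _, h', _⟩ | ⟨_, _, _, _, _, _, h', _⟩
  · grind
  · obtain rfl : L' = L₂ := by
      have := hf₂.src
      rw [singleton_add, cons_inj_right] at this
      exact this
    obtain ⟨-, hr', -, rfl, rfl, rfl⟩ := hf₂
    obtain ⟨-, -, -, rfl, rfl, rfl⟩ := hf
    have hT := Runs.refl hT
    rcases h with ⟨-, rfl, u, hX, rfl, hX'⟩ | ⟨-, rfl, u, κ', hX, hq', -, hκ₁, rfl, rfl⟩ |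
      ⟨-, rfl, u, c, κ', hq', -, hκ₁, rfl, rfl⟩
    · obtain ⟨a, B, J', h⟩ := meets_asleep (E' := E₂) hX hv hYok hq hv' hy hc hκ (hκ' hκ) (by rwa [add_assoc])
        hJ hX' hY' (hT.congr (by grind) (by abel))
      exact .inr ⟨_, _, n₂, u, u', a, κ, B, J', hr', h, .inl ⟨rfl, by omega⟩⟩
    · have h4 : Y.upriv u' = 0 := by rw [Br.upriv, Br.lin_of_Ok hYok (hq.trans hq')]
      rw [hY'.head hYok (hq.trans hq')] at hT
      have h := meets_comL (E' := E₂) hX hq' hYok (hq.trans hq') hv' hy hc hκ₁ (hκ' hκ₁)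
        (by simpa [h4] using he) hJ (hT.congr (by simp [h4])
          (by simp only [← singleton_add]; abel))
      exact .inr ⟨_, _, n₂, u, u', _, κ', _, J, hr', h, .inr (by omega)⟩
    · have hT := hY'.wake hYok (hT.congr (M' := e₂ + (X.call u c κ' ::ₘ
          (X.srv u + (E₂ + J)))) rfl (by simp only [← singleton_add]; abel))
        (fun c hc => by simp [hc])
      have hk : c ::ₘ X.upriv u + (Y.upriv u' + D₂) = {c} + (X.upriv u + Y.upriv u') + D₂ := by
        simp only [← singleton_add]; abel
      rw [hk] at he hT
      have h := meets_comU (E' := E₂) (fun _ => hq') hq' hYok (hq.trans hq') hv' hy hc hκ₁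
        (hκ' hκ₁) he hJ (hT.congr rfl (by simp only [← singleton_add]; abel))
      exact .inr ⟨_, _, n₂, u, u', _, κ', _, J, hr', h, .inr (by omega)⟩
  all_goals
    rw [hv'] at h'
    cases h'

theorem Meets.progress {i j v G K D' E' n' u u' a κ' κ B J'} (hr : Rep C L' D' E' n')
    (h : Meets T C L' D' E' X Y u u' a κ' B J') (hn : κ' = κ ∧ n' ≤ n ∨ n' < n)
    (hg : Good Γ₀ C (X.ann ::ₘ Y.ann ::ₘ L')) (hκ : κ = X.key i)
    (hi : X.act i = .send v) (hj : Y.act j = .recv) (hl : X.lab i = Y.lab j)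
    (hA : Flat (.par (X.P i) ((Y.P j).subst (inst v))) G K)
    (hK : New C (X.ann ::ₘ Y.ann ::ₘ L') K) :
    (∃ T' m, m ≤ n ∧ CMV.Steps T T' ∧ St T' (K + C) (G + (X.keep + Y.keep + L')) m) ∨
      Finishes T C (X.ann ::ₘ Y.ann ::ₘ L') n := by
  rcases hn with ⟨rfl, hn⟩ | hn
  · subst hκ
    obtain ⟨T', h1, h2⟩ := h.data.run_to hi hj hl rfl
      (by rw [Br.key, Br.key, hi, hj, hl]; rfl) hA hK hg hr h.env h.junk h.runs
    exact .inl ⟨T', n', hn, h1, h2⟩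
  · obtain ⟨T', C₁, L₁, h1, h2, h3⟩ := h.data.run hg hr h.env h.junk h.runs
    exact .inr ⟨T', C₁, L₁, n', hn, h1, h2, h3⟩

end

/-- An implementation can follow the source system, or complete a communication that has been
started. -/
theorem St.progress {T C L n Γ₀ C₂ L₂} (h : St T C L n) (hg : Good Γ₀ C L) (hs : SStep C L C₂ L₂) :
    (∃ T' m, m ≤ n ∧ CMV.Steps T T' ∧ St T' C₂ L₂ m) ∨ Finishes T C L n := by
  have hg' := hg.sstep hs
  obtain ⟨D, E, J, hr, he, hJ, hT⟩ := h
  cases hs with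
  | @ite v A B R X G K hv hX hK =>
    obtain ⟨S, p, e, w, L', D', E', n', hf, hS⟩ := hr.focus_src (A := .ite v A B) (by simp)
    obtain ⟨hi, h2, hL, rfl, rfl, rfl⟩ := hf
    obtain ⟨rfl, rfl, rfl, rfl⟩ : S = {.ite v A B} ∧ p = 0 ∧ e = {.ite v A.enc B.enc} ∧ w = 0 := by
      cases hi <;> simp_all [Br.ann]
    rw [singleton_add, cons_inj_right] at hL
    subst hL
    have : CMV.Step (sys (0 + D' + C) ({.ite v A.enc B.enc} + E' + J))
        (sys (0 + D' + C) (X.enc ::ₘ (E' + J))) := by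
      rw [add_assoc {_}, singleton_add]
      rcases hv with ⟨rfl, rfl⟩ | ⟨rfl, rfl⟩
      · exact (RS.ifT _ _ _).step
      · exact (RS.ifF _ _ _).step
    refine .inl ⟨_, n', by omega, .single (.struct hT this (.refl _)),
      St.branch hv hX (Good.valid hg' hX) hK h2 ?_ hJ (.refl _)⟩
    rwa [singleton_add]
  | @com R G K v X Y i j hy hc hi hj hl hX hK =>
    cases hv : X.vw with
    | int =>
      rcases hr.meets hg he hJ hT hv hy hc (Br.mem_keys.2 ⟨i, rfl⟩) with h |
        ⟨D', E', n', u, u', a, κ', B, J', h1, h2, h3⟩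
      · grind
      · exact h2.progress h1 h3 hg rfl hi hj hl hX hK
    | ext =>
      have hv' := (hg.dual hy hc).2.1
      rw [hv] at hv'
      have hg₂ := hg
      have e1 : X.ann ::ₘ Y.ann ::ₘ R = Y.ann ::ₘ X.ann ::ₘ R := cons_swap _ _ _
      rw [e1] at hr hg₂ he
      have hy' : X.y = co Y.y := by rw [hy, co_co]
      have hc' : ch Y.y ∈ C := by rwa [hy, ch_co]
      rcases hr.meets hg₂ he hJ hT hv' hy' hc' (Br.mem_keys.2 ⟨j, rfl⟩) with h |
        ⟨D', E', n', u, u', a, κ', B, J', h1, h2, h3⟩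
      · grind
      · have hk : dualKey (Y.key j) = X.key i := by rw [Br.key, Br.key, hi, hj, hl]; rfl
        refine h2.symm.progress (κ := X.key i) h1 (h3.imp_left fun h => ⟨by grind, h.2⟩) hg rfl hi hj hl hX hK

/-! ## Barbs of implementations -/

/-- The source system has a choice on the free name `y`. -/
def SBarb (C : Multiset ℕ) (L : Multiset Ann) (y : ℕ) : Prop :=
  ∃ X : Br, X.ann ∈ L ∧ X.y = y ∧ ch y ∉ C

theorem _root_.MixedSessions.CMV.IsJunk.not_barb {P : CMV.Proc} (h : IsJunk P) {y : ℕ} :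
    ¬ Barb P y := by
  obtain ⟨l, rfl⟩ := h
  intro hy
  rw [bundle, barb_res, barb_par, (prod_cong _).barb] at hy
  rcases hy with hy | hy
  · cases hy
  · have := (barb_sys (K := 0) (L := ↑(l.map fun k => CMV.Proc.sel (.var 1) k .inact))
      (x := y + 2)).1 (by rw [Calculus.sys, nuM_zero]; exact hy)
    obtain ⟨⟨P, hP, hb⟩, _⟩ := this
    simp only [Multiset.mem_coe, List.mem_map] at hP
    obtain ⟨i, _, rfl⟩ := hP
    simp at hb

theorem St.sBarb {T C L n y} (h : St T C L n) (hy : Barb T y) : SBarb C L y := by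
  obtain ⟨D, E, J, hr, he, hJ, hT⟩ := h
  rw [hT.barb, barb_sys] at hy
  obtain ⟨⟨P, hP, hb⟩, hK⟩ := hy
  simp only [mem_add, not_or] at hP hK
  rcases hP with hP | hP
  · obtain ⟨X, hX, hX'⟩ := (hr.barb hP hb).resolve_left hK.1
    exact ⟨X, hX, hX', hK.2⟩
  · exact absurd hb (hJ P hP).not_barb

theorem Runs.weakBarb {T K M P y} (h : Runs T K M) (hP : P ∈ M) (hb : Barb P y) (hy : ch y ∉ K) :
    WeakBarb T y := by
  obtain ⟨T', h1, h2⟩ := h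
  exact ⟨T', h1, (h2.barb y).2 (barb_sys.2 ⟨⟨P, hP, hb⟩, hy⟩)⟩

theorem Good.exists_key {Γ₀ C L} {X : Br} (h : Good Γ₀ C L) (hX : X.ann ∈ L) : ∃ κ, κ ∈ X.keys := by
  obtain ⟨R, rfl⟩ := exists_cons_of_mem hX
  obtain ⟨Γ, hΓ, hfin, hs, hdual, hdom⟩ := h
  obtain ⟨o₁, o₂, e, hd, hw, hR⟩ := hs.extract rfl
  change ChoiceWT Γ X.q₁ X.q₂ X.vw X.lab X.act (fun j => WT (X.P j)) (.var X.y) o₁ at hw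
  obtain @⟨_, S₁, m, labX, polX, TX, UX, kX, oX, hSX, hCX, hsX, hkX, hlX, hpX, hqX, hoX, hbX⟩ := hw
  obtain ⟨j, -⟩ := exists_branch hCX hkX
  exact ⟨_, Br.mem_keys.2 ⟨j, rfl⟩⟩

theorem St.weakBarb {T C L n Γ₀ y} (h : St T C L n) (hg : Good Γ₀ C L) (hy : SBarb C L y) :
    WeakBarb T y := by
  obtain ⟨D, E, J, hr, he, hJ, hT⟩ := h
  obtain ⟨X, hX, rfl, hC⟩ := hy
  have hK : ch X.y ∉ D + C := by
    simp only [mem_add, not_or]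
    exact ⟨he.y_not_mem hX, hC⟩
  obtain ⟨S, p, e, w, L', D', E', n', ⟨hi, hr', rfl, rfl, rfl, rfl⟩, hS⟩ := hr.focus_src hX
  rcases hi.src_inv hS with (⟨rfl, rfl, u, hX', rfl, h⟩ | ⟨rfl, rfl, u, κ, _, _, _, _, _, rfl⟩ |
    ⟨rfl, rfl, u, c, κ, _, _, _, _, rfl⟩) | ⟨X', Y, u, u', c, κ, _, _, h1, h2, _, _, rfl, _⟩ |
    ⟨X', Y, u, u', a, κ, B, P, Q, hd, rfl, _⟩
  · obtain ⟨κ, hκ⟩ := hg.exists_key hX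
    have hT := h.wake hX' ((Runs.refl hT).congr (M' := e + (E' + J)) rfl (by grind))
      (fun c hc => by simp [hc])
    cases hq : X.q₂ <;> cases hv : X.vw
    · rw [Br.head_lin_int hq hv] at hT
      obtain ⟨Q, hQ, hT⟩ := hT.nd (List.mem_map.2 ⟨κ, hκ, rfl⟩)
      exact hT.weakBarb (mem_cons_self _ _) .sel hK
    · rw [Br.head_lin_ext hq hv] at hT
      exact hT.weakBarb (mem_cons_self _ _) .bran hK
    · obtain ⟨f, hf, hf'⟩ := Br.head_un_int (u := u) hq hv
      rw [hf] at hT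
      obtain ⟨Q, hQ, hT⟩ := hT.nd (List.mem_map.2 ⟨κ, hκ, rfl⟩)
      obtain ⟨c, hc', hopen⟩ := he.exists_open (f κ) (Q ::ₘ (X.srv u + (E' + J)))
      have hT := hT.cong hopen
      rw [hf'] at hT
      refine hT.weakBarb (mem_cons_self _ _) .out ?_
      simp only [mem_add, not_or]
      exact ⟨hc'.y_not_mem hX, hC⟩
    · obtain ⟨Q, hQ, -⟩ := Br.head_un_ext (u := u) hq hv
      rw [hQ] at hT
      exact hT.weakBarb (mem_cons_self _ _) .inp hK
  · exact (Runs.refl hT).weakBarb (mem_add.2 (.inl (mem_add.2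
      (.inl (Multiset.mem_singleton_self _))))) .sel hK
  · exact (Runs.refl hT).weakBarb (mem_add.2 (.inl (mem_add.2
      (.inl (mem_cons_self _ _))))) .out hK
  · simp only [mem_cons, mem_singleton] at hS
    rcases hS with hS | hS <;> obtain rfl := Br.ann_injective hS
    · grind
    · simp_all
  · simp only [mem_cons, mem_singleton] at hS
    rcases hS with hS | hS <;> obtain rfl := Br.ann_injective hS
    · exact absurd hd.mem hC
    · rw [hd.y, ch_co] at hC
      exact absurd hd.mem hC

/-! ## Reachable source systems -/

/-- Reduction of source systems in many steps. -/
def SSteps (C : Multiset ℕ) (L : Multiset Ann) (C' : Multiset ℕ) (L' : Multiset Ann) : Prop :=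
  Relation.ReflTransGen (fun p q : Multiset ℕ × Multiset Ann => SStep p.1 p.2 q.1 q.2)
    (C, L) (C', L')

theorem SSteps.induction {C₀ L₀ C L} (h : SSteps C₀ L₀ C L) {Q : Multiset ℕ → Multiset Ann → Prop}
    (h₀ : Q C₀ L₀) (hs : ∀ {C L C' L'}, SSteps C₀ L₀ C L → Q C L → SStep C L C' L' → Q C' L') :
    Q C L := by
  have : ∀ p, Relation.ReflTransGen (fun p q : Multiset ℕ × Multiset Ann => SStep p.1 p.2 q.1 q.2)
      (C₀, L₀) p → Q p.1 p.2 := by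
    intro p hp
    induction hp with
    | refl => exact h₀
    | tail h1 h2 ih => exact hs h1 ih h2
  exact this _ h

theorem Good.ssteps {Γ₀ C L C' L'} (hg : Good Γ₀ C L) (h : SSteps C L C' L') : Good Γ₀ C' L' :=
  h.induction hg fun _ hg hs => hg.sstep hs

/-- The barbs of a source system that are reachable. -/
def weakBarbs (C : Multiset ℕ) (L : Multiset Ann) : Set ℕ :=
  {y | ∃ C' L', SSteps C L C' L' ∧ SBarb C' L' y}

theorem weakBarbs_subset {C L C' L'} (h : SSteps C L C' L') : weakBarbs C' L' ⊆ weakBarbs C L := by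
  rintro y ⟨C₂, L₂, h1, h2⟩
  exact ⟨C₂, L₂, h.trans h1, h2⟩

theorem weakBarbs_finite (C : Multiset ℕ) (L : Multiset Ann) : (weakBarbs C L).Finite := by
  refine (Set.Finite.biUnion L.finite_toSet fun A _ => A.FV_finite).subset ?_
  rintro y ⟨C', L', h, X, hX, rfl, hy⟩
  have key : ∀ A ∈ L', ∀ x ∈ A.FV, (∃ B ∈ L, x ∈ B.FV) ∨ ch x ∈ C' := by
    refine h.induction (Q := fun C' L' => ∀ A ∈ L', ∀ x ∈ A.FV, (∃ B ∈ L, x ∈ B.FV) ∨ ch x ∈ C')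
      (fun A hA x hx => .inl ⟨A, hA, hx⟩) ?_
    intro C₁ L₁ C₂ L₂ _ ih hs A hA x hx
    obtain ⟨K, rfl, -, -, -, hF⟩ := hs.names
    rcases hF A hA x hx with ⟨B, hB, hx⟩ | hx
    all_goals grind
  obtain ⟨B, hB, hx⟩ := (key _ hX _ X.y_mem_FV).resolve_right hy
  exact Set.mem_biUnion hB hx

/-- The reachable barbs cannot change any more. -/
def Stable (C : Multiset ℕ) (L : Multiset Ann) (W : Set ℕ) : Prop :=
  ∀ C' L', SSteps C L C' L' → weakBarbs C' L' = W

theorem Stable.mono {C L W C' L'} (h : Stable C L W) (hs : SSteps C L C' L') : Stable C' L' W :=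
  fun _ _ h' => h _ _ (hs.trans h')

/-- Runs of implementations implement runs of the source system. -/
theorem St.steps {T T' C L n Γ₀} (h : St T C L n) (hg : Good Γ₀ C L) (hs : CMV.Steps T T') :
    ∃ C' L' n', SSteps C L C' L' ∧ St T' C' L' n' := by
  induction hs with
  | refl => exact ⟨C, L, n, .refl, h⟩
  | tail _ hs ih =>
    obtain ⟨C₁, L₁, n₁, h1, h2⟩ := ih
    rcases h2.step (hg.ssteps h1) hs with ⟨n₂, h3⟩ | ⟨C₂, L₂, n₂, h3, h4⟩
    · grind
    · exact ⟨_, _, _, h1.tail h3, h4⟩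

theorem _root_.MixedSessions.CMV.WeakBarb.of_steps {T T' : CMV.Proc} {y : ℕ} (h : WeakBarb T' y) (hs : CMV.Steps T T') :
    WeakBarb T y := by
  obtain ⟨T₂, h1, h2⟩ := h
  exact ⟨T₂, hs.trans h1, h2⟩

theorem St.weakBarb_of_mem {Γ₀ W y} (hy : y ∈ W) (n : ℕ) : ∀ {T C L}, St T C L n → Good Γ₀ C L →
    Stable C L W → WeakBarb T y := by
  induction n using Nat.strong_induction_on with
  | _ n ih =>
  intro T C L h hg hW
  obtain ⟨C', L', hs, hb⟩ : y ∈ weakBarbs C L := by rw [hW C L .refl]; exact hy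
  have key : ∀ p, Relation.ReflTransGen (fun p q : Multiset ℕ × Multiset Ann =>
      SStep p.1 p.2 q.1 q.2) p (C', L') → ∀ {T m}, m ≤ n → St T p.1 p.2 m → Good Γ₀ p.1 p.2 →
      Stable p.1 p.2 W → WeakBarb T y := by
    intro p hp
    induction hp using Relation.ReflTransGen.head_induction_on with
    | refl => exact fun _ h hg _ => h.weakBarb hg hb
    | head h1 h2 ih' =>
      intro T m hm h hg hW
      rcases h.progress hg h1 with ⟨T', m', h3, h4, h5⟩ | ⟨T', C₁, L₁, m', h3, h4, h5, h6⟩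
      · exact WeakBarb.of_steps (ih' (h3.trans hm) h5 (hg.sstep h1) (hW.mono (.single h1))) h4
      · exact WeakBarb.of_steps (ih m' (h3.trans_le hm) h6 (hg.sstep h5) (hW.mono (.single h5))) h4
  exact key _ hs le_rfl h hg hW

theorem St.weakBarb_iff {T C L n Γ₀ W y} (h : St T C L n) (hg : Good Γ₀ C L) (hW : Stable C L W) :
    WeakBarb T y ↔ y ∈ W := by
  refine ⟨fun ⟨T', h1, h2⟩ => ?_, fun hy => St.weakBarb_of_mem hy n h hg hW⟩
  obtain ⟨C', L', n', h3, h4⟩ := h.steps hg h1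
  rw [← hW C L .refl]
  exact ⟨C', L', h3, h4.sBarb h2⟩

/-- Implementations of stable systems with the same barbs are bisimilar. -/
theorem St.bisimilar {P C L n Γ₀ W Q C' L' n'} (hP : St P C L n) (hg : Good Γ₀ C L)
    (hW : Stable C L W) (hQ : St Q C' L' n') (hg' : Good Γ₀ C' L') (hW' : Stable C' L' W) :
    Bisimilar P Q := by
  let S : CMV.Proc → Prop := fun P => ∃ C L n, St P C L n ∧ Good Γ₀ C L ∧ Stable C L W
  have hS : ∀ {P P'}, S P → CMV.Steps P P' → S P' := by
    rintro P P' ⟨C, L, n, h1, h2, h3⟩ hs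
    obtain ⟨C', L', n', h4, h5⟩ := h1.steps h2 hs
    exact ⟨C', L', n', h5, h2.ssteps h4, h3.mono h4⟩
  have hb : ∀ {P}, S P → ∀ y, WeakBarb P y ↔ y ∈ W := by
    rintro P ⟨C, L, n, h1, h2, h3⟩ y
    exact h1.weakBarb_iff h2 h3
  refine ⟨fun P Q => S P ∧ S Q, ?_, ⟨C, L, n, hP, hg, hW⟩, ⟨C', L', n', hQ, hg', hW'⟩⟩
  rintro P Q ⟨hP, hQ⟩
  exact ⟨fun P' h => ⟨Q, .refl, hS hP h, hQ⟩, fun Q' h => ⟨P, .refl, hP, hS hQ h⟩,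
    fun y => (hb hP y).trans (hb hQ y).symm⟩

/-- Every implementation can reach the implementation of a stable system. -/
theorem St.exists_stable {T C L n Γ₀} (h : St T C L n) (hg : Good Γ₀ C L) :
    ∃ T' C' L' n' W, CMV.Steps T T' ∧ SSteps C L C' L' ∧ St T' C' L' n' ∧ Stable C' L' W := by
  let Conf : Set (CMV.Proc × Multiset ℕ × Multiset Ann × ℕ) :=
    {x | CMV.Steps T x.1 ∧ SSteps C L x.2.1 x.2.2.1 ∧ St x.1 x.2.1 x.2.2.1 x.2.2.2}
  let f : CMV.Proc × Multiset ℕ × Multiset Ann × ℕ → ℕ ×ₗ ℕ :=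
    fun x => toLex ((weakBarbs x.2.1 x.2.2.1).ncard, x.2.2.2)
  have hne : Conf.Nonempty := ⟨(T, C, L, n), .refl, .refl, h⟩
  obtain ⟨⟨T', C', L', n'⟩, ⟨h1, h2, h3⟩, hmin⟩ :=
    (InvImage.wf f (wellFounded_lt (α := ℕ ×ₗ ℕ))).has_min Conf hne
  simp only at h1 h2 h3
  have hle : ∀ {T₂ C₂ L₂ m}, CMV.Steps T' T₂ → SSteps C' L' C₂ L₂ → St T₂ C₂ L₂ m →
      weakBarbs C₂ L₂ = weakBarbs C' L' ∧ n' ≤ m := by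
    intro T₂ C₂ L₂ m k1 k2 k3
    have := hmin (T₂, C₂, L₂, m) ⟨h1.trans k1, h2.trans k2, k3⟩
    simp only [InvImage, f, Prod.Lex.toLex_lt_toLex, not_or, not_lt, not_and] at this
    have e := Set.eq_of_subset_of_ncard_le (weakBarbs_subset k2) this.1 (weakBarbs_finite _ _)
    exact ⟨e, this.2 (by rw [e])⟩
  refine ⟨T', C', L', n', weakBarbs C' L', h1, h2, h3, fun C₂ L₂ hs => ?_⟩
  obtain ⟨T₂, m, -, k1, k2⟩ : ∃ T₂ m, m ≤ n' ∧ CMV.Steps T' T₂ ∧ St T₂ C₂ L₂ m := by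
    refine hs.induction (Q := fun C₂ L₂ => ∃ T₂ m, m ≤ n' ∧ CMV.Steps T' T₂ ∧ St T₂ C₂ L₂ m)
      ⟨T', n', le_rfl, .refl, h3⟩ ?_
    rintro C₁ L₁ C₂ L₂ hs ⟨T₂, m, hm, k1, k2⟩ hstep
    rcases k2.progress ((hg.ssteps h2).ssteps hs) hstep with ⟨T₃, m', k3, k4, k5⟩ |
      ⟨T₃, C₃, L₃, m', k3, k4, k5, k6⟩
    · exact ⟨T₃, m', k3.trans hm, k1.trans k4, k5⟩
    · exact absurd (hle (k1.trans k4) (hs.tail k5) k6).2 (by omega)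
  exact (hle k1 hs k2).1

/-! ## Operational soundness -/

theorem Rep.valid {C L D E n} (h : Rep C L D E n) : ∀ A ∈ L, Valid A ∧ A.IsGuard := by
  induction h with
  | nil => simp
  | cons h _ ih =>
    intro A hA
    rcases mem_add.1 hA with hA | hA
    · cases h with
      | ite v A B =>
        obtain rfl := mem_singleton.1 hA
        exact ⟨.inl ⟨_, _, _, rfl⟩, .ite _ _ _⟩
      | load X u _ h2 =>
        obtain rfl := mem_singleton.1 hA
        exact ⟨.inr ⟨X, rfl, fun _ => h2⟩, .choice ..⟩
      | idle X u h2 =>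
        obtain rfl := mem_singleton.1 hA
        exact ⟨.inr ⟨X, rfl, h2⟩, .choice ..⟩
      | comL X u _ h1 =>
        obtain rfl := mem_singleton.1 hA
        exact ⟨.inr ⟨X, rfl, fun h => by rw [h1] at h; cases h⟩, .choice ..⟩
      | comU X u _ _ h2 =>
        obtain rfl := mem_singleton.1 hA
        exact ⟨.inr ⟨X, rfl, fun _ => h2⟩, .choice ..⟩
      | sb X Y _ _ _ _ h1 h2 =>
        simp only [mem_cons, mem_singleton] at hA
        rcases hA with rfl | rfl
        · exact ⟨.inr ⟨X, rfl, fun _ => h1⟩, .choice ..⟩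
        · exact ⟨.inr ⟨Y, rfl, fun _ => h2⟩, .choice ..⟩
      | pair X Y _ _ _ _ _ h1 h2 =>
        simp only [mem_cons, mem_singleton] at hA
        rcases hA with rfl | rfl
        · exact ⟨.inr ⟨X, rfl, h1⟩, .choice ..⟩
        · exact ⟨.inr ⟨Y, rfl, h2⟩, .choice ..⟩
    · grind

/-- The encoding of a source system implements it. -/
theorem St.enc {T C L n} (h : St T C L n) : St (sys C L).enc C L 0 := by
  obtain ⟨D, E, J, hr, he, -, -⟩ := h
  have hL := hr.valid
  obtain ⟨D', E', hr', hD', hF, hc⟩ := Rep.enc (C := C) L (fun A hA => (hL A hA).1) ∅ Set.finite_empty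
  refine ⟨D', E', 0, hr', ⟨he.even, he.nodupC, hD', fun d hd => (hF d hd).1, fun d hd => (hF d hd).2.2⟩,
    by simp [Junk], ?_⟩
  refine (flat_enc (Flat.sys (P := Ann) (fun A hA => (hL A hA).2) he.nodupC)).trans ?_
  have := hc C 0 (by simp)
  rwa [add_zero] at this

theorem SSteps.erase {S : Ann} {C₀ L₀ C L} (h : SSteps C₀ L₀ C L) (hS : Ann.Cong S (sys C₀ L₀)) :
    (C₀ = C ∧ L₀ = L) ∨ Mix.Steps S.erase (sys C L).erase := by
  rcases h.cases_head with h | ⟨⟨C₁, L₁⟩, h1, h2⟩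
  · grind
  · refine .inr (.head (Ann.Step.struct hS (SStep.step h1) (.refl _)).erase ?_)
    exact SSteps.induction (Q := fun C L => Mix.Steps (sys C₁ L₁).erase (sys C L).erase) h2 .refl
      fun _ h h' => h.tail h'.step.erase

/-- The encoding of a typed process implements a source system. -/
theorem Typing.st {Γ : Ctx} {S : Proc} (hΓ : Γ.WF) (D : Typing Γ S) :
    ∃ C L, St D.encode C L 0 ∧ Good Γ C L ∧ Ann.Cong D.ann (sys C L) := by
  obtain ⟨G, K, hA, hK⟩ := exists_flat_new D.ann 0 {D.ann}
  have hg := (D.good hΓ).flat (R := 0) hA fun c hc => (hK c hc).2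
  refine ⟨K + 0, G + 0, ?_, hg, ?_⟩
  · refine St.unfold (D := 0) (E := 0) (J := 0) hA (Good.valid hg hA) (fun Z hZ x hx => ⟨Z, hZ, hx⟩)
      (.nil 0)
      ⟨by simp, by simp, by simp, by simp, by simp⟩ hK (by simp [Junk]) ?_
    rw [D.enc_ann, add_zero, add_zero]
    exact (sys_zero_singleton (P := CMV.Proc) _ : CMV.Cong _ _).symm
  · rw [add_zero, add_zero]
    exact Flat.cong (P := Ann) hA

end Mix
end MixedSessions

theorem mainTheorem4 (Γ : MixedSessions.Mix.Ctx) (hΓ : Γ.WF) (S : MixedSessions.Mix.Proc)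
    (D : MixedSessions.Mix.Typing Γ S) (T : MixedSessions.CMV.Proc)
    (hT : MixedSessions.CMV.Steps D.encode T) :
    ∃ (S' : MixedSessions.Mix.Proc) (Γ' : MixedSessions.Mix.Ctx)
      (D' : MixedSessions.Mix.Typing Γ' S') (T' : MixedSessions.CMV.Proc),
      Γ'.WF ∧ (∀ x, Γ' x = none ↔ Γ x = none) ∧
      MixedSessions.Mix.Steps S S' ∧ MixedSessions.CMV.Steps T T' ∧
      MixedSessions.CMV.Bisimilar T' D'.encode := by
  open MixedSessions Mix in
  obtain ⟨C₀, L₀, h₀, hg₀, hS⟩ := D.st hΓ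
  obtain ⟨C₁, L₁, n₁, h1, h2⟩ := h₀.steps hg₀ hT
  obtain ⟨T', C, L, n, W, h3, h4, h5, hW⟩ := h2.exists_stable (hg₀.ssteps h1)
  have hs : SSteps C₀ L₀ C L := Relation.ReflTransGen.trans h1 h4
  have hg := hg₀.ssteps hs
  rcases hs.erase hS with ⟨rfl, rfl⟩ | hr
  · exact ⟨S, Γ, D, T', hΓ, fun _ => .rfl, .refl, h3, h5.bisimilar hg hW h₀ hg hW⟩
  · have hC : C.Nodup := by
      obtain ⟨_, _, _, _, he, _⟩ := h5
      exact he.nodupC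
    obtain ⟨Γ', D', hΓ', hdom, hD'⟩ := hg.typing hC hΓ.1
    rw [D.erase_ann] at hr
    refine ⟨_, Γ', D', T', hΓ', hdom, hr, h3, ?_⟩
    rw [hD']
    exact h5.bisimilar hg hW h5.enc hg hW
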